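/- Let $D\subset\mathbb{R}^2$ be the open unit disc, let $\lambda_1$ be the first Dirichlet eigenvalue of $-\Delta$ on $D$, and let $$\langle\varphi\rangle=\limsup_{\tau\to\infty}\frac{1}{\tau|D|}\int_0^\tau\!\int_D\varphi(\mathbf{x},t)\,d\mathbf{x}\,dt .$$ Let $f(\mathbf{x},t)$, $\mathbf{x}\in D$, $t>0$, be a real source with $f(\cdot,t)\in H^2(D)$ for a.e. $t$, such that $$\lim_{\tau\to\infty}\frac{1}{\sqrt{\tau}}\int_0^\tau e^{-\lambda_1\min(\tau-t,\,t)}\|f(\cdot,t)\|_{L^2(D)}\,dt=0,\qquad \langle|f|^2+|\nabla f|^2+|\nabla\nabla f|^2\rangle<\infty,\qquad \langle f\rangle>0 .$$ Call a velocity $\mathbf{u}(\mathbf{x},t)$ admissible for $\mathrm{Pe}$ if $\mathbf{u}(\cdot,t)\in H^1(D;\mathbb{R}^2)$ for a.e. $t$, $\nabla\cdot\mathbf{u}=0$ in $D$, $\mathbf{u}\cdot\hat{\mathbf{n}}=0$ at $\partial D$, and $\langle|\nabla\mathbf{u}|^2\rangle=\mathrm{Pe}^2$. A temperature generated by $\mathbf{u}$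 is a weak solution $T$ of $$\partial_tT+\mathbf{u}\cdot\nabla T=\Delta T+f\ \text{ in }D,\qquad T=0\ \text{ at }\partial D,$$ with initial data in $L^2(D)$, where weak solution means that $T\in L^2_{\rm loc}((0,\infty);H^1_0(D))$, $\partial_tT\in L^2_{\rm loc}((0,\infty);H^{-1}(D))$, the equation holds in $H^{-1}(D)$ for a.e. $t>0$, and $T(\cdot,t)$ converges in $L^2(D)$ to the initial data as $t\to0$. Then there are positive constants $C,C',c$ depending only on $f$ such that, for all $\mathrm{Pe}\ge c$, $$\frac{C}{\mathrm{Pe}^{2/3}}\ \le\ \inf\,\langle|\nabla T|^2\rangle\ \le\ C'\,\frac{\log^{4/3}\mathrm{Pe}}{\mathrm{Pe}^{2/3}},$$ where the infimum is over all velocities $\mathbf{u}$ admissible for $\mathrm{Pe}$ and all temperatures $T$ generated by $\mathbf{u}$. Moreover, the upper bound is achieved irrespective of the initial data: for each $\mathrm{Pe}\ge c$ there is an admissible $\mathbf{u}$ that generates a temperature from every initial datum in $L^2(D)$, and $\langle|\nabla T|^2\rangle\le C'\log^{4/3}(\mathrm{Pe})\,\mathrm{Pe}^{-2/3}$ for all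 temperatures $T$ that it generates. -/

import Mathlib

open MeasureTheory Filter Set
open scoped ENNReal ContDiff Topology

namespace DiscCooling

/-- The plane with its Euclidean norm. -/
abbrev Plane : Type := EuclideanSpace ℝ (Fin 2)

/-- The open unit disc `D`. -/
def disc : Set Plane := Metric.ball 0 1

/-- Lebesgue measure on the disc. -/
noncomputable def discMeasure : Measure Plane := volume.restrict disc

/-- Lebesgue measure on the space-time cylinder `(0, ∞) × D`. -/
noncomputable def cylMeasure : Measure (ℝ × Plane) :=
  volume.restrict (Ioi (0 : ℝ) ×ˢ disc)

/-- Measurability of a time-dependent field on `(0, ∞) × D`, jointly in time and space. -/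
def JointlyMeasurable {F : Type*} [TopologicalSpace F] (v : ℝ → Plane → F) : Prop :=
  AEStronglyMeasurable (fun p : ℝ × Plane => v p.1 p.2) cylMeasure

/-! ### Sobolev spaces on the disc -/

/-- Test functions `C_c^∞(D)`. -/
def IsTest (φ : Plane → ℝ) : Prop :=
  ContDiff ℝ ∞ φ ∧ HasCompactSupport φ ∧ tsupport φ ⊆ disc

/-- Space-time test functions `C_c^∞((0, ∞) × D)`. -/
def IsSpaceTimeTest (φ : ℝ × Plane → ℝ) : Prop :=
  ContDiff ℝ ∞ φ ∧ HasCompactSupport φ ∧ tsupport φ ⊆ Ioi (0 : ℝ) ×ˢ disc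

/-- `v ∈ H¹(D)` with weak gradient `g`. -/
structure MemH1 (v : Plane → ℝ) (g : Plane → Plane) : Prop where
  memLp : MemLp v 2 discMeasure
  memLp_grad : MemLp g 2 discMeasure
  weak_grad : ∀ φ : Plane → ℝ, IsTest φ → ∀ i : Fin 2,
    ∫ x, v x * fderiv ℝ φ x (EuclideanSpace.single i 1) ∂discMeasure
      = - ∫ x, g x i * φ x ∂discMeasure

/-- A vector field `w ∈ H¹(D; ℝ²)`; `A x i` is the weak gradient of the component `wᵢ`,
so that `A x i j = ∂ⱼwᵢ`. -/
def MemH1Vec (w : Plane → Plane) (A : Plane → Fin 2 → Plane) : Prop :=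
  ∀ i : Fin 2, MemH1 (fun x => w x i) (fun x => A x i)

/-- `v ∈ H¹₀(D)` with weak gradient `g`: `v` is a limit of test functions in the `H¹`-norm. -/
structure MemH10 (v : Plane → ℝ) (g : Plane → Plane) : Prop where
  memLp : MemLp v 2 discMeasure
  memLp_grad : MemLp g 2 discMeasure
  approx : ∃ φ : ℕ → Plane → ℝ, (∀ n, IsTest (φ n)) ∧
    Tendsto (fun n => eLpNorm (fun x => φ n x - v x) 2 discMeasure) atTop (𝓝 0) ∧
    Tendsto (fun n => eLpNorm (fun x => gradient (φ n) x - g x) 2 discMeasure) atTop (𝓝 0)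

/-- The first Dirichlet eigenvalue `λ₁` of `-Δ` on the disc, as the least Rayleigh quotient. -/
noncomputable def firstEigenvalue : ℝ :=
  sInf {q : ℝ | ∃ (v : Plane → ℝ) (g : Plane → Plane), MemH10 v g ∧
    (∫ x, v x ^ 2 ∂discMeasure) ≠ 0 ∧
    q = (∫ x, ‖g x‖ ^ 2 ∂discMeasure) / ∫ x, v x ^ 2 ∂discMeasure}

/-! ### Space and long-time averages -/

/-- `⟨F⟩`, the limit superior of the space-time averages over `(0, τ) × D` as `τ → ∞`, for a
nonnegative `F`. -/
noncomputable def avg (F : ℝ → Plane → ℝ≥0∞) : ℝ≥0∞ :=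
  limsup (fun τ : ℝ =>
    (∫⁻ t in Ioc 0 τ, ∫⁻ x, F t x ∂discMeasure) / (ENNReal.ofReal τ * volume disc)) atTop

/-- `⟨F⟩` for a real-valued `F`. -/
noncomputable def signedAvg (F : ℝ → Plane → ℝ) : EReal :=
  limsup (fun τ : ℝ =>
    (((τ * volume.real disc)⁻¹ * ∫ t in Ioc 0 τ, ∫ x, F t x ∂discMeasure : ℝ) : EReal)) atTop

/-! ### Sources -/

/-- `f` is a measurable source on `(0, ∞) × D` with `f(·, t) ∈ H²(D)` for almost every `t`, with
weak gradient `Df` and weak Hessian `D2f`. -/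
structure IsSource (f : ℝ → Plane → ℝ) (Df : ℝ → Plane → Plane)
    (D2f : ℝ → Plane → Fin 2 → Plane) : Prop where
  meas : JointlyMeasurable f
  meas_grad : JointlyMeasurable Df
  meas_hess : JointlyMeasurable D2f
  memH1 : ∀ᵐ t ∂volume.restrict (Ioi (0 : ℝ)), MemH1 (f t) (Df t)
  memH1_grad : ∀ᵐ t ∂volume.restrict (Ioi (0 : ℝ)), MemH1Vec (Df t) (D2f t)

/-- The growth condition
`lim_{τ → ∞} τ^{-1/2} ∫₀^τ exp(-λ₁ ((τ - t) ∧ t)) ‖f(·, t)‖_{L²(D)} dt = 0`. -/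
def ControlledGrowth (f : ℝ → Plane → ℝ) : Prop :=
  Tendsto (fun τ : ℝ =>
    (∫⁻ t in Ioc 0 τ, ENNReal.ofReal (Real.exp (-firstEigenvalue * min (τ - t) t))
        * eLpNorm (f t) 2 discMeasure) / ENNReal.ofReal (Real.sqrt τ)) atTop (𝓝 0)

/-! ### Velocities -/

/-- `u` is a measurable velocity with `u(·, t) ∈ H¹(D; ℝ²)` for almost every `t`, divergence-free
and with no penetration at the boundary; `Du t x i` is the gradient of the component `uᵢ`. -/
structure IsVelocity (u : ℝ → Plane → Plane) (Du : ℝ → Plane → Fin 2 → Plane) : Prop where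
  meas : JointlyMeasurable u
  meas_grad : JointlyMeasurable Du
  memH1 : ∀ᵐ t ∂volume.restrict (Ioi (0 : ℝ)), MemH1Vec (u t) (Du t)
  div_free : ∀ᵐ t ∂volume.restrict (Ioi (0 : ℝ)),
    ∀ᵐ x ∂discMeasure, ∑ i : Fin 2, Du t x i i = 0
  /-- `u · n = 0` at the boundary: by Green's formula, the integral below is the integral of
  `φ (u · n)` over the unit circle. -/
  no_penetration : ∀ᵐ t ∂volume.restrict (Ioi (0 : ℝ)),
    ∀ φ : Plane → ℝ, ContDiff ℝ ∞ φ →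
      ∫ x, (fderiv ℝ φ x (u t x) + (∑ i : Fin 2, Du t x i i) * φ x) ∂discMeasure = 0

/-- The mean enstrophy `⟨|∇u|²⟩`. -/
noncomputable def meanEnstrophy (Du : ℝ → Plane → Fin 2 → Plane) : ℝ≥0∞ :=
  avg (fun t x => ∑ i : Fin 2, ‖Du t x i‖ₑ ^ 2)

/-- `u` is a divergence-free, no-penetration velocity with mean enstrophy `Pe²`. -/
def IsAdmissible (Pe : ℝ) (u : ℝ → Plane → Plane) : Prop :=
  ∃ Du : ℝ → Plane → Fin 2 → Plane,
    IsVelocity u Du ∧ meanEnstrophy Du = ENNReal.ofReal (Pe ^ 2)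

/-! ### Temperatures -/

/-- Membership in `L²_loc((0, ∞); L²(D))` of a measurable field. -/
def MemL2Loc {F : Type*} [NormedAddCommGroup F] (v : ℝ → Plane → F) : Prop :=
  JointlyMeasurable v ∧
    ∀ a b : ℝ, 0 < a → a < b → ∫⁻ t in Icc a b, ∫⁻ x, ‖v t x‖ₑ ^ 2 ∂discMeasure < ⊤

/-- `∂ₜT = ∇ · m` in the sense of distributions on `(0, ∞) × D`. As `m` ranges over
`L²_loc((0, ∞); L²(D; ℝ²))`, its divergence ranges over `L²_loc((0, ∞); H⁻¹(D))`. -/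
def IsTimeDeriv (T : ℝ → Plane → ℝ) (m : ℝ → Plane → Plane) : Prop :=
  ∀ φ : ℝ × Plane → ℝ, IsSpaceTimeTest φ →
    ∫ p : ℝ × Plane, T p.1 p.2 * fderiv ℝ φ p (1, 0) ∂cylMeasure
      = ∫ p : ℝ × Plane, fderiv ℝ φ p (0, m p.1 p.2) ∂cylMeasure

/-- `T`, with gradient `DT`, is a weak solution of `∂ₜT + u · ∇T = ΔT + f` in `D`, `T = 0` at the
boundary, with `T(·, 0) = T₀`:
`T ∈ L²_loc((0, ∞); H¹₀(D))`, `∂ₜT ∈ L²_loc((0, ∞); H⁻¹(D))`, the equation holds in `H⁻¹(D)` for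
almost every `t > 0`, and `T(·, t) → T₀` in `L²(D)` as `t → 0`. -/
structure IsTemperature (f : ℝ → Plane → ℝ) (u : ℝ → Plane → Plane) (T₀ : Plane → ℝ)
    (T : ℝ → Plane → ℝ) (DT : ℝ → Plane → Plane) : Prop where
  memL2Loc : MemL2Loc T
  memL2Loc_grad : MemL2Loc DT
  memH10 : ∀ᵐ t ∂volume.restrict (Ioi (0 : ℝ)), MemH10 (T t) (DT t)
  equation : ∃ m : ℝ → Plane → Plane, MemL2Loc m ∧ IsTimeDeriv T m ∧
    ∀ᵐ t ∂volume.restrict (Ioi (0 : ℝ)), ∀ φ : Plane → ℝ, IsTest φ →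
      - (∫ x, fderiv ℝ φ x (m t x) ∂discMeasure)
          + ∫ x, inner ℝ (u t x) (DT t x) * φ x ∂discMeasure
        = - (∫ x, fderiv ℝ φ x (DT t x) ∂discMeasure) + ∫ x, f t x * φ x ∂discMeasure
  initial : Tendsto (fun t => eLpNorm (fun x => T t x - T₀ x) 2 discMeasure)
    (ae (volume.restrict (Ioi (0 : ℝ))) ⊓ 𝓝 0) (𝓝 0)

/-- The mean-square temperature gradient `⟨|∇T|²⟩`. -/
noncomputable def meanSqGrad (DT : ℝ → Plane → Plane) : ℝ≥0∞ :=
  avg (fun t x => ‖DT t x‖ₑ ^ 2)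

/-- The least value of `⟨|∇T|²⟩` over all divergence-free, no-penetration velocities with mean
enstrophy `Pe²`, where `T` is any temperature generated by the velocity, with arbitrary initial
data in `L²(D)`. -/
noncomputable def minCooling (f : ℝ → Plane → ℝ) (Pe : ℝ) : ℝ≥0∞ :=
  sInf {q : ℝ≥0∞ | ∃ (u : ℝ → Plane → Plane) (T₀ : Plane → ℝ) (T : ℝ → Plane → ℝ)
    (DT : ℝ → Plane → Plane), IsAdmissible Pe u ∧ MemLp T₀ 2 discMeasure ∧
    IsTemperature f u T₀ T DT ∧ q = meanSqGrad DT}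

end DiscCooling

open DiscCooling

noncomputable section
namespace DiscCooling

notation "μD" => discMeasure
notation "μC" => cylMeasure
notation "μT" => volume.restrict (Ioi (0 : ℝ))
notation "μC[" b "]" => Measure.prod (volume.restrict (Ioc 0 b)) discMeasure
notation "ℝP" => ℝ × Plane
notation:max "♯" v:max => fun p : ℝP => v (Prod.fst p) (Prod.snd p)
notation "Smooth" => ContDiff ℝ ∞

open scoped Real Gradient RealInnerProductSpace
open EuclideanSpace (single volume_ball_fin_two)
open HasCompactSupport (comp_left of_support_subset_isCompact)
open InnerProductSpace (toDual)
open Real (sqrt_sq norm_eq_abs exp norm_of_nonneg sqrt_le_sqrt sqrt_nonneg sqrt_mul sq_sqrt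
  enorm_of_nonneg exp_pos smoothTransition pi_pos rpow_mul rpow_natCast log sin cos log_pow)
open ENNReal (ofReal ofReal_pow mul_lt_top tendsto_ofReal ofReal_le_ofReal toReal_ofReal ofReal_mul
  ofReal_le_ofReal_iff ofReal_add ofReal_one ofReal_ne_top)
open intervalIntegral (integral_hasDerivAt_right integral_of_le integral_add_adjacent_intervals
  integral_congr)
open MeasureTheory.Measure (restrict_mono restrict_le_self)
open ContinuousLinearMap (inr)
open WithLp (toLp)
open Metric (closedBall ball)
open WithTop (coe_le_coe)
open Finset (range mul_sum sum_add_distrib sum_congr mem_filter sum_le_sum sum_eq_zero sum_range_succ)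
open Nat (cast_nonneg)

variable {f g φ w k Z g' v W T₀ ξ g₀ g₁ g₁₁ Ψ η : Plane → ℝ} {x : Plane}
  {a b C s t c q P U ε δ r L y B h K B' Pe : ℝ} {e θ : ℝ → ℝ} {u DT : ℝ → Plane → Plane}
  {S : ℝP → ℝ} {DS N : ℝP → Plane} {M : ℕ} {T ψ : ℝ → Plane → ℝ}
  {Du : ℝ → Plane → Fin 2 → Plane} {Df : Plane → Plane} {D2f : Plane → Fin 2 → Plane}

lemma integral_ext {α E : Type*} [MeasurableSpace α] {μ : Measure α} [NormedAddCommGroup E]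
    [NormedSpace ℝ E] {f g : α → E} (h : ∀ x, f x = g x) : ∫ x, f x ∂μ = ∫ x, g x ∂μ :=
  integral_congr_ae (.of_forall h)

/-! ### Partial derivatives and test functions -/

/-- The `i`-th partial derivative. -/
def pd (i : Fin 2) (g : Plane → ℝ) (x : Plane) : ℝ := fderiv ℝ g x (single i 1)

/-- `1 - |x|²`, which is comparable to the distance to the boundary of the disc. -/
def bdist (x : Plane) : ℝ := 1 - (x 0 ^ 2 + x 1 ^ 2)

lemma plane_eq_sum (v : Plane) : v = v 0 • single (0 : Fin 2) (1 : ℝ) + v 1 • single 1 1 := by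
  ext i; fin_cases i <;> simp

lemma fderiv_apply_eq (g : Plane → ℝ) (x v : Plane) :
    fderiv ℝ g x v = pd 0 g x * v 0 + pd 1 g x * v 1 := by
  conv_lhs => rw [plane_eq_sum v]
  simp only [map_add, map_smul, smul_eq_mul, pd]
  ring

lemma inner_plane (v w : Plane) : ⟪v, w⟫ = v 0 * w 0 + v 1 * w 1 := by
  simp [PiLp.inner_apply, Fin.sum_univ_two, mul_comm]

lemma norm_sq_plane (v : Plane) : ‖v‖ ^ 2 = v 0 ^ 2 + v 1 ^ 2 := by
  simp [EuclideanSpace.norm_sq_eq, Fin.sum_univ_two]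

lemma gradient_apply (g : Plane → ℝ) (x : Plane) (i : Fin 2) : ∇ g x i = pd i g x := by
  have h : ⟪∇ g x, single i (1 : ℝ)⟫ = pd i g x := by simp [gradient, pd]
  rw [← h, inner_plane]
  fin_cases i <;> simp

lemma inner_gradient (g : Plane → ℝ) (x v : Plane) : ⟪∇ g x, v⟫ = fderiv ℝ g x v := by
  rw [inner_plane, fderiv_apply_eq, gradient_apply, gradient_apply]

lemma mem_disc_iff (x : Plane) : x ∈ disc ↔ 0 < bdist x := by
  have h := norm_sq_plane x
  rw [disc, mem_ball_zero_iff, bdist, ← h]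
  constructor
  · intro hx
    nlinarith [norm_nonneg x]
  · intro hx
    nlinarith [norm_nonneg x]

lemma bdist_le_one (x : Plane) : bdist x ≤ 1 := by
  unfold bdist; nlinarith [sq_nonneg (x 0), sq_nonneg (x 1)]

lemma isOpen_disc : IsOpen disc := Metric.isOpen_ball

lemma measurableSet_disc : MeasurableSet disc := isOpen_disc.measurableSet

lemma ae_mem_disc : ∀ᵐ x ∂μD, x ∈ disc := ae_restrict_mem measurableSet_disc

instance : IsFiniteMeasure μD := by
  unfold discMeasure disc
  exact ⟨by simp⟩

lemma contDiff_coord (i : Fin 2) {n : WithTop ℕ∞} : ContDiff ℝ n (fun x : Plane => x i) := by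
  fun_prop

lemma contDiff_bdist {n : WithTop ℕ∞} : ContDiff ℝ n bdist := by unfold bdist; fun_prop

lemma pd_add (i : Fin 2) (hf : DifferentiableAt ℝ f x)
    (hg : DifferentiableAt ℝ g x) : pd i (fun y => f y + g y) x = pd i f x + pd i g x := by
  simp [pd, fderiv_fun_add hf hg]

lemma pd_sub (i : Fin 2) (hf : DifferentiableAt ℝ f x)
    (hg : DifferentiableAt ℝ g x) : pd i (fun y => f y - g y) x = pd i f x - pd i g x := by
  simp [pd, fderiv_fun_sub hf hg]

lemma pd_mul (i : Fin 2) (hf : DifferentiableAt ℝ f x) (hg : DifferentiableAt ℝ g x) :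
    pd i (fun y => f y * g y) x = pd i f x * g x + f x * pd i g x := by
  simp [pd, fderiv_fun_mul hf hg]; ring

lemma pd_const_mul (c : ℝ) (i : Fin 2) (hf : DifferentiableAt ℝ f x) :
    pd i (fun y => c * f y) x = c * pd i f x := by simp [pd, fderiv_const_mul hf]

lemma pd_const (c : ℝ) (i : Fin 2) (x : Plane) : pd i (fun _ => c) x = 0 := by simp [pd]

lemma pd_sum {ι : Type*} (s : Finset ι) {f : ι → Plane → ℝ} (i : Fin 2)
    (hf : ∀ n ∈ s, DifferentiableAt ℝ (f n) x) :
    pd i (fun y => ∑ n ∈ s, f n y) x = ∑ n ∈ s, pd i (f n) x := by simp [pd, fderiv_fun_sum hf]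

lemma pd_comp {φ : ℝ → ℝ} (i : Fin 2)
    (hφ : DifferentiableAt ℝ φ (g x)) (hg : DifferentiableAt ℝ g x) :
    pd i (fun y => φ (g y)) x = deriv φ (g x) * pd i g x := by
  have h := (hφ.hasDerivAt.comp_hasFDerivAt x hg.hasFDerivAt).fderiv
  have h2 : fderiv ℝ (fun y => φ (g y)) x = deriv φ (g x) • fderiv ℝ g x := h
  simp [pd, h2]

lemma pd_coord (i j : Fin 2) (x : Plane) : pd i (fun y => y j) x = if j = i then 1 else 0 := by
  have h : HasFDerivAt (fun y : Plane => y j) (EuclideanSpace.proj j : Plane →L[ℝ] ℝ) x :=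
    (EuclideanSpace.proj j : Plane →L[ℝ] ℝ).hasFDerivAt
  simp [pd, h.fderiv, Pi.single_apply]

lemma pd_bdist (i : Fin 2) (x : Plane) : pd i bdist x = -2 * x i := by
  have h : bdist = fun x => 1 - (x 0 * x 0 + x 1 * x 1) := by
    funext x; simp only [bdist]; ring
  rw [h, pd_sub i (by fun_prop) (by fun_prop), pd_const, pd_add i (by fun_prop) (by fun_prop),
    pd_mul i (by fun_prop) (by fun_prop), pd_mul i (by fun_prop) (by fun_prop), pd_coord, pd_coord]
  fin_cases i <;> simp <;> ring

lemma contDiff_pd (i : Fin 2) (hg : Smooth g) : Smooth (pd i g) := by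
  unfold pd
  exact (hg.fderiv_right (m := ∞) (by simp)).clm_apply contDiff_const

lemma continuous_pd (i : Fin 2) (hg : ContDiff ℝ 1 g) : Continuous (pd i g) := by
  unfold pd
  exact (hg.continuous_fderiv (by simp)).clm_apply continuous_const

lemma pd_comm (hg : ContDiff ℝ 2 g) (x : Plane) : pd 0 (pd 1 g) x = pd 1 (pd 0 g) x := by
  have hsym : IsSymmSndFDerivAt ℝ g x := hg.contDiffAt.isSymmSndFDerivAt (by simp)
  have hd : DifferentiableAt ℝ (fderiv ℝ g) x :=
    (hg.fderiv_right (m := 1) (by norm_num)).differentiable (by simp) x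
  have key : ∀ i j : Fin 2, pd i (pd j g) x =
      fderiv ℝ (fderiv ℝ g) x (single i 1) (single j 1) := by
    intro i j
    unfold pd
    rw [fderiv_clm_apply hd (differentiableAt_const _)]
    simp
  rw [key, key, hsym.eq]

lemma hasCompactSupport_pd (i : Fin 2) (hg : HasCompactSupport g) : HasCompactSupport (pd i g) :=
  comp_left (g := fun L : Plane →L[ℝ] ℝ => L (single i 1)) (hg.fderiv (𝕜 := ℝ)) (by simp)

lemma tsupport_pd_subset (i : Fin 2) (g : Plane → ℝ) : tsupport (pd i g) ⊆ tsupport g := by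
  refine (closure_mono ?_).trans (tsupport_fderiv_subset ℝ (f := g))
  intro x hx h
  exact hx (by simp [pd, h])

lemma integral_pd_eq_zero (i : Fin 2) (hg : ContDiff ℝ 1 g)
    (hc : HasCompactSupport g) : ∫ x, pd i g x = 0 := by
  have hint : Integrable (pd i g) :=
    (continuous_pd i hg).integrable_of_hasCompactSupport (hasCompactSupport_pd i hc)
  have := integral_mul_fderiv_eq_neg_fderiv_mul_of_integrable (μ := (volume : Measure Plane))
    (f := fun _ : Plane => (1 : ℝ)) (g := g) (v := single i 1) (by simp) (by simpa using! hint)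
    (by simpa using hg.continuous.integrable_of_hasCompactSupport hc)
    (by simp) (fun x _ => hg.differentiable (by simp) x)
  simpa [pd] using this

lemma integral_disc_eq {F : Type*} [NormedAddCommGroup F] [NormedSpace ℝ F] {g : Plane → F}
    (h : ∀ x ∉ disc, g x = 0) : ∫ x, g x ∂μD = ∫ x, g x :=
  setIntegral_eq_integral_of_forall_compl_eq_zero h

namespace IsTest

variable {φ ψ : Plane → ℝ}

lemma eq_zero (h : IsTest φ) (hx : x ∉ disc) : φ x = 0 :=
  image_eq_zero_of_notMem_tsupport fun hh => hx (h.2.2 hh)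

lemma mul_left (h : IsTest φ) (hψ : Smooth ψ) : IsTest (fun x => ψ x * φ x) :=
  ⟨hψ.mul h.1, h.2.1.mul_left, (tsupport_mul_subset_right).trans h.2.2⟩

lemma add (h : IsTest φ) (h' : IsTest ψ) : IsTest (fun x => φ x + ψ x) :=
  ⟨h.1.add h'.1, h.2.1.add h'.2.1, (tsupport_add φ ψ).trans (union_subset h.2.2 h'.2.2)⟩

lemma const_mul (h : IsTest φ) (c : ℝ) : IsTest (fun x => c * φ x) := h.mul_left contDiff_const

lemma sub (h : IsTest φ) (h' : IsTest ψ) : IsTest (fun x => φ x - ψ x) := by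
  simpa [sub_eq_add_neg] using h.add (h'.const_mul (-1))

lemma pd (h : IsTest φ) (i : Fin 2) : IsTest (pd i φ) :=
  ⟨contDiff_pd i h.1, hasCompactSupport_pd i h.2.1, (tsupport_pd_subset i φ).trans h.2.2⟩

lemma continuous (h : IsTest φ) : Continuous φ := h.1.continuous

lemma differentiable (h : IsTest φ) : Differentiable ℝ φ := h.1.differentiable (by simp)

lemma memLp (h : IsTest φ) (p : ℝ≥0∞) : MemLp φ p μD :=
  (h.continuous.memLp_of_hasCompactSupport (μ := volume) h.2.1).restrict _

lemma continuous_gradient (h : IsTest φ) : Continuous (∇ φ) := by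
  unfold gradient
  exact (LinearIsometryEquiv.continuous _).comp (h.1.continuous_fderiv (by simp))

lemma memLp_gradient (h : IsTest φ) (p : ℝ≥0∞) : MemLp (∇ φ) p μD := by
  have hc : HasCompactSupport (∇ φ) := comp_left (g := (toDual ℝ Plane).symm)
      (h.2.1.fderiv (𝕜 := ℝ)) (by simp)
  exact (h.continuous_gradient.memLp_of_hasCompactSupport (μ := volume) hc).restrict _

lemma gradient_eq_zero (h : IsTest φ) (hx : x ∉ disc) : ∇ φ x = 0 := by
  ext i
  rw [gradient_apply, (h.pd i).eq_zero hx]; simp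

lemma integral_pd (h : IsTest φ) (i : Fin 2) : ∫ x, DiscCooling.pd i φ x ∂μD = 0 := by
  rw [integral_disc_eq fun x hx => (h.pd i).eq_zero hx]
  exact integral_pd_eq_zero i (h.1.of_le (by simp)) h.2.1

lemma memH10 (h : IsTest φ) : MemH10 φ (∇ φ) :=
  ⟨h.memLp 2, h.memLp_gradient 2, fun _ => φ, fun _ => h, by simp, by simp⟩

end IsTest

lemma integral_mul_pd_test (i : Fin 2) (hw : ContDiff ℝ 1 w) (h : IsTest φ) :
    ∫ x, w x * pd i φ x ∂μD = - ∫ x, pd i w x * φ x ∂μD := by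
  have h1 : IsTest φ := h
  rw [integral_disc_eq fun x hx => by simp [(h.pd i).eq_zero hx],
    integral_disc_eq fun x hx => by simp [h.eq_zero hx]]
  refine integral_mul_fderiv_eq_neg_fderiv_mul_of_integrable ?_ ?_ ?_ ?_ ?_
  · exact ((continuous_pd i hw).mul h.continuous).integrable_of_hasCompactSupport h.2.1.mul_left
  · exact (hw.continuous.mul (h.pd i).continuous).integrable_of_hasCompactSupport
      (h.pd i).2.1.mul_left
  · exact (hw.continuous.mul h.continuous).integrable_of_hasCompactSupport h.2.1.mul_left
  · exact fun x _ => hw.differentiable (by simp) x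
  · exact fun x _ => h.differentiable x

lemma IsTest.div_bdist (h : IsTest φ) : IsTest (fun x => φ x / bdist x) := by
  have hsub : tsupport (fun x => φ x / bdist x) ⊆ tsupport φ :=
    closure_mono fun x hx hz => hx (by simp [hz])
  refine ⟨contDiff_iff_contDiffAt.2 fun x => ?_, ?_, hsub.trans h.2.2⟩
  · by_cases hx : x ∈ tsupport (fun x => φ x / bdist x)
    · have hx' := (mem_disc_iff x).1 (h.2.2 (hsub hx))
      exact h.1.contDiffAt.div contDiff_bdist.contDiffAt hx'.ne'
    · exact contDiffAt_const.congr_of_eventuallyEq (notMem_tsupport_iff_eventuallyEq.1 hx)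
  · exact h.2.1.mono fun x hx hz => hx (by simp [hz])

/-- The sharp Hardy inequality on the disc, for the weight `1 - |x|²`. -/
theorem hardy_test (h : IsTest φ) : ∫ x, (φ x / bdist x) ^ 2 ∂μD ≤ ∫ x, ‖∇ φ x‖ ^ 2 ∂μD := by
  set w : Plane → ℝ := fun x => φ x / bdist x with hw
  have hwt : IsTest w := h.div_bdist
  have hφ : ∀ x, φ x = bdist x * w x := by
    intro x
    by_cases hx : x ∈ disc
    · have := (mem_disc_iff x).1 hx
      simp only [hw]; field_simp
    · simp [hw, h.eq_zero hx]
  have hφ' : φ = fun x => bdist x * w x := funext hφ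
  have hbd : Differentiable ℝ bdist := contDiff_bdist.differentiable (n := 1) (by simp)
  have hpdφ : ∀ i x, pd i φ x = -2 * x i * w x + bdist x * pd i w x := by
    intro i x
    rw [hφ', pd_mul i (hbd x) (hwt.differentiable x), pd_bdist]
  have hvi : ∀ i : Fin 2, IsTest (fun x => (x i * bdist x * w x) * w x) := fun i =>
    hwt.mul_left (((contDiff_coord i).mul contDiff_bdist).mul hwt.1)
  have hdiv : ∀ x, w x ^ 2 = (1 / 2) * (pd 0 (fun x => (x 0 * bdist x * w x) * w x) x
      + pd 1 (fun x => (x 1 * bdist x * w x) * w x) x)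
      - w x * (x 0 * pd 0 φ x + x 1 * pd 1 φ x) := by
    intro x
    have hwd := hwt.differentiable x
    have hb := hbd x
    have hpd : ∀ i : Fin 2, pd i (fun x => (x i * bdist x * w x) * w x) x
        = (bdist x + x i * (-2 * x i)) * w x ^ 2 + 2 * x i * bdist x * w x * pd i w x := by
      intro i
      have hc : DifferentiableAt ℝ (fun y : Plane => y i) x := by fun_prop
      rw [pd_mul i ((hc.fun_mul hb).fun_mul hwd) hwd, pd_mul i (hc.fun_mul hb) hwd, pd_mul i hc hb,
        pd_bdist, pd_coord]
      simp; ring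
    rw [hpd, hpd, hpdφ, hpdφ]
    simp only [bdist]
    ring
  have hint1 : Integrable (fun x => w x ^ 2) μD := (hwt.memLp 2).integrable_sq
  have hint2 : Integrable (fun x => ‖∇ φ x‖ ^ 2) μD :=
    (h.memLp_gradient 2).integrable_norm_pow (by simp)
  have hint3 : Integrable (fun x => w x * (x 0 * pd 0 φ x + x 1 * pd 1 φ x)) μD := by
    have ht : IsTest (fun x => w x * (x 0 * pd 0 φ x + x 1 * pd 1 φ x)) :=
      (((h.pd 0).mul_left (contDiff_coord 0)).add ((h.pd 1).mul_left (contDiff_coord 1))).mul_left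
        hwt.1
    exact memLp_one_iff_integrable.1 (ht.memLp 1)
  have hi : ∀ i : Fin 2, Integrable (pd i (fun x => (x i * bdist x * w x) * w x)) μD :=
    fun i => memLp_one_iff_integrable.1 (((hvi i).pd i).memLp 1)
  have heq : ∫ x, w x ^ 2 ∂μD = - ∫ x, w x * (x 0 * pd 0 φ x + x 1 * pd 1 φ x) ∂μD := by
    rw [integral_congr_ae (.of_forall hdiv),
      integral_sub (((hi 0).fun_add (hi 1)).const_mul _) hint3, integral_const_mul,
      integral_add (hi 0) (hi 1), (hvi 0).integral_pd 0, (hvi 1).integral_pd 1]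
    simp
  have hle : - ∫ x, w x * (x 0 * pd 0 φ x + x 1 * pd 1 φ x) ∂μD
      ≤ ∫ x, ((1 / 2) * w x ^ 2 + (1 / 2) * ‖∇ φ x‖ ^ 2) ∂μD := by
    rw [← integral_neg]
    refine setIntegral_mono_on hint3.neg ((hint1.const_mul _).add (hint2.const_mul _))
      measurableSet_disc fun x hx => ?_
    have hb := (mem_disc_iff x).1 hx
    rw [norm_sq_plane, gradient_apply, gradient_apply]
    unfold bdist at hb
    nlinarith [sq_nonneg (w x * x 0 + pd 0 φ x), sq_nonneg (w x * x 1 + pd 1 φ x),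
      mul_nonneg (sq_nonneg (w x)) hb.le]
  rw [integral_add (hint1.const_mul _) (hint2.const_mul _), integral_const_mul,
    integral_const_mul] at hle
  linarith

/-! ### Square-integrable functions -/

section L2

variable {α : Type*} [MeasurableSpace α] {μ : Measure α}

section Normed

variable {F : Type*} [NormedAddCommGroup F]

lemma integrable_normSq {a : α → F} (ha : MemLp a 2 μ) :
    Integrable (fun x => ‖a x‖ ^ 2) μ := ha.integrable_norm_pow (by simp)

lemma memLp_two_of_lintegral {a : α → F} (ha : AEStronglyMeasurable a μ)
    (h : ∫⁻ x, ‖a x‖ₑ ^ 2 ∂μ < ⊤) : MemLp a 2 μ := by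
  refine ⟨ha, ?_⟩
  rw [eLpNorm_lt_top_iff_lintegral_rpow_enorm_lt_top (by simp) (by simp)]
  simpa using h

lemma lintegral_enorm_sq_eq {a : α → F} : ∫⁻ x, ‖a x‖ₑ ^ 2 ∂μ = eLpNorm a 2 μ ^ 2 := by
  rw [eLpNorm_eq_lintegral_rpow_enorm_toReal (by simp) (by simp)]
  rw [← ENNReal.rpow_natCast, ← ENNReal.rpow_mul]
  simp

lemma lintegral_enorm_sq_lt_top {a : α → F} (ha : MemLp a 2 μ) : ∫⁻ x, ‖a x‖ₑ ^ 2 ∂μ < ⊤ := by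
  rw [lintegral_enorm_sq_eq]
  exact ENNReal.pow_lt_top ha.2

lemma tendsto_toLp {ι : Type*} {l : Filter ι} {a : ι → α → F} {a₀ : α → F}
    (ha : ∀ n, MemLp (a n) 2 μ) (ha₀ : MemLp a₀ 2 μ)
    (h : Tendsto (fun n => eLpNorm (fun x => a n x - a₀ x) 2 μ) l (𝓝 0)) :
    Tendsto (fun n => (ha n).toLp (a n)) l (𝓝 (ha₀.toLp a₀)) :=
  (Lp.tendsto_Lp_iff_tendsto_eLpNorm'' a ha a₀ ha₀).2 h

end Normed

variable {F : Type*} [NormedAddCommGroup F] [InnerProductSpace ℝ F]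

lemma integrable_inner {a b : α → F} (ha : MemLp a 2 μ) (hb : MemLp b 2 μ) :
    Integrable (fun x => ⟪a x, b x⟫) μ := by
  refine (L2.integrable_inner (𝕜 := ℝ) (ha.toLp a) (hb.toLp b)).congr ?_
  filter_upwards [ha.coeFn_toLp, hb.coeFn_toLp] with x h1 h2
  rw [h1, h2]

lemma inner_toLp {a b : α → F} (ha : MemLp a 2 μ) (hb : MemLp b 2 μ) :
    ⟪ha.toLp a, hb.toLp b⟫ = ∫ x, ⟪a x, b x⟫ ∂μ := by
  rw [L2.inner_def]
  refine integral_congr_ae ?_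
  filter_upwards [ha.coeFn_toLp, hb.coeFn_toLp] with x h1 h2
  rw [h1, h2]

lemma norm_toLp_sq {a : α → F} (ha : MemLp a 2 μ) : ‖ha.toLp a‖ ^ 2 = ∫ x, ‖a x‖ ^ 2 ∂μ := by
  rw [← real_inner_self_eq_norm_sq, inner_toLp]
  simp

lemma norm_toLp_eq_sqrt {a : α → F} (ha : MemLp a 2 μ) : ‖ha.toLp a‖ = √(∫ x, ‖a x‖ ^ 2 ∂μ) := by
  rw [← norm_toLp_sq ha, sqrt_sq (norm_nonneg _)]

lemma abs_integral_inner_le {a b : α → F} (ha : MemLp a 2 μ) (hb : MemLp b 2 μ) :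
    |∫ x, ⟪a x, b x⟫ ∂μ| ≤ √(∫ x, ‖a x‖ ^ 2 ∂μ) * √(∫ x, ‖b x‖ ^ 2 ∂μ) := by
  rw [← inner_toLp ha hb, ← norm_toLp_eq_sqrt ha, ← norm_toLp_eq_sqrt hb]
  exact abs_real_inner_le_norm _ _

lemma abs_integral_mul_le {a b : α → ℝ} (ha : MemLp a 2 μ) (hb : MemLp b 2 μ) :
    |∫ x, a x * b x ∂μ| ≤ √(∫ x, a x ^ 2 ∂μ) * √(∫ x, b x ^ 2 ∂μ) := by
  have := abs_integral_inner_le hb ha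
  simp only [RCLike.inner_apply, conj_trivial, norm_eq_abs, sq_abs] at this
  rw [mul_comm (√_)]
  exact this

lemma integrable_mul_L2 {a b : α → ℝ} (ha : MemLp a 2 μ) (hb : MemLp b 2 μ) :
    Integrable (fun x => a x * b x) μ := by
  have := integrable_inner hb ha
  simpa only [RCLike.inner_apply, conj_trivial] using this

lemma ofReal_integral_normSq {a : α → F} (ha : MemLp a 2 μ) :
    ofReal (∫ x, ‖a x‖ ^ 2 ∂μ) = ∫⁻ x, ‖a x‖ₑ ^ 2 ∂μ := by
  rw [ofReal_integral_eq_lintegral_ofReal (integrable_normSq ha)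
    (.of_forall fun x => by positivity)]
  refine lintegral_congr fun x => ?_
  rw [← ofReal_norm, ofReal_pow (norm_nonneg _)]

lemma eLpNorm_eq_ofReal_sqrt {a : α → F} (ha : MemLp a 2 μ) :
    eLpNorm a 2 μ = ofReal √(∫ x, ‖a x‖ ^ 2 ∂μ) := by
  rw [← norm_toLp_eq_sqrt ha, Lp.norm_toLp, ENNReal.ofReal_toReal ha.2.ne]

lemma tendsto_integral_inner {ι : Type*} {l : Filter ι} {a b : ι → α → F} {a₀ b₀ : α → F}
    (ha : ∀ n, MemLp (a n) 2 μ) (ha₀ : MemLp a₀ 2 μ)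
    (h : Tendsto (fun n => eLpNorm (fun x => a n x - a₀ x) 2 μ) l (𝓝 0))
    (hb : ∀ n, MemLp (b n) 2 μ) (hb₀ : MemLp b₀ 2 μ)
    (h' : Tendsto (fun n => eLpNorm (fun x => b n x - b₀ x) 2 μ) l (𝓝 0)) :
    Tendsto (fun n => ∫ x, ⟪a n x, b n x⟫ ∂μ) l (𝓝 (∫ x, ⟪a₀ x, b₀ x⟫ ∂μ)) := by
  have := (tendsto_toLp ha ha₀ h).inner (𝕜 := ℝ) (tendsto_toLp hb hb₀ h')
  simpa only [inner_toLp] using this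

lemma tendsto_integral_inner_const {ι : Type*} {l : Filter ι} {a : ι → α → F} {a₀ b : α → F}
    (ha : ∀ n, MemLp (a n) 2 μ) (ha₀ : MemLp a₀ 2 μ)
    (h : Tendsto (fun n => eLpNorm (fun x => a n x - a₀ x) 2 μ) l (𝓝 0)) (hb : MemLp b 2 μ) :
    Tendsto (fun n => ∫ x, ⟪a n x, b x⟫ ∂μ) l (𝓝 (∫ x, ⟪a₀ x, b x⟫ ∂μ)) :=
  tendsto_integral_inner (b := fun _ => b) ha ha₀ h (fun _ => hb) hb
    (by simpa using tendsto_const_nhds)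

lemma tendsto_integral_mul_const {ι : Type*} {l : Filter ι} {a : ι → α → ℝ} {a₀ b : α → ℝ}
    (ha : ∀ n, MemLp (a n) 2 μ) (ha₀ : MemLp a₀ 2 μ)
    (h : Tendsto (fun n => eLpNorm (fun x => a n x - a₀ x) 2 μ) l (𝓝 0)) (hb : MemLp b 2 μ) :
    Tendsto (fun n => ∫ x, b x * a n x ∂μ) l (𝓝 (∫ x, b x * a₀ x ∂μ)) := by
  have := tendsto_integral_inner_const ha ha₀ h hb
  simpa only [RCLike.inner_apply, conj_trivial] using this

lemma tendsto_integral_normSq {ι : Type*} {l : Filter ι} {a : ι → α → F} {a₀ : α → F}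
    (ha : ∀ n, MemLp (a n) 2 μ) (ha₀ : MemLp a₀ 2 μ)
    (h : Tendsto (fun n => eLpNorm (fun x => a n x - a₀ x) 2 μ) l (𝓝 0)) :
    Tendsto (fun n => ∫ x, ‖a n x‖ ^ 2 ∂μ) l (𝓝 (∫ x, ‖a₀ x‖ ^ 2 ∂μ)) := by
  have := tendsto_integral_inner ha ha₀ h ha ha₀ h
  simpa only [real_inner_self_eq_norm_sq] using this

lemma memLp_bdd_mul {F : Type*} [NormedAddCommGroup F] [NormedSpace ℝ F] {a : α → ℝ} {b : α → F}
    (hb : MemLp b 2 μ) (ha : AEStronglyMeasurable a μ) (C : ℝ) (hC : ∀ᵐ x ∂μ, |a x| ≤ C) :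
    MemLp (fun x => a x • b x) 2 μ := by
  refine hb.of_le_mul (c := C) (ha.smul hb.1) ?_
  filter_upwards [hC] with x hx
  rw [norm_smul, norm_eq_abs]
  gcongr

end L2

/-! ### Functions in `H¹₀(D)` -/

namespace MemH10

variable {v : Plane → ℝ} {g : Plane → Plane}

lemma abs_integral_le (h : MemH10 v g) {Z : Plane → Plane} (hk : MemLp k 2 μD) (hZ : MemLp Z 2 μD)
    (hC : ∀ φ, IsTest φ → |∫ x, k x * φ x ∂μD + ∫ x, ⟪∇ φ x, Z x⟫ ∂μD|
      ≤ C * √(∫ x, ‖∇ φ x‖ ^ 2 ∂μD)) : |∫ x, k x * v x ∂μD + ∫ x, ⟪g x, Z x⟫ ∂μD|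
      ≤ C * √(∫ x, ‖g x‖ ^ 2 ∂μD) := by
  obtain ⟨φ, hφ, h1, h2⟩ := h.approx
  have t1 := tendsto_integral_mul_const (fun n => (hφ n).memLp 2) h.memLp h1 hk
  have t2 := tendsto_integral_inner_const (fun n => (hφ n).memLp_gradient 2) h.memLp_grad h2 hZ
  have t3 := tendsto_integral_normSq (fun n => (hφ n).memLp_gradient 2) h.memLp_grad h2
  exact le_of_tendsto_of_tendsto' (t1.add t2).abs (t3.sqrt.const_mul C) fun n => hC _ (hφ n)

lemma integral_eq_zero (h : MemH10 v g) {Z : Plane → Plane} (hk : MemLp k 2 μD) (hZ : MemLp Z 2 μD)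
    (hC : ∀ φ, IsTest φ → ∫ x, k x * φ x ∂μD + ∫ x, ⟪∇ φ x, Z x⟫ ∂μD = 0) :
    ∫ x, k x * v x ∂μD + ∫ x, ⟪g x, Z x⟫ ∂μD = 0 := by
  have := h.abs_integral_le hk hZ (C := 0) (fun φ hφ => by rw [hC φ hφ]; simp)
  simpa using this

lemma poincare (h : MemH10 v g) : ∫ x, v x ^ 2 ∂μD ≤ ∫ x, ‖g x‖ ^ 2 ∂μD := by
  obtain ⟨φ, hφ, h1, h2⟩ := h.approx
  have t1 := tendsto_integral_normSq (fun n => (hφ n).memLp 2) h.memLp h1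
  have t3 := tendsto_integral_normSq (fun n => (hφ n).memLp_gradient 2) h.memLp_grad h2
  simp only [norm_eq_abs, sq_abs] at t1
  refine le_of_tendsto_of_tendsto' t1 t3 fun n => le_trans ?_ (hardy_test (hφ n))
  refine setIntegral_mono_on ((hφ n).memLp 2).integrable_sq
    ((hφ n).div_bdist.memLp 2).integrable_sq measurableSet_disc fun x hx => ?_
  have hb := (mem_disc_iff x).1 hx
  rw [div_pow, le_div_iff₀ (by positivity)]
  have : bdist x ^ 2 ≤ 1 := pow_le_one₀ hb.le (bdist_le_one x)
  nlinarith [sq_nonneg (φ n x)]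

lemma sub {v' : Plane → ℝ} {g' : Plane → Plane} (h : MemH10 v g) (h' : MemH10 v' g') :
    MemH10 (fun x => v x - v' x) (fun x => g x - g' x) := by
  obtain ⟨φ, hφ, h1, h2⟩ := h.approx
  obtain ⟨φ', hφ', h1', h2'⟩ := h'.approx
  refine ⟨h.memLp.sub h'.memLp, h.memLp_grad.sub h'.memLp_grad,
    fun n x => φ n x - φ' n x, fun n => (hφ n).sub (hφ' n), ?_, ?_⟩
  · refine tendsto_of_tendsto_of_tendsto_of_le_of_le tendsto_const_nhds
      (by simpa using h1.add h1') (fun _ => zero_le) fun n => ?_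
    refine (le_of_eq ?_).trans (eLpNorm_sub_le (((hφ n).memLp 2).sub h.memLp).1
      (((hφ' n).memLp 2).sub h'.memLp).1 (by simp))
    congr 1; funext x; simp; ring
  · refine tendsto_of_tendsto_of_tendsto_of_le_of_le tendsto_const_nhds
      (by simpa using h2.add h2') (fun _ => zero_le) fun n => ?_
    refine (le_of_eq ?_).trans (eLpNorm_sub_le (((hφ n).memLp_gradient 2).sub h.memLp_grad).1
      (((hφ' n).memLp_gradient 2).sub h'.memLp_grad).1 (by simp))
    congr 1; funext x
    have : ∇ (fun x => φ n x - φ' n x) x = ∇ (φ n) x - ∇ (φ' n) x := by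
      ext i
      simp only [gradient_apply, PiLp.sub_apply]
      exact pd_sub i ((hφ n).differentiable x) ((hφ' n).differentiable x)
    rw [this]; simp; abel

end MemH10

/-! ### The lemma of du Bois-Reymond on a half-line -/

lemma locallyIntegrable_indicator_Icc (h : IntegrableOn e (Icc a b)) :
    LocallyIntegrable ((Icc a b).indicator e) :=
  (h.integrable_indicator measurableSet_Icc).locallyIntegrable

/-- The primitive of a normalized bump function. -/
def bumpStep (φ : ContDiffBump (0 : ℝ)) (t : ℝ) : ℝ :=
  ∫ s in (-φ.rOut)..t, φ.normed volume s

lemma hasDerivAt_bumpStep (φ : ContDiffBump (0 : ℝ)) (t : ℝ) :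
    HasDerivAt (bumpStep φ) (φ.normed volume t) t :=
  integral_hasDerivAt_right (φ.continuous_normed.intervalIntegrable _ _)
    (φ.continuous_normed.stronglyMeasurableAtFilter _ _) φ.continuous_normed.continuousAt

lemma contDiff_bumpStep (φ : ContDiffBump (0 : ℝ)) : Smooth (bumpStep φ) := by
  rw [contDiff_infty_iff_deriv]
  refine ⟨fun t => (hasDerivAt_bumpStep φ t).differentiableAt, ?_⟩
  rw [show deriv (bumpStep φ) = φ.normed volume from
    funext fun t => (hasDerivAt_bumpStep φ t).deriv]
  exact φ.contDiff_normed

lemma normed_eq_zero {φ : ContDiffBump (0 : ℝ)} (h : φ.rOut ≤ |s|) : φ.normed volume s = 0 := by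
  have : s ∉ Function.support (φ.normed volume) := by rw [φ.support_normed_eq]; simpa using h
  simpa using this

lemma bumpStep_of_le (φ : ContDiffBump (0 : ℝ)) (h : t ≤ -φ.rOut) : bumpStep φ t = 0 := by
  unfold bumpStep
  refine intervalIntegral.integral_zero_ae (.of_forall fun s hs => ?_)
  rw [uIoc_of_ge h] at hs
  have := φ.rOut_pos
  exact normed_eq_zero (by rw [abs_of_nonpos (by linarith [hs.2])]; linarith [hs.2])

lemma bumpStep_of_ge (φ : ContDiffBump (0 : ℝ)) (h : φ.rOut ≤ t) : bumpStep φ t = 1 := by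
  have hp := φ.rOut_pos
  unfold bumpStep
  rw [integral_of_le (by linarith), ← φ.integral_normed (μ := volume)]
  refine setIntegral_eq_integral_of_forall_compl_eq_zero fun s hs => ?_
  refine normed_eq_zero ?_
  by_contra! hlt
  rw [abs_lt] at hlt
  exact hs ⟨hlt.1, by linarith [hlt.2]⟩

lemma bumpStep_mem (φ : ContDiffBump (0 : ℝ)) (t : ℝ) : bumpStep φ t ∈ Icc (0 : ℝ) 1 := by
  have hm : Monotone (bumpStep φ) := monotone_of_deriv_nonneg
    (fun t => (hasDerivAt_bumpStep φ t).differentiableAt)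
    fun t => by rw [(hasDerivAt_bumpStep φ t).deriv]; exact φ.nonneg_normed t
  constructor
  · rcases le_total t (-φ.rOut) with h | h
    · rw [bumpStep_of_le φ h]
    · rw [← bumpStep_of_le φ le_rfl]; exact hm h
  · rcases le_total t φ.rOut with h | h
    · rw [← bumpStep_of_ge φ le_rfl]; exact hm h
    · rw [bumpStep_of_ge φ h]

/-- A sequence of bump functions shrinking to the origin. -/
def shrinkBump (n : ℕ) : ContDiffBump (0 : ℝ) :=
  ⟨(1 / 2) * (1 / ((n : ℝ) + 1)), 1 / ((n : ℝ) + 1), by positivity, by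
    have : 0 < 1 / ((n : ℝ) + 1) := by positivity
    linarith⟩

lemma tendsto_shrinkBump : Tendsto (fun n => (shrinkBump n).rOut) atTop (𝓝 0) :=
  tendsto_one_div_add_atTop_nhds_zero_nat

lemma ae_tendsto_shrinkBump (he : LocallyIntegrable e) :
    ∀ᵐ t, Tendsto (fun n => ∫ s, (shrinkBump n).normed volume (s - t) * e s) atTop (𝓝 (e t)) := by
  have := ContDiffBump.ae_convolution_tendsto_right_of_locallyIntegrable (φ := shrinkBump)
    (μ := volume) (K := 2) tendsto_shrinkBump (.of_forall fun n => by simp [shrinkBump]) he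
  filter_upwards [this] with t ht
  refine ht.congr fun n => ?_
  rw [convolution_eq_swap]
  refine integral_ext fun s => ?_
  simp only [ContinuousLinearMap.lsmul_apply, smul_eq_mul]
  rw [← ContDiffBump.normed_neg, neg_sub]

/-- A locally integrable function on `(c, ∞)` whose distributional derivative is `-q` is almost
everywhere a primitive of `-q`. -/
theorem exists_ae_primitive {q : ℝ → ℝ} (he : ∀ a b, c < a → a < b → IntegrableOn e (Icc a b))
    (hq : ∀ a b, c < a → a < b → IntegrableOn q (Icc a b))
    (h : ∀ θ : ℝ → ℝ, Smooth θ → HasCompactSupport θ → tsupport θ ⊆ Ioi c →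
      ∫ t, deriv θ t * e t = ∫ t, θ t * q t) :
    ∃ S : Set ℝ, (∀ᵐ t, t ∈ S) ∧ ∀ a ∈ S, ∀ b ∈ S, c < a → a < b →
      e b - e a = - ∫ t in a..b, q t := by
  set I : ℕ → Set ℝ := fun n => Icc (c + 1 / ((n : ℝ) + 1)) (c + n + 2) with hI
  have hIint : ∀ n, IntegrableOn e (I n) ∧ IntegrableOn q (I n) := by
    intro n
    have : 1 / ((n : ℝ) + 1) ≤ 1 := by
      rw [div_le_one (by positivity)]; linarith [n.cast_nonneg (α := ℝ)]
    have h0 : 0 < 1 / ((n : ℝ) + 1) := by positivity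
    exact ⟨he _ _ (by linarith) (by linarith [n.cast_nonneg (α := ℝ)]),
      hq _ _ (by linarith) (by linarith [n.cast_nonneg (α := ℝ)])⟩
  refine ⟨{t | ∀ n, Tendsto (fun k => ∫ s, (shrinkBump k).normed volume (s - t)
    * (I n).indicator e s) atTop (𝓝 ((I n).indicator e t))}, ?_, ?_⟩
  · simp only [mem_ofPred_eq]
    rw [ae_all_iff]
    exact fun n => ae_tendsto_shrinkBump (locallyIntegrable_indicator_Icc (hIint n).1)
  intro a ha b hb hca hab
  -- choose an interval containing a neighbourhood of `[a, b]`
  obtain ⟨n, hn1, hn2⟩ : ∃ n : ℕ, c + 1 / ((n : ℝ) + 1) < a ∧ b < c + n + 2 := by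
    obtain ⟨n1, hn1⟩ := exists_nat_one_div_lt (sub_pos.2 hca)
    obtain ⟨n2, hn2⟩ := exists_nat_gt (b - c)
    refine ⟨max n1 n2, ?_, ?_⟩
    · have : 1 / (((max n1 n2 : ℕ) : ℝ) + 1) ≤ 1 / ((n1 : ℝ) + 1) := by
        gcongr; exact le_max_left _ _
      linarith
    · have : ((n2 : ℕ) : ℝ) ≤ ((max n1 n2 : ℕ) : ℝ) := by exact_mod_cast le_max_right _ _
      linarith
  have haI : a ∈ I n := ⟨hn1.le, by linarith⟩
  have hbI : b ∈ I n := ⟨by linarith, hn2.le⟩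
  have ta := ha n
  have tb := hb n
  rw [indicator_of_mem haI] at ta
  rw [indicator_of_mem hbI] at tb
  set θ : ℕ → ℝ → ℝ := fun k t => bumpStep (shrinkBump k) (t - a) - bumpStep (shrinkBump k) (t - b)
  have hsmall : ∀ᶠ k in atTop, (shrinkBump k).rOut < min (a - (c + 1 / ((n : ℝ) + 1)))
      (min (c + n + 2 - b) (b - a)) := tendsto_shrinkBump.eventually_lt_const
      (lt_min (by linarith) (lt_min (by linarith) (by linarith)))
  have hθ0 : ∀ k t, t ∉ Icc (a - (shrinkBump k).rOut) (b + (shrinkBump k).rOut) → θ k t = 0 := by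
    intro k t ht
    rw [mem_Icc, not_and_or, not_le, not_le] at ht
    rcases ht with ht | ht
    · simp only [θ]
      rw [bumpStep_of_le _ (by linarith), bumpStep_of_le _ (by linarith), sub_zero]
    · simp only [θ]
      rw [bumpStep_of_ge _ (by linarith), bumpStep_of_ge _ (by linarith), sub_self]
  have hθts : ∀ k, tsupport (θ k) ⊆ Icc (a - (shrinkBump k).rOut) (b + (shrinkBump k).rOut) :=
    fun k => closure_minimal (fun t ht => by_contra fun hh => ht (hθ0 k t hh)) isClosed_Icc
  have hθsm : ∀ k, Smooth (θ k) := fun k =>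
    ((contDiff_bumpStep _).comp (contDiff_id.sub contDiff_const)).sub
      ((contDiff_bumpStep _).comp (contDiff_id.sub contDiff_const))
  have hθd : ∀ k t, deriv (θ k) t = (shrinkBump k).normed volume (t - a)
      - (shrinkBump k).normed volume (t - b) := by
    intro k t
    have h1 := (hasDerivAt_bumpStep (shrinkBump k) (t - a)).comp_sub_const t a
    have h2 := (hasDerivAt_bumpStep (shrinkBump k) (t - b)).comp_sub_const t b
    exact (h1.sub h2).deriv
  have hIcI : ∀ᶠ k in atTop, ∀ t ∈ Icc (a - (shrinkBump k).rOut) (b + (shrinkBump k).rOut),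
      t ∈ I n := by
    filter_upwards [hsmall] with k hk t ht
    rw [lt_min_iff, lt_min_iff] at hk
    exact ⟨by linarith [ht.1, hk.1], by linarith [ht.2, hk.2.1]⟩
  have hlim1 : Tendsto (fun k => ∫ t, deriv (θ k) t * e t) atTop (𝓝 (e a - e b)) := by
    refine (ta.sub tb).congr' ?_
    filter_upwards [hsmall, hIcI] with k hk hkI
    have hint : ∀ y, Integrable (fun s => (shrinkBump k).normed volume (s - y)
        * (I n).indicator e s) := by
      intro y
      obtain ⟨C, hC⟩ := (shrinkBump k).hasCompactSupport_normed (μ := volume)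
        |>.exists_bound_of_continuous (shrinkBump k).continuous_normed
      refine ((hIint n).1.integrable_indicator measurableSet_Icc).bdd_mul (c := C) ?_ ?_
      · exact ((shrinkBump k).continuous_normed.comp (continuous_sub_right y)).aestronglyMeasurable
      · exact .of_forall fun s => hC _
    rw [← integral_sub (hint a) (hint b)]
    refine integral_ext fun s => ?_
    rw [hθd]
    by_cases hs : s ∈ I n
    · rw [indicator_of_mem hs]; ring
    · rw [indicator_of_notMem hs]
      have hs' : s ∉ Icc (a - (shrinkBump k).rOut) (b + (shrinkBump k).rOut) :=
        fun hh => hs (hkI s hh)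
      have : deriv (θ k) s = 0 := by
        have hsub := (tsupport_deriv_subset (f := θ k) (𝕜 := ℝ)).trans (hθts k)
        exact image_eq_zero_of_notMem_tsupport fun hh => hs' (hsub hh)
      rw [hθd] at this
      rw [this]; ring
  have hlim2 : Tendsto (fun k => ∫ t, θ k t * q t) atTop (𝓝 (∫ t in a..b, q t)) := by
    rw [integral_of_le hab.le, ← integral_indicator measurableSet_Ioc]
    have hqI : Integrable ((I n).indicator fun t => ‖q t‖) :=
      IntegrableOn.integrable_indicator (f := fun t => ‖q t‖) (hIint n).2.norm measurableSet_Icc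
    have hqm : AEStronglyMeasurable q (volume.restrict (I n)) := (hIint n).2.1
    have hrw : ∀ᶠ k in atTop, (fun t => θ k t * q t) = (I n).indicator (θ k * q) := by
      filter_upwards [hIcI] with k hkI
      funext t
      by_cases ht : t ∈ I n
      · rw [indicator_of_mem ht]; rfl
      · rw [indicator_of_notMem ht, hθ0 k t fun hh => ht (hkI t hh), zero_mul]
    refine tendsto_integral_filter_of_dominated_convergence _ ?_ ?_ hqI ?_
    · filter_upwards [hrw] with k hk
      rw [hk]
      exact (aestronglyMeasurable_indicator_iff measurableSet_Icc).2
        (((hθsm k).continuous.aestronglyMeasurable).mul hqm)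
    · filter_upwards [hrw] with k hk
      refine .of_forall fun t => ?_
      rw [congrFun hk t]
      by_cases ht : t ∈ I n
      · rw [indicator_of_mem ht, indicator_of_mem ht, Pi.mul_apply, norm_mul]
        have h1 := bumpStep_mem (shrinkBump k) (t - a)
        have h2 := bumpStep_mem (shrinkBump k) (t - b)
        have : ‖θ k t‖ ≤ 1 := by
          simp only [θ, norm_eq_abs, abs_le]
          exact ⟨by linarith [h1.1, h2.2], by linarith [h1.2, h2.1]⟩
        nlinarith [norm_nonneg (q t)]
      · rw [indicator_of_notMem ht, indicator_of_notMem ht, norm_zero]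
    · have hne : ∀ᵐ t : ℝ, t ≠ a ∧ t ≠ b := by
        have h1 : ∀ᵐ t : ℝ, t ≠ a := by simp [ae_iff]
        have h2 : ∀ᵐ t : ℝ, t ≠ b := by simp [ae_iff]
        exact h1.and h2
      filter_upwards [hne] with t ht
      refine tendsto_const_nhds.congr' ?_
      have : ∀ᶠ k in atTop, (shrinkBump k).rOut < min |t - a| |t - b| :=
        tendsto_shrinkBump.eventually_lt_const
          (lt_min (abs_pos.2 (sub_ne_zero.2 ht.1)) (abs_pos.2 (sub_ne_zero.2 ht.2)))
      filter_upwards [this] with k hk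
      rw [lt_min_iff] at hk
      have hstep : ∀ y, (shrinkBump k).rOut < |t - y| →
          bumpStep (shrinkBump k) (t - y) = if y < t then 1 else 0 := by
        intro y hy
        split_ifs with hyt
        · rw [abs_of_pos (by linarith)] at hy
          exact bumpStep_of_ge _ hy.le
        · rw [abs_of_nonpos (by linarith)] at hy
          exact bumpStep_of_le _ (by linarith)
      simp only [θ, hstep a hk.1, hstep b hk.2]
      by_cases hat : a < t
      · by_cases hbt : b < t
        · rw [indicator_of_notMem (by simp [hbt])]; simp [hat, hbt]
        · rw [indicator_of_mem (by simp [hat, not_lt.1 hbt])]; simp [hat, hbt]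
      · have : ¬ b < t := by linarith
        rw [indicator_of_notMem (by simp [hat])]; simp [hat, this]
  have heq : ∀ᶠ k in atTop, ∫ t, deriv (θ k) t * e t = ∫ t, θ k t * q t := by
    filter_upwards [hIcI] with k hkI
    refine h _ (hθsm k) (of_support_subset_isCompact isCompact_Icc
      (subset_closure.trans (hθts k))) fun t ht => ?_
    have := (hkI t (hθts k ht)).1
    have h0 : 0 < 1 / ((n : ℝ) + 1) := by positivity
    exact lt_of_lt_of_le (by linarith) this
  have := tendsto_nhds_unique (hlim1.congr' heq) hlim2
  linarith

/-! ### Slices of space-time functions -/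

section Slices

variable {F : Type*} [NormedAddCommGroup F] {ν : Measure ℝ} [SFinite ν]

lemma cylMeasure_eq : μC = (μT).prod μD := by
  rw [cylMeasure, discMeasure, Measure.prod_restrict, Measure.volume_eq_prod]

lemma ae_memLp_slice {v : ℝ → Plane → F}
    (hv : MemLp ♯v 2 (ν.prod μD)) : ∀ᵐ t ∂ν, MemLp (v t) 2 μD := by
  have h1 : Integrable (fun p => ‖v p.1 p.2‖ ^ 2) (ν.prod μD) := integrable_normSq hv
  filter_upwards [h1.prod_right_ae, hv.1.prodMk_left] with t ht1 ht2
  refine memLp_two_of_lintegral ht2 ?_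
  have := ht1.2
  rw [hasFiniteIntegral_iff_enorm] at this
  simpa using this

lemma integrable_slice_normSq {v : ℝ → Plane → F} (hv : MemLp ♯v 2 (ν.prod μD)) :
    Integrable (fun t => ∫ x, ‖v t x‖ ^ 2 ∂μD) ν :=
  (integrable_normSq hv).integral_prod_left

lemma integrable_slice_inner [InnerProductSpace ℝ F] {v w : ℝ → Plane → F}
    (hv : MemLp ♯v 2 (ν.prod μD))
    (hw : MemLp ♯w 2 (ν.prod μD)) :
    Integrable (fun t => ∫ x, ⟪v t x, w t x⟫ ∂μD) ν :=
  (integrable_inner hv hw).integral_prod_left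

lemma integrable_slice_mul {v w : ℝ → Plane → ℝ} (hv : MemLp ♯v 2 (ν.prod μD))
    (hw : MemLp ♯w 2 (ν.prod μD)) :
    Integrable (fun t => ∫ x, v t x * w t x ∂μD) ν :=
  (integrable_mul_L2 hv hw).integral_prod_left

lemma memLp_snd [IsFiniteMeasure ν] {g : Plane → F} (hg : MemLp g 2 μD) :
    MemLp (fun p => g p.2) 2 (ν.prod μD) := hg.comp_snd ν

lemma eLpNorm_snd [IsFiniteMeasure ν] {g : Plane → F} (hg : AEStronglyMeasurable g μD) :
    eLpNorm (fun p => g p.2) 2 (ν.prod μD) = (ν univ) ^ (1 / 2 : ℝ) * eLpNorm g 2 μD := by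
  have h1 : Measure.map Prod.snd (ν.prod μD) = ν univ • μD := Measure.map_snd_prod
  have h2 : AEStronglyMeasurable g (Measure.map Prod.snd (ν.prod μD)) := by
    rw [h1]; exact hg.smul_measure _
  have := eLpNorm_map_measure (p := 2) h2 measurable_snd.aemeasurable
  rw [h1] at this
  rw [show (fun p => g p.2) = g ∘ Prod.snd from rfl, ← this,
    eLpNorm_smul_measure_of_ne_top (by simp)]
  simp

lemma MemL2Loc.memLp_Icc {v : ℝ → Plane → F} (hv : MemL2Loc v) (ha : 0 < a) (hab : a < b) :
    MemLp ♯v 2 ((volume.restrict (Icc a b)).prod μD) := by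
  have hm : AEStronglyMeasurable ♯v
      ((volume.restrict (Icc a b)).prod μD) := by
    have := hv.1
    rw [JointlyMeasurable, cylMeasure_eq] at this
    refine this.mono_measure (Measure.prod_mono ?_ le_rfl)
    exact restrict_mono (fun t ht => lt_of_lt_of_le ha ht.1) le_rfl
  refine memLp_two_of_lintegral hm ?_
  rw [lintegral_prod _ (by fun_prop)]
  exact hv.2 a b ha hab

end Slices

/-! ### Translations in time -/

section Translation

variable {F : Type*} [NormedAddCommGroup F]

lemma measurePreserving_shift (z : ℝ) :
    MeasurePreserving (fun p => (p.1 + z, p.2)) (volume.prod μD) (volume.prod μD) :=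
  (measurePreserving_add_right volume z).prod (MeasurePreserving.id _)

lemma tendsto_shift {W : ℝP → F} (hW : MemLp W 2 (volume.prod μD)) :
    Tendsto (fun z : ℝ => eLpNorm (fun p => W (p.1 + z, p.2) - W p) 2
      (volume.prod μD)) (𝓝 0) (𝓝 0) := by
  let g : ℝ → C(ℝP, ℝP) := fun z => ⟨fun p => (p.1 + z, p.2), by fun_prop⟩
  have hg : Continuous g := ContinuousMap.continuous_of_continuous_uncurry _ (by
    simp only [g, Function.uncurry_def, ContinuousMap.coe_mk]; fun_prop)
  have hmp : ∀ z, MeasurePreserving (g z) (volume.prod μD)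
    (volume.prod μD) := measurePreserving_shift
  have hc : Continuous fun z => Lp.compMeasurePreserving (g z) (hmp z) (hW.toLp W) :=
    (continuous_const (y := hW.toLp W)).compMeasurePreservingLp hg hmp (by simp)
  have h0 := hc.tendsto 0
  rw [Lp.tendsto_Lp_iff_tendsto_eLpNorm'] at h0
  refine h0.congr fun z => ?_
  refine eLpNorm_congr_ae ?_
  have e1 : ∀ z, Lp.compMeasurePreserving (g z) (hmp z) (hW.toLp W)
      =ᵐ[volume.prod μD] fun p => W (p.1 + z, p.2) := by
    intro z
    refine (Lp.coeFn_compMeasurePreserving _ (hmp z)).trans ?_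
    exact (hmp z).quasiMeasurePreserving.ae_eq_comp hW.coeFn_toLp
  filter_upwards [e1 z, e1 0] with p h1 h2
  rw [Pi.sub_apply, h1, h2]
  simp

lemma memLp_shift {W : ℝP → F} (hW : MemLp W 2 (volume.prod μD)) (z : ℝ) :
    MemLp (fun p => W (p.1 + z, p.2)) 2 (volume.prod μD) :=
  hW.comp_measurePreserving (measurePreserving_shift z)

variable [InnerProductSpace ℝ F]

lemma tendsto_shift_inner {V W : ℝP → F} (hV : MemLp V 2 (volume.prod μD))
    (hW : MemLp W 2 (volume.prod μD)) (I : Set ℝ) :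
    Tendsto (fun z : ℝ × ℝ => ∫ t in I, ∫ x, ⟪V (t + z.1, x), W (t + z.2, x)⟫ ∂μD)
      (𝓝 (0, 0)) (𝓝 (∫ t in I, ∫ x, ⟪V (t, x), W (t, x)⟫ ∂μD)) := by
  have hle : (volume.restrict I).prod μD ≤ (volume : Measure ℝ).prod μD :=
    Measure.prod_mono restrict_le_self le_rfl
  have hmem : ∀ {U : ℝP → F}, MemLp U 2 (volume.prod μD) → ∀ z : ℝ,
      MemLp (fun p : ℝP => U (p.1 + z, p.2)) 2 ((volume.restrict I).prod μD) :=
    fun hU z => (memLp_shift hU z).mono_measure hle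
  have hprod : ∀ z : ℝ × ℝ, ∫ t in I, ∫ x, ⟪V (t + z.1, x), W (t + z.2, x)⟫ ∂μD
      = ∫ p, ⟪V (p.1 + z.1, p.2), W (p.1 + z.2, p.2)⟫
        ∂((volume.restrict I).prod μD) := fun z =>
    (integral_prod _ (integrable_inner (hmem hV z.1) (hmem hW z.2))).symm
  have hprod0 := hprod (0, 0)
  simp only [add_zero] at hprod0
  rw [hprod0]
  simp only [hprod]
  have hto : ∀ {U : ℝP → F}, MemLp U 2 (volume.prod μD) →
      Tendsto (fun z : ℝ => eLpNorm (fun p : ℝP => U (p.1 + z, p.2) - U p) 2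
        ((volume.restrict I).prod μD)) (𝓝 0) (𝓝 0) := fun hU =>
    tendsto_of_tendsto_of_tendsto_of_le_of_le tendsto_const_nhds (tendsto_shift hU)
      (fun _ => zero_le) fun z => eLpNorm_mono_measure _ hle
  exact tendsto_integral_inner (a := fun z : ℝ × ℝ => fun p : ℝP => V (p.1 + z.1, p.2))
    (b := fun z : ℝ × ℝ => fun p : ℝP => W (p.1 + z.2, p.2))
    (fun z => hmem hV z.1) (hV.mono_measure hle) ((hto hV).comp (continuous_fst.tendsto (0, 0)))
    (fun z => hmem hW z.2) (hW.mono_measure hle) ((hto hW).comp (continuous_snd.tendsto (0, 0)))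

lemma lintegral_shift_le {W : ℝP → F} (hWm : StronglyMeasurable W) (I : Set ℝ) (h : ℝ) :
    ∫⁻ t in I, ∫⁻ z in Ioc 0 h, ∫⁻ x, ‖W (t + z, x)‖ₑ ^ 2 ∂μD
      ≤ ofReal h * ∫⁻ p, ‖W p‖ₑ ^ 2 ∂(volume.prod μD) := by
  have hm : Measurable fun p : (ℝ × ℝ) × Plane => ‖W (p.1.1 + p.1.2, p.2)‖ₑ ^ 2 :=
    (hWm.comp_measurable (by fun_prop)).enorm.pow_const 2
  have hm2 : Measurable fun p : ℝ × ℝ => ∫⁻ x, ‖W (p.1 + p.2, x)‖ₑ ^ 2 ∂μD :=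
    hm.lintegral_prod_right'
  rw [lintegral_lintegral_swap (by exact hm2.aemeasurable)]
  have hb : ∀ z : ℝ, ∫⁻ t in I, ∫⁻ x, ‖W (t + z, x)‖ₑ ^ 2 ∂μD
      ≤ ∫⁻ p, ‖W p‖ₑ ^ 2 ∂(volume.prod μD) := by
    intro z
    rw [lintegral_prod _ (hWm.enorm.pow_const 2).aemeasurable]
    refine (setLIntegral_le_lintegral _ _).trans (le_of_eq ?_)
    exact lintegral_add_right_eq_self (fun t => ∫⁻ x, ‖W (t, x)‖ₑ ^ 2 ∂μD) z
  refine (lintegral_mono hb).trans ?_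
  rw [lintegral_const, Measure.restrict_apply_univ, Real.volume_Ioc, sub_zero, mul_comm]

lemma integrable_correlation {V W : ℝP → F} (hVm : StronglyMeasurable V)
    (hWm : StronglyMeasurable W) (hV : MemLp V 2 (volume.prod μD))
    (hW : MemLp W 2 (volume.prod μD)) (α β c h : ℝ) : Integrable (fun p : ℝ × ℝ =>
      ∫ x, ⟪V (p.1 + c, x), W (p.1 + p.2, x)⟫ ∂μD)
      ((volume.restrict (Icc α β)).prod (volume.restrict (Ioc 0 h))) := by
  set μ3 := ((volume.restrict (Icc α β)).prod (volume.restrict (Ioc 0 h))).prod μD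
  have hm1 : StronglyMeasurable fun p : (ℝ × ℝ) × Plane => V (p.1.1 + c, p.2) :=
    hVm.comp_measurable (by fun_prop)
  have hm2 : StronglyMeasurable fun p : (ℝ × ℝ) × Plane => W (p.1.1 + p.1.2, p.2) :=
    hWm.comp_measurable (by fun_prop)
  have hL1 : MemLp (fun p : (ℝ × ℝ) × Plane => V (p.1.1 + c, p.2)) 2 μ3 := by
    refine memLp_two_of_lintegral hm1.aestronglyMeasurable ?_
    rw [lintegral_prod _ (hm1.enorm.pow_const 2).aemeasurable, lintegral_prod _
      ((hm1.enorm.pow_const 2).lintegral_prod_right').aemeasurable]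
    simp only [lintegral_const, Measure.restrict_apply_univ, Real.volume_Ioc, sub_zero]
    rw [lintegral_mul_const']
    · refine mul_lt_top ?_ (by simp)
      have h1 := lintegral_enorm_sq_lt_top (memLp_shift hV (c))
      have hm3 : StronglyMeasurable fun p : ℝP => V (p.1 + c, p.2) :=
        hVm.comp_measurable (by fun_prop)
      rw [lintegral_prod _ (hm3.enorm.pow_const 2).aemeasurable] at h1
      exact lt_of_le_of_lt (setLIntegral_le_lintegral _ _) h1
    · simp
  have hL2 : MemLp (fun p : (ℝ × ℝ) × Plane => W (p.1.1 + p.1.2, p.2)) 2 μ3 := by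
    refine memLp_two_of_lintegral hm2.aestronglyMeasurable ?_
    rw [lintegral_prod _ (hm2.enorm.pow_const 2).aemeasurable, lintegral_prod _
      ((hm2.enorm.pow_const 2).lintegral_prod_right').aemeasurable]
    exact lt_of_le_of_lt (lintegral_shift_le hWm _ h)
      (mul_lt_top (by simp) (lintegral_enorm_sq_lt_top hW))
  exact (integrable_inner hL1 hL2).integral_prod_left

lemma tendsto_average_correlation {V W : ℝP → F} (hVm : StronglyMeasurable V)
    (hWm : StronglyMeasurable W) (hV : MemLp V 2 (volume.prod μD))
    (hW : MemLp W 2 (volume.prod μD)) (α β : ℝ) (c : ℝ) :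
    Tendsto (fun h : ℝ => h⁻¹ * ∫ t in Icc α β, ∫ z in (0 : ℝ)..h,
        ∫ x, ⟪V (t + c * h, x), W (t + z, x)⟫ ∂μD)
      (𝓝[>] 0) (𝓝 (∫ t in Icc α β, ∫ x, ⟪V (t, x), W (t, x)⟫ ∂μD)) := by
  set Q : ℝ × ℝ → ℝ := fun z => ∫ t in Icc α β, ∫ x, ⟪V (t + z.1, x), W (t + z.2, x)⟫ ∂μD with hQ
  set Q₀ := ∫ t in Icc α β, ∫ x, ⟪V (t, x), W (t, x)⟫ ∂μD
  have hlim : Tendsto Q (𝓝 (0, 0)) (𝓝 Q₀) := tendsto_shift_inner hV hW _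
  have hswap : ∀ h : ℝ, 0 < h → ∫ t in Icc α β, ∫ z in (0 : ℝ)..h,
        ∫ x, ⟪V (t + c * h, x), W (t + z, x)⟫ ∂μD = ∫ z in (0 : ℝ)..h, Q (c * h, z) := by
    intro h hh
    simp only [integral_of_le hh.le, hQ]
    refine integral_integral_swap ?_
    exact integrable_correlation hVm hWm hV hW α β _ h
  rw [Metric.tendsto_nhds]
  intro ε hε
  rw [Metric.tendsto_nhds_nhds] at hlim
  obtain ⟨δ, hδ, hlim⟩ := hlim (ε / 2) (by positivity)
  have hδ' : 0 < δ / (1 + |c|) := by positivity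
  filter_upwards [Ioo_mem_nhdsGT hδ'] with h hh
  rw [hswap h hh.1]
  have hlt : h * (1 + |c|) < δ := by
    have := hh.2; rwa [lt_div_iff₀ (by positivity)] at this
  have key : ∀ z ∈ uIoc 0 h, ‖Q (c * h, z) - Q₀‖ ≤ ε / 2 := by
    intro z hz
    rw [uIoc_of_le hh.1.le] at hz
    refine (hlim ?_).le
    rw [Prod.dist_eq, max_lt_iff]
    simp only [dist_zero_right, norm_eq_abs, abs_mul, abs_of_pos hh.1, abs_of_pos hz.1]
    constructor <;> nlinarith [abs_nonneg c, hh.1, hz.2]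
  have hQc : AEStronglyMeasurable (fun z => Q (c * h, z)) volume := by
    have hm : StronglyMeasurable fun p : (ℝ × ℝ) × Plane =>
        ⟪V (p.1.2 + c * h, p.2), W (p.1.2 + p.1.1, p.2)⟫ :=
      (hVm.comp_measurable (by fun_prop)).inner (hWm.comp_measurable (by fun_prop))
    have h2 : StronglyMeasurable fun p : ℝ × ℝ =>
        ∫ x, ⟪V (p.2 + c * h, x), W (p.2 + p.1, x)⟫ ∂μD := hm.integral_prod_right
    have h3 : StronglyMeasurable fun z : ℝ => ∫ t in Icc α β,
        ∫ x, ⟪V (t + c * h, x), W (t + z, x)⟫ ∂μD := h2.integral_prod_right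
    exact (h3.comp_measurable measurable_id).aestronglyMeasurable
  have hint : IntervalIntegrable (fun z => Q (c * h, z)) volume 0 h := by
    rw [intervalIntegrable_iff_integrableOn_Ioc_of_le hh.1.le]
    refine Measure.integrableOn_of_bounded (M := ‖Q₀‖ + ε / 2) (by simp) hQc ?_
    rw [ae_restrict_iff' measurableSet_Ioc]
    refine .of_forall fun z hz => ?_
    have := key z (by rwa [uIoc_of_le hh.1.le])
    calc ‖Q (c * h, z)‖ ≤ ‖Q₀‖ + ‖Q (c * h, z) - Q₀‖ := norm_le_norm_add_norm_sub' _ _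
      _ ≤ _ := by gcongr
  have hdiff : h⁻¹ * ∫ z in (0 : ℝ)..h, Q (c * h, z)
      = Q₀ + h⁻¹ * ∫ z in (0 : ℝ)..h, (Q (c * h, z) - Q₀) := by
    rw [intervalIntegral.integral_sub hint (by simp)]
    have := hh.1.ne'
    simp
    field_simp
    ring
  rw [hdiff, dist_self_add_left, norm_mul, norm_inv, norm_eq_abs, abs_of_pos hh.1]
  have := intervalIntegral.norm_integral_le_of_norm_le_const key
  rw [sub_zero, abs_of_pos hh.1] at this
  calc h⁻¹ * ‖∫ z in (0 : ℝ)..h, (Q (c * h, z) - Q₀)‖ ≤ h⁻¹ * (ε / 2 * h) := by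
        gcongr; exact inv_nonneg.2 hh.1.le
    _ = ε / 2 := by field_simp [hh.1.ne']
    _ < ε := by linarith

end Translation

/-! ### Evolution equations in `H⁻¹(D)` -/

/-- `T ∈ L²_loc((0, ∞); H¹₀(D))` with gradient `DT` and `∂ₜT = ∇ · m`, where
`m ∈ L²_loc((0, ∞); L²(D; ℝ²))`. -/
structure IsEvolution (T : ℝ → Plane → ℝ) (DT m : ℝ → Plane → Plane) : Prop where
  memL2Loc : MemL2Loc T
  memL2Loc_grad : MemL2Loc DT
  memH10 : ∀ᵐ t ∂μT, MemH10 (T t) (DT t)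
  memL2Loc_flux : MemL2Loc m
  timeDeriv : IsTimeDeriv T m

lemma isTest_zero : IsTest (fun _ => 0) :=
  ⟨contDiff_const, HasCompactSupport.zero, by simp [tsupport, Function.support]⟩

lemma exists_dense_tests : ∃ Φ : ℕ → Plane → ℝ, (∀ n, IsTest (Φ n)) ∧
    ∀ v g, MemH10 v g → ∃ k : ℕ → ℕ,
      Tendsto (fun n => eLpNorm (fun x => Φ (k n) x - v x) 2 μD) atTop (𝓝 0) ∧
      Tendsto (fun n => eLpNorm (fun x => ∇ (Φ (k n)) x - g x) 2 μD) atTop (𝓝 0) := by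
  haveI : Fact ((2 : ℝ≥0∞) ≠ ⊤) := ⟨by simp⟩
  let X := Lp ℝ 2 μD × Lp Plane 2 μD
  haveI i1 : SecondCountableTopology (Lp ℝ 2 μD) := inferInstance
  haveI i2 : SecondCountableTopology (Lp Plane 2 μD) := inferInstance
  haveI i3 : SecondCountableTopology X := inferInstance
  let ι : {φ // IsTest φ} → X := fun φ => ((φ.2.memLp 2).toLp φ.1, (φ.2.memLp_gradient 2).toLp _)
  haveI : Nonempty (range ι) := ⟨⟨ι ⟨_, isTest_zero⟩, mem_range_self _⟩⟩
  let d : ℕ → range ι := TopologicalSpace.denseSeq (range ι)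
  have hd : ∀ n, ∃ φ : {φ // IsTest φ}, ι φ = d n := fun n => (d n).2
  choose Φ hΦ using hd
  refine ⟨fun n => (Φ n).1, fun n => (Φ n).2, fun v g hv => ?_⟩
  obtain ⟨φ, hφ, h1, h2⟩ := hv.approx
  have hlim : Tendsto (fun n => ι ⟨φ n, hφ n⟩) atTop
      (𝓝 ((hv.memLp.toLp v, hv.memLp_grad.toLp g) : X)) :=
    (tendsto_toLp (fun n => (hφ n).memLp 2) hv.memLp h1).prodMk_nhds
      (tendsto_toLp (fun n => (hφ n).memLp_gradient 2) hv.memLp_grad h2)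
  have hk : ∀ n : ℕ, ∃ k, dist (ι (Φ k)) (ι ⟨φ n, hφ n⟩) < 1 / ((n : ℝ) + 1) := by
    intro n
    have := (TopologicalSpace.denseRange_denseSeq (range ι)).exists_dist_lt
      ⟨ι ⟨φ n, hφ n⟩, mem_range_self _⟩ (ε := 1 / ((n : ℝ) + 1)) (by positivity)
    obtain ⟨k, hk⟩ := this
    refine ⟨k, ?_⟩
    rw [hΦ k, dist_comm]
    exact hk
  choose k hk using hk
  have hlim2 : Tendsto (fun n => ι (Φ (k n))) atTop
      (𝓝 ((hv.memLp.toLp v, hv.memLp_grad.toLp g) : X)) := by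
    refine tendsto_of_tendsto_of_dist hlim ?_
    refine squeeze_zero (fun _ => dist_nonneg) (fun n => ?_) tendsto_one_div_add_atTop_nhds_zero_nat
    rw [dist_comm]; exact (hk n).le
  refine ⟨k, ?_, ?_⟩
  · exact (Lp.tendsto_Lp_iff_tendsto_eLpNorm'' _ (fun n => (Φ (k n)).2.memLp 2) v hv.memLp).1
      ((continuous_fst.tendsto _).comp hlim2)
  · exact (Lp.tendsto_Lp_iff_tendsto_eLpNorm'' _ (fun n => (Φ (k n)).2.memLp_gradient 2) g
      hv.memLp_grad).1 ((continuous_snd.tendsto _).comp hlim2)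

lemma pairing_eq_of_dense (hab : a ≤ b) (hw : MemLp w 2 μD) {m : ℝ → Plane → Plane}
    (hm : MemLp ♯m 2 ((volume.restrict (Ioc a b)).prod μD))
    {φ : ℕ → Plane → ℝ} (hφ : ∀ n, IsTest (φ n)) {g : Plane → Plane} (hv : MemH10 v g)
    (h1 : Tendsto (fun n => eLpNorm (fun x => φ n x - v x) 2 μD) atTop (𝓝 0))
    (h2 : Tendsto (fun n => eLpNorm (fun x => ∇ (φ n) x - g x) 2 μD) atTop (𝓝 0))
    (h : ∀ n, ∫ x, w x * φ n x ∂μD = - ∫ t in a..b, ∫ x, ⟪∇ (φ n) x, m t x⟫ ∂μD) :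
    ∫ x, w x * v x ∂μD = - ∫ t in a..b, ∫ x, ⟪g x, m t x⟫ ∂μD := by
  have t1 := tendsto_integral_mul_const (fun n => (hφ n).memLp 2) hv.memLp h1 hw
  have hprod : ∀ {G : Plane → Plane}, MemLp G 2 μD → ∫ t in a..b, ∫ x, ⟪G x, m t x⟫ ∂μD
      = ∫ p, ⟪G p.2, m p.1 p.2⟫ ∂((volume.restrict (Ioc a b)).prod μD) := by
    intro G hG
    rw [integral_of_le hab]
    exact (integral_prod _ (integrable_inner (memLp_snd hG) hm)).symm
  have t2 : Tendsto (fun n => ∫ t in a..b, ∫ x, ⟪∇ (φ n) x, m t x⟫ ∂μD)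
      atTop (𝓝 (∫ t in a..b, ∫ x, ⟪g x, m t x⟫ ∂μD)) := by
    rw [hprod hv.memLp_grad]
    simp only [fun n => hprod ((hφ n).memLp_gradient 2)]
    refine tendsto_integral_inner_const (a := fun n => fun p : ℝP => ∇ (φ n) p.2)
      (fun n => memLp_snd ((hφ n).memLp_gradient 2)) (memLp_snd hv.memLp_grad) ?_ hm
    have : ∀ n, eLpNorm (fun p : ℝP => ∇ (φ n) p.2 - g p.2) 2
        ((volume.restrict (Ioc a b)).prod μD) = (volume.restrict (Ioc a b) univ) ^ (1 / 2 : ℝ)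
          * eLpNorm (fun x => ∇ (φ n) x - g x) 2 μD := fun n =>
      eLpNorm_snd (g := fun x => ∇ (φ n) x - g x)
        (((hφ n).memLp_gradient 2).1.sub hv.memLp_grad.1)
    simp only [this]
    have := ENNReal.Tendsto.const_mul (a := (volume.restrict (Ioc a b) univ) ^ (1 / 2 : ℝ)) h2
      (Or.inr (by simp))
    simpa using this
  exact tendsto_nhds_unique t1 (t2.neg.congr fun n => (h n).symm)

lemma isSpaceTimeTest_mul (h1 : Smooth θ)
    (h2 : HasCompactSupport θ) (h3 : tsupport θ ⊆ Ioi 0) (hφ : IsTest φ) :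
    IsSpaceTimeTest (fun p => θ p.1 * φ p.2) := by
  have hsub : Function.support (fun p => θ p.1 * φ p.2) ⊆ tsupport θ ×ˢ tsupport φ := by
    intro p hp
    simp only [Function.mem_support, ne_eq, mul_eq_zero, not_or] at hp
    exact ⟨subset_tsupport _ hp.1, subset_tsupport _ hp.2⟩
  have hsub' : tsupport (fun p => θ p.1 * φ p.2) ⊆ tsupport θ ×ˢ tsupport φ :=
    closure_minimal hsub ((isClosed_tsupport _).prod (isClosed_tsupport _))
  exact ⟨(h1.comp contDiff_fst).mul (hφ.1.comp contDiff_snd),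
    of_support_subset_isCompact (h2.isCompact.prod hφ.2.1.isCompact) hsub,
    hsub'.trans (prod_mono h3 hφ.2.2)⟩

lemma fderiv_mul_time (h1 : Differentiable ℝ θ)
    (hφ : Differentiable ℝ φ) (p : ℝP) (τ : ℝ) (w : Plane) :
    fderiv ℝ (fun p => θ p.1 * φ p.2) p (τ, w)
      = τ * deriv θ p.1 * φ p.2 + θ p.1 * fderiv ℝ φ p.2 w := by
  have e1 : HasFDerivAt (fun p => θ p.1)
      ((fderiv ℝ θ p.1).comp (ContinuousLinearMap.fst ℝ ℝ Plane)) p :=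
    (h1 p.1).hasFDerivAt.comp p hasFDerivAt_fst
  have e2 : HasFDerivAt (fun p => φ p.2)
      ((fderiv ℝ φ p.2).comp (ContinuousLinearMap.snd ℝ ℝ Plane)) p :=
    (hφ p.2).hasFDerivAt.comp p hasFDerivAt_snd
  rw [(e1.fun_mul e2).fderiv]
  simp
  ring

namespace IsEvolution

variable {T : ℝ → Plane → ℝ} {DT m : ℝ → Plane → Plane}

lemma weak_test (h : IsEvolution T DT m) (hφ : IsTest φ) :
    ∃ S : Set ℝ, (∀ᵐ t, t ∈ S) ∧ ∀ a ∈ S, ∀ b ∈ S, 0 < a → a < b →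
      ∫ x, T b x * φ x ∂μD - ∫ x, T a x * φ x ∂μD = - ∫ t in a..b, ∫ x, ⟪∇ φ x, m t x⟫ ∂μD := by
  have hφ2 : ∀ a b : ℝ, MemLp (fun p => φ p.2) 2
      ((volume.restrict (Icc a b)).prod μD) := fun a b => memLp_snd (hφ.memLp 2)
  have hg2 : ∀ a b : ℝ, MemLp (fun p => ∇ φ p.2) 2
      ((volume.restrict (Icc a b)).prod μD) := fun a b => memLp_snd (hφ.memLp_gradient 2)
  refine exists_ae_primitive (c := 0) (e := fun t => ∫ x, T t x * φ x ∂μD)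
    (q := fun t => ∫ x, ⟪∇ φ x, m t x⟫ ∂μD)
    (fun a b ha hab => integrable_slice_mul (w := fun _ x => φ x)
      (h.memL2Loc.memLp_Icc ha hab) (hφ2 a b))
    (fun a b ha hab => integrable_slice_inner (v := fun _ x => ∇ φ x)
      (hg2 a b) (h.memL2Loc_flux.memLp_Icc ha hab)) ?_
  intro θ h1 h2 h3
  have key := h.timeDeriv _ (isSpaceTimeTest_mul h1 h2 h3 hφ)
  have hθd : Differentiable ℝ θ := h1.differentiable (by simp)
  simp only [fderiv_mul_time hθd hφ.differentiable, one_mul, zero_mul, zero_add, map_zero,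
    mul_zero, add_zero] at key
  -- a compact interval carrying `θ`
  obtain ⟨a, b, ha, hab, hsub⟩ : ∃ a b : ℝ, 0 < a ∧ a < b ∧ tsupport θ ⊆ Icc a b := by
    rcases (tsupport θ).eq_empty_or_nonempty with he | hne
    · exact ⟨1, 2, by norm_num, by norm_num, by rw [he]; exact empty_subset _⟩
    · obtain ⟨x, hx, hxm⟩ := h2.isCompact.exists_isMinOn hne continuousOn_id
      obtain ⟨y, hy, hym⟩ := h2.isCompact.exists_isMaxOn hne continuousOn_id
      refine ⟨x, y + 1, h3 hx, ?_, fun t ht => ⟨hxm ht, ?_⟩⟩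
      · have : x ≤ y := hxm hy
        linarith
      · have : t ≤ y := hym ht
        linarith
  have hres : ∀ {k : ℝ → ℝ} {F : ℝ → Plane → ℝ}, (∀ t ∉ Icc a b, k t = 0) → Continuous k →
      Integrable ♯F ((volume.restrict (Icc a b)).prod μD) →
      ∫ p, k p.1 * F p.1 p.2 ∂μC = ∫ t, k t * ∫ x, F t x ∂μD := by
    intro k F hk hkc hF
    have hsubset : Icc a b ⊆ Ioi 0 := fun t ht => lt_of_lt_of_le ha ht.1
    have e1 : ∫ p, k p.1 * F p.1 p.2 ∂μC
        = ∫ p, k p.1 * F p.1 p.2 ∂((volume.restrict (Icc a b)).prod μD) := by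
      rw [cylMeasure, discMeasure, Measure.prod_restrict, ← Measure.volume_eq_prod]
      refine setIntegral_eq_of_subset_of_forall_sdiff_eq_zero
        (measurableSet_Ioi.prod measurableSet_disc) (prod_mono hsubset le_rfl) ?_
      rintro ⟨t, x⟩ ⟨h1, h2⟩
      have : t ∉ Icc a b := fun hh => h2 ⟨hh, h1.2⟩
      simp [hk t this]
    rw [e1, integral_prod]
    · simp only [integral_const_mul]
      exact setIntegral_eq_integral_of_forall_compl_eq_zero fun t ht => by simp [hk t ht]
    · obtain ⟨C, hC⟩ := isCompact_Icc.exists_bound_of_continuousOn (s := Icc a b) hkc.continuousOn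
      refine hF.bdd_mul (c := C) ?_ ?_
      · exact (hkc.comp continuous_fst).aestronglyMeasurable
      · rw [discMeasure, Measure.prod_restrict,
          ae_restrict_iff' (measurableSet_Icc.prod measurableSet_disc)]
        exact .of_forall fun p hp => hC _ hp.1
  have hk0 : ∀ t ∉ Icc a b, θ t = 0 := fun t ht =>
    image_eq_zero_of_notMem_tsupport fun hh => ht (hsub hh)
  have hk1 : ∀ t ∉ Icc a b, deriv θ t = 0 := fun t ht =>
    image_eq_zero_of_notMem_tsupport fun hh => ht (hsub (tsupport_deriv_subset (𝕜 := ℝ) hh))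
  have e1 := hres (F := fun t x => T t x * φ x) hk1 (h1.continuous_deriv (by simp))
    (integrable_mul_L2 (h.memL2Loc.memLp_Icc ha hab) (hφ2 a b))
  have e2 := hres (F := fun t x => ⟪∇ φ x, m t x⟫) hk0 h1.continuous
    (integrable_inner (hg2 a b) (h.memL2Loc_flux.memLp_Icc ha hab))
  rw [← e1, ← e2]
  simp only [inner_gradient]
  rw [← key]
  refine integral_ext fun p => ?_
  ring

/-- The weak formulation against all of `H¹₀(D)`, between almost all times. -/
theorem weak_H10 (h : IsEvolution T DT m) :
    ∃ S : Set ℝ, (∀ᵐ t, t ∈ S) ∧ ∀ a ∈ S, ∀ b ∈ S, 0 < a → a < b →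
      MemLp (T a) 2 μD ∧ MemLp (T b) 2 μD ∧ ∀ v g, MemH10 v g → ∫ x, (T b x - T a x) * v x ∂μD
        = - ∫ t in a..b, ∫ x, ⟪g x, m t x⟫ ∂μD := by
  obtain ⟨Φ, hΦ, hdense⟩ := exists_dense_tests
  choose S hS hS' using fun n => h.weak_test (hΦ n)
  refine ⟨{t | (∀ n, t ∈ S n) ∧ (0 < t → MemLp (T t) 2 μD)}, ?_, ?_⟩
  · have h1 : ∀ᵐ t, ∀ n, t ∈ S n := ae_all_iff.2 hS
    have h2 : ∀ᵐ t, 0 < t → MemLp (T t) 2 μD := by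
      have := h.memH10
      rw [ae_restrict_iff' measurableSet_Ioi] at this
      filter_upwards [this] with t ht h0 using (ht h0).memLp
    exact h1.and h2
  · rintro a ⟨ha, haL⟩ b ⟨hb, hbL⟩ h0 hab
    have haL := haL h0
    have hbL := hbL (h0.trans hab)
    refine ⟨haL, hbL, fun v g hv => ?_⟩
    obtain ⟨k, hk1, hk2⟩ := hdense v g hv
    refine pairing_eq_of_dense hab.le (hbL.sub haL)
      ((h.memL2Loc_flux.memLp_Icc h0 hab).mono_measure (Measure.prod_mono
        (restrict_mono Ioc_subset_Icc_self le_rfl) le_rfl))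
      (fun n => hΦ (k n)) hv hk1 hk2 fun n => ?_
    rw [← hS' (k n) a (ha _) b (hb _) h0 hab,
      ← integral_sub (integrable_mul_L2 hbL ((hΦ _).memLp 2))
        (integrable_mul_L2 haL ((hΦ _).memLp 2))]
    refine integral_ext fun x => ?_
    simp only [Pi.sub_apply]; ring

end IsEvolution

lemma exists_rep {F : Type*} [NormedAddCommGroup F] {v : ℝ → Plane → F}
    (hv : MemLp ♯v 2 ((volume.restrict (Icc a b)).prod μD)) :
    ∃ V : ℝP → F, StronglyMeasurable V ∧ MemLp V 2 (volume.prod μD) ∧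
      ∀ᵐ t, t ∈ Icc a b → (fun x => V (t, x)) =ᵐ[discMeasure] v t := by
  have hset : MeasurableSet (Icc a b ×ˢ (univ : Set Plane)) := measurableSet_Icc.prod .univ
  refine ⟨(Icc a b ×ˢ univ).indicator (hv.1.mk _), hv.1.stronglyMeasurable_mk.indicator hset, ?_, ?_⟩
  · have : (volume.restrict (Icc a b)).prod μD
        = ((volume : Measure ℝ).prod μD).restrict (Icc a b ×ˢ univ) := by
      rw [← Measure.prod_restrict, Measure.restrict_univ]
    rw [memLp_indicator_iff_restrict hset, ← this]
    exact hv.ae_eq hv.1.ae_eq_mk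
  · have := Measure.ae_ae_of_ae_prod hv.1.ae_eq_mk
    rw [ae_restrict_iff' measurableSet_Icc] at this
    filter_upwards [this] with t ht hmem
    filter_upwards [ht hmem] with x hx
    rw [indicator_of_mem (by exact ⟨hmem, mem_univ _⟩), ← hx]

namespace IsEvolution

variable {T : ℝ → Plane → ℝ} {DT m : ℝ → Plane → Plane}

lemma ae_shift {P : ℝ → Prop} (h : ∀ᵐ t, P t) (z : ℝ) : ∀ᵐ t, P (t + z) :=
  (measurePreserving_add_right volume z).quasiMeasurePreserving.ae h

lemma energy_local (h : IsEvolution T DT m) {a₀ b₀ : ℝ} (ha₀ : 0 < a₀) (hab₀ : a₀ < b₀) :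
    ∃ S : Set ℝ, (∀ᵐ t, t ∈ S) ∧ ∀ a ∈ S, ∀ b ∈ S, a₀ < a → a < b → b < b₀ →
      ∫ x, T b x ^ 2 ∂μD - ∫ x, T a x ^ 2 ∂μD = - 2 * ∫ t in a..b, ∫ x, ⟪DT t x, m t x⟫ ∂μD := by
  obtain ⟨S₀, hS₀, hweak⟩ := h.weak_H10
  have hDTL := h.memL2Loc_grad.memLp_Icc ha₀ hab₀
  have hmL := h.memL2Loc_flux.memLp_Icc ha₀ hab₀
  obtain ⟨V, hVm, hV, hVe⟩ := exists_rep hDTL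
  obtain ⟨W, hWm, hW, hWe⟩ := exists_rep hmL
  set E : ℝ → ℝ := fun t => ∫ x, T t x ^ 2 ∂μD with hE
  have hEint : IntegrableOn E (Icc a₀ b₀) := by
    have := integrable_slice_normSq (h.memL2Loc.memLp_Icc ha₀ hab₀)
    simpa [hE, IntegrableOn] using this
  set E₁ := (Icc a₀ b₀).indicator E
  have hE₁ : Integrable E₁ := hEint.integrable_indicator measurableSet_Icc
  refine ⟨{t | ∀ c, HasDerivAt (fun x => ∫ s in c..x, E₁ s) (E₁ t) t},
    LocallyIntegrable.ae_hasDerivAt_integral hE₁.locallyIntegrable, ?_⟩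
  intro α hα β hβ h0 hαβ h1
  have h10 : ∀ᵐ t, 0 < t → MemH10 (T t) (DT t) := by
    have := h.memH10
    rwa [ae_restrict_iff' measurableSet_Ioi] at this
  -- averages of `E`
  have hAvg : ∀ t, HasDerivAt (fun x => ∫ s in t..x, E₁ s) (E₁ t) t →
      Tendsto (fun k : ℝ => k⁻¹ * ∫ s in t..(t + k), E₁ s) (𝓝[>] 0) (𝓝 (E₁ t)) := by
    intro t ht
    have := ht.tendsto_slope_zero_right
    simpa using this
  have hL := (hAvg β (hβ β)).sub (hAvg α (hα α))
  have hEα : E₁ α = E α := indicator_of_mem (mem_Icc.2 ⟨h0.le, by linarith⟩) _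
  have hEβ : E₁ β = E β := indicator_of_mem (mem_Icc.2 ⟨by linarith, h1.le⟩) _
  rw [hEα, hEβ] at hL
  have hR := (tendsto_average_correlation hVm hWm hV hW α β 1).add
    (tendsto_average_correlation hVm hWm hV hW α β 0)
  have hQ : ∫ t in α..β, ∫ x, ⟪DT t x, m t x⟫ ∂μD
      = ∫ t in Icc α β, ∫ x, ⟪V (t, x), W (t, x)⟫ ∂μD := by
    rw [integral_of_le hαβ.le, ← integral_Icc_eq_integral_Ioc]
    refine setIntegral_congr_ae measurableSet_Icc ?_
    filter_upwards [hVe, hWe] with t h2 h3 ht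
    have htm : t ∈ Icc a₀ b₀ := ⟨by linarith [ht.1], by linarith [ht.2]⟩
    refine integral_congr_ae ?_
    filter_upwards [h2 htm, h3 htm] with x h4 h5
    rw [h4, h5]
  rw [hQ]
  refine tendsto_nhds_unique hL ((hR.const_mul (-1)).congr' ?_ |>.trans (by
    refine le_of_eq (congrArg 𝓝 ?_); ring))
  filter_upwards [Ioo_mem_nhdsGT (show 0 < b₀ - β by linarith)] with k hk
  have hk0 := hk.1
  have hi : ∀ c : ℝ, Integrable (fun t => ∫ z in (0 : ℝ)..k,
      ∫ x, ⟪V (t + c, x), W (t + z, x)⟫ ∂μD) (volume.restrict (Icc α β)) := by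
    intro c
    simp only [integral_of_le hk0.le]
    exact (integrable_correlation hVm hWm hV hW α β c k).integral_prod_left
  have hpt : ∀ᵐ t ∂volume.restrict (Icc α β), E₁ (t + k) - E₁ t
      = -1 * ((∫ z in (0 : ℝ)..k, ∫ x, ⟪V (t + 1 * k, x), W (t + z, x)⟫ ∂μD)
        + ∫ z in (0 : ℝ)..k, ∫ x, ⟪V (t + 0 * k, x), W (t + z, x)⟫ ∂μD) := by
    rw [ae_restrict_iff' measurableSet_Icc]
    filter_upwards [hS₀, ae_shift hS₀ k, hVe, ae_shift hVe k, h10, ae_shift h10 k]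
      with t s1 s2 v1 v2 d1 d2 ht
    have tm : t ∈ Icc a₀ b₀ := ⟨by linarith [ht.1], by linarith [ht.2]⟩
    have tkm : t + k ∈ Icc a₀ b₀ := ⟨by linarith [ht.1], by linarith [ht.2, hk.2]⟩
    have t0 : 0 < t := by linarith [ht.1]
    have tk0 : 0 < t + k := by linarith
    obtain ⟨l1, l2, hw⟩ := hweak t s1 (t + k) s2 t0 (by linarith)
    have hshift : ∀ {g : Plane → Plane} (c : ℝ), (fun x => V (t + c, x)) =ᵐ[discMeasure] g →
        ∫ s in t..(t + k), ∫ x, ⟪g x, m s x⟫ ∂μD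
        = ∫ z in (0 : ℝ)..k, ∫ x, ⟪V (t + c, x), W (t + z, x)⟫ ∂μD := by
      intro g c hg
      have e1 := intervalIntegral.integral_comp_add_left (a := 0) (b := k)
        (fun s => ∫ x, ⟪V (t + c, x), W (s, x)⟫ ∂μD) t
      rw [add_zero] at e1
      rw [e1]
      refine intervalIntegral.integral_congr_ae ?_
      filter_upwards [hWe] with s hs hsm
      rw [uIoc_of_le (by linarith)] at hsm
      have hs' := hs ⟨by linarith [hsm.1, ht.1], by linarith [hsm.2, ht.2, hk.2]⟩
      refine integral_congr_ae ?_
      filter_upwards [hg, hs'] with x h4 h5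
      rw [h4, h5]
    have w1 := hw _ _ (d2 tk0)
    have w2 := hw _ _ (d1 t0)
    rw [hshift (1 * k) (by simpa using v2 tkm)] at w1
    rw [hshift (0 * k) (by simpa using v1 tm)] at w2
    have eT : E₁ (t + k) - E₁ t = ∫ x, (T (t + k) x - T t x) * T (t + k) x ∂μD
        + ∫ x, (T (t + k) x - T t x) * T t x ∂μD := by
      have l12 : MemLp (fun x => T (t + k) x - T t x) 2 μD := l2.sub l1
      rw [← integral_add (integrable_mul_L2 l12 l2)
        (integrable_mul_L2 l12 l1), show E₁ t = E t from indicator_of_mem tm _,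
        show E₁ (t + k) = E (t + k) from indicator_of_mem tkm _, hE, ← integral_sub l2.integrable_sq l1.integrable_sq]
      refine integral_ext fun x => ?_
      ring
    rw [eT, w1, w2]
    ring
  have hint1 : ∀ c d, IntervalIntegrable E₁ volume c d := fun c d => hE₁.intervalIntegrable
  have hLHS : (∫ s in β..(β + k), E₁ s) - ∫ s in α..(α + k), E₁ s
      = ∫ t in Icc α β, (E₁ (t + k) - E₁ t) := by
    rw [integral_sub (hE₁.comp_add_right k).integrableOn hE₁.integrableOn,
      integral_Icc_eq_integral_Ioc, integral_Icc_eq_integral_Ioc,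
      ← integral_of_le hαβ.le, ← integral_of_le hαβ.le,
      intervalIntegral.integral_comp_add_right (fun s => E₁ s) k]
    have e1 := integral_add_adjacent_intervals (hint1 α β) (hint1 β (β + k))
    have e2 := integral_add_adjacent_intervals (hint1 α (α + k)) (hint1 (α + k) (β + k))
    linarith
  rw [← mul_sub, hLHS, integral_congr_ae hpt, integral_const_mul, integral_add (hi _) (hi _)]
  ring

/-- The energy identity, between almost all times. -/
theorem energy (h : IsEvolution T DT m) :
    ∃ S : Set ℝ, (∀ᵐ t, t ∈ S) ∧ ∀ a ∈ S, ∀ b ∈ S, 0 < a → a < b →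
      ∫ x, T b x ^ 2 ∂μD - ∫ x, T a x ^ 2 ∂μD = - 2 * ∫ t in a..b, ∫ x, ⟪DT t x, m t x⟫ ∂μD := by
  have hpos : ∀ n : ℕ, 0 < 1 / ((n : ℝ) + 1) := fun n => by positivity
  have hlt : ∀ n : ℕ, 1 / ((n : ℝ) + 1) < n + 2 := fun n => by
    rw [div_lt_iff₀ (by positivity)]; nlinarith [n.cast_nonneg (α := ℝ)]
  choose S hS hS' using fun n : ℕ => h.energy_local (hpos n) (hlt n)
  refine ⟨{t | ∀ n, t ∈ S n}, ae_all_iff.2 hS, fun a ha b hb h0 hab => ?_⟩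
  obtain ⟨n1, hn1⟩ := exists_nat_one_div_lt h0
  obtain ⟨n2, hn2⟩ := exists_nat_gt b
  refine hS' (max n1 n2) a (ha _) b (hb _) (lt_of_le_of_lt ?_ hn1) hab (hn2.trans_le ?_)
  · gcongr; exact le_max_left _ _
  · have : ((n2 : ℕ) : ℝ) ≤ ((max n1 n2 : ℕ) : ℝ) := by exact_mod_cast le_max_right _ _
    linarith

end IsEvolution

/-! ### The projection theorem of Lions -/

section Lions

variable {Φ H : Type*} [AddCommGroup Φ] [Module ℝ Φ] [NormedAddCommGroup H]
  [InnerProductSpace ℝ H] [CompleteSpace H]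

lemma exists_inner_eq_of_bound (K : Φ →ₗ[ℝ] H) (L : Φ →ₗ[ℝ] ℝ) (C : ℝ)
    (hC : ∀ φ, |L φ| ≤ C * ‖K φ‖) : ∃ h : H, ∀ φ, ⟪h, K φ⟫ = L φ := by
  obtain ⟨s, hs⟩ := K.rangeRestrict.exists_rightInverse_of_surjective K.range_rangeRestrict
  have hs' : ∀ y : LinearMap.range K, K (s y) = y := fun y => by
    have := LinearMap.congr_fun hs y
    exact congrArg Subtype.val this
  let ℓ : StrongDual ℝ (LinearMap.range K) := (L ∘ₗ s).mkContinuous C fun y => by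
    rw [norm_eq_abs]
    simpa [hs' y] using hC (s y)
  obtain ⟨g, hg, -⟩ := exists_extension_norm_eq (LinearMap.range K) ℓ
  refine ⟨(toDual ℝ H).symm g, fun φ => ?_⟩
  rw [InnerProductSpace.toDual_symm_apply]
  have h1 := hg ⟨K φ, LinearMap.mem_range_self K φ⟩
  rw [h1]
  change L (s ⟨K φ, _⟩) = L φ
  have h2 := hC (s ⟨K φ, LinearMap.mem_range_self K φ⟩ - φ)
  rw [map_sub K, hs', sub_self, norm_zero, mul_zero, map_sub] at h2
  linarith [abs_nonpos_iff.1 h2]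

/-- The projection theorem of Lions. -/
theorem lions_projection (ι K : Φ →ₗ[ℝ] H) (L : Φ →ₗ[ℝ] ℝ) (p : Φ → ℝ) (C : ℝ) (hC0 : 0 ≤ C)
    (hp : ∀ φ, 0 ≤ p φ) (hL : ∀ φ, |L φ| ≤ C * p φ) (hι : ∀ φ, ‖ι φ‖ ≤ p φ)
    (hK : ∀ φ, p φ ^ 2 ≤ ⟪ι φ, K φ⟫) :
    ∃ h ∈ closure (range ι), ∀ φ, ⟪h, K φ⟫ = L φ := by
  let H₀ : Submodule ℝ H := (LinearMap.range ι).topologicalClosure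
  haveI : CompleteSpace H₀ := (Submodule.isClosed_topologicalClosure _).completeSpace_coe
  let P : H →L[ℝ] H := H₀.starProjection
  have hP : ∀ x y, ⟪P x, y⟫ = ⟪x, P y⟫ := fun x y =>
    H₀.inner_starProjection_left_eq_right x y
  have hPι : ∀ φ, P (ι φ) = ι φ := fun φ => Submodule.starProjection_eq_self_iff.2
      (Submodule.le_topologicalClosure _ (LinearMap.mem_range_self ι φ))
  have hb : ∀ φ, |L φ| ≤ C * ‖(P.toLinearMap ∘ₗ K) φ‖ := by
    intro φ
    refine (hL φ).trans (mul_le_mul_of_nonneg_left ?_ hC0)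
    have h1 : p φ ^ 2 ≤ p φ * ‖P (K φ)‖ := by
      calc p φ ^ 2 ≤ ⟪ι φ, K φ⟫ := hK φ
        _ = ⟪ι φ, P (K φ)⟫ := by rw [← hP, hPι]
        _ ≤ ‖ι φ‖ * ‖P (K φ)‖ := real_inner_le_norm _ _
        _ ≤ p φ * ‖P (K φ)‖ := by gcongr; exact hι φ
    change p φ ≤ ‖P (K φ)‖
    rcases (hp φ).eq_or_lt with h0 | h0
    · rw [← h0]; exact norm_nonneg _
    · rw [sq] at h1
      exact le_of_mul_le_mul_left h1 h0
  obtain ⟨h, hh⟩ := exists_inner_eq_of_bound (P.toLinearMap ∘ₗ K) L C hb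
  refine ⟨P h, ?_, fun φ => ?_⟩
  · have : P h ∈ H₀ := Submodule.starProjection_apply_mem H₀ h
    have h2 : (H₀ : Set H) = closure (range ι) := by
      simp only [H₀, Submodule.topologicalClosure_coe, LinearMap.coe_range]
    rw [← h2]; exact this
  · rw [hP]; exact hh φ

end Lions

/-! ### Space-time test functions on `ℝ × D` -/

/-- Smooth functions with compact support in `ℝ × D`. -/
def CylTest : Submodule ℝ (ℝP → ℝ) where
  carrier := {φ | Smooth φ ∧ HasCompactSupport φ ∧ tsupport φ ⊆ univ ×ˢ disc}
  add_mem' := fun {a b} ha hb => ⟨ha.1.add hb.1, ha.2.1.add hb.2.1,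
    (tsupport_add a b).trans (union_subset ha.2.2 hb.2.2)⟩
  zero_mem' := ⟨contDiff_const, HasCompactSupport.zero, by simp [tsupport]⟩
  smul_mem' := fun c a ha => ⟨contDiff_const.smul ha.1, ha.2.1.smul_left,
    (tsupport_smul_subset_right (fun _ => c) a).trans ha.2.2⟩

/-- The spatial gradient. -/
def sgrad (φ : ℝP → ℝ) (p : ℝP) : Plane :=
  (toDual ℝ Plane).symm ((fderiv ℝ φ p).comp (inr ℝ ℝ Plane))

lemma inner_sgrad (φ : ℝP → ℝ) (p : ℝP) (w : Plane) :
    ⟪sgrad φ p, w⟫ = fderiv ℝ φ p (0, w) := by simp [sgrad]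

/-- The time derivative. -/
def tderiv (φ : ℝP → ℝ) (p : ℝP) : ℝ := fderiv ℝ φ p (1, 0)

namespace CylTest

variable {φ ψ : ℝP → ℝ}

lemma differentiable (h : φ ∈ CylTest) : Differentiable ℝ φ := h.1.differentiable (by simp)

lemma continuous_sgrad (h : φ ∈ CylTest) : Continuous (sgrad φ) := by
  unfold sgrad
  exact (LinearIsometryEquiv.continuous _).comp
    ((h.1.continuous_fderiv (by simp)).clm_comp continuous_const)

lemma hasCompactSupport_sgrad (h : φ ∈ CylTest) : HasCompactSupport (sgrad φ) :=
  comp_left (g := fun L : ℝP →L[ℝ] ℝ => (toDual ℝ Plane).symm (L.comp (inr ℝ ℝ Plane)))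
    (h.2.1.fderiv (𝕜 := ℝ)) (by simp)

lemma continuous_tderiv (h : φ ∈ CylTest) : Continuous (tderiv φ) :=
  (h.1.continuous_fderiv (by simp)).clm_apply continuous_const

lemma hasCompactSupport_tderiv (h : φ ∈ CylTest) : HasCompactSupport (tderiv φ) :=
  comp_left (g := fun L : ℝP →L[ℝ] ℝ => L (1, 0)) (h.2.1.fderiv (𝕜 := ℝ)) (by simp)

lemma memLp_cyl {F : Type*} [NormedAddCommGroup F] {g : ℝP → F} (hg : Continuous g)
    (hc : HasCompactSupport g) : MemLp g 2 μC :=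
  (hg.memLp_of_hasCompactSupport (μ := volume) hc).restrict _

lemma slice (h : φ ∈ CylTest) (t : ℝ) : IsTest (fun x => φ (t, x)) := by
  have hc : Continuous fun x : Plane => (t, x) := by fun_prop
  have hsub : tsupport (fun x => φ (t, x)) ⊆ (fun x : Plane => (t, x)) ⁻¹' tsupport φ :=
    tsupport_comp_subset_preimage φ hc
  refine ⟨h.1.comp (contDiff_const.prodMk contDiff_id), ?_, fun x hx => (h.2.2 (hsub hx)).2⟩
  refine of_support_subset_isCompact (h.2.1.isCompact.image continuous_snd) ?_
  intro x hx
  exact ⟨(t, x), subset_tsupport _ hx, rfl⟩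

lemma gradient_slice (h : φ ∈ CylTest) (t : ℝ) (x : Plane) :
    ∇ (fun x => φ (t, x)) x = sgrad φ (t, x) := by
  have h1 : HasFDerivAt (fun x => φ (t, x)) ((fderiv ℝ φ (t, x)).comp (inr ℝ ℝ Plane)) x :=
    ((differentiable h (t, x)).hasFDerivAt).comp x (hasFDerivAt_prodMk_right t x)
  rw [gradient, h1.fderiv, sgrad]

lemma hasDerivAt_time (h : φ ∈ CylTest) (t : ℝ) (x : Plane) :
    HasDerivAt (fun s => φ (s, x)) (tderiv φ (t, x)) t := by
  have h1 : HasFDerivAt (fun s => φ (s, x))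
      ((fderiv ℝ φ (t, x)).comp (ContinuousLinearMap.inl ℝ ℝ Plane)) t :=
    ((differentiable h (t, x)).hasFDerivAt).comp t (hasFDerivAt_prodMk_left t x)
  simpa [tderiv] using h1.hasDerivAt

lemma mul_mem {θ : ℝ → ℝ} {φ : Plane → ℝ} (h1 : Smooth θ)
    (h2 : HasCompactSupport θ) (hφ : IsTest φ) : (fun p => θ p.1 * φ p.2) ∈ CylTest := by
  have hsub : Function.support (fun p => θ p.1 * φ p.2)
      ⊆ tsupport θ ×ˢ tsupport φ := by
    intro p hp
    simp only [Function.mem_support, ne_eq, mul_eq_zero, not_or] at hp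
    exact ⟨subset_tsupport _ hp.1, subset_tsupport _ hp.2⟩
  have hsub' : tsupport (fun p => θ p.1 * φ p.2) ⊆ tsupport θ ×ˢ tsupport φ :=
    closure_minimal hsub ((isClosed_tsupport _).prod (isClosed_tsupport _))
  exact ⟨(h1.comp contDiff_fst).mul (hφ.1.comp contDiff_snd),
    of_support_subset_isCompact (h2.isCompact.prod hφ.2.1.isCompact) hsub,
    hsub'.trans (prod_mono (subset_univ _) hφ.2.2)⟩

lemma exp_mul_mem (h : φ ∈ CylTest) : (fun p => exp p.1 * φ p) ∈ CylTest :=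
  ⟨(Real.contDiff_exp.comp contDiff_fst).mul h.1, h.2.1.mul_left,
    tsupport_mul_subset_right.trans h.2.2⟩

lemma sgrad_exp (h : φ ∈ CylTest) (p : ℝP) :
    sgrad (fun p => exp p.1 * φ p) p = exp p.1 • sgrad φ p := by
  rw [← gradient_slice (exp_mul_mem h) p.1 p.2, ← gradient_slice h p.1 p.2]
  ext i
  rw [gradient_apply, PiLp.smul_apply, gradient_apply, smul_eq_mul]
  exact pd_const_mul (exp p.1) i ((slice h p.1).differentiable p.2)

lemma tderiv_exp (h : φ ∈ CylTest) (p : ℝP) : tderiv (fun p => exp p.1 * φ p) p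
      = exp p.1 * φ p + exp p.1 * tderiv φ p := by
  have h1 := hasDerivAt_time (exp_mul_mem h) p.1 p.2
  have h2 := (Real.hasDerivAt_exp p.1).mul (hasDerivAt_time h p.1 p.2)
  exact h1.unique h2

lemma sgrad_add (h : φ ∈ CylTest) (h' : ψ ∈ CylTest) : sgrad (φ + ψ) = sgrad φ + sgrad ψ := by
  funext p
  simp only [sgrad, Pi.add_apply]
  rw [fderiv_add (differentiable h p) (differentiable h' p)]
  simp [ContinuousLinearMap.add_comp]

lemma sgrad_smul (h : φ ∈ CylTest) (c : ℝ) : sgrad (c • φ) = c • sgrad φ := by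
  funext p
  simp only [sgrad, Pi.smul_apply]
  rw [fderiv_const_smul (differentiable h p)]
  simp [ContinuousLinearMap.smul_comp]

lemma tderiv_add (h : φ ∈ CylTest) (h' : ψ ∈ CylTest) : tderiv (φ + ψ) = tderiv φ + tderiv ψ := by
  funext p
  simp only [tderiv, Pi.add_apply]
  rw [fderiv_add (differentiable h p) (differentiable h' p)]
  simp

lemma tderiv_smul (h : φ ∈ CylTest) (c : ℝ) : tderiv (c • φ) = c • tderiv φ := by
  funext p
  simp only [tderiv, Pi.smul_apply]
  rw [fderiv_const_smul (differentiable h p)]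
  simp

lemma integral_mul_tderiv (h : φ ∈ CylTest) :
    ∫ p, φ p * tderiv φ p ∂μC = - (1 / 2) * ∫ x, φ (0, x) ^ 2 ∂μD := by
  have hint : Integrable (fun p => φ p * tderiv φ p) μC :=
    integrable_mul_L2 (memLp_cyl h.1.continuous h.2.1)
      (memLp_cyl (continuous_tderiv h) (hasCompactSupport_tderiv h))
  rw [cylMeasure_eq] at hint ⊢
  rw [integral_prod_symm _ hint, ← integral_const_mul]
  refine integral_ext fun x => ?_
  have hd : ∀ t, HasDerivAt (fun s => φ (s, x) ^ 2) (2 * (φ (t, x) * tderiv φ (t, x))) t := by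
    intro t
    refine ((hasDerivAt_time h t x).pow 2).congr_deriv ?_
    simp; ring
  have hcs : HasCompactSupport fun s => φ (s, x) ^ 2 := by
    refine of_support_subset_isCompact (h.2.1.isCompact.image continuous_fst) ?_
    intro s hs
    exact ⟨(s, x), subset_tsupport _ (fun h0 => hs (by simp [h0])), rfl⟩
  have hc1 : ContDiff ℝ 1 fun s => φ (s, x) ^ 2 :=
    ((h.1.of_le (by simp)).comp (contDiff_id.prodMk contDiff_const)).pow 2
  have := hcs.integral_Ioi_deriv_eq hc1 0
  simp only [(hd _).deriv, integral_const_mul] at this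
  linarith

end CylTest

/-! ### Existence of weak solutions: the weighted equation on the space-time cylinder -/

/-- A scalar together with a vector of the plane, with the Euclidean norm of the pair. -/
abbrev ScalarVec : Type := WithLp 2 (ℝP)

section ScalarVec

variable {α : Type*} [MeasurableSpace α] {μ : Measure α}

lemma norm_sq_scalarVec (a : ℝ) (v : Plane) :
    ‖(toLp 2 (a, v) : ScalarVec)‖ ^ 2 = a ^ 2 + ‖v‖ ^ 2 := by
  rw [WithLp.prod_norm_sq_eq_of_L2]; simp

lemma inner_scalarVec (z : ScalarVec) (a : ℝ) (v : Plane) :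
    ⟪z, (toLp 2 (a, v) : ScalarVec)⟫ = z.fst * a + ⟪z.snd, v⟫ := by
  rw [WithLp.prod_inner_apply]
  simp [mul_comm]

lemma memLp_scalarVec {a : α → ℝ} {v : α → Plane} (ha : MemLp a 2 μ) (hv : MemLp v 2 μ) :
    MemLp (fun x => (toLp 2 (a x, v x) : ScalarVec)) 2 μ := by
  have hm : AEStronglyMeasurable (fun x => (toLp 2 (a x, v x) : ScalarVec)) μ :=
    (WithLp.prod_continuous_toLp 2 ℝ Plane).comp_aestronglyMeasurable (ha.1.prodMk hv.1)
  have h1 : MemLp (fun x => ‖a x‖ + ‖v x‖) 2 μ := ha.norm.add hv.norm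
  refine h1.mono hm (.of_forall fun x => ?_)
  rw [norm_of_nonneg (by positivity)]
  refine abs_le_of_sq_le_sq' ?_ (by positivity) |>.2
  rw [norm_sq_scalarVec, norm_eq_abs]
  nlinarith [sq_abs (a x), mul_nonneg (abs_nonneg (a x)) (norm_nonneg (v x))]

lemma norm_fst_le_scalarVec (z : ScalarVec) : ‖z.fst‖ ≤ ‖z‖ := by
  refine abs_le_of_sq_le_sq' ?_ (norm_nonneg _) |>.2
  rw [WithLp.prod_norm_sq_eq_of_L2]; nlinarith [sq_nonneg ‖z.snd‖]

lemma norm_snd_le_scalarVec (z : ScalarVec) : ‖z.snd‖ ≤ ‖z‖ := by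
  refine abs_le_of_sq_le_sq' ?_ (norm_nonneg _) |>.2
  rw [WithLp.prod_norm_sq_eq_of_L2]; nlinarith [sq_nonneg ‖z.fst‖]

lemma memLp_fst {z : α → ScalarVec} (hz : MemLp z 2 μ) : MemLp (fun x => (z x).fst) 2 μ :=
  hz.mono ((continuous_fst.comp (WithLp.prod_continuous_ofLp 2 ℝ Plane)).comp_aestronglyMeasurable
    hz.1) (.of_forall fun x => norm_fst_le_scalarVec _)

lemma memLp_sndVec {z : α → ScalarVec} (hz : MemLp z 2 μ) : MemLp (fun x => (z x).snd) 2 μ :=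
  hz.mono ((continuous_snd.comp (WithLp.prod_continuous_ofLp 2 ℝ Plane)).comp_aestronglyMeasurable
    hz.1) (.of_forall fun x => norm_snd_le_scalarVec _)

end ScalarVec

namespace CylTest

lemma memLp {φ : ℝP → ℝ} (h : φ ∈ CylTest) : MemLp φ 2 μC := memLp_cyl h.1.continuous h.2.1

lemma memLp_sgrad {φ : ℝP → ℝ} (h : φ ∈ CylTest) : MemLp (sgrad φ) 2 μC :=
  memLp_cyl (continuous_sgrad h) (hasCompactSupport_sgrad h)

lemma memLp_tderiv {φ : ℝP → ℝ} (h : φ ∈ CylTest) : MemLp (tderiv φ) 2 μC :=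
  memLp_cyl (continuous_tderiv h) (hasCompactSupport_tderiv h)

lemma poincare {φ : ℝP → ℝ} (h : φ ∈ CylTest) :
    ∫ p, φ p ^ 2 ∂μC ≤ ∫ p, ‖sgrad φ p‖ ^ 2 ∂μC := by
  have h1 := (memLp h).integrable_sq
  have h2 := integrable_normSq (memLp_sgrad h)
  rw [cylMeasure_eq] at *
  rw [integral_prod _ h1, integral_prod _ h2]
  refine integral_mono h1.integral_prod_left h2.integral_prod_left fun t => ?_
  have := (slice h t).memH10.poincare
  simpa only [gradient_slice h] using this

end CylTest

/-- A bounded-in-space, weakly divergence-free flow, with exponential growth in time. -/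
structure IsFlow (u : ℝ → Plane → Plane) (U : ℝ) : Prop where
  meas : StronglyMeasurable ♯u
  bound : ∀ t x, 0 < t → ‖u t x‖ ≤ U * exp t
  div_free : ∀ t φ, 0 < t → IsTest φ → ∫ x, ⟪∇ φ x, u t x⟫ ∂μD = 0

lemma ae_cyl_pos : ∀ᵐ p ∂μC, 0 < p.1 := by
  rw [cylMeasure]
  filter_upwards [ae_restrict_mem (measurableSet_Ioi.prod measurableSet_disc)] with p hp
  exact hp.1

namespace IsFlow

variable {u : ℝ → Plane → Plane} {U : ℝ}

lemma memLp_inner (hu : IsFlow u U) {φ : ℝP → ℝ} (h : φ ∈ CylTest) :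
    MemLp (fun p => ⟪u p.1 p.2, sgrad φ p⟫) 2 μC := by
  have h1 : MemLp (fun p => (U * exp p.1) * ‖sgrad φ p‖) 2 μC := CylTest.memLp_cyl (by
      have := CylTest.continuous_sgrad h
      fun_prop) (CylTest.hasCompactSupport_sgrad h).norm.mul_left
  refine h1.mono (hu.meas.aestronglyMeasurable.inner (CylTest.memLp_sgrad h).1) ?_
  filter_upwards [ae_cyl_pos] with p hp
  rw [norm_mul, norm_norm]
  refine (norm_inner_le_norm _ _).trans (mul_le_mul_of_nonneg_right ?_ (norm_nonneg _))
  exact (hu.bound _ _ hp).trans (le_abs_self _)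

lemma memLp_slice (hu : IsFlow u U) (ht : 0 < t) : MemLp (u t) 2 μD :=
  (memLp_const (U * exp t)).mono
    (hu.meas.comp_measurable measurable_prodMk_left).aestronglyMeasurable
    (.of_forall fun x => (hu.bound t x ht).trans (le_abs_self _))

lemma skew (hu : IsFlow u U) (ht : 0 < t) (hφ : IsTest φ) {g : Plane → Plane} (hv : MemH10 v g) :
    ∫ x, ⟪u t x, ∇ φ x⟫ * v x ∂μD + ∫ x, ⟪g x, φ x • u t x⟫ ∂μD = 0 := by
  have hum := hu.memLp_slice ht
  obtain ⟨C, hC⟩ := hφ.2.1.exists_bound_of_continuous hφ.continuous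
  have hgc : HasCompactSupport (∇ φ) := comp_left (g := (toDual ℝ Plane).symm)
      (hφ.2.1.fderiv (𝕜 := ℝ)) (by simp)
  have h1 : MemLp (fun x => ⟪u t x, ∇ φ x⟫) 2 μD := by
    refine ((hφ.memLp_gradient 2).norm.const_mul (U * exp t)).mono
      (hum.1.inner (hφ.memLp_gradient 2).1) (.of_forall fun x => ?_)
    rw [norm_mul, norm_norm]
    exact (norm_inner_le_norm _ _).trans (mul_le_mul_of_nonneg_right
      ((hu.bound t x ht).trans (le_abs_self _)) (norm_nonneg _))
  have h2 : MemLp (fun x => φ x • u t x) 2 μD :=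
    memLp_bdd_mul hum hφ.continuous.aestronglyMeasurable C (.of_forall hC)
  refine hv.integral_eq_zero h1 h2 fun ψ hψ => ?_
  rw [← hu.div_free t (fun x => φ x * ψ x) ht (hψ.mul_left hφ.1),
    ← integral_add (integrable_mul_L2 h1 (hψ.memLp 2))
      (integrable_inner (hψ.memLp_gradient 2) h2)]
  refine integral_ext fun x => ?_
  simp only [inner_plane, gradient_apply, PiLp.smul_apply, smul_eq_mul]
  rw [pd_mul 0 (hφ.differentiable x) (hψ.differentiable x),
    pd_mul 1 (hφ.differentiable x) (hψ.differentiable x)]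
  ring

lemma integral_mul_inner (hu : IsFlow u U) {φ : ℝP → ℝ} (h : φ ∈ CylTest) :
    ∫ p, φ p * ⟪u p.1 p.2, sgrad φ p⟫ ∂μC = 0 := by
  have hi := integrable_mul_L2 (CylTest.memLp h) (hu.memLp_inner h)
  rw [cylMeasure_eq] at hi ⊢
  rw [integral_prod _ hi]
  refine integral_eq_zero_of_ae ?_
  filter_upwards [ae_restrict_mem measurableSet_Ioi] with t ht
  have h1 := hu.skew ht (CylTest.slice h t) (CylTest.slice h t).memH10
  simp only [CylTest.gradient_slice h, inner_smul_right] at h1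
  have h2 : ∀ x, ⟪u t x, sgrad φ (t, x)⟫ * φ (t, x)
      = φ (t, x) * ⟪u t x, sgrad φ (t, x)⟫ := fun x => mul_comm _ _
  have h3 : ∀ x, φ (t, x) * ⟪sgrad φ (t, x), u t x⟫
      = φ (t, x) * ⟪u t x, sgrad φ (t, x)⟫ := fun x => by rw [real_inner_comm]
  simp only [h2, h3] at h1
  simp only [Pi.zero_apply]
  linarith

end IsFlow

lemma ofFun_smul_toLp {α F : Type*} [MeasurableSpace α] {μ : Measure α} [NormedAddCommGroup F]
    [NormedSpace ℝ F] {a b : α → F} (c : ℝ) (ha : MemLp a 2 μ) (hb : MemLp b 2 μ)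
    (h : b = c • a) : hb.toLp b = c • ha.toLp a := by subst h; exact MemLp.toLp_const_smul c ha

lemma toLp_add_of_eq {α F : Type*} [MeasurableSpace α] {μ : Measure α} [NormedAddCommGroup F]
    {a b c : α → F} (ha : MemLp a 2 μ) (hb : MemLp b 2 μ) (hc : MemLp c 2 μ)
    (h : c = a + b) : hc.toLp c = ha.toLp a + hb.toLp b := by subst h; exact MemLp.toLp_add ha hb

/-- The spatial gradient as a linear map to `L²`. -/
def sgradLp : CylTest →ₗ[ℝ] Lp Plane 2 μC where
  toFun φ := (CylTest.memLp_sgrad φ.2).toLp _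
  map_add' φ ψ := toLp_add_of_eq _ _ _ (CylTest.sgrad_add φ.2 ψ.2)
  map_smul' c φ := ofFun_smul_toLp c _ _ (CylTest.sgrad_smul φ.2 c)

/-- Integration against `F` along a map into space-time, as a linear form on test functions. -/
def pairForm {α : Type*} [MeasurableSpace α] {μ : Measure α} {F : α → ℝ} (hF : MemLp F 2 μ)
    (r : α → ℝP) (hr : ∀ φ ∈ CylTest, MemLp (fun x => φ (r x)) 2 μ) : CylTest →ₗ[ℝ] ℝ where
  toFun φ := ∫ x, F x * φ.1 (r x) ∂μ
  map_add' φ ψ := by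
    rw [← integral_add (integrable_mul_L2 hF (hr _ φ.2)) (integrable_mul_L2 hF (hr _ ψ.2))]
    exact integral_ext fun x => mul_add _ _ _
  map_smul' c φ := by
    rw [RingHom.id_apply, smul_eq_mul, ← integral_const_mul]
    exact integral_ext fun x => mul_left_comm _ _ _

lemma exists_divergence_form {F : ℝP → ℝ} (hF : MemLp F 2 μC) :
    ∃ N : ℝP → Plane, MemLp N 2 μC ∧ ∀ φ ∈ CylTest,
      ∫ p, ⟪N p, sgrad φ p⟫ ∂μC = ∫ p, F p * φ p ∂μC := by
  obtain ⟨h, hh⟩ := exists_inner_eq_of_bound sgradLp (pairForm hF id fun φ hφ => CylTest.memLp hφ) (√(∫ p, F p ^ 2 ∂μC)) fun φ => by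
    refine (abs_integral_mul_le hF (CylTest.memLp φ.2)).trans ?_
    have : ‖sgradLp φ‖ = √(∫ p, ‖sgrad φ.1 p‖ ^ 2 ∂μC) :=
      norm_toLp_eq_sqrt (CylTest.memLp_sgrad φ.2)
    rw [this]
    exact mul_le_mul_of_nonneg_left (sqrt_le_sqrt (CylTest.poincare φ.2)) (sqrt_nonneg _)
  refine ⟨h, Lp.memLp h, fun φ hφ => ?_⟩
  have h1 := hh ⟨φ, hφ⟩
  rw [← inner_toLp (Lp.memLp h) (CylTest.memLp_sgrad hφ), Lp.toLp_coeFn]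
  exact h1

/-- Existence for the equation with an exponential weight in time. -/
theorem IsFlow.exists_weighted (hu : IsFlow u U) {F : ℝP → ℝ} (hF : MemLp F 2 μC)
    (hT₀ : MemLp T₀ 2 μD) :
    ∃ (S : ℝP → ℝ) (DS : ℝP → Plane), MemLp S 2 μC ∧ MemLp DS 2 μC ∧
      (∃ φ : ℕ → ℝP → ℝ, (∀ n, φ n ∈ CylTest) ∧
        Tendsto (fun n => eLpNorm (fun p => φ n p - S p) 2 μC) atTop (𝓝 0) ∧
        Tendsto (fun n => eLpNorm (fun p => sgrad (φ n) p - DS p) 2 μC) atTop (𝓝 0)) ∧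
      ∀ φ ∈ CylTest, ∫ p, S p * (φ p - tderiv φ p - ⟪u p.1 p.2, sgrad φ p⟫) ∂μC
          + ∫ p, ⟪DS p, sgrad φ p⟫ ∂μC
        = ∫ p, F p * φ p ∂μC + ∫ x, T₀ x * φ (0, x) ∂μD := by
  have ha : ∀ φ ∈ CylTest, MemLp (fun p => φ p - tderiv φ p - ⟪u p.1 p.2, sgrad φ p⟫) 2
      μC := fun φ hφ => ((CylTest.memLp hφ).sub (CylTest.memLp_tderiv hφ)).sub (hu.memLp_inner hφ)
  have hι : ∀ φ ∈ CylTest, MemLp (fun p => (toLp 2 (φ p, sgrad φ p) : ScalarVec)) 2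
      μC := fun φ hφ => memLp_scalarVec (CylTest.memLp hφ) (CylTest.memLp_sgrad hφ)
  have hκ : ∀ φ ∈ CylTest, MemLp (fun p => (toLp 2
      (φ p - tderiv φ p - ⟪u p.1 p.2, sgrad φ p⟫, sgrad φ p) : ScalarVec)) 2
      μC := fun φ hφ => memLp_scalarVec (ha φ hφ) (CylTest.memLp_sgrad hφ)
  let ι : CylTest →ₗ[ℝ] Lp ScalarVec 2 μC :=
    { toFun := fun φ => (hι φ.1 φ.2).toLp _
      map_add' := fun φ ψ => toLp_add_of_eq _ _ _ (by
        funext p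
        simp only [Submodule.coe_add, CylTest.sgrad_add φ.2 ψ.2, Pi.add_apply]
        rfl)
      map_smul' := fun c φ => ofFun_smul_toLp c _ _ (by
        funext p
        simp only [Submodule.coe_smul, CylTest.sgrad_smul φ.2, Pi.smul_apply, RingHom.id_apply]
        rfl) }
  let K : CylTest →ₗ[ℝ] Lp ScalarVec 2 μC :=
    { toFun := fun φ => (hκ φ.1 φ.2).toLp _
      map_add' := fun φ ψ => toLp_add_of_eq _ _ _ (by
        funext p
        simp only [Submodule.coe_add, CylTest.sgrad_add φ.2 ψ.2, CylTest.tderiv_add φ.2 ψ.2,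
          Pi.add_apply, inner_add_right]
        change (toLp 2 (_, _) : ScalarVec) = toLp 2 (_ + _, _ + _)
        congr 2
        change _ = (φ.1 p - tderiv φ.1 p - ⟪u p.1 p.2, sgrad φ.1 p⟫)
          + (ψ.1 p - tderiv ψ.1 p - ⟪u p.1 p.2, sgrad ψ.1 p⟫)
        ring)
      map_smul' := fun c φ => ofFun_smul_toLp c _ _ (by
        funext p
        simp only [Submodule.coe_smul, CylTest.sgrad_smul φ.2, CylTest.tderiv_smul φ.2,
          Pi.smul_apply, inner_smul_right, RingHom.id_apply]
        change (toLp 2 (_, _) : ScalarVec) = toLp 2 (c • _, c • _)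
        congr 2
        change _ = c * (φ.1 p - tderiv φ.1 p - ⟪u p.1 p.2, sgrad φ.1 p⟫)
        simp only [smul_eq_mul]
        ring) }
  let p2 : CylTest → ℝ := fun φ => (1 / 2) * ∫ x, φ.1 (0, x) ^ 2 ∂μD
    + ∫ p, φ.1 p ^ 2 ∂μC + ∫ p, ‖sgrad φ.1 p‖ ^ 2 ∂μC
  have hp φ : 0 ≤ p2 φ ∧ ∫ p, φ.1 p ^ 2 ∂μC ≤ p2 φ ∧ ∫ x, φ.1 (0, x) ^ 2 ∂μD ≤ 2 * p2 φ := by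
    have n1 : 0 ≤ ∫ x, φ.1 (0, x) ^ 2 ∂μD := by positivity
    have n2 : 0 ≤ ∫ p, φ.1 p ^ 2 ∂μC := by positivity
    have n3 : 0 ≤ ∫ p, ‖sgrad φ.1 p‖ ^ 2 ∂μC := by positivity
    simp only [p2]; constructorm* _ ∧ _ <;> linarith
  obtain ⟨h, hcl, hh⟩ := lions_projection ι K
    (pairForm hF id (fun φ hφ => CylTest.memLp hφ)
      + pairForm hT₀ (fun x => (0, x)) fun φ hφ => (CylTest.slice hφ 0).memLp 2) (fun φ => √(p2 φ))
    (√(∫ p, F p ^ 2 ∂μC) + √(∫ x, T₀ x ^ 2 ∂μD) * √2) (by positivity)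
    (fun φ => sqrt_nonneg _) (fun φ => by
      refine (abs_add_le _ _).trans ?_
      rw [add_mul]
      refine add_le_add ?_ ?_
      · refine (abs_integral_mul_le hF (CylTest.memLp φ.2)).trans ?_
        exact mul_le_mul_of_nonneg_left (sqrt_le_sqrt (hp φ).2.1) (sqrt_nonneg _)
      · refine (abs_integral_mul_le hT₀ ((CylTest.slice φ.2 0).memLp 2)).trans ?_
        rw [mul_assoc, ← sqrt_mul (x := 2) (by norm_num)]
        exact mul_le_mul_of_nonneg_left (sqrt_le_sqrt (hp φ).2.2) (sqrt_nonneg _)) (fun φ => by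
      have h1 : ‖ι φ‖ = √(∫ p, ‖(toLp 2 (φ.1 p, sgrad φ.1 p) : ScalarVec)‖ ^ 2 ∂μC) :=
        norm_toLp_eq_sqrt (hι φ.1 φ.2)
      rw [h1]
      refine sqrt_le_sqrt ?_
      simp only [norm_sq_scalarVec]
      rw [integral_add (CylTest.memLp φ.2).integrable_sq
        (integrable_normSq (CylTest.memLp_sgrad φ.2))]
      have : 0 ≤ ∫ x, φ.1 (0, x) ^ 2 ∂μD := by positivity
      simp only [p2]; linarith) (fun φ => by
      rw [sq_sqrt (hp φ).1]
      have h1 : ⟪ι φ, K φ⟫ = ∫ p, inner ℝ (toLp 2 (φ.1 p, sgrad φ.1 p) : ScalarVec)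
          (toLp 2 (φ.1 p - tderiv φ.1 p - ⟪u p.1 p.2, sgrad φ.1 p⟫, sgrad φ.1 p)) ∂μC := inner_toLp (hι φ.1 φ.2) (hκ φ.1 φ.2)
      have h2 : ⟪ι φ, K φ⟫ = ∫ p, ((φ.1 p ^ 2 - φ.1 p * tderiv φ.1 p
          - φ.1 p * ⟪u p.1 p.2, sgrad φ.1 p⟫) + ‖sgrad φ.1 p‖ ^ 2) ∂μC := by
        rw [h1]
        refine integral_ext fun p => ?_
        simp only [inner_scalarVec]
        change φ.1 p * _ + ⟪sgrad φ.1 p, sgrad φ.1 p⟫ = _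
        rw [real_inner_self_eq_norm_sq]
        ring
      have i1 := (CylTest.memLp φ.2).integrable_sq
      have i2 := integrable_mul_L2 (CylTest.memLp φ.2) (CylTest.memLp_tderiv φ.2)
      have i3 := integrable_mul_L2 (CylTest.memLp φ.2) (hu.memLp_inner φ.2)
      have i12 : Integrable (fun p => φ.1 p ^ 2 - φ.1 p * tderiv φ.1 p) μC := i1.sub i2
      have i123 : Integrable (fun p => φ.1 p ^ 2 - φ.1 p * tderiv φ.1 p
          - φ.1 p * ⟪u p.1 p.2, sgrad φ.1 p⟫) μC := i12.sub i3
      rw [h2, integral_add i123 (integrable_normSq (CylTest.memLp_sgrad φ.2)),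
        integral_sub i12 i3, integral_sub i1 i2, hu.integral_mul_inner φ.2,
        CylTest.integral_mul_tderiv φ.2]
      simp only [p2]
      linarith)
  have hm := Lp.memLp h
  refine ⟨fun p => (h p).fst, fun p => (h p).snd, memLp_fst hm, memLp_sndVec hm, ?_, ?_⟩
  · obtain ⟨y, hy, hlim⟩ := mem_closure_iff_seq_limit.1 hcl
    choose φ hφ using hy
    have hl : Tendsto (fun n => eLpNorm (fun p =>
        (toLp 2 ((φ n).1 p, sgrad (φ n).1 p) : ScalarVec) - h p) 2 μC) atTop (𝓝 0) := by
      have h1 := (tendsto_iff_edist_tendsto_0.1 hlim)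
      refine h1.congr fun n => ?_
      rw [← hφ n, Lp.edist_def]
      refine eLpNorm_congr_ae ?_
      filter_upwards [(hι (φ n).1 (φ n).2).coeFn_toLp] with p hp
      rw [← hp]; rfl
    refine ⟨fun n => (φ n).1, fun n => (φ n).2, ?_, ?_⟩
    · refine tendsto_of_tendsto_of_tendsto_of_le_of_le tendsto_const_nhds hl (fun _ => zero_le)
        fun n => eLpNorm_mono fun p => ?_
      exact norm_fst_le_scalarVec ((toLp 2 ((φ n).1 p, sgrad (φ n).1 p) : ScalarVec) - h p)
    · refine tendsto_of_tendsto_of_tendsto_of_le_of_le tendsto_const_nhds hl (fun _ => zero_le)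
        fun n => eLpNorm_mono fun p => ?_
      exact norm_snd_le_scalarVec ((toLp 2 ((φ n).1 p, sgrad (φ n).1 p) : ScalarVec) - h p)
  · intro φ hφ
    have h1 : ⟪h, K ⟨φ, hφ⟩⟫ = _ := hh ⟨φ, hφ⟩
    rw [← Lp.toLp_coeFn h hm] at h1
    have h2 : ⟪hm.toLp h, K ⟨φ, hφ⟩⟫ = _ := inner_toLp hm (hκ φ hφ)
    rw [h2] at h1
    simp only [inner_scalarVec] at h1
    rw [integral_add (integrable_mul_L2 (memLp_fst hm) (ha φ hφ))
      (integrable_inner (memLp_sndVec hm) (CylTest.memLp_sgrad hφ))] at h1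
    exact h1

lemma MemH10.const_mul {g : Plane → Plane} (h : MemH10 v g) (c : ℝ) :
    MemH10 (fun x => c * v x) (fun x => c • g x) := by
  obtain ⟨φ, hφ, h1, h2⟩ := h.approx
  refine ⟨h.memLp.const_mul c, h.memLp_grad.const_smul c, fun n x => c * φ n x,
    fun n => (hφ n).const_mul c, ?_, ?_⟩
  · have h3 : ∀ n, eLpNorm (fun x => c * φ n x - c * v x) 2 μD
        = ‖c‖ₑ * eLpNorm (fun x => φ n x - v x) 2 μD := fun n => by
      rw [← eLpNorm_const_smul]
      congr 1
      funext x; simp [mul_sub]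
    simp only [h3]
    simpa using ENNReal.Tendsto.const_mul (a := ‖c‖ₑ) h1 (Or.inr (by simp))
  · have h3 : ∀ n, eLpNorm (fun x => ∇ (fun x => c * φ n x) x - c • g x) 2 μD
        = ‖c‖ₑ * eLpNorm (fun x => ∇ (φ n) x - g x) 2 μD := fun n => by
      rw [← eLpNorm_const_smul]
      congr 1
      funext x
      ext i
      simp only [PiLp.sub_apply, gradient_apply, PiLp.smul_apply, Pi.smul_apply, smul_eq_mul]
      rw [pd_const_mul c i ((hφ n).differentiable x)]
      ring
    simp only [h3]
    simpa using ENNReal.Tendsto.const_mul (a := ‖c‖ₑ) h2 (Or.inr (by simp))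

lemma ae_memH10_of_tendsto (hS : MemLp S 2 μC) (hDS : MemLp DS 2 μC) {φ : ℕ → ℝP → ℝ}
    (hφ : ∀ n, φ n ∈ CylTest)
    (h1 : Tendsto (fun n => eLpNorm (fun p => φ n p - S p) 2 μC) atTop (𝓝 0))
    (h2 : Tendsto (fun n => eLpNorm (fun p => sgrad (φ n) p - DS p) 2 μC) atTop (𝓝 0)) :
    ∀ᵐ t ∂μT, MemH10 (fun x => S (t, x)) (fun x => DS (t, x)) := by
  have ha : ∀ n, MemLp (fun p => φ n p - S p) 2 μC := fun n => (CylTest.memLp (hφ n)).sub hS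
  have hb : ∀ n, MemLp (fun p => sgrad (φ n) p - DS p) 2 μC := fun n =>
    (CylTest.memLp_sgrad (hφ n)).sub hDS
  have l1 := tendsto_integral_normSq ha MemLp.zero' (by simpa using h1)
  have l2 := tendsto_integral_normSq hb MemLp.zero' (by simpa using h2)
  simp only [norm_zero, ne_eq, OfNat.ofNat_ne_zero, not_false_eq_true, zero_pow,
    integral_zero] at l1 l2
  rw [cylMeasure_eq] at hS hDS ha hb l1 l2
  let A : ℕ → ℝ → ℝ := fun n t => ∫ x, ‖φ n (t, x) - S (t, x)‖ ^ 2 ∂μD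
  let B : ℕ → ℝ → ℝ := fun n t => ∫ x, ‖sgrad (φ n) (t, x) - DS (t, x)‖ ^ 2 ∂μD
  have iA : ∀ n, Integrable (A n) μT := fun n =>
    integrable_slice_normSq (v := fun t x => φ n (t, x) - S (t, x)) (ha n)
  have iB : ∀ n, Integrable (B n) μT := fun n =>
    integrable_slice_normSq (v := fun t x => sgrad (φ n) (t, x) - DS (t, x)) (hb n)
  have nA : ∀ n t, 0 ≤ A n t := fun n t => by positivity
  have nB : ∀ n t, 0 ≤ B n t := fun n t => by positivity
  have hlim : Tendsto (fun n => eLpNorm ((fun t => A n t + B n t) - fun _ => (0 : ℝ)) 1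
      μT) atTop (𝓝 0) := by
    have h3 : ∀ n, eLpNorm ((fun t => A n t + B n t) - fun _ => (0 : ℝ)) 1 μT = ofReal
        ((∫ p, ‖φ n p - S p‖ ^ 2 ∂((μT).prod μD))
        + ∫ p, ‖sgrad (φ n) p - DS p‖ ^ 2 ∂((μT).prod μD)) := by
      intro n
      rw [integral_prod _ (integrable_normSq (ha n)),
        integral_prod _ (integrable_normSq (hb n)), ← integral_add (iA n) (iB n),
        ofReal_integral_eq_lintegral_ofReal ((iA n).fun_add (iB n))
          (.of_forall fun t => add_nonneg (nA n t) (nB n t)), eLpNorm_one_eq_lintegral_enorm]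
      refine lintegral_congr fun t => ?_
      simp only [Pi.sub_apply, sub_zero, Pi.add_apply]
      rw [enorm_of_nonneg (add_nonneg (nA n t) (nB n t))]
    simp only [h3]
    simpa using tendsto_ofReal (l1.add l2)
  obtain ⟨ns, -, hns⟩ := (tendstoInMeasure_of_tendsto_eLpNorm one_ne_zero
    (fun n => ((iA n).add (iB n)).1) aestronglyMeasurable_const hlim).exists_seq_tendsto_ae
  have sS := ae_memLp_slice (v := fun t x => S (t, x)) hS
  have sDS := ae_memLp_slice (v := fun t x => DS (t, x)) hDS
  filter_upwards [hns, sS, sDS] with t ht hSt hDSt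
  refine ⟨hSt, hDSt, fun k x => φ (ns k) (t, x), fun k => CylTest.slice (hφ _) t, ?_, ?_⟩
  · have h3 : ∀ k, eLpNorm (fun x => φ (ns k) (t, x) - S (t, x)) 2 μD
        = ofReal √(A (ns k) t) := fun k =>
      eLpNorm_eq_ofReal_sqrt (((CylTest.slice (hφ _) t).memLp 2).sub hSt)
    simp only [h3]
    have h4 : Tendsto (fun k => A (ns k) t) atTop (𝓝 0) :=
      squeeze_zero (fun k => nA _ _) (fun k => le_add_of_nonneg_right (nB _ _)) ht
    simpa using tendsto_ofReal (h4.sqrt)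
  · have h3 : ∀ k, eLpNorm (fun x => ∇ (fun x => φ (ns k) (t, x)) x - DS (t, x)) 2 μD
        = ofReal √(B (ns k) t) := fun k => by
      simp only [CylTest.gradient_slice (hφ _)]
      refine eLpNorm_eq_ofReal_sqrt (a := fun x => sgrad (φ (ns k)) (t, x) - DS (t, x)) ?_
      have := (CylTest.slice (hφ (ns k)) t).memLp_gradient 2
      have h5 : (∇ fun x => φ (ns k) (t, x)) = fun x => sgrad (φ (ns k)) (t, x) :=
        funext fun x => CylTest.gradient_slice (hφ _) t x
      rw [h5] at this
      exact this.sub hDSt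
    simp only [h3]
    have h4 : Tendsto (fun k => B (ns k) t) atTop (𝓝 0) :=
      squeeze_zero (fun k => nB _ _) (fun k => le_add_of_nonneg_left (nA _ _)) ht
    simpa using tendsto_ofReal (h4.sqrt)

lemma exists_isTest_approx (hv : MemLp v 2 μD) (hε : 0 < ε) :
    ∃ φ, IsTest φ ∧ ∫ x, (v x - φ x) ^ 2 ∂μD < ε := by
  let K : Submodule ℝ (Lp ℝ 2 μD) :=
    { carrier := {h | ∃ φ, ∃ hφ : IsTest φ, (hφ.memLp 2).toLp φ = h}
      add_mem' := by
        rintro _ _ ⟨φ, hφ, rfl⟩ ⟨ψ, hψ, rfl⟩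
        exact ⟨_, hφ.add hψ, toLp_add_of_eq _ _ _ rfl⟩
      zero_mem' := ⟨_, isTest_zero, MemLp.toLp_zero _⟩
      smul_mem' := by
        rintro c _ ⟨φ, hφ, rfl⟩
        exact ⟨_, hφ.const_mul c, ofFun_smul_toLp c _ _ rfl⟩ }
  have hK : K.topologicalClosure = ⊤ := by
    rw [Submodule.topologicalClosure_eq_top_iff, Submodule.eq_bot_iff]
    intro w hw
    have h0 : ∀ φ, IsTest φ → ∫ x, φ x • w x ∂(volume : Measure Plane).restrict disc = 0 := by
      intro φ hφ
      have h1 := (Submodule.mem_orthogonal _ _).1 hw _ ⟨φ, hφ, rfl⟩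
      rw [← Lp.toLp_coeFn w (Lp.memLp w), inner_toLp] at h1
      rw [← h1]
      refine integral_ext fun x => ?_
      simp [mul_comm]
    have hwi : Integrable w μD := (Lp.memLp w).integrable (by norm_num)
    have h2 := isOpen_disc.ae_eq_zero_of_integral_contDiff_smul_eq_zero (μ := volume) (f := w)
      (IntegrableOn.locallyIntegrableOn hwi) fun g hg hc hsub => by
        rw [← h0 g ⟨hg, hc, hsub⟩, setIntegral_eq_integral_of_forall_compl_eq_zero]
        intro x hx
        rw [IsTest.eq_zero ⟨hg, hc, hsub⟩ hx, zero_smul]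
    rw [Lp.eq_zero_iff_ae_eq_zero]
    exact (ae_restrict_iff' measurableSet_disc).2 h2
  have h1 : hv.toLp v ∈ closure (K : Set (Lp ℝ 2 μD)) := by
    rw [← Submodule.topologicalClosure_coe, hK]; trivial
  obtain ⟨_, ⟨φ, hφ, rfl⟩, h2⟩ := Metric.mem_closure_iff.1 h1 (√ε) (Real.sqrt_pos.2 hε)
  refine ⟨φ, hφ, ?_⟩
  have h3 : MemLp (fun x => v x - φ x) 2 μD := hv.sub (hφ.memLp 2)
  have h4 : ‖h3.toLp _‖ = √(∫ x, ‖v x - φ x‖ ^ 2 ∂μD) := norm_toLp_eq_sqrt h3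
  have h5 : h3.toLp _ = hv.toLp v - (hφ.memLp 2).toLp φ := MemLp.toLp_sub hv (hφ.memLp 2)
  rw [dist_eq_norm, ← h5, h4] at h2
  simpa using (Real.sqrt_lt_sqrt_iff (by positivity)).1 h2

lemma memL2Loc_of_le {F : Type*} [NormedAddCommGroup F] {v : ℝ → Plane → F} {V : ℝP → ℝ}
    (hV : MemLp V 2 μC) (hv : JointlyMeasurable v) {k : ℝ} (hC : 0 ≤ C) (hk : 0 ≤ k)
    (h : ∀ᵐ p ∂μC, ‖v p.1 p.2‖ ≤ C * exp (k * p.1) * ‖V p‖) :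
    MemL2Loc v ∧ ∀ b, MemLp ♯v 2 μC[b] := by
  have key : ∀ b, MemLp ♯v 2 μC[b] := by
    intro b
    have hle : μC[b] ≤ μC := by
      rw [cylMeasure_eq]
      exact Measure.prod_mono (restrict_mono Ioc_subset_Ioi_self le_rfl) le_rfl
    refine ((hV.mono_measure hle).const_mul (C * exp (k * b))).mono (hv.mono_measure hle) ?_
    have hb : ∀ᵐ p ∂μC[b], p.1 ∈ Ioc 0 b :=
      Measure.quasiMeasurePreserving_fst.ae (ae_restrict_mem measurableSet_Ioc)
    filter_upwards [ae_mono hle h, hb] with p hp hpb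
    refine hp.trans ?_
    rw [norm_mul, norm_of_nonneg (r := C * exp (k * b)) (by positivity)]
    gcongr
    exact hpb.2
  refine ⟨⟨hv, fun a b ha hab => ?_⟩, key⟩
  have h1 := lintegral_enorm_sq_lt_top (key b)
  rw [lintegral_prod _ ((key b).1.enorm.pow_const 2)] at h1
  exact (lintegral_mono_set (s := Icc a b) (t := Ioc 0 b)
    (fun t ht => ⟨ha.trans_le ht.1, ht.2⟩)).trans_lt h1

/-! ### Attainment of the initial datum -/

/-- `T` is a weak solution of `∂ₜT = ∇ · m` with initial data `T₀`. -/
def IsWeakFrom (T₀ : Plane → ℝ) (T : ℝ → Plane → ℝ) (m : ℝ → Plane → Plane) : Prop :=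
  ∀ χ ∈ CylTest, ∫ p, T p.1 p.2 * tderiv χ p ∂μC
    = ∫ p, ⟪m p.1 p.2, sgrad χ p⟫ ∂μC - ∫ x, T₀ x * χ (0, x) ∂μD

lemma integrable_cyl_of_eq_zero {G : ℝP → ℝ} (hG : Integrable G μC[b])
    (h0 : ∀ p : ℝP, b < p.1 → G p = 0) : Integrable G μC := by
  have h1 : μC[b] = (volume : Measure (ℝP)).restrict (Ioc 0 b ×ˢ disc) := by
    rw [discMeasure, Measure.prod_restrict]; rfl
  rw [h1] at hG
  refine IntegrableOn.of_forall_sdiff_eq_zero (s := Ioc 0 b ×ˢ disc) hG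
    (measurableSet_Ioi.prod measurableSet_disc) fun p hp => h0 p ?_
  by_contra hle
  exact hp.2 ⟨⟨hp.1.1, not_lt.1 hle⟩, hp.1.2⟩

lemma exists_bound_support (hc : HasCompactSupport θ) :
    ∃ b, 0 < b ∧ ∀ t, b < t → θ t = 0 ∧ deriv θ t = 0 := by
  obtain ⟨r, hr⟩ := hc.isCompact.isBounded.subset_ball 0
  refine ⟨max r 1, by positivity, fun t ht => ?_⟩
  have ht' : t ∉ tsupport θ := fun h => by
    have := hr h
    rw [mem_ball_zero_iff, norm_eq_abs] at this
    linarith [le_abs_self t, le_max_left r 1]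
  refine ⟨image_eq_zero_of_notMem_tsupport ht', ?_⟩
  have := (tsupport_deriv_subset (𝕜 := ℝ) (f := θ)).trans le_rfl
  exact image_eq_zero_of_notMem_tsupport fun h => ht' (this h)

section

variable {T : ℝ → Plane → ℝ} {DT m : ℝ → Plane → Plane} {T₀ : Plane → ℝ}

lemma initial_pairing_test (hT₀ : MemLp T₀ 2 μD) (bT : ∀ b, MemLp ♯T 2
      μC[b]) (bm : ∀ b, MemLp ♯m 2 μC[b])
    (hp : IsWeakFrom T₀ T m) (hv : IsTest v) : ∃ S : Set ℝ, (∀ᵐ t, t ∈ S) ∧ ∀ b ∈ S, 0 < b →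
      ∫ x, T b x * v x ∂μD - ∫ x, T₀ x * v x ∂μD
        = - ∫ t in (0 : ℝ)..b, ∫ x, ⟪∇ v x, m t x⟫ ∂μD := by
  set c := ∫ x, T₀ x * v x ∂μD with hc
  let R : ℝ → ℝ := fun t => ∫ x, T t x * v x ∂μD
  let Q : ℝ → ℝ := fun t => ∫ x, ⟪∇ v x, m t x⟫ ∂μD
  have iR : ∀ b, IntegrableOn R (Ioc 0 b) := fun b =>
    integrable_slice_mul (w := fun _ => v) (bT b) (memLp_snd (hv.memLp 2))
  have iQ : ∀ b, IntegrableOn Q (Ioc 0 b) := fun b =>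
    integrable_slice_inner (v := fun _ => ∇ v) (memLp_snd (hv.memLp_gradient 2)) (bm b)
  let e : ℝ → ℝ := (Ioi (0 : ℝ)).indicator fun t => R t - c
  let q : ℝ → ℝ := (Ioi (0 : ℝ)).indicator Q
  have hind : ∀ (F : ℝ → ℝ), (∀ b, IntegrableOn F (Ioc 0 b)) → ∀ a b : ℝ,
      IntegrableOn ((Ioi (0 : ℝ)).indicator F) (Icc a b) := by
    intro F hF a b
    rw [integrableOn_indicator_iff measurableSet_Ioi]
    exact (hF b).mono_set fun t ht => ⟨ht.1, ht.2.2⟩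
  have iRc : ∀ b, IntegrableOn (fun t => R t - c) (Ioc 0 b) := fun b =>
    (iR b).sub (integrableOn_const (by simp))
  obtain ⟨S, hS, hSe⟩ := exists_ae_primitive (c := -1) (e := e) (q := q)
    (fun a b _ _ => hind _ iRc a b) (fun a b _ _ => hind _ iQ a b) (by
      intro θ hθ hθc _
      obtain ⟨b, hb0, hb⟩ := exists_bound_support hθc
      have hθd : Differentiable ℝ θ := hθ.differentiable (by simp)
      have hχ : (fun p => θ p.1 * v p.2) ∈ CylTest := CylTest.mul_mem hθ hθc hv
      have ht : ∀ p : ℝP, tderiv (fun p => θ p.1 * v p.2) p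
          = deriv θ p.1 * v p.2 := fun p => by
        rw [tderiv, fderiv_mul_time hθd hv.differentiable]; simp
      have hg : ∀ p : ℝP, ⟪m p.1 p.2, sgrad (fun p => θ p.1 * v p.2) p⟫
          = θ p.1 * ⟪∇ v p.2, m p.1 p.2⟫ := fun p => by
        rw [real_inner_comm, inner_sgrad, fderiv_mul_time hθd hv.differentiable, inner_gradient]
        simp
      have h1 := hp _ hχ
      have hcd : Continuous (deriv θ) := hθ.continuous_deriv (by simp)
      obtain ⟨C1, hC1⟩ := (hθc.deriv).exists_bound_of_continuous hcd
      obtain ⟨C2, hC2⟩ := hθc.exists_bound_of_continuous hθ.continuous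
      have i1 : Integrable (fun p => T p.1 p.2 * (deriv θ p.1 * v p.2)) μC := by
        refine integrable_cyl_of_eq_zero (b := b) ?_ fun p hpb => by simp [(hb _ hpb).2]
        refine integrable_mul_L2 (bT b) ?_
        exact memLp_bdd_mul (a := fun p : ℝP => deriv θ p.1) (memLp_snd (hv.memLp 2))
          (hcd.comp continuous_fst).aestronglyMeasurable C1 (.of_forall fun p => hC1 _)
      have i2 : Integrable (fun p => θ p.1 * ⟪∇ v p.2, m p.1 p.2⟫)
          μC := by
        refine integrable_cyl_of_eq_zero (b := b) ?_ fun p hpb => by simp [(hb _ hpb).1]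
        have := integrable_inner (memLp_bdd_mul (a := fun p => θ p.1)
          (memLp_snd (ν := volume.restrict (Ioc 0 b)) (hv.memLp_gradient 2))
          (hθ.continuous.comp continuous_fst).aestronglyMeasurable C2
          (.of_forall fun p => hC2 _)) (bm b)
        simpa only [real_inner_smul_left] using this
      simp only [ht, hg] at h1
      rw [cylMeasure_eq] at h1 i1 i2
      rw [integral_prod _ i1, integral_prod _ i2] at h1
      have h2 : ∀ t, ∫ x, T t x * (deriv θ t * v x) ∂μD = deriv θ t * R t := fun t => by
        rw [← integral_const_mul]
        exact integral_ext (fun x => mul_left_comm _ _ _)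
      have h3 : ∀ t, ∫ x, θ t * ⟪∇ v x, m t x⟫ ∂μD = θ t * Q t := fun t =>
        integral_const_mul _ _
      have h4 : ∫ x, T₀ x * (θ 0 * v x) ∂μD = θ 0 * c := by
        rw [hc, ← integral_const_mul]
        exact integral_ext (fun x => mul_left_comm _ _ _)
      simp only [h2, h3, h4] at h1
      have h5 : ∀ F : ℝ → ℝ, ∀ G : ℝ → ℝ, ∫ t, F t * (Ioi (0 : ℝ)).indicator G t
          = ∫ t in Ioi (0 : ℝ), F t * G t := fun F G => by
        rw [← integral_indicator measurableSet_Ioi]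
        refine integral_ext fun t => ?_
        by_cases ht : t ∈ Ioi (0 : ℝ) <;> simp [ht]
      have i3 := i1.integral_prod_left
      simp only [h2] at i3
      have i4 : Integrable (fun t => deriv θ t * c) μT :=
        ((hcd.integrable_of_hasCompactSupport hθc.deriv).mul_const c).integrableOn
      have h6 : ∫ t in Ioi (0 : ℝ), deriv θ t = - θ 0 :=
        hθc.integral_Ioi_deriv_eq (hθ.of_le (by simp)) 0
      simp only [e, q]
      rw [h5, h5]
      simp only [mul_sub]
      rw [integral_sub i3 i4, integral_mul_const, h6]
      linarith)
  refine ⟨S, hS, fun b hb hb0 => ?_⟩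
  obtain ⟨a, haS, ha⟩ : ∃ a ∈ S, a ∈ Ioo (-1 : ℝ) 0 := by
    have h1 : ∃ᵐ t : ℝ, t ∈ Ioo (-1 : ℝ) 0 := by rw [frequently_ae_mem_iff]; simp
    obtain ⟨a, ha⟩ := (h1.and_eventually hS).exists
    exact ⟨a, ha.2, ha.1⟩
  have h1 := hSe a haS b hb ha.1 (ha.2.trans hb0)
  have hea : e a = 0 := indicator_of_notMem (by simpa using ha.2.le) _
  have heb : e b = R b - c := indicator_of_mem (by simpa using hb0) _
  rw [hea, heb, sub_zero] at h1
  rw [h1, integral_of_le (ha.2.trans hb0).le,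
    integral_of_le hb0.le, setIntegral_indicator measurableSet_Ioi]
  congr 3
  ext t
  simp only [mem_inter_iff, mem_Ioc, mem_Ioi]
  exact ⟨fun h => ⟨h.2, h.1.2⟩, fun h => ⟨⟨ha.2.trans h.1, h.2⟩, h.1⟩⟩

lemma initial_pairing (hT₀ : MemLp T₀ 2 μD) (bT : ∀ b, MemLp ♯T 2
      μC[b]) (bm : ∀ b, MemLp ♯m 2 μC[b])
    (hT : ∀ᵐ t ∂μT, MemLp (T t) 2 μD)
    (hp : IsWeakFrom T₀ T m) :
    ∃ S : Set ℝ, (∀ᵐ t, t ∈ S) ∧ ∀ b ∈ S, 0 < b → ∀ v g, MemH10 v g → ∫ x, (T b x - T₀ x) * v x ∂μD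
        = - ∫ t in (0 : ℝ)..b, ∫ x, ⟪g x, m t x⟫ ∂μD := by
  obtain ⟨Φ, hΦ, hdense⟩ := exists_dense_tests
  choose S hS hSe using fun n => initial_pairing_test hT₀ bT bm hp (hΦ n)
  rw [ae_restrict_iff' measurableSet_Ioi] at hT
  refine ⟨{b | (∀ n, b ∈ S n) ∧ (b ∈ Ioi (0 : ℝ) → MemLp (T b) 2 μD)},
    (ae_all_iff.2 hS).and hT, fun b hb hb0 v g hv => ?_⟩
  obtain ⟨k, hk1, hk2⟩ := hdense v g hv
  have hTb := hb.2 hb0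
  refine pairing_eq_of_dense hb0.le (w := fun x => T b x - T₀ x) (hTb.sub hT₀) (bm b)
    (fun n => hΦ (k n)) hv hk1 hk2 fun n => ?_
  rw [← hSe (k n) b (hb.1 _) hb0, ← integral_sub (integrable_mul_L2 hTb ((hΦ _).memLp 2))
    (integrable_mul_L2 hT₀ ((hΦ _).memLp 2))]
  exact integral_ext (fun x => sub_mul _ _ _)

end

section

variable {T : ℝ → Plane → ℝ} {DT m : ℝ → Plane → Plane} {T₀ : Plane → ℝ}

lemma abs_two_inner_le {α F : Type*} [MeasurableSpace α] {μ : Measure α} [NormedAddCommGroup F]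
    [InnerProductSpace ℝ F] {a b : α → F} (ha : MemLp a 2 μ) (hb : MemLp b 2 μ) :
    |2 * ∫ x, ⟪a x, b x⟫ ∂μ| ≤ ∫ x, ‖a x‖ ^ 2 ∂μ + ∫ x, ‖b x‖ ^ 2 ∂μ := by
  have h1 := abs_integral_inner_le ha hb
  have h2 : 0 ≤ ∫ x, ‖a x‖ ^ 2 ∂μ := by positivity
  have h3 : 0 ≤ ∫ x, ‖b x‖ ^ 2 ∂μ := by positivity
  rw [abs_mul, abs_two]
  nlinarith [sq_nonneg (√(∫ x, ‖a x‖ ^ 2 ∂μ) - √(∫ x, ‖b x‖ ^ 2 ∂μ)), sq_sqrt h2, sq_sqrt h3]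

lemma IsEvolution.energy_sub (h : IsEvolution T DT m) (hv : IsTest v) :
    ∃ S : Set ℝ, (∀ᵐ t, t ∈ S) ∧ ∀ a ∈ S, ∀ b ∈ S, 0 < a → a < b →
      MemH10 (T a) (DT a) ∧ MemH10 (T b) (DT b) ∧
      IntegrableOn (fun t => ∫ x, ⟪DT t x - ∇ v x, m t x⟫ ∂μD) (Ioc a b) ∧
      ∫ x, (T b x - v x) ^ 2 ∂μD - ∫ x, (T a x - v x) ^ 2 ∂μD
        = -2 * ∫ t in Ioc a b, ∫ x, ⟪DT t x - ∇ v x, m t x⟫ ∂μD := by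
  obtain ⟨S1, hS1, e1⟩ := h.energy
  obtain ⟨S2, hS2, e2⟩ := h.weak_H10
  refine ⟨{t | t ∈ S1 ∧ t ∈ S2 ∧ (t ∈ Ioi (0 : ℝ) → MemH10 (T t) (DT t))}, ?_, ?_⟩
  · filter_upwards [hS1, hS2, (ae_restrict_iff' measurableSet_Ioi).1 h.memH10] with t a b c
      using ⟨a, b, c⟩
  rintro a ⟨ha1, ha2, ha3⟩ b ⟨hb1, hb2, hb3⟩ ha hab
  have hMa := ha3 ha
  have hMb := hb3 (ha.trans hab)
  have hvt := hv.memLp 2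
  have bD := h.memL2Loc_grad.memLp_Icc ha hab
  have bm := h.memL2Loc_flux.memLp_Icc ha hab
  have bv : MemLp (fun p => ∇ v p.2) 2
      ((volume.restrict (Icc a b)).prod μD) := memLp_snd (hv.memLp_gradient 2)
  have iD : IntegrableOn (fun t => ∫ x, ⟪DT t x, m t x⟫ ∂μD) (Ioc a b) :=
    IntegrableOn.mono_set (integrable_slice_inner bD bm) Ioc_subset_Icc_self
  have iV : IntegrableOn (fun t => ∫ x, ⟪∇ v x, m t x⟫ ∂μD) (Ioc a b) :=
    IntegrableOn.mono_set (integrable_slice_inner (v := fun _ x => ∇ v x) bv bm)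
      Ioc_subset_Icc_self
  have he : ∀ᵐ t ∂volume.restrict (Ioc a b), ∫ x, ⟪DT t x, m t x⟫ ∂μD - ∫ x, ⟪∇ v x, m t x⟫ ∂μD
        = ∫ x, ⟪DT t x - ∇ v x, m t x⟫ ∂μD := by
    filter_upwards [ae_mono (restrict_mono Ioc_subset_Icc_self le_rfl)
      (ae_memLp_slice bD), ae_mono (restrict_mono Ioc_subset_Icc_self le_rfl)
      (ae_memLp_slice bm)] with t h1 h2
    rw [← integral_sub (integrable_inner h1 h2)
      (integrable_inner (hv.memLp_gradient 2) h2)]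
    exact integral_ext (fun x => (inner_sub_left _ _ _).symm)
  have hexp : ∀ t, MemLp (T t) 2 μD → ∫ x, (T t x - v x) ^ 2 ∂μD
      = ∫ x, T t x ^ 2 ∂μD - 2 * ∫ x, T t x * v x ∂μD + ∫ x, v x ^ 2 ∂μD := fun t ht => by
    have j1 : Integrable (fun x => T t x ^ 2) μD := by simpa using! integrable_normSq ht
    have j2 : Integrable (fun x => 2 * (T t x * v x)) μD := (integrable_mul_L2 ht hvt).const_mul 2
    have j3 : Integrable (fun x => v x ^ 2) μD := by simpa using! integrable_normSq hvt
    have j12 : Integrable (fun x => T t x ^ 2 - 2 * (T t x * v x)) μD := j1.sub j2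
    rw [← integral_const_mul, ← integral_sub j1 j2, ← integral_add j12 j3]
    exact integral_ext (fun x => by ring)
  have h1 := e1 a ha1 b hb1 ha hab
  have h2 := (e2 a ha2 b hb2 ha hab).2.2 _ _ hv.memH10
  simp only [sub_mul] at h2
  rw [integral_sub (integrable_mul_L2 hMb.memLp hvt) (integrable_mul_L2 hMa.memLp hvt),
    integral_of_le hab.le] at h2
  rw [integral_of_le hab.le] at h1
  refine ⟨hMa, hMb, (iD.sub iV).congr he, ?_⟩
  rw [hexp b hMb.memLp, hexp a hMa.memLp, ← integral_congr_ae he, integral_sub iD iV]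
  linarith

lemma IsEvolution.approx_initial (h : IsEvolution T DT m) (hT₀ : MemLp T₀ 2 μD)
    (bT : ∀ b, MemLp ♯T 2 μC[b])
    (bDT : ∀ b, MemLp ♯DT 2 μC[b])
    (bm : ∀ b, MemLp ♯m 2 μC[b])
    (hp : IsWeakFrom T₀ T m) (hv : IsTest v) :
    ∃ S : Set ℝ, (∀ᵐ t, t ∈ S) ∧ ∀ b ∈ S, 0 < b → MemLp (T b) 2 μD ∧
      ∫ x, (T b x - v x) ^ 2 ∂μD ≤ ∫ x, (T₀ x - v x) ^ 2 ∂μD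
        + 3 * (∫ t in Ioc 0 b, ∫ x, ‖DT t x - ∇ v x‖ ^ 2 ∂μD)
        + 2 * ∫ t in Ioc 0 b, ∫ x, ‖m t x‖ ^ 2 ∂μD := by
  have hmT : ∀ᵐ t ∂μT, MemLp (T t) 2 μD := h.memH10.mono fun t ht => ht.memLp
  obtain ⟨S1, hS1, e1⟩ := h.energy_sub hv
  obtain ⟨S3, hS3, e3⟩ := initial_pairing hT₀ bT bm hmT hp
  refine ⟨S1 ∩ S3, hS1.and hS3, ?_⟩
  rintro b ⟨hb1, hb3⟩ hb0
  let X : ℝ → ℝ := fun t => ∫ x, ‖DT t x - ∇ v x‖ ^ 2 ∂μD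
  let Y : ℝ → ℝ := fun t => ∫ x, ‖m t x‖ ^ 2 ∂μD
  have hX0 : ∀ t, 0 ≤ X t := fun t => by positivity
  have hY0 : ∀ t, 0 ≤ Y t := fun t => by positivity
  have bv : MemLp (fun p => ∇ v p.2) 2 μC[b] := memLp_snd (hv.memLp_gradient 2)
  have bX : MemLp (fun p => DT p.1 p.2 - ∇ v p.2) 2 μC[b] := (bDT b).sub bv
  have iX : IntegrableOn X (Ioc 0 b) := integrable_slice_normSq (v := fun t x => DT t x - ∇ v x) bX
  have iY : IntegrableOn Y (Ioc 0 b) := integrable_slice_normSq (bm b)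
  change _ ∧ _ ≤ _ + 3 * (∫ t in Ioc 0 b, X t) + 2 * ∫ t in Ioc 0 b, Y t
  obtain ⟨a, ⟨ha1, ha3⟩, hab, haX⟩ : ∃ a, (a ∈ S1 ∧ a ∈ S3) ∧ a ∈ Ioo (b / 2) b ∧
      b * X a ≤ 2 * ∫ t in Ioc 0 b, X t := by
    have hsub : Ioo (b / 2) b ⊆ Ioc 0 b := fun t ht => ⟨by linarith [ht.1], ht.2.le⟩
    have hnull : ∀ᵐ t ∂volume.restrict (Ioo (b / 2) b), (t ∈ S1 ∧ t ∈ S3) ∧ t ∈ Ioo (b / 2) b := by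
      filter_upwards [ae_restrict_of_ae hS1, ae_restrict_of_ae hS3,
        ae_restrict_mem measurableSet_Ioo] with t a b c using ⟨⟨a, b⟩, c⟩
    obtain ⟨a, ha, hle⟩ := exists_notMem_null_le_average
      (μ := volume.restrict (Ioo (b / 2) b)) (f := X)
      (by rw [Ne, Measure.restrict_eq_zero, Real.volume_Ioo]; simp; linarith) (iX.mono_set hsub)
      hnull
    have ha' := not_not.1 ha
    refine ⟨a, ha'.1, ha'.2, ?_⟩
    rw [setAverage_eq, Real.volume_real_Ioo_of_le (by linarith), smul_eq_mul] at hle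
    have h1 : ∫ t in Ioo (b / 2) b, X t ≤ ∫ t in Ioc 0 b, X t :=
      setIntegral_mono_set iX (.of_forall fun t => hX0 t) hsub.eventuallyLE
    have h2 : b - b / 2 = b / 2 := by ring
    rw [h2, ← div_eq_inv_mul, le_div_iff₀ (by positivity)] at hle
    linarith
  have ha0 : 0 < a := by linarith [hab.1]
  obtain ⟨hMa, hMb, iDv, key⟩ := e1 a ha1 b hb1 ha0 hab.2
  have hvt := hv.memLp 2
  refine ⟨hMb.memLp, ?_⟩
  have hsl : ∀ᵐ t ∂volume.restrict (Ioc 0 b), MemLp (DT t) 2 μD ∧ MemLp (m t) 2 μD := by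
    filter_upwards [ae_memLp_slice (bDT b), ae_memLp_slice (bm b)] with t h1 h2 using ⟨h1, h2⟩
  have hab_sub : Ioc a b ⊆ Ioc 0 b := Ioc_subset_Ioc_left ha0.le
  have h0a_sub : Ioc 0 a ⊆ Ioc 0 b := Ioc_subset_Ioc_right hab.2.le
  -- at the intermediate time
  have hEa : ∫ x, (T a x - v x) ^ 2 ∂μD ≤ ∫ x, (T₀ x - v x) ^ 2 ∂μD
      + 2 * (∫ t in Ioc 0 b, X t) + ∫ t in Ioc 0 b, Y t := by
    have hw := hMa.sub hv.memH10
    have h1 := e3 a ha3 ha0 _ _ hw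
    have iw : MemLp (fun x => T a x - v x) 2 μD := hw.memLp
    have i0 : MemLp (fun x => T₀ x - v x) 2 μD := hT₀.sub hvt
    have id : MemLp (fun x => T a x - T₀ x) 2 μD := hMa.memLp.sub hT₀
    have h2 : ∫ x, (T a x - v x) ^ 2 ∂μD = ∫ x, (T a x - T₀ x) * (T a x - v x) ∂μD
          + ∫ x, (T₀ x - v x) * (T a x - v x) ∂μD := by
      rw [← integral_add (integrable_mul_L2 id iw) (integrable_mul_L2 i0 iw)]
      exact integral_ext (fun x => by ring)
    have h3 := abs_two_inner_le i0 iw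
    have h3' : 2 * ∫ x, (T₀ x - v x) * (T a x - v x) ∂μD
        ≤ ∫ x, (T₀ x - v x) ^ 2 ∂μD + ∫ x, (T a x - v x) ^ 2 ∂μD := by
      have := (le_abs_self _).trans h3
      simpa [mul_comm] using this
    have h4 : -2 * ∫ t in (0 : ℝ)..a, ∫ x, ⟪DT a x - ∇ v x, m t x⟫ ∂μD
        ≤ ∫ t in Ioc 0 a, (X a + Y t) := by
      rw [integral_of_le ha0.le, ← integral_const_mul]
      refine integral_mono_ae ((integrable_slice_inner (v := fun _ x => DT a x - ∇ v x)
        (memLp_snd hw.memLp_grad) (bm a)).const_mul _)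
        ((integrableOn_const (by simp)).add (iY.mono_set h0a_sub)) ?_
      filter_upwards [ae_mono (restrict_mono h0a_sub le_rfl) hsl] with t ht
      have := abs_two_inner_le hw.memLp_grad ht.2
      have h5 := (neg_abs_le _).trans (neg_le_neg (neg_le_abs
        (2 * ∫ x, ⟪DT a x - ∇ v x, m t x⟫ ∂μD)))
      have h6 := (neg_le_abs _).trans this
      simp only [X, Y]
      linarith
    have h5 : ∫ t in Ioc 0 a, (X a + Y t) ≤ b * X a + ∫ t in Ioc 0 b, Y t := by
      rw [integral_add (integrable_const _) (iY.mono_set h0a_sub), setIntegral_const,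
        Real.volume_real_Ioc_of_le ha0.le, smul_eq_mul, sub_zero]
      refine add_le_add (mul_le_mul_of_nonneg_right hab.2.le (hX0 a)) ?_
      exact setIntegral_mono_set iY (.of_forall fun t => hY0 t) h0a_sub.eventuallyLE
    linarith
  -- from the intermediate time on
  have h4 : -2 * (∫ t in Ioc a b, ∫ x, ⟪DT t x - ∇ v x, m t x⟫ ∂μD)
      ≤ (∫ t in Ioc 0 b, X t) + ∫ t in Ioc 0 b, Y t := by
    rw [← integral_const_mul, ← integral_add iX iY]
    refine le_trans ?_ (setIntegral_mono_set (iX.add iY)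
      (.of_forall fun t => add_nonneg (hX0 t) (hY0 t)) hab_sub.eventuallyLE)
    refine integral_mono_ae (iDv.const_mul _) ((iX.add iY).mono_set hab_sub) ?_
    filter_upwards [ae_mono (restrict_mono hab_sub le_rfl) hsl] with t ht
    have hd : MemLp (fun x => DT t x - ∇ v x) 2 μD := ht.1.sub (hv.memLp_gradient 2)
    have h5 := (neg_le_abs _).trans (abs_two_inner_le hd ht.2)
    simp only [X, Y]
    linarith
  linarith

theorem IsEvolution.tendsto_initial (h : IsEvolution T DT m) (hT₀ : MemLp T₀ 2 μD)
    (bT : ∀ b, MemLp ♯T 2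
      μC[b])
    (bDT : ∀ b, MemLp ♯DT 2
      μC[b])
    (bm : ∀ b, MemLp ♯m 2
      μC[b])
    (hp : IsWeakFrom T₀ T m) :
    Tendsto (fun t => eLpNorm (fun x => T t x - T₀ x) 2 μD) (ae μT ⊓ 𝓝 0) (𝓝 0) := by
  rw [ENNReal.tendsto_nhds_zero]
  intro ε hε
  obtain ⟨r, hr, hrε⟩ : ∃ r : ℝ, 0 < r ∧ ofReal √r ≤ ε := by
    obtain ⟨r, hr0, hr⟩ := ENNReal.lt_iff_exists_nnreal_btwn.1 hε
    refine ⟨(r : ℝ) ^ 2, by have : 0 < r := by exact_mod_cast hr0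
                            positivity, ?_⟩
    rw [sqrt_sq r.coe_nonneg, ENNReal.ofReal_coe_nnreal]
    exact hr.le
  obtain ⟨v, hv, hvr⟩ := exists_isTest_approx hT₀ (ε := r / 8) (by positivity)
  obtain ⟨S, hS, hSe⟩ := h.approx_initial hT₀ bT bDT bm hp hv
  let X : ℝ → ℝ := fun t => ∫ x, ‖DT t x - ∇ v x‖ ^ 2 ∂μD
  let Y : ℝ → ℝ := fun t => ∫ x, ‖m t x‖ ^ 2 ∂μD
  have bv : MemLp (fun p : ℝP => ∇ v p.2) 2
      μC[1] := memLp_snd (hv.memLp_gradient 2)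
  have bX : MemLp (fun p : ℝP => DT p.1 p.2 - ∇ v p.2) 2
      μC[1] := (bDT 1).sub bv
  have iX : IntegrableOn X (Ioc 0 1) := integrable_slice_normSq (v := fun t x => DT t x - ∇ v x) bX
  have iY : IntegrableOn Y (Ioc 0 1) := integrable_slice_normSq (bm 1)
  have hlim : ∀ F : ℝ → ℝ, IntegrableOn F (Ioc 0 1) →
      Tendsto (fun b => ∫ t in Ioc 0 b, F t) (𝓝[>] 0) (𝓝 0) := by
    intro F hF
    have hI : IntegrableOn F (uIcc 0 1) := by
      rw [uIcc_of_le zero_le_one]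
      rw [integrableOn_Icc_iff_integrableOn_Ioc (by simp)]
      exact hF
    have h1 : ContinuousWithinAt (fun b => ∫ t in (0 : ℝ)..b, F t) (Icc 0 1) 0 := by
      have := intervalIntegral.continuousOn_primitive_interval hI
      rw [uIcc_of_le zero_le_one] at this
      exact this 0 (by simp)
    have h2 : Tendsto (fun b => ∫ t in (0 : ℝ)..b, F t) (𝓝[>] 0) (𝓝 0) := by
      have h3 : 𝓝[>] (0 : ℝ) ≤ 𝓝[Icc 0 1] 0 := by
        rw [← nhdsWithin_Ioc_eq_nhdsGT (zero_lt_one' ℝ)]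
        exact nhdsWithin_mono _ Ioc_subset_Icc_self
      simpa using h1.tendsto.mono_left h3
    refine h2.congr' ?_
    filter_upwards [self_mem_nhdsWithin] with b hb
    exact integral_of_le (le_of_lt hb)
  have hsum : Tendsto (fun b => 3 * (∫ t in Ioc 0 b, X t) + 2 * ∫ t in Ioc 0 b, Y t)
      (𝓝[>] 0) (𝓝 0) := by
    simpa using ((hlim X iX).const_mul 3).add ((hlim Y iY).const_mul 2)
  have hev := (tendsto_order.1 hsum).2 (r / 4) (by positivity)
  have hpos : ∀ᶠ t in ae μT ⊓ 𝓝 0, t ∈ S ∧ t ∈ Ioi (0 : ℝ) := by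
    refine Filter.Eventually.filter_mono inf_le_left ?_
    filter_upwards [ae_restrict_of_ae hS, ae_restrict_mem measurableSet_Ioi] with t h1 h2
      using ⟨h1, h2⟩
  have hev2 : ∀ᶠ t in ae μT ⊓ 𝓝 0, t ∈ Ioi (0 : ℝ) →
      3 * (∫ t in Ioc 0 t, X t) + 2 * ∫ t in Ioc 0 t, Y t < r / 4 :=
    Filter.Eventually.filter_mono inf_le_right (eventually_nhdsWithin_iff.1 hev)
  filter_upwards [hpos, hev2] with b hb hb2
  obtain ⟨hTb, hle⟩ := hSe b hb.1 hb.2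
  have hb3 := hb2 hb.2
  have hd : MemLp (fun x => T b x - T₀ x) 2 μD := hTb.sub hT₀
  rw [eLpNorm_eq_ofReal_sqrt hd]
  refine le_trans (ofReal_le_ofReal (sqrt_le_sqrt ?_)) hrε
  have j1 : Integrable (fun x => (T b x - v x) ^ 2) μD := by
    simpa using! integrable_normSq (hTb.sub (hv.memLp 2))
  have j2 : Integrable (fun x => (T₀ x - v x) ^ 2) μD := by
    simpa using! integrable_normSq (hT₀.sub (hv.memLp 2))
  have h5 : ∫ x, ‖T b x - T₀ x‖ ^ 2 ∂μD ≤ 2 * (∫ x, (T b x - v x) ^ 2 ∂μD)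
      + 2 * ∫ x, (T₀ x - v x) ^ 2 ∂μD := by
    rw [← integral_const_mul, ← integral_const_mul,
      ← integral_add (j1.const_mul 2) (j2.const_mul 2)]
    refine integral_mono (integrable_normSq hd) ((j1.const_mul 2).add (j2.const_mul 2))
      fun x => ?_
    simp only [norm_eq_abs, sq_abs, Pi.add_apply]
    nlinarith [sq_nonneg (T b x - v x + (T₀ x - v x))]
  simp only [X, Y] at hb3
  linarith

end

lemma IsSpaceTimeTest.mem_cylTest {φ : ℝP → ℝ} (h : IsSpaceTimeTest φ) : φ ∈ CylTest :=
  ⟨h.1, h.2.1, h.2.2.trans (prod_mono (subset_univ _) le_rfl)⟩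

lemma IsSpaceTimeTest.eq_zero {φ : ℝP → ℝ} (h : IsSpaceTimeTest φ) (x : Plane) :
    φ (0, x) = 0 := image_eq_zero_of_notMem_tsupport fun hh => lt_irrefl (0 : ℝ) (h.2.2 hh).1

lemma ae_divergence_form {F : ℝP → ℝ} (hF : MemLp F 2 μC) (hN : MemLp N 2 μC) (h : ∀ φ ∈ CylTest,
      ∫ p, ⟪N p, sgrad φ p⟫ ∂μC = ∫ p, F p * φ p ∂μC) : ∀ᵐ t ∂μT, ∀ φ, IsTest φ →
      ∫ x, ⟪∇ φ x, N (t, x)⟫ ∂μD = ∫ x, F (t, x) * φ x ∂μD := by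
  obtain ⟨Φ, hΦ, hdense⟩ := exists_dense_tests
  have hF' := hF
  have hN' := hN
  rw [cylMeasure_eq] at hF' hN'
  have key : ∀ n, ∀ᵐ t ∂μT, ∫ x, ⟪∇ (Φ n) x, N (t, x)⟫ ∂μD = ∫ x, F (t, x) * Φ n x ∂μD := by
    intro n
    let A : ℝ → ℝ := fun t => ∫ x, ⟪∇ (Φ n) x, N (t, x)⟫ ∂μD
    let B : ℝ → ℝ := fun t => ∫ x, F (t, x) * Φ n x ∂μD
    have hle : ∀ b, μC[b] ≤ (μT).prod μD := fun b =>
      Measure.prod_mono (restrict_mono Ioc_subset_Ioi_self le_rfl) le_rfl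
    have iA : ∀ b, IntegrableOn A (Ioc 0 b) := fun b =>
      integrable_slice_inner (v := fun _ => ∇ (Φ n)) (w := fun t x => N (t, x))
        (memLp_snd ((hΦ n).memLp_gradient 2)) (hN'.mono_measure (hle b))
    have iB : ∀ b, IntegrableOn B (Ioc 0 b) := fun b =>
      integrable_slice_mul (v := fun t x => F (t, x)) (w := fun _ => Φ n)
        (hF'.mono_measure (hle b)) (memLp_snd ((hΦ n).memLp 2))
    have hloc : LocallyIntegrableOn (fun t => A t - B t) (Ioi (0 : ℝ)) := by
      intro t ht
      refine ⟨Ioc 0 (t + 1), ?_, (iA _).sub (iB _)⟩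
      exact mem_nhdsWithin_of_mem_nhds (Ioc_mem_nhds ht (by linarith))
    have h0 := isOpen_Ioi.ae_eq_zero_of_integral_contDiff_smul_eq_zero (μ := volume) hloc
      fun θ hθ hθc hsub => by
        have hχ := CylTest.mul_mem hθ hθc (hΦ n)
        have hθd : Differentiable ℝ θ := hθ.differentiable (by simp)
        have h1 := h _ hχ
        have i1 := integrable_inner hN (CylTest.memLp_sgrad hχ)
        have i2 := integrable_mul_L2 hF (CylTest.memLp hχ)
        have hg : ∀ p : ℝP, ⟪N p, sgrad (fun p => θ p.1 * Φ n p.2) p⟫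
            = θ p.1 * ⟪∇ (Φ n) p.2, N p⟫ := fun p => by
          rw [real_inner_comm, inner_sgrad, fderiv_mul_time hθd (hΦ n).differentiable,
            inner_gradient]
          simp
        have hF2 : ∀ p : ℝP, F p * (θ p.1 * Φ n p.2) = θ p.1 * (F p * Φ n p.2) := fun p => by ring
        simp only [hg, hF2] at h1 i1 i2
        rw [cylMeasure_eq] at h1 i1 i2
        rw [integral_prod _ i1, integral_prod _ i2] at h1
        have j1 := i1.integral_prod_left
        have j2 := i2.integral_prod_left
        simp only [integral_const_mul] at h1 j1 j2
        have h2 : ∫ t, θ t • (A t - B t) = ∫ t in Ioi (0 : ℝ), θ t • (A t - B t) := by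
          rw [setIntegral_eq_integral_of_forall_compl_eq_zero]
          intro t ht
          rw [image_eq_zero_of_notMem_tsupport fun hh => ht (hsub hh), zero_smul]
        rw [h2]
        simp only [smul_eq_mul, mul_sub]
        rw [integral_sub j1 j2, sub_eq_zero]
        exact h1
    rw [ae_restrict_iff' measurableSet_Ioi]
    filter_upwards [h0] with t ht hpos using sub_eq_zero.1 (ht hpos)
  filter_upwards [ae_all_iff.2 key, ae_memLp_slice (v := fun t x => N (t, x)) hN',
    ae_memLp_slice (v := fun t x => F (t, x)) hF'] with t ht hNt hFt φ hφ
  obtain ⟨k, hk1, hk2⟩ := hdense φ _ hφ.memH10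
  have l1 := tendsto_integral_inner_const (fun n => (hΦ (k n)).memLp_gradient 2)
    (hφ.memLp_gradient 2) hk2 hNt
  have l2 := tendsto_integral_mul_const (fun n => (hΦ (k n)).memLp 2) (hφ.memLp 2) hk1 hFt
  simp only [ht] at l1
  exact tendsto_nhds_unique l1 l2

lemma IsFlow.unweighted_pairing (hu : IsFlow u U) {F : ℝP → ℝ}
    (hS : MemLp S 2 μC) (hDS : MemLp DS 2 μC) (hN : MemLp N 2 μC) (heq : ∀ φ ∈ CylTest,
      ∫ p, S p * (φ p - tderiv φ p - ⟪u p.1 p.2, sgrad φ p⟫) ∂μC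
          + ∫ p, ⟪DS p, sgrad φ p⟫ ∂μC = ∫ p, F p * φ p ∂μC + ∫ x, T₀ x * φ (0, x) ∂μD)
    (hNeq : ∀ φ ∈ CylTest, ∫ p, ⟪N p, sgrad φ p⟫ ∂μC = ∫ p, F p * φ p ∂μC)
    {χ : ℝP → ℝ} (hχ : χ ∈ CylTest) : ∫ p, exp p.1 * S p * tderiv χ p ∂μC
      = ∫ p, ⟪exp p.1 • DS p - (exp p.1 * S p) • u p.1 p.2
          - exp p.1 • N p, sgrad χ p⟫ ∂μC - ∫ x, T₀ x * χ (0, x) ∂μD := by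
  have hχ' := CylTest.exp_mul_mem hχ
  have h1 := heq _ hχ'
  have h2 := hNeq _ hχ'
  simp only [CylTest.sgrad_exp hχ, CylTest.tderiv_exp hχ, inner_smul_right, Real.exp_zero,
    one_mul] at h1 h2
  have hcs : HasCompactSupport (fun p => exp p.1 * tderiv χ p) :=
    (CylTest.hasCompactSupport_tderiv hχ).mono fun p hp h0 => hp (by simp only [h0, mul_zero])
  have hct : Continuous (fun p => exp p.1 * tderiv χ p) := by
    have := CylTest.continuous_tderiv hχ
    fun_prop
  have hcs2 : HasCompactSupport (fun p => exp p.1 • sgrad χ p) :=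
    (CylTest.hasCompactSupport_sgrad hχ).mono fun p hp h0 => hp (by simp only [h0, smul_zero])
  have hct2 : Continuous (fun p => exp p.1 • sgrad χ p) := by
    have := CylTest.continuous_sgrad hχ
    fun_prop
  have m1 := CylTest.memLp_cyl hct hcs
  have m2 := CylTest.memLp_cyl hct2 hcs2
  have m3 := hu.memLp_inner hχ'
  simp only [CylTest.sgrad_exp hχ, inner_smul_right] at m3
  have i1 := integrable_mul_L2 hS m1
  have i2 := integrable_mul_L2 hS m3
  have i3 := integrable_inner hDS m2
  have i4 := integrable_inner hN m2
  simp only [inner_smul_right] at i3 i4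
  have h3 : ∫ p, S p * (exp p.1 * χ p - (exp p.1 * χ p + exp p.1 * tderiv χ p)
        - exp p.1 * ⟪u p.1 p.2, sgrad χ p⟫) ∂μC = - (∫ p, S p * (exp p.1 * tderiv χ p) ∂μC)
        - ∫ p, S p * (exp p.1 * ⟪u p.1 p.2, sgrad χ p⟫) ∂μC := by
    rw [← integral_neg, ← integral_sub i1.fun_neg i2]
    exact integral_ext (fun p => by ring)
  have i32 : Integrable (fun p => exp p.1 * ⟪DS p, sgrad χ p⟫
      - S p * (exp p.1 * ⟪u p.1 p.2, sgrad χ p⟫)) μC := i3.sub i2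
  have h4 : ∫ p, ⟪exp p.1 • DS p - (exp p.1 * S p) • u p.1 p.2 - exp p.1 • N p, sgrad χ p⟫ ∂μC = (∫ p, exp p.1 * ⟪DS p, sgrad χ p⟫ ∂μC)
        - (∫ p, S p * (exp p.1 * ⟪u p.1 p.2, sgrad χ p⟫) ∂μC)
        - ∫ p, exp p.1 * ⟪N p, sgrad χ p⟫ ∂μC := by
    rw [← integral_sub i3 i2, ← integral_sub i32 i4]
    refine integral_ext fun p => ?_
    simp only [inner_sub_left, real_inner_smul_left]
    ring
  have h5 : ∫ p, exp p.1 * S p * tderiv χ p ∂μC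
      = ∫ p, S p * (exp p.1 * tderiv χ p) ∂μC := integral_ext (fun p => by ring)
  rw [h3] at h1
  rw [h4, h5]
  linarith

set_option maxHeartbeats 800000 in
/-- Existence of a weak solution for a bounded divergence-free flow. -/
theorem IsFlow.exists_temperature (hu : IsFlow u U) {f : ℝ → Plane → ℝ}
    (hf : MemLp (fun p => exp (-p.1) * f p.1 p.2) 2 μC) (hT₀ : MemLp T₀ 2 μD) :
    ∃ T DT, IsTemperature f u T₀ T DT := by
  obtain ⟨S, DS, hS, hDS, ⟨φ, hφ, hφ1, hφ2⟩, heq⟩ := hu.exists_weighted hf hT₀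
  obtain ⟨N, hN, hNeq⟩ := exists_divergence_form hf
  let T : ℝ → Plane → ℝ := fun t x => exp t * S (t, x)
  let DT : ℝ → Plane → Plane := fun t x => exp t • DS (t, x)
  let m : ℝ → Plane → Plane := fun t x => DT t x - T t x • u t x - exp t • N (t, x)
  have hexp : AEStronglyMeasurable (fun p => exp p.1) μC :=
    (Real.continuous_exp.comp continuous_fst).aestronglyMeasurable
  have jT : JointlyMeasurable T := hexp.mul hS.1
  have jDT : JointlyMeasurable DT := hexp.smul hDS.1
  have jm : JointlyMeasurable m :=
    (jDT.sub (jT.smul hu.meas.aestronglyMeasurable)).sub (hexp.smul hN.1)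
  have hU : 0 ≤ U := by
    have := (norm_nonneg _).trans (hu.bound 1 0 one_pos)
    by_contra hneg
    nlinarith [exp_pos 1]
  obtain ⟨lT, bT⟩ := memL2Loc_of_le hS jT zero_le_one zero_le_one
    (.of_forall fun p => by simp [T, abs_of_pos (exp_pos _)])
  obtain ⟨lDT, bDT⟩ := memL2Loc_of_le hDS.norm jDT zero_le_one zero_le_one
    (.of_forall fun p => by simp [DT, norm_smul, abs_of_pos (exp_pos _)])
  have hV : MemLp (fun p => ‖DS p‖ + ‖S p‖ + ‖N p‖) 2 μC := (hDS.norm.add hS.norm).add hN.norm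
  obtain ⟨lm, bm⟩ := memL2Loc_of_le (C := 1 + U) (k := 2) hV jm (by positivity) (by norm_num) (by
    filter_upwards [ae_cyl_pos] with p hp
    have h1 := hu.bound p.1 p.2 hp
    have h2 : exp (2 * p.1) = exp p.1 * exp p.1 := by rw [← Real.exp_add]; ring_nf
    have h3 : 1 ≤ exp p.1 := Real.one_le_exp hp.le
    rw [norm_of_nonneg (r := ‖DS p‖ + ‖S p‖ + ‖N p‖) (by positivity)]
    calc ‖m p.1 p.2‖ ≤ ‖DT p.1 p.2‖ + ‖T p.1 p.2 • u p.1 p.2‖ + ‖exp p.1 • N (p.1, p.2)‖ :=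
          (norm_sub_le _ _).trans (add_le_add_left (norm_sub_le _ _) _)
      _ = exp p.1 * ‖DS p‖ + exp p.1 * ‖S p‖ * ‖u p.1 p.2‖ + exp p.1 * ‖N p‖ := by
          simp [DT, T, norm_smul, abs_of_pos (exp_pos _)]
      _ ≤ exp p.1 * ‖DS p‖ + exp p.1 * ‖S p‖ * (U * exp p.1) + exp p.1 * ‖N p‖ := by gcongr
      _ ≤ (1 + U) * exp (2 * p.1) * (‖DS p‖ + ‖S p‖ + ‖N p‖) := by
          rw [h2]
          have a1 : exp p.1 ≤ (1 + U) * (exp p.1 * exp p.1) := by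
            nlinarith [mul_nonneg hU (mul_pos (exp_pos p.1) (exp_pos p.1)).le]
          have a2 : exp p.1 * (U * exp p.1) ≤ (1 + U) * (exp p.1 * exp p.1) := by
            nlinarith [(mul_pos (exp_pos p.1) (exp_pos p.1)).le]
          nlinarith [mul_le_mul_of_nonneg_right a1 (norm_nonneg (DS p)),
            mul_le_mul_of_nonneg_right a1 (norm_nonneg (N p)),
            mul_le_mul_of_nonneg_right a2 (norm_nonneg (S p))])
  have hpair : IsWeakFrom T₀ T m := fun χ hχ =>
    hu.unweighted_pairing hS hDS hN heq hNeq hχ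
  have hH10 : ∀ᵐ t ∂μT, MemH10 (T t) (DT t) :=
    (ae_memH10_of_tendsto hS hDS hφ hφ1 hφ2).mono fun t ht => ht.const_mul _
  have htime : IsTimeDeriv T m := fun χ hχ => by
    have h1 := hpair χ hχ.mem_cylTest
    simp only [hχ.eq_zero, mul_zero, integral_zero, sub_zero, real_inner_comm, inner_sgrad] at h1
    exact h1
  have hev : IsEvolution T DT m := ⟨lT, lDT, hH10, lm, htime⟩
  refine ⟨T, DT, lT, lDT, hH10, ⟨m, lm, htime, ?_⟩, hev.tendsto_initial hT₀ bT bDT bm hpair⟩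
  have hN' := hN
  rw [cylMeasure_eq] at hN'
  filter_upwards [ae_divergence_form hf hN hNeq, hH10, ae_restrict_mem measurableSet_Ioi,
    ae_memLp_slice (v := fun t x => N (t, x)) hN'] with t h1 h2 ht hNt ψ hψ
  have hsk := hu.skew ht hψ h2
  have hgψ := hψ.memLp_gradient 2
  obtain ⟨C, hC⟩ := hψ.2.1.exists_bound_of_continuous hψ.continuous
  have hTu : MemLp (fun x => T t x • u t x) 2 μD := by
    refine (h2.memLp.const_mul (U * exp t)).mono
      (f := fun x => T t x • u t x) (h2.memLp.1.smul (hu.memLp_slice ht).1) (.of_forall fun x => ?_)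
    have h3 : ‖u t x‖ ≤ ‖U * exp t‖ := (hu.bound t x ht).trans (le_abs_self _)
    have h4 := mul_le_mul_of_nonneg_right h3 (norm_nonneg (T t x))
    have h5 : ‖T t x • u t x‖ = ‖T t x‖ * ‖u t x‖ := norm_smul _ _
    have h6 : ‖U * exp t * T t x‖ = ‖U * exp t‖ * ‖T t x‖ := norm_mul _ _
    rw [h5, h6]
    linarith [mul_comm ‖T t x‖ ‖u t x‖]
  have j1 := integrable_inner hgψ h2.memLp_grad
  have j2 := integrable_inner hgψ hTu
  have j3 : Integrable (fun x => ⟪∇ ψ x, exp t • N (t, x)⟫) μD :=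
    integrable_inner hgψ (hNt.const_smul (exp t))
  have j12 : Integrable (fun x => ⟪∇ ψ x, DT t x⟫
      - ⟪∇ ψ x, T t x • u t x⟫) μD := j1.sub j2
  have e1 : ∫ x, fderiv ℝ ψ x (m t x) ∂μD = (∫ x, fderiv ℝ ψ x (DT t x) ∂μD)
      - (∫ x, ⟪∇ ψ x, T t x • u t x⟫ ∂μD) - ∫ x, f t x * ψ x ∂μD := by
    have h3 := h1 ψ hψ
    have h4 : ∫ x, f t x * ψ x ∂μD = ∫ x, ⟪∇ ψ x, exp t • N (t, x)⟫ ∂μD := by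
      simp only [inner_smul_right, integral_const_mul]
      rw [h3, ← integral_const_mul]
      refine integral_ext fun x => ?_
      rw [← mul_assoc, ← mul_assoc, ← Real.exp_add, add_neg_cancel, Real.exp_zero, one_mul]
    simp only [← inner_gradient]
    rw [h4, ← integral_sub j1 j2, ← integral_sub j12 j3]
    refine integral_ext fun x => ?_
    simp only [m, inner_sub_right, Pi.smul_apply]
  have e2 : ∫ x, ⟪u t x, DT t x⟫ * ψ x ∂μD = ∫ x, ⟪DT t x, ψ x • u t x⟫ ∂μD := by
    refine integral_ext fun x => ?_
    simp only [inner_smul_right, real_inner_comm (u t x) (DT t x)]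
    ring
  have e3 : ∫ x, ⟪∇ ψ x, T t x • u t x⟫ ∂μD = ∫ x, ⟪u t x, ∇ ψ x⟫ * T t x ∂μD := by
    refine integral_ext fun x => ?_
    simp only [inner_smul_right, real_inner_comm (u t x) (∇ ψ x)]
    ring
  rw [e1, e2, e3]
  linarith

/-! ### Integrals of smooth functions depending on a parameter -/

section Param

variable {G : Type} [NormedAddCommGroup G] [NormedSpace ℝ G] [CompleteSpace G]

lemma hasFDerivAt_param_integral {F : ℝP → G} (hF : ContDiff ℝ 1 F) (x : Plane) :
    HasFDerivAt (fun x => ∫ σ in (0 : ℝ)..1, F (σ, x))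
      (∫ σ in (0 : ℝ)..1, (fderiv ℝ F (σ, x)).comp (inr ℝ ℝ Plane)) x := by
  have hd : Continuous fun p => (fderiv ℝ F p).comp (inr ℝ ℝ Plane) :=
    (hF.continuous_fderiv (by simp)).clm_comp continuous_const
  obtain ⟨C, hC⟩ := ((isCompact_Icc (a := (0 : ℝ)) (b := 1)).prod
    (isCompact_closedBall x 1)).exists_bound_of_continuousOn hd.continuousOn
  refine (intervalIntegral.hasFDerivAt_integral_of_dominated_of_fderiv_le
    (F := fun x σ => F (σ, x)) (s := closedBall x 1)
    (F' := fun y σ => (fderiv ℝ F (σ, y)).comp (inr ℝ ℝ Plane))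
    (bound := fun _ => C) (Metric.closedBall_mem_nhds x one_pos) ?_ ?_ ?_ ?_ ?_ ?_)
  · exact .of_forall fun y => (hF.continuous.comp
      (continuous_id.prodMk continuous_const)).aestronglyMeasurable
  · exact (hF.continuous.comp (continuous_id.prodMk continuous_const)).intervalIntegrable _ _
  · exact (hd.comp (continuous_id.prodMk continuous_const)).aestronglyMeasurable
  · refine .of_forall fun σ hσ y hy => hC (σ, y) ⟨?_, hy⟩
    rw [uIoc_of_le zero_le_one] at hσ
    exact Ioc_subset_Icc_self hσ
  · exact intervalIntegrable_const
  · refine .of_forall fun σ hσ y hy => ?_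
    exact ((hF.differentiable (by simp) (σ, y)).hasFDerivAt).comp y (hasFDerivAt_prodMk_right σ y)

lemma contDiff_param_integral_nat (n : ℕ) : ∀ {G : Type} [NormedAddCommGroup G] [NormedSpace ℝ G]
    [CompleteSpace G] {F : ℝP → G}, Smooth F →
    ContDiff ℝ n fun x => ∫ σ in (0 : ℝ)..1, F (σ, x) := by
  induction n with
  | zero =>
    intro G _ _ _ F hF
    rw [Nat.cast_zero, contDiff_zero, continuous_iff_continuousAt]
    exact fun x => (hasFDerivAt_param_integral (hF.of_le (by simp)) x).continuousAt
  | succ n ih =>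
    intro G _ _ _ F hF
    have hd := hasFDerivAt_param_integral (hF.of_le (m := 1) (by simp))
    rw [show ((n + 1 : ℕ) : WithTop ℕ∞) = (n : WithTop ℕ∞) + 1 by push_cast; rfl,
      contDiff_succ_iff_fderiv]
    refine ⟨fun x => (hd x).differentiableAt, by simp, ?_⟩
    rw [show fderiv ℝ (fun x => ∫ σ in (0 : ℝ)..1, F (σ, x)) = _ from funext fun x => (hd x).fderiv]
    exact ih (F := fun p => (fderiv ℝ F p).comp (inr ℝ ℝ Plane))
      ((hF.fderiv_right (m := ∞) (by simp)).clm_comp contDiff_const)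

lemma contDiff_param_integral {F : ℝP → G} (hF : Smooth F) :
    Smooth fun x => ∫ σ in (0 : ℝ)..1, F (σ, x) :=
  contDiff_infty.2 fun n => contDiff_param_integral_nat n hF

lemma fderiv_param_integral {F : ℝP → G} (hF : ContDiff ℝ 1 F) (x v : Plane) :
    fderiv ℝ (fun x => ∫ σ in (0 : ℝ)..1, F (σ, x)) x v
      = ∫ σ in (0 : ℝ)..1, fderiv ℝ F (σ, x) (0, v) := by
  have hd : Continuous fun p => (fderiv ℝ F p).comp (inr ℝ ℝ Plane) :=
    (hF.continuous_fderiv (by simp)).clm_comp continuous_const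
  have hi : IntervalIntegrable (fun σ : ℝ => (fderiv ℝ F (σ, x)).comp (inr ℝ ℝ Plane)) volume 0 1 :=
    (hd.comp (continuous_id.prodMk continuous_const)).intervalIntegrable _ _
  rw [(hasFDerivAt_param_integral hF x).fderiv, ContinuousLinearMap.intervalIntegral_apply hi]
  simp

end Param

/-! ### The radial moment of a function -/

/-- The solution `P` of `x · ∇P + 3 P = g`. -/
def radialMoment (g : Plane → ℝ) (x : Plane) : ℝ :=
  ∫ σ in (0 : ℝ)..1, σ ^ 2 * g (σ • x)

lemma contDiff_dilate (hg : Smooth g) : Smooth fun p : ℝP => p.1 ^ 2 * g (p.1 • p.2) :=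
  (contDiff_fst.pow 2).mul (hg.comp (contDiff_fst.smul contDiff_snd))

lemma contDiff_radialMoment (hg : Smooth g) :
    Smooth (radialMoment g) := contDiff_param_integral (contDiff_dilate hg)

lemma fderiv_radialMoment (hg : Smooth g) (x : Plane) :
    fderiv ℝ (radialMoment g) x x = g x - 3 * radialMoment g x := by
  have hgd : Differentiable ℝ g := hg.differentiable (by simp)
  have hgc : Continuous (fderiv ℝ g) := hg.continuous_fderiv (by simp)
  have h1 : fderiv ℝ (radialMoment g) x x
      = ∫ σ in (0 : ℝ)..1, σ ^ 2 * (σ * fderiv ℝ g (σ • x) x) := by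
    refine (fderiv_param_integral ((contDiff_dilate hg).of_le (by simp)) x x).trans ?_
    refine integral_congr fun σ _ => ?_
    have h2 : HasFDerivAt (fun y : Plane => σ ^ 2 * g (σ • y))
        (σ ^ 2 • (fderiv ℝ g (σ • x)).comp (σ • ContinuousLinearMap.id ℝ Plane)) x :=
      (((hgd (σ • x)).hasFDerivAt).comp x ((hasFDerivAt_id x).const_smul σ)).const_mul _
    have h3 : HasFDerivAt (fun y : Plane => σ ^ 2 * g (σ • y))
        ((fderiv ℝ (fun p : ℝP => p.1 ^ 2 * g (p.1 • p.2)) (σ, x)).comp (inr ℝ ℝ Plane)) x :=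
      (((contDiff_dilate hg).differentiable (by simp) (σ, x)).hasFDerivAt).comp x
        (hasFDerivAt_prodMk_right σ x)
    have h4 := congrArg (fun L : Plane →L[ℝ] ℝ => L x) (h3.unique h2)
    simpa using h4
  have h2 : ∀ σ : ℝ, HasDerivAt (fun σ : ℝ => σ ^ 3 * g (σ • x))
      (3 * (σ ^ 2 * g (σ • x)) + σ ^ 2 * (σ * fderiv ℝ g (σ • x) x)) σ := by
    intro σ
    have h3 : HasDerivAt (fun σ : ℝ => g (σ • x)) (fderiv ℝ g (σ • x) x) σ := by
      have := (hgd (σ • x)).hasFDerivAt.comp_hasDerivAt σ ((hasDerivAt_id σ).smul_const x)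
      simpa using! this
    refine ((hasDerivAt_pow 3 σ).mul h3).congr_deriv ?_
    push_cast; ring
  have i1 : Continuous fun σ : ℝ => 3 * (σ ^ 2 * g (σ • x)) := by
    have := hg.continuous; fun_prop
  have i2 : Continuous fun σ : ℝ => σ ^ 2 * (σ * fderiv ℝ g (σ • x) x) := by
    have : Continuous fun σ : ℝ => fderiv ℝ g (σ • x) x :=
      (hgc.comp (continuous_id.smul continuous_const)).clm_apply continuous_const
    fun_prop
  have h3 := intervalIntegral.integral_eq_sub_of_hasDerivAt (a := 0) (b := 1)
    (fun σ _ => h2 σ) ((i1.add i2).intervalIntegrable _ _)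
  rw [intervalIntegral.integral_add (i1.intervalIntegrable _ _) (i2.intervalIntegrable _ _),
    intervalIntegral.integral_const_mul, ← h1] at h3
  simp only [one_pow, one_smul, one_mul, ne_eq, OfNat.ofNat_ne_zero, not_false_eq_true, zero_pow,
    zero_mul, sub_zero] at h3
  simp only [radialMoment] at h3 ⊢
  linarith

lemma bdist_smul (σ : ℝ) (x : Plane) : bdist (σ • x) = 1 - σ ^ 2 * (1 - bdist x) := by
  simp [bdist]; ring

lemma integral_radialMoment_sq_le (hg : IsTest g) (hδ : 0 < δ)
    (hδ1 : δ ≤ 1) (h0 : ∀ x, δ ≤ bdist x → g x = 0) :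
    ∫ x, radialMoment g x ^ 2 ∂μD ≤ δ ^ 2 * ∫ x, g x ^ 2 ∂μD := by
  have hgc := hg.continuous
  let ν : Measure ℝ := volume.restrict (Ioc (1 - δ) 1)
  have hν : ν univ = ofReal δ := by simp [ν]
  let k : ℝ → Plane → ℝ := fun σ x => σ ^ 2 * g (σ • x) ^ 2
  have hkc : Continuous fun p : ℝP => k p.1 p.2 := by simp only [k]; fun_prop
  obtain ⟨M, hM⟩ := hg.2.1.exists_bound_of_continuous hgc
  have hσ : ∀ᵐ σ ∂ν, σ ∈ Ioc (1 - δ) 1 := ae_restrict_mem measurableSet_Ioc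
  have hki : Integrable ♯k (ν.prod μD) := by
    refine Integrable.mono' (integrable_const (M ^ 2)) hkc.aestronglyMeasurable ?_
    filter_upwards [Measure.quasiMeasurePreserving_fst.ae hσ] with p hp
    have h1 : 0 ≤ p.1 := by linarith [hp.1]
    have h2 := hM (p.1 • p.2)
    rw [norm_eq_abs] at h2
    rw [norm_of_nonneg (by positivity)]
    have h3 : g (p.1 • p.2) ^ 2 ≤ M ^ 2 := by
      rw [← sq_abs]; exact pow_le_pow_left₀ (abs_nonneg _) h2 2
    calc p.1 ^ 2 * g (p.1 • p.2) ^ 2 ≤ 1 * M ^ 2 := by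
          refine mul_le_mul (pow_le_one₀ h1 hp.2) h3 (sq_nonneg _) zero_le_one
      _ = M ^ 2 := one_mul _
  have hpt : ∀ x ∈ disc, radialMoment g x ^ 2 ≤ δ * ∫ σ, k σ x ∂ν := by
    intro x hx
    have hb := (mem_disc_iff x).1 hx
    have hP : radialMoment g x = ∫ σ, σ ^ 2 * g (σ • x) ∂ν := by
      rw [radialMoment, integral_of_le zero_le_one]
      refine (setIntegral_eq_of_subset_of_forall_sdiff_eq_zero measurableSet_Ioc
        (Ioc_subset_Ioc_left (by linarith)) fun σ hσ => ?_)
      have h1 : σ ≤ 1 - δ := by by_contra hlt; exact hσ.2 ⟨not_le.1 hlt, hσ.1.2⟩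
      rw [h0, mul_zero]
      rw [bdist_smul]
      have h2 : σ ^ 2 ≤ 1 - δ := by nlinarith [hσ.1.1]
      nlinarith [sq_nonneg σ]
    have c1 : Continuous fun σ : ℝ => σ ^ 2 * g (σ • x) := by fun_prop
    have hc2 : MemLp (fun σ : ℝ => σ ^ 2 * g (σ • x)) 2 ν := by
      refine (memLp_two_iff_integrable_sq c1.aestronglyMeasurable).2 ?_
      exact ((c1.pow 2).integrableOn_Icc (a := 1 - δ) (b := 1)).mono_set Ioc_subset_Icc_self
    have h1 := abs_integral_mul_le (memLp_const (1 : ℝ)) hc2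
    simp only [one_mul, one_pow, integral_const, smul_eq_mul, mul_one] at h1
    have hνr : ν.real univ = δ := by rw [Measure.real, hν, toReal_ofReal hδ.le]
    rw [hνr, ← hP] at h1
    have hnn : 0 ≤ ∫ σ, (σ ^ 2 * g (σ • x)) ^ 2 ∂ν := by positivity
    have h2 : radialMoment g x ^ 2 ≤ δ * ∫ σ, (σ ^ 2 * g (σ • x)) ^ 2 ∂ν := by
      rw [← sq_abs]
      refine (pow_le_pow_left₀ (abs_nonneg _) h1 2).trans (le_of_eq ?_)
      rw [mul_pow, sq_sqrt hδ.le, sq_sqrt hnn]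
    refine h2.trans (mul_le_mul_of_nonneg_left ?_ hδ.le)
    have c2 : Continuous fun σ : ℝ => k σ x := by simp only [k]; fun_prop
    refine integral_mono_ae ?_ ?_ ?_
    · exact ((c1.pow 2).integrableOn_Icc (a := 1 - δ) (b := 1)).mono_set Ioc_subset_Icc_self
    · exact (c2.integrableOn_Icc (a := 1 - δ) (b := 1)).mono_set Ioc_subset_Icc_self
    · filter_upwards [hσ] with σ hσ
      have h3 : 0 ≤ σ := by linarith [hσ.1]
      have h4 : σ ^ 2 ≤ 1 := pow_le_one₀ h3 hσ.2
      simp only [k]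
      nlinarith [mul_nonneg (sq_nonneg σ) (sq_nonneg (g (σ • x)))]
  have hki2 := hki.integral_prod_right
  calc ∫ x, radialMoment g x ^ 2 ∂μD ≤ ∫ x, δ * ∫ σ, k σ x ∂ν ∂μD := by
        refine integral_mono_of_nonneg (.of_forall fun x => sq_nonneg _) (hki2.const_mul δ) ?_
        filter_upwards [ae_mem_disc] with x hx using hpt x hx
    _ = δ * ∫ σ, ∫ x, k σ x ∂μD ∂ν := by
        rw [integral_const_mul, ← integral_prod_symm _ hki, integral_prod _ hki]
    _ ≤ δ * ∫ _σ, (∫ x, g x ^ 2 ∂μD) ∂ν := by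
        refine mul_le_mul_of_nonneg_left ?_ hδ.le
        refine integral_mono_ae hki.integral_prod_left (integrable_const _) ?_
        filter_upwards [hσ] with σ hσ
        have h3 : 0 < σ := by linarith [hσ.1]
        have h4 : ∫ x, g x ^ 2 ∂μD = ∫ x, g x ^ 2 :=
          integral_disc_eq fun x hx => by rw [hg.eq_zero hx]; simp
        have h5 : ∫ x, g (σ • x) ^ 2 = (σ ^ 2)⁻¹ * ∫ x, g x ^ 2 := by
          have := Measure.integral_comp_smul (volume : Measure Plane) (fun x => g x ^ 2) σ
          rw [this]
          simp [abs_of_pos h3]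
        have hcs : HasCompactSupport fun x => g (σ • x) ^ 2 := by
          have h6 : HasCompactSupport fun x => g (σ • x) := hg.2.1.comp_smul h3.ne'
          exact h6.mono fun x hx h7 => hx (by simp [h7])
        have hi : Integrable (fun x => g (σ • x) ^ 2) :=
          Continuous.integrable_of_hasCompactSupport (by fun_prop) hcs
        have h6 : ∫ x, g (σ • x) ^ 2 ∂μD ≤ ∫ x, g (σ • x) ^ 2 :=
          setIntegral_le_integral hi (.of_forall fun x => sq_nonneg _)
        simp only [k]
        rw [integral_const_mul, h4]
        calc σ ^ 2 * ∫ x, g (σ • x) ^ 2 ∂μD ≤ σ ^ 2 * ((σ ^ 2)⁻¹ * ∫ x, g x ^ 2) := by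
              rw [← h5]; gcongr
          _ = ∫ x, g x ^ 2 := by field_simp
    _ = δ ^ 2 * ∫ x, g x ^ 2 ∂μD := by
        rw [integral_const, Measure.real, hν, toReal_ofReal hδ.le, smul_eq_mul]; ring

/-! ### Radial cutoffs -/

/-- A radial cutoff, vanishing for `bdist ≤ 1 / a` and equal to one for `bdist ≥ 2 / a`. -/
def cutoff (a : ℝ) (x : Plane) : ℝ := smoothTransition (a * bdist x - 1)

/-- The derivative of the smooth transition. -/
def stepDeriv (s : ℝ) : ℝ := deriv smoothTransition s

lemma contDiff_smoothTransition : Smooth smoothTransition := smoothTransition.contDiff (n := ⊤)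

lemma contDiff_stepDeriv : Smooth stepDeriv := by
  have h := contDiff_smoothTransition
  exact (contDiff_infty_iff_deriv.1 h).2

lemma stepDeriv_of_nonpos (hs : s ≤ 0) : stepDeriv s = 0 := by
  have h1 : ∀ s, s < 0 → stepDeriv s = 0 := fun s hs => by
    have : smoothTransition =ᶠ[𝓝 s] fun _ => 0 := by
      filter_upwards [Iio_mem_nhds hs] with t ht using smoothTransition.zero_of_nonpos ht.le
    rw [stepDeriv, this.deriv_eq, deriv_const]
  rcases hs.lt_or_eq with h | h
  · exact h1 s h
  · have hc := contDiff_stepDeriv.continuous.tendsto s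
    have h2 : Tendsto stepDeriv (𝓝[<] s) (𝓝 0) := by
      refine tendsto_const_nhds.congr' ?_
      filter_upwards [self_mem_nhdsWithin] with t ht using (h1 t (h ▸ ht)).symm
    exact tendsto_nhds_unique (hc.mono_left nhdsWithin_le_nhds) h2

lemma stepDeriv_of_one_le (hs : 1 ≤ s) : stepDeriv s = 0 := by
  have h1 : ∀ s, 1 < s → stepDeriv s = 0 := fun s hs => by
    have : smoothTransition =ᶠ[𝓝 s] fun _ => 1 := by
      filter_upwards [Ioi_mem_nhds hs] with t ht using smoothTransition.one_of_one_le (le_of_lt ht)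
    rw [stepDeriv, this.deriv_eq, deriv_const]
  rcases hs.lt_or_eq with h | h
  · exact h1 s h
  · have hc := contDiff_stepDeriv.continuous.tendsto s
    have h2 : Tendsto stepDeriv (𝓝[>] s) (𝓝 0) := by
      refine tendsto_const_nhds.congr' ?_
      filter_upwards [self_mem_nhdsWithin] with t ht using (h1 t (h ▸ ht)).symm
    exact tendsto_nhds_unique (hc.mono_left nhdsWithin_le_nhds) h2

lemma exists_stepDeriv_bound : ∃ M, 0 < M ∧ ∀ s, |stepDeriv s| ≤ M := by
  obtain ⟨M, hM⟩ := (isCompact_Icc (a := (0 : ℝ)) (b := 1)).exists_bound_of_continuousOn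
    contDiff_stepDeriv.continuous.continuousOn
  refine ⟨max M 1, by positivity, fun s => ?_⟩
  by_cases h : s ∈ Icc (0 : ℝ) 1
  · exact (hM s h).trans (le_max_left _ _)
  · have : stepDeriv s = 0 := by
      rw [mem_Icc, not_and_or, not_le, not_le] at h
      rcases h with h | h
      · exact stepDeriv_of_nonpos h.le
      · exact stepDeriv_of_one_le h.le
    rw [this, abs_zero]; positivity

lemma contDiff_cutoff (a : ℝ) : Smooth (cutoff a) :=
  contDiff_smoothTransition.comp ((contDiff_const.mul contDiff_bdist).sub contDiff_const)

lemma isTest_of_eq_zero (h : Smooth φ) (hr : 0 < r)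
    (h0 : ∀ x, bdist x < r → φ x = 0) : IsTest φ := by
  have hcl : IsClosed {x : Plane | r ≤ bdist x} :=
    isClosed_le continuous_const (contDiff_bdist (n := 0)).continuous
  have hsub : tsupport φ ⊆ {x : Plane | r ≤ bdist x} :=
    closure_minimal (fun x hx => not_lt.1 fun hlt => hx (h0 x hlt)) hcl
  have hd : tsupport φ ⊆ disc := fun x hx => (mem_disc_iff x).2 (hr.trans_le (hsub hx))
  refine ⟨h, ?_, hd⟩
  exact (isCompact_closedBall (0 : Plane) 1).of_isClosed_subset (isClosed_tsupport _)
    (hd.trans Metric.ball_subset_closedBall)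

lemma cutoff_eq_zero (ha : 0 < a) (hx : bdist x < 1 / a) : cutoff a x = 0 := by
  refine smoothTransition.zero_of_nonpos ?_
  rw [lt_div_iff₀ ha] at hx
  linarith

lemma cutoff_eq_one (ha : 0 < a) (hx : 2 / a ≤ bdist x) : cutoff a x = 1 := by
  refine smoothTransition.one_of_one_le ?_
  rw [div_le_iff₀ ha] at hx
  linarith

lemma isTest_cutoff (ha : 0 < a) : IsTest (cutoff a) :=
  isTest_of_eq_zero (contDiff_cutoff a) (one_div_pos.2 ha) fun _ hx => cutoff_eq_zero ha hx

lemma pd_cutoff (a : ℝ) (i : Fin 2) (x : Plane) :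
    pd i (cutoff a) x = -2 * a * stepDeriv (a * bdist x - 1) * x i := by
  have hb : Differentiable ℝ bdist := (contDiff_bdist (n := 1)).differentiable (by simp)
  have hS : Differentiable ℝ smoothTransition := contDiff_smoothTransition.differentiable (by simp)
  have h1 : pd i (fun y => a * bdist y - 1) x = -2 * a * x i := by
    rw [pd_sub i ((hb x).const_mul a) (by fun_prop), pd_const_mul a i (hb x), pd_const, pd_bdist]
    ring
  have h2 := pd_comp i (φ := smoothTransition) (g := fun y => a * bdist y - 1) (x := x)
    (hS _) (((hb x).const_mul a).sub (by fun_prop))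
  change pd i (fun y => smoothTransition (a * bdist y - 1)) x = _
  rw [h2, h1, stepDeriv]
  ring

/-! ### Vector fields in `H¹` without penetration -/

lemma integrable_continuous_mul {c : Plane → ℝ} (hc : Continuous c)
    (hv : MemLp v 2 μD) : Integrable (fun x => c x * v x) μD := by
  have hv1 : Integrable v μD := hv.integrable (by norm_num)
  obtain ⟨C, hC⟩ := (isCompact_closedBall (0 : Plane) 1).exists_bound_of_continuousOn
    hc.continuousOn
  refine Integrable.bdd_mul (c := C) hv1 hc.aestronglyMeasurable ?_
  filter_upwards [ae_mem_disc] with x hx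
  exact hC x (Metric.ball_subset_closedBall hx)

lemma memLp_continuous_mul {c : Plane → ℝ} (hc : Continuous c)
    (hv : MemLp v 2 μD) : MemLp (fun x => c x * v x) 2 μD := by
  obtain ⟨C, hC⟩ := (isCompact_closedBall (0 : Plane) 1).exists_bound_of_continuousOn
    hc.continuousOn
  refine memLp_bdd_mul hv hc.aestronglyMeasurable C ?_
  filter_upwards [ae_mem_disc] with x hx
  exact hC x (Metric.ball_subset_closedBall hx)

/-- The derivative in the direction of `x^⊥ = (-x₁, x₀)`. -/
def rotDeriv (q : Plane → ℝ) (x : Plane) : ℝ := - x 1 * pd 0 q x + x 0 * pd 1 q x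

/-- `x^⊥ · A x^⊥`. -/
def rotForm (A : Plane → Fin 2 → Plane) (x : Plane) : ℝ :=
  x 1 ^ 2 * A x 0 0 - x 0 * x 1 * A x 0 1 - x 0 * x 1 * A x 1 0 + x 0 ^ 2 * A x 1 1

section

variable {w : Plane → Plane} {A : Plane → Fin 2 → Plane}

lemma memLp_apply {g : Plane → Plane} (hg : MemLp g 2 μD) (i : Fin 2) :
    MemLp (fun x => g x i) 2 μD :=
  hg.mono (((contDiff_coord i (n := 0)).continuous).comp_aestronglyMeasurable hg.1)
    (.of_forall fun x => PiLp.norm_apply_le (g x) i)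

lemma MemH1Vec.memLp (h : MemH1Vec w A) : MemLp w 2 μD := by
  have h0 := (h 0).memLp
  have h1 := (h 1).memLp
  have hm : AEStronglyMeasurable w μD := by
    have : w = fun x => w x 0 • single (0 : Fin 2) (1 : ℝ)
        + w x 1 • single 1 1 := funext fun x => plane_eq_sum (w x)
    rw [this]
    exact (h0.1.smul_const _).add (h1.1.smul_const _)
  refine (h0.norm.add h1.norm).mono hm (.of_forall fun x => ?_)
  simp only [Pi.add_apply]
  rw [norm_of_nonneg (by positivity)]
  refine abs_le_of_sq_le_sq' ?_ (by positivity) |>.2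
  rw [norm_sq_plane, norm_eq_abs, norm_eq_abs]
  nlinarith [sq_abs (w x 0), sq_abs (w x 1), mul_nonneg (abs_nonneg (w x 0)) (abs_nonneg (w x 1))]

lemma MemH1Vec.rot_test (h : MemH1Vec w A) {q : Plane → ℝ} (hq : IsTest q) :
    ∫ x, ((- x 1 * w x 0 + x 0 * w x 1) * rotDeriv q x + q x * rotForm A x
      - q x * (w x 0 * x 0 + w x 1 * x 1)) ∂μD = 0 := by
  have ca : ∀ i, Continuous fun x : Plane => x i := fun i => (contDiff_coord i (n := 0)).continuous
  have key : ∀ (i j : Fin 2) (p : Plane → ℝ), Smooth p →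
      ∫ x, ((p x * pd j q x + pd j p x * q x) * w x i + p x * q x * A x i j) ∂μD = 0 ∧
      Integrable (fun x => (p x * pd j q x + pd j p x * q x) * w x i + p x * q x * A x i j)
        μD := by
    intro i j p hp
    have h1 := (h i).weak_grad _ (hq.mul_left hp) j
    have h2 : ∀ x, fderiv ℝ (fun x => p x * q x) x (single j 1)
        = p x * pd j q x + pd j p x * q x := fun x => by
      change pd j (fun x => p x * q x) x = _
      rw [pd_mul j (hp.differentiable (by simp) x) (hq.differentiable x)]; ring
    simp only [h2] at h1
    have i1 : Integrable (fun x => (p x * pd j q x + pd j p x * q x) * w x i) μD :=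
      integrable_continuous_mul ((hp.continuous.mul (hq.pd j).continuous).add
        ((contDiff_pd j hp).continuous.mul hq.continuous)) (h i).memLp
    have i2 : Integrable (fun x => p x * q x * A x i j) μD :=
      integrable_continuous_mul (hp.continuous.mul hq.continuous) (memLp_apply (h i).memLp_grad j)
    refine ⟨?_, i1.add i2⟩
    rw [integral_add i1 i2]
    have h3 : ∫ x, (p x * pd j q x + pd j p x * q x) * w x i ∂μD
        = ∫ x, w x i * (p x * pd j q x + pd j p x * q x) ∂μD :=
      integral_ext (fun x => mul_comm _ _)
    have h4 : ∫ x, p x * q x * A x i j ∂μD = ∫ x, A x i j * (p x * q x) ∂μD :=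
      integral_ext (fun x => mul_comm _ _)
    rw [h3, h4, h1]; ring
  have dc : ∀ (i : Fin 2) (x : Plane), DifferentiableAt ℝ (fun x => x i) x :=
    fun i x => (contDiff_coord i (n := 1)).differentiable (by simp) x
  have e11 : ∀ i x, pd i (fun x => x 1 * x 1) x = if i = 1 then 2 * x 1 else 0 := by
    intro i x; rw [pd_mul i (dc 1 x) (dc 1 x), pd_coord]; fin_cases i <;> simp; ring
  have e00 : ∀ i x, pd i (fun x => x 0 * x 0) x = if i = 0 then 2 * x 0 else 0 := by
    intro i x; rw [pd_mul i (dc 0 x) (dc 0 x), pd_coord]; fin_cases i <;> simp; ring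
  have e01 : ∀ i x, pd i (fun x => -1 * (x 0 * x 1)) x
      = if i = 0 then - x 1 else - x 0 := by
    intro i x
    rw [pd_const_mul (-1) i ((dc 0 x).fun_mul (dc 1 x)), pd_mul i (dc 0 x) (dc 1 x), pd_coord, pd_coord]
    fin_cases i <;> simp
  obtain ⟨k1, j1⟩ := key 0 0 (fun x => x 1 * x 1) (by fun_prop)
  obtain ⟨k2, j2⟩ := key 0 1 (fun x => -1 * (x 0 * x 1)) (by fun_prop)
  obtain ⟨k3, j3⟩ := key 1 0 (fun x => -1 * (x 0 * x 1)) (by fun_prop)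
  obtain ⟨k4, j4⟩ := key 1 1 (fun x => x 0 * x 0) (by fun_prop)
  simp only [e00, e01, e11] at k1 k2 k3 k4 j1 j2 j3 j4
  have h12 := integral_add j1 j2
  have h34 := integral_add j3 j4
  have h1234 := integral_add (j1.add j2) (j3.add j4)
  simp only [Pi.add_apply] at h1234
  rw [h12, h34, k1, k2, k3, k4] at h1234
  simp only [add_zero] at h1234
  rw [← h1234]
  refine integral_ext fun x => ?_
  simp only [rotDeriv, rotForm]
  simp
  ring

lemma MemH1Vec.rot_smooth (h : MemH1Vec w A) {q : Plane → ℝ} (hq : Smooth q) :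
    Integrable (fun x => (- x 1 * w x 0 + x 0 * w x 1) * rotDeriv q x + q x * rotForm A x
      - q x * (w x 0 * x 0 + w x 1 * x 1)) μD ∧
    ∫ x, ((- x 1 * w x 0 + x 0 * w x 1) * rotDeriv q x + q x * rotForm A x
      - q x * (w x 0 * x 0 + w x 1 * x 1)) ∂μD = 0 := by
  have ca : ∀ i, Continuous fun x : Plane => x i := fun i => (contDiff_coord i (n := 0)).continuous
  have c0 := ca 0
  have c1 := ca 1
  have cq := hq.continuous
  have cp : ∀ i, Continuous (pd i q) := fun i => (contDiff_pd i hq).continuous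
  have cp0 := cp 0
  have cp1 := cp 1
  have hA : ∀ i j, MemLp (fun x => A x i j) 2 μD := fun i j => memLp_apply (h i).memLp_grad j
  have hint : Integrable (fun x => (- x 1 * w x 0 + x 0 * w x 1) * rotDeriv q x + q x * rotForm A x
      - q x * (w x 0 * x 0 + w x 1 * x 1)) μD := by
    have t0 : Integrable (fun x => (- x 1 * (- x 1 * pd 0 q x + x 0 * pd 1 q x) - q x * x 0) * w x 0)
        μD := integrable_continuous_mul (by fun_prop) (h 0).memLp
    have t1 : Integrable (fun x => (x 0 * (- x 1 * pd 0 q x + x 0 * pd 1 q x) - q x * x 1) * w x 1)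
        μD := integrable_continuous_mul (by fun_prop) (h 1).memLp
    have t2 : Integrable (fun x => (q x * x 1 ^ 2) * A x 0 0) μD :=
      integrable_continuous_mul (by fun_prop) (hA 0 0)
    have t3 : Integrable (fun x => (- q x * (x 0 * x 1)) * A x 0 1) μD :=
      integrable_continuous_mul (by fun_prop) (hA 0 1)
    have t4 : Integrable (fun x => (- q x * (x 0 * x 1)) * A x 1 0) μD :=
      integrable_continuous_mul (by fun_prop) (hA 1 0)
    have t5 : Integrable (fun x => (q x * x 0 ^ 2) * A x 1 1) μD :=
      integrable_continuous_mul (by fun_prop) (hA 1 1)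
    refine (((((t0.add t1).add t2).add t3).add t4).add t5).congr (.of_forall fun x => ?_)
    simp only [Pi.add_apply, rotDeriv, rotForm]
    ring
  refine ⟨hint, ?_⟩
  set H : Plane → ℝ := fun x => (- x 1 * w x 0 + x 0 * w x 1) * rotDeriv q x + q x * rotForm A x
      - q x * (w x 0 * x 0 + w x 1 * x 1) with hH
  have hz : ∀ n : ℕ, ∫ x, cutoff (n + 1) x * H x ∂μD = 0 := by
    intro n
    have ha : (0 : ℝ) < n + 1 := by positivity
    have ht : IsTest fun x => q x * cutoff (n + 1) x := (isTest_cutoff ha).mul_left hq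
    rw [← h.rot_test ht]
    refine integral_ext fun x => ?_
    have hr : rotDeriv (fun x => q x * cutoff (n + 1) x) x = cutoff (n + 1) x * rotDeriv q x := by
      have d1 := hq.differentiable (by simp) x
      have d2 := (contDiff_cutoff (n + 1)).differentiable (by simp) x
      simp only [rotDeriv]
      rw [pd_mul 0 d1 d2, pd_mul 1 d1 d2, pd_cutoff, pd_cutoff]
      ring
    simp only [hH]
    rw [hr]
    ring
  have hlim : Tendsto (fun n : ℕ => ∫ x, cutoff (n + 1) x * H x ∂μD) atTop (𝓝 (∫ x, H x ∂μD)) := by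
    refine tendsto_integral_of_dominated_convergence (fun x => ‖H x‖)
      (fun n => ((contDiff_cutoff _).continuous.aestronglyMeasurable.mul hint.1)) hint.norm ?_ ?_
    · refine fun n => .of_forall fun x => ?_
      rw [norm_mul, norm_eq_abs, cutoff, abs_of_nonneg (smoothTransition.nonneg _)]
      exact mul_le_of_le_one_left (norm_nonneg _) (smoothTransition.le_one _)
    · filter_upwards [ae_mem_disc] with x hx
      have hb := (mem_disc_iff x).1 hx
      refine tendsto_const_nhds.congr' ?_
      obtain ⟨N, hN⟩ := exists_nat_gt (2 / bdist x)
      filter_upwards [eventually_ge_atTop N] with n hn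
      rw [cutoff_eq_one (by positivity), one_mul]
      have h1 : (N : ℝ) ≤ n := by exact_mod_cast hn
      rw [div_le_iff₀ (by positivity)]
      rw [div_lt_iff₀ hb] at hN
      nlinarith
  exact tendsto_nhds_unique hlim (by simp only [hz]; exact tendsto_const_nhds)

/-- `w` is divergence-free and tangential at the boundary. -/
def IsTangential (w : Plane → Plane) : Prop :=
  ∀ φ : Plane → ℝ, Smooth φ → ∫ x, fderiv ℝ φ x (w x) ∂μD = 0

lemma MemH1Vec.integral_radial (h : MemH1Vec w A) (hno : IsTangential w) (hg : IsTest g) :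
    ∫ x, (w x 0 * x 0 + w x 1 * x 1) * g x ∂μD = ∫ x, radialMoment g x * rotForm A x ∂μD := by
  set P := radialMoment g with hP
  have hPs : Smooth P := contDiff_radialMoment hg.1
  obtain ⟨i1, e1⟩ := h.rot_smooth hPs
  have hΦ : Smooth fun x => (x 0 * x 0 + x 1 * x 1) * P x := by fun_prop
  have e2 := hno _ hΦ
  have dc : ∀ (i : Fin 2) (x : Plane), DifferentiableAt ℝ (fun x => x i) x :=
    fun i x => (contDiff_coord i (n := 1)).differentiable (by simp) x
  have hpd : ∀ i x, pd i (fun x => (x 0 * x 0 + x 1 * x 1) * P x) x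
      = 2 * x i * P x + (x 0 * x 0 + x 1 * x 1) * pd i P x := by
    intro i x
    rw [pd_mul i (((dc 0 x).fun_mul (dc 0 x)).fun_add ((dc 1 x).fun_mul (dc 1 x)))
      (hPs.differentiable (by simp) x), pd_add i ((dc 0 x).fun_mul (dc 0 x)) ((dc 1 x).fun_mul (dc 1 x)),
      pd_mul i (dc 0 x) (dc 0 x), pd_mul i (dc 1 x) (dc 1 x), pd_coord, pd_coord]
    have hi : i = 0 ∨ i = 1 := by fin_cases i <;> simp
    rcases hi with rfl | rfl <;> simp only [reduceIte, zero_ne_one, one_ne_zero] <;> ring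
  have hE : ∀ x : Plane, x 0 * pd 0 P x + x 1 * pd 1 P x = g x - 3 * P x := fun x => by
    rw [← fderiv_radialMoment hg.1 x, fderiv_apply_eq]; ring
  have i2 : Integrable (fun x => fderiv ℝ (fun x => (x 0 * x 0 + x 1 * x 1) * P x) x (w x))
      μD := by
    have c0 : Continuous (pd 0 (fun x => (x 0 * x 0 + x 1 * x 1) * P x)) :=
      (contDiff_pd 0 hΦ).continuous
    have c1 : Continuous (pd 1 (fun x => (x 0 * x 0 + x 1 * x 1) * P x)) :=
      (contDiff_pd 1 hΦ).continuous
    refine ((integrable_continuous_mul c0 (h 0).memLp).add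
      (integrable_continuous_mul c1 (h 1).memLp)).congr (.of_forall fun x => ?_)
    simp only [Pi.add_apply]
    rw [fderiv_apply_eq]
  have i3 : Integrable (fun x => P x * rotForm A x) μD := by
    have hA : ∀ i j, MemLp (fun x => A x i j) 2 μD := fun i j => memLp_apply (h i).memLp_grad j
    have cP := hPs.continuous
    have t2 : Integrable (fun x => (P x * x 1 ^ 2) * A x 0 0) μD :=
      integrable_continuous_mul (by fun_prop) (hA 0 0)
    have t3 : Integrable (fun x => (- P x * (x 0 * x 1)) * A x 0 1) μD :=
      integrable_continuous_mul (by fun_prop) (hA 0 1)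
    have t4 : Integrable (fun x => (- P x * (x 0 * x 1)) * A x 1 0) μD :=
      integrable_continuous_mul (by fun_prop) (hA 1 0)
    have t5 : Integrable (fun x => (P x * x 0 ^ 2) * A x 1 1) μD :=
      integrable_continuous_mul (by fun_prop) (hA 1 1)
    refine (((t2.add t3).add t4).add t5).congr (.of_forall fun x => ?_)
    simp only [Pi.add_apply, rotForm]
    ring
  have i12 := i2.sub i1
  have h3 := integral_add i12 i3
  have h4 := integral_sub i2 i1
  simp only [Pi.sub_apply] at h3
  rw [h4, e2, e1, sub_zero, zero_add] at h3
  rw [← h3]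
  refine integral_ext fun x => ?_
  rw [fderiv_apply_eq, hpd, hpd, rotDeriv]
  have hEx := hE x
  linear_combination (- (w x 0 * x 0 + w x 1 * x 1)) * hEx

end

lemma volume_disc : volume disc = ofReal π := by rw [disc, volume_ball_fin_two]; simp

lemma volume_real_disc : volume.real disc = π := by
  rw [Measure.real, volume_disc, toReal_ofReal pi_pos.le]

lemma measureReal_layer_le (hδ : 0 < δ) (hδ1 : δ ≤ 1) :
    discMeasure.real {x | bdist x < δ} ≤ π * δ := by
  have hsub : {x | bdist x < δ} ∩ disc ⊆ disc \ ball (0 : Plane) √(1 - δ) := by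
    rintro x ⟨hx, hxd⟩
    refine ⟨hxd, fun hb => ?_⟩
    rw [mem_ball_zero_iff] at hb
    have h1 := norm_sq_plane x
    have h2 : ‖x‖ ^ 2 < 1 - δ := by
      rw [← sq_sqrt (by linarith : (0 : ℝ) ≤ 1 - δ)]
      exact pow_lt_pow_left₀ hb (norm_nonneg _) (by norm_num)
    have hx' : bdist x < δ := hx
    simp only [bdist] at hx'
    linarith
  have hms : MeasurableSet {x : Plane | bdist x < δ} :=
    (isOpen_lt (contDiff_bdist (n := 0)).continuous continuous_const).measurableSet
  have hbs : ball (0 : Plane) √(1 - δ) ⊆ disc :=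
    Metric.ball_subset_ball (Real.sqrt_le_one.2 (by linarith))
  have hb : volume.real (ball (0 : Plane) √(1 - δ)) = π * (1 - δ) := by
    rw [Measure.real, volume_ball_fin_two, ENNReal.toReal_mul, ENNReal.toReal_pow,
      toReal_ofReal (sqrt_nonneg _), sq_sqrt (by linarith)]
    rw [toReal_ofReal pi_pos.le, mul_comm]
  have hfin : volume disc ≠ ⊤ := by rw [volume_disc]; simp
  rw [discMeasure, measureReal_restrict_apply hms]
  refine (measureReal_mono hsub (ne_top_of_le_ne_top hfin (measure_mono sdiff_subset))).trans ?_
  rw [measureReal_sdiff hbs Metric.isOpen_ball.measurableSet hfin, volume_real_disc, hb]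
  linarith

lemma cutoff_mem (a : ℝ) (x : Plane) : 0 ≤ cutoff a x ∧ cutoff a x ≤ 1 :=
  ⟨smoothTransition.nonneg _, smoothTransition.le_one _⟩

lemma integral_sq_le_of_layer (hδ : 0 < δ) (hδ1 : δ ≤ 1)
    (hC : ∀ x ∈ disc, bdist x < δ → k x ^ 2 ≤ C) (h0 : ∀ x ∈ disc, δ ≤ bdist x → k x = 0)
    (hC0 : 0 ≤ C) : ∫ x, k x ^ 2 ∂μD ≤ C * (π * δ) := by
  have hms : MeasurableSet {x : Plane | bdist x < δ} :=
    (isOpen_lt (contDiff_bdist (n := 0)).continuous continuous_const).measurableSet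
  calc ∫ x, k x ^ 2 ∂μD ≤ ∫ x, {x : Plane | bdist x < δ}.indicator (fun _ => C) x ∂μD := by
        refine integral_mono_of_nonneg (.of_forall fun x => sq_nonneg _)
          ((integrable_const C).indicator hms) ?_
        filter_upwards [ae_mem_disc] with x hx
        by_cases h : bdist x < δ
        · rw [indicator_of_mem (show x ∈ {x : Plane | bdist x < δ} from h)]; exact hC x hx h
        · rw [indicator_of_notMem (show x ∉ {x : Plane | bdist x < δ} from h), h0 x hx (not_lt.1 h)]; simp
    _ = C * discMeasure.real {x | bdist x < δ} := by
        rw [integral_indicator_const _ hms, smul_eq_mul, mul_comm]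
    _ ≤ C * (π * δ) := mul_le_mul_of_nonneg_left (measureReal_layer_le hδ hδ1) hC0

lemma integral_one_sub_cutoff_le (ha : 2 ≤ a) : ∫ x, (1 - cutoff a x) ^ 2 ∂μD ≤ π * (2 / a) := by
  have ha0 : 0 < a := by linarith
  have := integral_sq_le_of_layer (k := fun x => 1 - cutoff a x) (δ := 2 / a) (C := 1)
    (by positivity) ((div_le_one ha0).2 ha) (fun x _ _ => by
      have := cutoff_mem a x; nlinarith) (fun x _ hx => by
      rw [cutoff_eq_one ha0 hx, sub_self]) zero_le_one
  simpa using this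

lemma norm_gradient_cutoff_sq (a : ℝ) (x : Plane) : ‖∇ (cutoff a) x‖ ^ 2
      = (2 * a * stepDeriv (a * bdist x - 1)) ^ 2 * (x 0 ^ 2 + x 1 ^ 2) := by
  rw [norm_sq_plane, gradient_apply, gradient_apply, pd_cutoff, pd_cutoff]; ring

lemma sq_add_sq_lt_one (hx : x ∈ disc) : x 0 ^ 2 + x 1 ^ 2 < 1 := by
  have := (mem_disc_iff x).1 hx; simp only [bdist] at this; linarith

lemma stepDeriv_layer (ha : 0 < a) (hx : 2 / a ≤ bdist x) : stepDeriv (a * bdist x - 1) = 0 := by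
  refine stepDeriv_of_one_le ?_
  rw [div_le_iff₀ ha] at hx
  linarith

lemma integral_gradient_cutoff_le {M : ℝ} (hM : ∀ s, |stepDeriv s| ≤ M) (ha : 2 ≤ a) :
    ∫ x, ‖∇ (cutoff a) x‖ ^ 2 ∂μD ≤ 8 * π * M ^ 2 * a := by
  have ha0 : 0 < a := by linarith
  have hM0 : 0 ≤ M := (abs_nonneg _).trans (hM 0)
  have hM2 : ∀ s, stepDeriv s ^ 2 ≤ M ^ 2 := fun s => by
    rw [← sq_abs]; exact pow_le_pow_left₀ (abs_nonneg _) (hM s) 2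
  refine (integral_sq_le_of_layer (k := fun x => ‖∇ (cutoff a) x‖) (δ := 2 / a)
    (C := 4 * a ^ 2 * M ^ 2) (by positivity) ((div_le_one ha0).2 ha) (fun x hx _ => ?_)
    (fun x _ hx => ?_) (by positivity)).trans (le_of_eq ?_)
  · rw [norm_gradient_cutoff_sq]
    have h1 := sq_add_sq_lt_one hx
    have h2 := hM2 (a * bdist x - 1)
    calc _ ≤ (2 * a * stepDeriv (a * bdist x - 1)) ^ 2 * 1 := by gcongr
      _ = 4 * a ^ 2 * stepDeriv (a * bdist x - 1) ^ 2 := by ring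
      _ ≤ _ := by gcongr
  · have h1 := norm_gradient_cutoff_sq a x
    rw [stepDeriv_layer ha0 hx] at h1
    have h2 : ‖∇ (cutoff a) x‖ ^ 2 = 0 := by rw [h1]; ring
    exact pow_eq_zero_iff (by norm_num) |>.1 h2
  · field_simp; ring

section

variable {w : Plane → Plane} {A : Plane → Fin 2 → Plane}

lemma memLp_rotForm (h : MemH1Vec w A) : MemLp (rotForm A) 2 μD := by
  have hA : ∀ i j, MemLp (fun x => A x i j) 2 μD := fun i j => memLp_apply (h i).memLp_grad j
  have c : ∀ i, Continuous fun x : Plane => x i := fun i => (contDiff_coord i (n := 0)).continuous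
  have c0 := c 0
  have c1 := c 1
  exact (((memLp_continuous_mul (c := fun x => x 1 ^ 2) (by fun_prop) (hA 0 0)).sub
    (memLp_continuous_mul (c := fun x => x 0 * x 1) (by fun_prop) (hA 0 1))).sub
    (memLp_continuous_mul (c := fun x => x 0 * x 1) (by fun_prop) (hA 1 0))).add
    (memLp_continuous_mul (c := fun x => x 0 ^ 2) (by fun_prop) (hA 1 1))

lemma integral_rotForm_sq_le (h : MemH1Vec w A) : ∫ x, rotForm A x ^ 2 ∂μD
      ≤ ∫ x, ‖A x 0‖ ^ 2 ∂μD + ∫ x, ‖A x 1‖ ^ 2 ∂μD := by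
  have i0 := integrable_normSq (h 0).memLp_grad
  have i1 := integrable_normSq (h 1).memLp_grad
  rw [← integral_add i0 i1]
  refine integral_mono_ae (by simpa using! integrable_normSq (memLp_rotForm h))
    (i0.add i1) ?_
  filter_upwards [ae_mem_disc] with x hx
  have h1 := sq_add_sq_lt_one hx
  simp only [norm_sq_plane, Pi.add_apply]
  have key : rotForm A x ^ 2 = (x 0 ^ 2 + x 1 ^ 2) ^ 2
        * (A x 0 0 ^ 2 + A x 0 1 ^ 2 + (A x 1 0 ^ 2 + A x 1 1 ^ 2))
      - ((x 1 ^ 2 * A x 0 1 + x 0 * x 1 * A x 0 0) ^ 2 + (x 1 ^ 2 * A x 1 0 + x 0 * x 1 * A x 0 0) ^ 2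
        + (x 1 ^ 2 * A x 1 1 - x 0 ^ 2 * A x 0 0) ^ 2
        + (x 0 * x 1 * A x 1 0 - x 0 * x 1 * A x 0 1) ^ 2
        + (x 0 * x 1 * A x 1 1 + x 0 ^ 2 * A x 0 1) ^ 2
        + (x 0 * x 1 * A x 1 1 + x 0 ^ 2 * A x 1 0) ^ 2) := by simp only [rotForm]; ring
  have h2 : (x 0 ^ 2 + x 1 ^ 2) ^ 2 ≤ 1 := by
    have : 0 ≤ x 0 ^ 2 + x 1 ^ 2 := by positivity
    nlinarith
  have h3 : 0 ≤ A x 0 0 ^ 2 + A x 0 1 ^ 2 + (A x 1 0 ^ 2 + A x 1 1 ^ 2) := by positivity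
  rw [key]
  have h4 := mul_le_mul_of_nonneg_right h2 h3
  have h5 : ∀ a b c d e f : ℝ, 0 ≤ a ^ 2 + b ^ 2 + c ^ 2 + d ^ 2 + e ^ 2 + f ^ 2 := fun _ _ _ _ _ _ =>
    by positivity
  linarith [h5 (x 1 ^ 2 * A x 0 1 + x 0 * x 1 * A x 0 0) (x 1 ^ 2 * A x 1 0 + x 0 * x 1 * A x 0 0)
    (x 1 ^ 2 * A x 1 1 - x 0 ^ 2 * A x 0 0) (x 0 * x 1 * A x 1 0 - x 0 * x 1 * A x 0 1)
    (x 0 * x 1 * A x 1 1 + x 0 ^ 2 * A x 0 1) (x 0 * x 1 * A x 1 1 + x 0 ^ 2 * A x 1 0)]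

lemma memLp_fderiv_apply (h : MemH1Vec w A) (hξ : Smooth ξ) :
    MemLp (fun x => fderiv ℝ ξ x (w x)) 2 μD := by
  have := (memLp_continuous_mul (contDiff_pd 0 hξ).continuous (h 0).memLp).add
    (memLp_continuous_mul (contDiff_pd 1 hξ).continuous (h 1).memLp)
  refine this.congr_norm ?_ (.of_forall fun x => ?_)
  · refine this.1.congr (.of_forall fun x => ?_)
    simp only [Pi.add_apply]; rw [fderiv_apply_eq]
  · simp only [Pi.add_apply]; rw [fderiv_apply_eq]

lemma MemH1Vec.abs_flux_le (h : MemH1Vec w A) (hno : IsTangential w)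
    {M : ℝ} (hM : ∀ s, |stepDeriv s| ≤ M) (ha : 2 ≤ a) {g : Plane → Plane} (hv : MemH10 v g) :
    |∫ x, fderiv ℝ (cutoff a) x (w x) * v x ∂μD|
      ≤ 8 * M / a * √(∫ x, ‖A x 0‖ ^ 2 ∂μD + ∫ x, ‖A x 1‖ ^ 2 ∂μD) * √(∫ x, ‖g x‖ ^ 2 ∂μD) := by
  have ha0 : 0 < a := by linarith
  have hM0 : 0 ≤ M := (abs_nonneg _).trans (hM 0)
  set N := √(∫ x, ‖A x 0‖ ^ 2 ∂μD + ∫ x, ‖A x 1‖ ^ 2 ∂μD) with hN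
  have key := hv.abs_integral_le (Z := fun _ => 0) (memLp_fderiv_apply h (contDiff_cutoff a))
    MemLp.zero' (C := 8 * M / a * N) fun φ hφ => by
      simp only [inner_zero_right, integral_zero, add_zero]
      let κ : Plane → ℝ := fun x => -2 * a * stepDeriv (a * bdist x - 1)
      have hκ : Smooth κ := contDiff_const.mul (contDiff_stepDeriv.comp
        ((contDiff_const.mul contDiff_bdist).sub contDiff_const))
      have hg := hφ.mul_left hκ
      have e1 : ∫ x, fderiv ℝ (cutoff a) x (w x) * φ x ∂μD
          = ∫ x, (w x 0 * x 0 + w x 1 * x 1) * (κ x * φ x) ∂μD := by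
        refine integral_ext fun x => ?_
        simp only [fderiv_apply_eq, pd_cutoff, κ]; ring
      rw [e1, h.integral_radial hno hg]
      have hPm : MemLp (radialMoment fun x => κ x * φ x) 2 μD := by
        have := memLp_continuous_mul (contDiff_radialMoment hg.1).continuous
          (memLp_const (1 : ℝ) (μ := μD) (p := 2))
        simpa using this
      refine (abs_integral_mul_le hPm (memLp_rotForm h)).trans ?_
      have h1 := integral_radialMoment_sq_le hg (δ := 2 / a) (by positivity)
        ((div_le_one ha0).2 ha) fun x hx => by simp only [κ, stepDeriv_layer ha0 hx]; ring
      have h2 : ∫ x, (κ x * φ x) ^ 2 ∂μD ≤ (4 * M) ^ 2 * ∫ x, ‖∇ φ x‖ ^ 2 ∂μD := by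
        refine le_trans ?_ (mul_le_mul_of_nonneg_left (hardy_test hφ) (sq_nonneg _))
        rw [← integral_const_mul]
        have hi : Integrable (fun x => (φ x / bdist x) ^ 2) μD := by
          exact (hφ.div_bdist.memLp 2).integrable_sq
        refine integral_mono_of_nonneg (.of_forall fun x => sq_nonneg _) (hi.const_mul _) ?_
        filter_upwards [ae_mem_disc] with x hx
        have hb := (mem_disc_iff x).1 hx
        rw [← mul_pow, ← sq_abs, ← sq_abs (4 * M * (φ x / bdist x))]
        refine pow_le_pow_left₀ (abs_nonneg _) ?_ 2
        rw [abs_mul (κ x), abs_mul (4 * M), abs_div (φ x), abs_of_pos hb,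
          abs_of_nonneg (by positivity : 0 ≤ 4 * M)]
        rcases le_or_gt (2 / a) (bdist x) with h3 | h3
        · simp only [κ, stepDeriv_layer ha0 h3, mul_zero, abs_zero, zero_mul]
          positivity
        · rw [lt_div_iff₀ ha0] at h3
          have h4 : |κ x| ≤ 2 * a * M := by
            simp only [κ]
            rw [abs_mul]
            have : |(-2 : ℝ) * a| = 2 * a := by rw [abs_mul, abs_of_pos ha0]; norm_num
            rw [this]
            exact mul_le_mul_of_nonneg_left (hM _) (by positivity)
          calc |κ x| * |φ x| ≤ 2 * a * M * |φ x| := by gcongr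
            _ = (2 * M) * (bdist x * a) * (|φ x| / bdist x) := by field_simp
            _ ≤ (2 * M) * 2 * (|φ x| / bdist x) := by gcongr
            _ = 4 * M * (|φ x| / bdist x) := by ring
      have h3 : √(∫ x, radialMoment (fun x => κ x * φ x) x ^ 2 ∂μD)
          ≤ 8 * M / a * √(∫ x, ‖∇ φ x‖ ^ 2 ∂μD) := by
        rw [← sqrt_sq (by positivity : 0 ≤ 8 * M / a), ← sqrt_mul (sq_nonneg _)]
        refine sqrt_le_sqrt (h1.trans ?_)
        calc (2 / a) ^ 2 * ∫ x, (κ x * φ x) ^ 2 ∂μD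
            ≤ (2 / a) ^ 2 * ((4 * M) ^ 2 * ∫ x, ‖∇ φ x‖ ^ 2 ∂μD) := by gcongr
          _ = (8 * M / a) ^ 2 * ∫ x, ‖∇ φ x‖ ^ 2 ∂μD := by ring
      calc _ ≤ 8 * M / a * √(∫ x, ‖∇ φ x‖ ^ 2 ∂μD) * N :=
            mul_le_mul h3 (sqrt_le_sqrt (integral_rotForm_sq_le h)) (sqrt_nonneg _) (by positivity)
        _ = _ := by ring
  simpa using key

lemma MemH1Vec.skew (h : MemH1Vec w A)
    (hno : IsTangential w) (hξ : IsTest ξ) {g : Plane → Plane} (hv : MemH10 v g) :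
    ∫ x, fderiv ℝ ξ x (w x) * v x ∂μD + ∫ x, ⟪w x, g x⟫ * ξ x ∂μD = 0 := by
  obtain ⟨C, hC⟩ := hξ.2.1.exists_bound_of_continuous hξ.continuous
  have h1 := memLp_fderiv_apply h hξ.1
  have h2 : MemLp (fun x => ξ x • w x) 2 μD :=
    memLp_bdd_mul h.memLp hξ.continuous.aestronglyMeasurable C (.of_forall hC)
  have h3 := hv.integral_eq_zero h1 h2 fun φ hφ => by
    rw [← hno (fun x => ξ x * φ x) (hξ.1.mul hφ.1),
      ← integral_add (integrable_mul_L2 h1 (hφ.memLp 2))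
        (integrable_inner (hφ.memLp_gradient 2) h2)]
    refine integral_ext fun x => ?_
    simp only [fderiv_apply_eq, inner_plane, gradient_apply, PiLp.smul_apply, smul_eq_mul]
    rw [pd_mul 0 (hξ.differentiable x) (hφ.differentiable x),
      pd_mul 1 (hξ.differentiable x) (hφ.differentiable x)]
    ring
  rw [← h3]
  congr 1
  refine integral_ext fun x => ?_
  simp only [inner_smul_right]
  rw [real_inner_comm]; ring

end

/-! ### The lower bound -/

lemma eventually_lintegral_le_of_avg_lt {F : ℝ → Plane → ℝ≥0∞} (hL : 0 ≤ L) (h : avg F < ofReal L) :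
    ∃ τ₀, 0 < τ₀ ∧ ∀ τ, τ₀ ≤ τ → ∫⁻ t in Ioc 0 τ, ∫⁻ x, F t x ∂μD ≤ ofReal (L * π * τ) := by
  have h1 := eventually_lt_of_limsup_lt h
  obtain ⟨τ₀, hτ₀⟩ := eventually_atTop.1 h1
  refine ⟨max τ₀ 1, by positivity, fun τ hτ => ?_⟩
  have hτ0 : 0 < τ := lt_of_lt_of_le one_pos ((le_max_right _ _).trans hτ)
  have h2 := hτ₀ τ ((le_max_left _ _).trans hτ)
  have hv : ofReal τ * volume disc = ofReal (π * τ) := by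
    rw [volume_disc, ← ofReal_mul hτ0.le, mul_comm]
  rw [hv] at h2
  have hpos : 0 < π * τ := by positivity
  have h3 := (ENNReal.div_lt_iff (Or.inl (by simpa using hpos)) (Or.inl (by simp))).1 h2
  rw [← ofReal_mul hL, ← mul_assoc] at h3
  exact h3.le

section

variable {F : Type*} [NormedAddCommGroup F] {v : ℝ → Plane → F}

lemma JointlyMeasurable.restrict (hv : JointlyMeasurable v) (b : ℝ) :
    AEStronglyMeasurable ♯v μC[b] := by
  refine AEStronglyMeasurable.mono_measure hv ?_
  rw [cylMeasure_eq]
  exact Measure.prod_mono (restrict_mono Ioc_subset_Ioi_self le_rfl) le_rfl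

lemma memLp_of_avg_lt [InnerProductSpace ℝ F] (hv : JointlyMeasurable v) (hL : 0 ≤ L)
    (h : avg (fun t x => ‖v t x‖ₑ ^ 2) < ofReal L) : (∀ τ, MemLp ♯v 2
      μC[τ]) ∧ ∃ τ₀, 0 < τ₀ ∧ ∀ τ, τ₀ ≤ τ → ∫ t in Ioc 0 τ, ∫ x, ‖v t x‖ ^ 2 ∂μD ≤ L * π * τ := by
  obtain ⟨τ₀, hτ₀, hle⟩ := eventually_lintegral_le_of_avg_lt hL h
  have hm : ∀ τ, MemLp ♯v 2 μC[τ] := by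
    intro τ
    refine memLp_two_of_lintegral (hv.restrict τ) ?_
    rw [lintegral_prod _ ((hv.restrict τ).enorm.pow_const 2)]
    calc _ ≤ ∫⁻ t in Ioc 0 (max τ τ₀), ∫⁻ x, ‖v t x‖ₑ ^ 2 ∂μD :=
          lintegral_mono_set (Ioc_subset_Ioc_right (le_max_left _ _))
      _ ≤ _ := hle _ (le_max_right _ _)
      _ < ⊤ := ENNReal.ofReal_lt_top
  refine ⟨hm, τ₀, hτ₀, fun τ hτ => ?_⟩
  have hτ0 : 0 < τ := hτ₀.trans_le hτ
  have h1 := ofReal_integral_normSq (hm τ)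
  have h2 := hle τ hτ
  rw [← lintegral_prod _ ((hv.restrict τ).enorm.pow_const 2), ← h1,
    integral_prod _ (integrable_normSq (hm τ))] at h2
  exact (ofReal_le_ofReal_iff (by positivity)).1 h2

end

lemma IsTemperature.exists_evolution {f : ℝ → Plane → ℝ} (h : IsTemperature f u T₀ T DT) :
    ∃ m, IsEvolution T DT m ∧ ∀ᵐ t ∂μT, ∀ φ : Plane → ℝ, IsTest φ →
        ∫ x, ⟪∇ φ x, m t x⟫ ∂μD = ∫ x, ⟪∇ φ x, DT t x⟫ ∂μD
            + ∫ x, ⟪u t x, DT t x⟫ * φ x ∂μD - ∫ x, f t x * φ x ∂μD := by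
  obtain ⟨m, hm, htd, heq⟩ := h.equation
  refine ⟨m, ⟨h.memL2Loc, h.memL2Loc_grad, h.memH10, hm, htd⟩, ?_⟩
  filter_upwards [heq] with t ht φ hφ
  have := ht φ hφ
  simp only [← inner_gradient] at this
  linarith

lemma mul_le_young {x : ℝ} (hε : 0 < ε) : x * y ≤ ε * x ^ 2 + y ^ 2 / (4 * ε) := by
  rw [← sub_nonneg]
  have : ε * x ^ 2 + y ^ 2 / (4 * ε) - x * y = (2 * ε * x - y) ^ 2 / (4 * ε) := by field_simp; ring
  rw [this]; positivity

lemma heat_balance {w : Plane → Plane} {A : Plane → Fin 2 → Plane} (h : MemH1Vec w A)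
    (hno : IsTangential w)
    {M : ℝ} (hM : ∀ s, |stepDeriv s| ≤ M) (hP : 1 ≤ P) {g μ : Plane → Plane} (hv : MemH10 v g)
    (hk : MemLp k 2 μD) (heq : ∫ x, ⟪∇ (cutoff (2 * P)) x, μ x⟫ ∂μD
          = ∫ x, ⟪∇ (cutoff (2 * P)) x, g x⟫ ∂μD + ∫ x, ⟪w x, g x⟫ * cutoff (2 * P) x ∂μD
            - ∫ x, k x * cutoff (2 * P) x ∂μD) (hε : 0 < ε) : ∫ x, k x ∂μD
      ≤ - (∫ x, ⟪∇ (cutoff (2 * P)) x, μ x⟫ ∂μD) + 2 * ε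
        + ε / P ^ 3 * (∫ x, ‖A x 0‖ ^ 2 ∂μD + ∫ x, ‖A x 1‖ ^ 2 ∂μD)
        + (4 * π * M ^ 2 + 4 * M ^ 2) * P / ε * (∫ x, ‖g x‖ ^ 2 ∂μD)
        + π / (4 * ε * P) * ∫ x, k x ^ 2 ∂μD := by
  have hP0 : 0 < P := by linarith
  have ha : 2 ≤ 2 * P := by linarith
  have hξ := isTest_cutoff (a := 2 * P) (by positivity)
  have hsk := h.skew hno hξ hv
  have hfl := h.abs_flux_le hno hM ha hv
  set α := ∫ x, ‖A x 0‖ ^ 2 ∂μD + ∫ x, ‖A x 1‖ ^ 2 ∂μD with hα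
  set d := ∫ x, ‖g x‖ ^ 2 ∂μD with hd
  set q := ∫ x, k x ^ 2 ∂μD with hq
  have hα0 : 0 ≤ α := add_nonneg (by positivity)
    (by positivity)
  have hd0 : 0 ≤ d := by positivity
  have hq0 : 0 ≤ q := by positivity
  have h1 : ∫ x, ⟪∇ (cutoff (2 * P)) x, g x⟫ ∂μD ≤ ε + 4 * π * M ^ 2 * P / ε * d := by
    have h2 := (le_abs_self _).trans (abs_integral_inner_le (hξ.memLp_gradient 2) hv.memLp_grad)
    have h3 := integral_gradient_cutoff_le hM ha
    have h4 : √(∫ x, ‖∇ (cutoff (2 * P)) x‖ ^ 2 ∂μD) ≤ √(8 * π * M ^ 2 * (2 * P)) := sqrt_le_sqrt h3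
    have h5 := mul_le_young (x := 1) (y := √(8 * π * M ^ 2 * (2 * P)) * √d) hε
    rw [mul_pow, sq_sqrt (by positivity), sq_sqrt hd0] at h5
    calc _ ≤ √(8 * π * M ^ 2 * (2 * P)) * √d :=
          h2.trans (mul_le_mul_of_nonneg_right h4 (sqrt_nonneg _))
      _ ≤ ε * 1 ^ 2 + 8 * π * M ^ 2 * (2 * P) * d / (4 * ε) := by linarith
      _ = _ := by field_simp; ring
  have h2 : ∫ x, k x * (1 - cutoff (2 * P) x) ∂μD ≤ ε + π / (4 * ε * P) * q := by
    have hm : MemLp (fun x => 1 - cutoff (2 * P) x) 2 μD := (memLp_const 1).sub (hξ.memLp 2)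
    have h2 := (le_abs_self _).trans (abs_integral_mul_le hk hm)
    have h4 := sqrt_le_sqrt (integral_one_sub_cutoff_le ha)
    have h5 := mul_le_young (x := 1) (y := √(π * (2 / (2 * P))) * √q) hε
    rw [mul_pow, sq_sqrt (by positivity), sq_sqrt hq0] at h5
    calc _ ≤ √q * √(π * (2 / (2 * P))) := h2.trans (mul_le_mul_of_nonneg_left h4 (sqrt_nonneg _))
      _ ≤ ε * 1 ^ 2 + π * (2 / (2 * P)) * q / (4 * ε) := by linarith
      _ = _ := by field_simp
  have h3 : - ∫ x, fderiv ℝ (cutoff (2 * P)) x (w x) * v x ∂μD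
      ≤ ε / P ^ 3 * α + 4 * M ^ 2 * P / ε * d := by
    have h4 := (neg_le_abs _).trans hfl
    have h5 := mul_le_young (x := √α) (y := 8 * M / (2 * P) * √d) (div_pos hε (pow_pos hP0 3))
    rw [mul_pow, sq_sqrt hα0, sq_sqrt hd0] at h5
    calc _ ≤ ε / P ^ 3 * α + (8 * M / (2 * P)) ^ 2 * d / (4 * (ε / P ^ 3)) := by linarith
      _ = _ := by field_simp; ring
  have h4 : ∫ x, k x ∂μD = ∫ x, k x * cutoff (2 * P) x ∂μD
      + ∫ x, k x * (1 - cutoff (2 * P) x) ∂μD := by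
    have i1 := integrable_mul_L2 hk (hξ.memLp 2)
    have i2 : Integrable (fun x => k x * (1 - cutoff (2 * P) x)) μD :=
      integrable_mul_L2 hk ((memLp_const 1).sub (hξ.memLp 2))
    rw [← integral_add i1 i2]
    exact integral_ext (fun x => by ring)
  have h5 : (4 * π * M ^ 2 + 4 * M ^ 2) * P / ε * d
      = 4 * π * M ^ 2 * P / ε * d + 4 * M ^ 2 * P / ε * d := by ring
  rw [h5]
  linarith

lemma IsVelocity.ae_no_flux (h : IsVelocity u Du) : ∀ᵐ t ∂μT, ∀ φ : Plane → ℝ,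
      Smooth φ → ∫ x, fderiv ℝ φ x (u t x) ∂μD = 0 := by
  filter_upwards [h.div_free, h.no_penetration] with t h1 h2 φ hφ
  rw [← h2 φ hφ]
  refine integral_congr_ae ?_
  filter_upwards [h1] with x hx
  rw [hx, zero_mul, add_zero]

lemma JointlyMeasurable.apply {A : ℝ → Plane → Fin 2 → Plane} (h : JointlyMeasurable A)
    (i : Fin 2) : JointlyMeasurable fun t x => A t x i :=
  (continuous_apply i).comp_aestronglyMeasurable h

lemma integral_source_le {f : ℝ → Plane → ℝ} (hu : IsVelocity u Du) (hT : IsTemperature f u T₀ T DT)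
    (mf : ∀ τ, MemLp ♯f 2 μC[τ])
    (mD : ∀ τ, MemLp ♯DT 2 μC[τ])
    (mA : ∀ i τ, MemLp (fun p => Du p.1 p.2 i) 2 μC[τ])
    {M : ℝ} (hM : ∀ s, |stepDeriv s| ≤ M) (hP : 1 ≤ P) {θ : ℝ} (hε : 0 < ε) (hθ : 0 < θ) :
    ∃ c, ∀ τ, 2 ≤ τ → ∫ t in Ioc 0 τ, ∫ x, f t x ∂μD ≤ c + 2 * ε * (τ + 1)
      + ε / P ^ 3 * ((∫ t in Ioc 0 (τ + 1), ∫ x, ‖Du t x 0‖ ^ 2 ∂μD)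
          + ∫ t in Ioc 0 (τ + 1), ∫ x, ‖Du t x 1‖ ^ 2 ∂μD)
      + ((4 * π * M ^ 2 + 4 * M ^ 2) * P / ε + 1 / 2)
          * (∫ t in Ioc 0 (τ + 1), ∫ x, ‖DT t x‖ ^ 2 ∂μD)
      + (π / (4 * ε * P) + θ) * ∫ t in Ioc 0 (τ + 1), ∫ x, f t x ^ 2 ∂μD := by
  have hP0 : 0 < P := by linarith
  have hξ := isTest_cutoff (a := 2 * P) (by positivity)
  set ξ := cutoff (2 * P)
  obtain ⟨m, hev, heq⟩ := hT.exists_evolution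
  obtain ⟨S, hS, hw⟩ := hev.weak_test hξ
  have hS' : ∀ᵐ t, t ∈ S ∧ (t ∈ Ioi (0 : ℝ) → MemH10 (T t) (DT t)) :=
    hS.and ((ae_restrict_iff' measurableSet_Ioi).1 hev.memH10)
  set κ := (4 * π * M ^ 2 + 4 * M ^ 2) * P / ε with hκ
  have hκ0 : 0 ≤ κ := by positivity
  let X : ℝ → ℝ := fun t => ∫ x, f t x ∂μD
  let d : ℝ → ℝ := fun t => ∫ x, ‖DT t x‖ ^ 2 ∂μD
  let q : ℝ → ℝ := fun t => ∫ x, f t x ^ 2 ∂μD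
  let α : Fin 2 → ℝ → ℝ := fun i t => ∫ x, ‖Du t x i‖ ^ 2 ∂μD
  let J : ℝ → ℝ := fun t => ∫ x, ⟪∇ ξ x, m t x⟫ ∂μD
  let G : ℝ → ℝ := fun t => 2 * ε + ε / P ^ 3 * (α 0 t + α 1 t) + κ * d t + π / (4 * ε * P) * q t
  have id : ∀ τ, IntegrableOn d (Ioc 0 τ) := fun τ => integrable_slice_normSq (mD τ)
  have iq : ∀ τ, IntegrableOn q (Ioc 0 τ) := fun τ => by
    have := integrable_slice_normSq (mf τ)
    simp only [norm_eq_abs, sq_abs] at this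
    exact this
  have iα : ∀ i τ, IntegrableOn (α i) (Ioc 0 τ) := fun i τ =>
    integrable_slice_normSq (v := fun t x => Du t x i) (mA i τ)
  have iX : ∀ τ, IntegrableOn X (Ioc 0 τ) := fun τ => by
    have := integrable_slice_mul (w := fun _ _ => (1 : ℝ)) (mf τ) (memLp_snd (memLp_const 1))
    simp only [mul_one] at this
    exact this
  have ic : ∀ c b : ℝ, IntegrableOn (fun _ : ℝ => c) (Ioc 0 b) := fun c b =>
    integrableOn_const (by simp)
  have k2 : ∀ τ, IntegrableOn (fun t => ε / P ^ 3 * (α 0 t + α 1 t)) (Ioc 0 τ) := fun τ =>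
    ((iα 0 τ).add (iα 1 τ)).const_mul _
  have k12 : ∀ τ, IntegrableOn (fun t => 2 * ε + ε / P ^ 3 * (α 0 t + α 1 t)) (Ioc 0 τ) := fun τ =>
    (ic _ τ).add (k2 τ)
  have k123 : ∀ τ, IntegrableOn (fun t => 2 * ε + ε / P ^ 3 * (α 0 t + α 1 t) + κ * d t)
    (Ioc 0 τ) := fun τ => (k12 τ).add ((id τ).const_mul κ)
  have iG : ∀ τ, IntegrableOn G (Ioc 0 τ) := fun τ => (k123 τ).add ((iq τ).const_mul _)
  have nq : ∀ t, 0 ≤ q t := fun t => by positivity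
  have nd : ∀ t, 0 ≤ d t := fun t => by positivity
  have nα : ∀ i t, 0 ≤ α i t := fun i t => by positivity
  have hmono : ∀ {F : ℝ → ℝ} {τ : ℝ} {s : Set ℝ}, (∀ τ, IntegrableOn F (Ioc 0 τ)) →
      (∀ t, 0 ≤ F t) → s ⊆ Ioc 0 τ → ∫ t in s, F t ≤ ∫ t in Ioc 0 τ, F t := fun hi hn hs =>
    setIntegral_mono_set (hi _) (.of_forall hn) hs.eventuallyLE
  have hft : ∀ᵐ t ∂μT, MemLp (f t) 2 μD := by
    rw [ae_restrict_iff' measurableSet_Ioi]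
    filter_upwards [ae_all_iff.2 fun n : ℕ => (ae_restrict_iff' measurableSet_Ioc).1
      (ae_memLp_slice (mf n))] with t ht ht0
    obtain ⟨n, hn⟩ := exists_nat_ge t
    exact ht n ⟨ht0, hn⟩
  have hbal : ∀ᵐ t ∂μT, X t ≤ - J t + G t := by
    filter_upwards [hu.memH1, hu.ae_no_flux, hev.memH10, heq, hft] with t h1 h2 h3 h4 h5
    have : X t ≤ - J t + 2 * ε + ε / P ^ 3 * (α 0 t + α 1 t) + κ * d t + π / (4 * ε * P) * q t :=
      heat_balance h1 h2 hM hP h3 h5 (h4 ξ hξ) hε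
    simp only [G]; linarith
  have habs : ∀ᵐ t ∂μT, -X t ≤ θ * q t + π / (4 * θ) := by
    filter_upwards [hft] with t ht
    have h1 := (neg_le_abs _).trans (abs_integral_mul_le ht (memLp_const (1 : ℝ)))
    simp only [mul_one, one_pow, integral_const, smul_eq_mul] at h1
    rw [show discMeasure.real univ = π by
      rw [discMeasure, measureReal_restrict_apply_univ, volume_real_disc]] at h1
    have h2 := mul_le_young (x := √(q t)) (y := √π) hθ
    rw [sq_sqrt (nq t), sq_sqrt pi_pos.le] at h2
    exact h1.trans h2
  obtain ⟨a, ha, haS⟩ : ∃ a ∈ Ioo (1 : ℝ) 2, a ∈ S := by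
    have h1 : ∃ᵐ t : ℝ, t ∈ Ioo (1 : ℝ) 2 := by rw [frequently_ae_mem_iff]; simp
    exact (h1.and_eventually hS).exists
  have ha0 : 0 < a := by linarith [ha.1]
  refine ⟨(∫ t in Ioc 0 a, X t) - ∫ x, T a x * ξ x ∂μD + ∫ x, ξ x ^ 2 ∂μD + π / (4 * θ),
    fun τ hτ => ?_⟩
  have hτ0 : 0 < τ := by linarith
  obtain ⟨b, ⟨hbS, h10⟩, hb, hbd⟩ : ∃ b, (b ∈ S ∧ (b ∈ Ioi (0 : ℝ) → MemH10 (T b) (DT b))) ∧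
      b ∈ Ioo τ (τ + 1) ∧ d b ≤ ∫ t in Ioc 0 (τ + 1), d t := by
    have hsub : Ioo τ (τ + 1) ⊆ Ioc 0 (τ + 1) := fun t ht => ⟨hτ0.trans ht.1, ht.2.le⟩
    obtain ⟨b, hb, hle⟩ := exists_notMem_null_le_average (μ := volume.restrict (Ioo τ (τ + 1)))
      (f := d) (by rw [Ne, Measure.restrict_eq_zero, Real.volume_Ioo]; simp)
      ((id (τ + 1)).mono_set hsub)
      ((ae_restrict_of_ae hS').and (ae_restrict_mem measurableSet_Ioo))
    have hb' := not_not.1 hb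
    refine ⟨b, hb'.1, hb'.2, hle.trans ?_⟩
    rw [setAverage_eq, Real.volume_real_Ioo_of_le (by linarith)]
    simp only [add_sub_cancel_left, inv_one, one_smul]
    exact hmono id nd hsub
  have hab : a < b := (ha.2.trans_le hτ).trans hb.1
  have hb0 : 0 < b := ha0.trans hab
  have hwk := hw a haS b hbS ha0 hab
  rw [integral_of_le hab.le] at hwk
  have hbound : ∫ x, T b x * ξ x ∂μD ≤ 1 / 2 * (∫ t in Ioc 0 (τ + 1), d t) + ∫ x, ξ x ^ 2 ∂μD := by
    have h1 := (le_abs_self _).trans (abs_integral_mul_le (h10 hb0).memLp (hξ.memLp 2))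
    have h2 := mul_le_young (x := √(∫ x, T b x ^ 2 ∂μD)) (y := √(∫ x, ξ x ^ 2 ∂μD)) one_half_pos
    have hn : ∀ φ : Plane → ℝ, 0 ≤ ∫ x, φ x ^ 2 ∂μD := fun φ => by positivity
    rw [sq_sqrt (hn _), sq_sqrt (hn ξ)] at h2
    have h4 : _ ≤ d b := (h10 hb0).poincare
    linarith [hn ξ]
  have hsub : ∀ {s}, 0 ≤ s → Ioc s b ⊆ Ioc 0 (τ + 1) := fun hs t ht =>
    ⟨hs.trans_lt ht.1, ht.2.trans hb.2.le⟩
  have iJ : IntegrableOn J (Ioc a b) := by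
    have h2 : IntegrableOn J (Icc a b) := integrable_slice_inner (v := fun _ => ∇ ξ)
      (memLp_snd (hξ.memLp_gradient 2)) (hev.memL2Loc_flux.memLp_Icc ha0 hab)
    exact h2.mono_set Ioc_subset_Icc_self
  have hmain : ∫ t in Ioc a b, X t ≤ - (∫ t in Ioc a b, J t) + ∫ t in Ioc 0 (τ + 1), G t := by
    have i1 := (iG _).mono_set (hsub ha0.le)
    refine (integral_mono_ae ((iX _).mono_set (hsub ha0.le)) (iJ.neg.add i1)
      (ae_mono (restrict_mono (fun t ht => ha0.trans ht.1) le_rfl) hbal)).trans ?_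
    rw [integral_add' iJ.neg i1, integral_neg']
    refine add_le_add_right (hmono iG (fun t => ?_) (hsub ha0.le)) _
    have := nq t; have := nd t; have := nα 0 t; have := nα 1 t
    simp only [G]; positivity
  have hG : ∫ t in Ioc 0 (τ + 1), G t = 2 * ε * (τ + 1) + ε / P ^ 3 *
      ((∫ t in Ioc 0 (τ + 1), α 0 t) + ∫ t in Ioc 0 (τ + 1), α 1 t)
      + κ * (∫ t in Ioc 0 (τ + 1), d t) + π / (4 * ε * P) * ∫ t in Ioc 0 (τ + 1), q t := by
    simp only [G]
    rw [integral_add (k123 _) ((iq _).const_mul _), integral_add (k12 _) ((id _).const_mul κ),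
      integral_add (ic _ _) (k2 _), integral_const_mul (ε / P ^ 3), integral_const_mul κ d,
      integral_const_mul (π / (4 * ε * P)) q, integral_add (iα 0 _) (iα 1 _), setIntegral_const,
      Real.volume_real_Ioc_of_le (by linarith), smul_eq_mul]
    ring
  have ii : ∀ {s t}, 0 ≤ s → 0 ≤ t → IntervalIntegrable X volume s t := fun hs ht =>
    intervalIntegrable_iff.2 ((iX _).mono_set (Ioc_subset_Ioc_left (le_min hs ht)))
  have h1 := integral_add_adjacent_intervals (ii le_rfl ha0.le) (ii ha0.le hb0.le)
  rw [← integral_add_adjacent_intervals (ii le_rfl hτ0.le) (ii hτ0.le hb0.le), integral_of_le ha0.le,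
    integral_of_le hab.le, integral_of_le hτ0.le, integral_of_le hb.1.le] at h1
  have htail : - ∫ t in Ioc τ b, X t ≤ θ * (∫ t in Ioc 0 (τ + 1), q t) + π / (4 * θ) := by
    have k1 : IntegrableOn (fun t => θ * q t) (Ioc τ b) :=
      ((iq _).mono_set (hsub hτ0.le)).const_mul _
    have hc := (ic (π / (4 * θ)) _).mono_set (hsub hτ0.le)
    rw [← integral_neg]
    refine (integral_mono_ae ((iX _).mono_set (hsub hτ0.le)).neg (k1.add hc)
      (ae_mono (restrict_mono (fun t ht => hτ0.trans ht.1) le_rfl) habs)).trans ?_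
    rw [integral_add' k1 hc, integral_const_mul, setIntegral_const,
      Real.volume_real_Ioc_of_le hb.1.le, smul_eq_mul]
    exact add_le_add (mul_le_mul_of_nonneg_left (hmono iq nq (hsub hτ0.le)) hθ.le)
      (mul_le_of_le_one_left (by positivity) (by linarith [hb.2]))
  change ∫ t in Ioc 0 τ, X t ≤ _ + _ + _ * ((∫ t in Ioc 0 (τ + 1), α 0 t)
    + ∫ t in Ioc 0 (τ + 1), α 1 t) + _ * (∫ t in Ioc 0 (τ + 1), d t) + _ * ∫ t in Ioc 0 (τ + 1), q t
  rw [add_mul κ, add_mul (_ / _) θ]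
  linarith

lemma avg_mono {F G : ℝ → Plane → ℝ≥0∞} (h : ∀ t x, F t x ≤ G t x) : avg F ≤ avg G := by
  refine limsup_le_limsup (.of_forall fun τ => ?_)
  refine ENNReal.div_le_div_right (lintegral_mono fun t => lintegral_mono fun x => h t x) _

lemma pi_div_mul_le (hB : 0 ≤ B) (hε : 0 < ε) (hc : 0 < c) (hP : 0 < P)
    (h : 8 * B / (ε * c) ≤ P) : π / (4 * ε * P) * B ≤ c / 8 := by
  rw [div_le_iff₀ (by positivity)] at h
  rw [div_mul_eq_mul_div, div_le_iff₀ (by positivity)]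
  have h1 : π * B ≤ 4 * B := mul_le_mul_of_nonneg_right Real.pi_le_four hB
  have h2 : c / 8 * (4 * ε * P) = P * (ε * c) / 2 := by ring
  linarith

/-- The lower bound on the mean-square temperature gradient. -/
theorem exists_le_meanSqGrad {f : ℝ → Plane → ℝ} (hf : JointlyMeasurable f)
    (hfin : avg (fun t x => ‖f t x‖ₑ ^ 2) < ⊤) (hpos : 0 < signedAvg f) :
    ∃ K c : ℝ, 0 < K ∧ 0 < c ∧ ∀ Pe : ℝ, c ≤ Pe → ∀ (u : ℝ → Plane → Plane) (T₀ : Plane → ℝ)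
      (T : ℝ → Plane → ℝ) (DT : ℝ → Plane → Plane), IsAdmissible Pe u → IsTemperature f u T₀ T DT →
      ofReal (K * (1 / Pe ^ (2 / 3 : ℝ))) ≤ meanSqGrad DT := by
  obtain ⟨B₀, hB₀, hB₀'⟩ := ENNReal.lt_iff_exists_nnreal_btwn.1 hfin
  set B : ℝ := NNReal.toReal B₀ with hBdef
  have hB : 0 ≤ B := B₀.2
  have hfB : avg (fun t x => ‖f t x‖ₑ ^ 2) < ofReal B := by rwa [hBdef, ENNReal.ofReal_coe_nnreal]
  obtain ⟨c₁, hc₁, hc₁'⟩ := EReal.lt_iff_exists_real_btwn.1 hpos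
  replace hc₁ : 0 < c₁ := by exact_mod_cast hc₁
  have hfreq := frequently_lt_of_lt_limsup (by isBoundedDefault) hc₁'
  obtain ⟨M, -, hM⟩ := exists_stepDeriv_bound
  obtain ⟨mf, τf, hτf, hf2⟩ := memLp_of_avg_lt hf hB hfB
  set ε : ℝ := c₁ / 48 with hε
  have hε0 : 0 < ε := by positivity
  set θ : ℝ := c₁ / (8 * (B + 1)) with hθ
  have hθ0 : 0 < θ := by positivity
  set K₁ : ℝ := 4 * π * M ^ 2 + 4 * M ^ 2 with hK₁
  have hK₁0 : 0 ≤ K₁ := by have := pi_pos; positivity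
  set K : ℝ := (c₁ / 8) / (1 / 2 + K₁ / ε) with hK
  have hK0 : 0 < K := by positivity
  set P₀ : ℝ := max 1 (8 * B / (ε * c₁)) with hP₀
  have hP₀1 : 1 ≤ P₀ := le_max_left _ _
  refine ⟨K, P₀ ^ (3 / 2 : ℝ), hK0, by positivity, fun Pe hPe u T₀ T DT hu hT => ?_⟩
  have hPe0 : 0 < Pe := lt_of_lt_of_le (by positivity) hPe
  set P : ℝ := Pe ^ (2 / 3 : ℝ) with hPdef
  have hP0 : 0 < P := by positivity
  have hPP₀ : P₀ ≤ P := by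
    have h1 := Real.rpow_le_rpow (by positivity) hPe (by norm_num : (0 : ℝ) ≤ 2 / 3)
    rw [← rpow_mul (by positivity)] at h1
    norm_num at h1
    exact h1
  have hP1 : 1 ≤ P := hP₀1.trans hPP₀
  have hP3 : P ^ 3 = Pe ^ 2 := by
    rw [hPdef, ← rpow_natCast, ← rpow_mul hPe0.le, ← rpow_natCast]
    norm_num
  by_contra hlt
  push Not at hlt
  rw [mul_one_div] at hlt
  obtain ⟨mD, τD, hτD, hD2⟩ := memLp_of_avg_lt hT.memL2Loc_grad.1 (by positivity) hlt
  obtain ⟨Du, hvel, hens⟩ := hu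
  have hA : ∀ i, avg (fun t x => ‖Du t x i‖ₑ ^ 2) < ofReal (2 * P ^ 3) := by
    intro i
    refine (avg_mono (G := fun t x => ∑ i : Fin 2, ‖Du t x i‖ₑ ^ 2) fun t x => ?_).trans_lt ?_
    · exact Finset.single_le_sum (f := fun i => ‖Du t x i‖ₑ ^ 2) (fun _ _ => zero_le)
        (Finset.mem_univ i)
    · change meanEnstrophy Du < _
      rw [hens, hP3, ENNReal.ofReal_lt_ofReal_iff (by positivity)]
      nlinarith [sq_pos_of_pos hPe0]
  choose mA τA hτA hA2 using fun i =>
    memLp_of_avg_lt (hvel.meas_grad.apply i) (by positivity) (hA i)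
  obtain ⟨c, hc⟩ := integral_source_le hvel hT mf mD mA hM hP1 hε0 hθ0
  have hev : ∀ᶠ τ : ℝ in atTop, 2 ≤ τ ∧ τf ≤ τ ∧ τD ≤ τ ∧ τA 0 ≤ τ ∧ τA 1 ≤ τ ∧
      (c + c₁ * π / 2) / (c₁ * π / 2) < τ :=
    (eventually_ge_atTop _).and ((eventually_ge_atTop _).and ((eventually_ge_atTop _).and
      ((eventually_ge_atTop _).and ((eventually_ge_atTop _).and (eventually_gt_atTop _)))))
  obtain ⟨τ, hτ, h2, h3, h4, h5, h6, h7⟩ := (hfreq.and_eventually hev).exists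
  have hπ := pi_pos
  have hπ3 := Real.pi_gt_three
  have hπ4 := Real.pi_le_four
  rw [volume_real_disc] at hτ
  replace hτ : c₁ < (τ * π)⁻¹ * ∫ t in Ioc 0 τ, ∫ x, f t x ∂μD := by exact_mod_cast hτ
  have hτ0 : 0 < τ := by linarith
  rw [inv_mul_eq_div, lt_div_iff₀ (by positivity)] at hτ
  have b0 := hc τ h2
  have b1 := hf2 (τ + 1) (by linarith)
  simp only [norm_eq_abs, sq_abs] at b1
  have b2 := hD2 (τ + 1) (by linarith)
  have b3 := hA2 0 (τ + 1) (by linarith)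
  have b4 := hA2 1 (τ + 1) (by linarith)
  rw [div_lt_iff₀ (by positivity)] at h7
  have k3 := mul_le_mul_of_nonneg_left (add_le_add b3 b4) (by positivity : 0 ≤ ε / P ^ 3)
  have k2 := mul_le_mul_of_nonneg_left b2 (by positivity : 0 ≤ K₁ * P / ε + 1 / 2)
  have k1 := mul_le_mul_of_nonneg_left b1 (by positivity : 0 ≤ π / (4 * ε * P) + θ)
  have e3 : ε / P ^ 3 * (2 * P ^ 3 * π * (τ + 1) + 2 * P ^ 3 * π * (τ + 1))
      = 4 * ε * (π * (τ + 1)) := by field_simp; ring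
  have e2 : (K₁ * P / ε + 1 / 2) * (K / P * π * (τ + 1)) ≤ c₁ / 8 * (π * (τ + 1)) := by
    have : (K₁ * P / ε + 1 / 2) * (K / P) ≤ c₁ / 8 := by
      have h8 : (K₁ * P / ε + 1 / 2) * (K / P) = K * (K₁ / ε + 1 / 2 * (1 / P)) := by field_simp
      have h9 : K * (1 / 2 + K₁ / ε) = c₁ / 8 := div_mul_cancel₀ _ (by positivity)
      rw [h8, ← h9]
      refine mul_le_mul_of_nonneg_left ?_ hK0.le
      have : 1 / P ≤ 1 := (div_le_one hP0).2 hP1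
      linarith
    calc _ = (K₁ * P / ε + 1 / 2) * (K / P) * (π * (τ + 1)) := by ring
      _ ≤ _ := mul_le_mul_of_nonneg_right this (by positivity)
  have e1 : (π / (4 * ε * P) + θ) * (B * π * (τ + 1)) ≤ c₁ / 4 * (π * (τ + 1)) := by
    have h8 : π / (4 * ε * P) * B ≤ c₁ / 8 :=
      pi_div_mul_le hB hε0 hc₁ hP0 ((le_max_right _ _).trans hPP₀)
    have h9 : θ * B ≤ c₁ / 8 := by
      have : θ * (B + 1) = c₁ / 8 := by rw [hθ]; field_simp
      linarith [mul_add θ B 1]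
    calc _ = (π / (4 * ε * P) * B + θ * B) * (π * (τ + 1)) := by ring
      _ ≤ _ := mul_le_mul_of_nonneg_right (by linarith) (by positivity)
  have e4 : 2 * ε * (τ + 1) ≤ ε * (π * (τ + 1)) := by
    nlinarith [mul_pos hε0 (by linarith : 0 < τ + 1)]
  have e5 : ε * (π * (τ + 1)) = c₁ / 48 * (π * (τ + 1)) := by rw [hε]
  have e6 : 0 ≤ c₁ * (π * (τ + 1)) := by positivity
  rw [← hK₁, add_mul] at b0
  clear_value ε θ K₁ K P
  have e7 : c₁ * (τ * π) = c₁ * (π * (τ + 1)) - c₁ * π / 2 * 2 := by ring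
  have e8 : τ * (c₁ * π / 2) = (c₁ * (π * (τ + 1)) - c₁ * π / 2 * 2) / 2 := by ring
  linarith

/-! ### Velocities from stream functions -/

lemma stronglyMeasurable_pd (hm : StronglyMeasurable fun p : ℝP => ψ p.1 p.2)
    (hd : ∀ t, Differentiable ℝ (ψ t)) (i : Fin 2) :
    StronglyMeasurable fun p : ℝP => pd i (ψ p.1) p.2 := by
  let e : Plane := single i 1
  refine stronglyMeasurable_of_tendsto atTop (f := fun (n : ℕ) (p : ℝP) =>
    (n : ℝ) • (ψ p.1 (p.2 + (n : ℝ)⁻¹ • e) - ψ p.1 p.2)) (fun n => ?_) ?_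
  · have h1 : Measurable fun p : ℝP => (p.1, p.2 + (n : ℝ)⁻¹ • e) := by fun_prop
    exact StronglyMeasurable.const_smul (𝕜 := ℝ) ((hm.comp_measurable h1).sub hm) (n : ℝ)
  · rw [tendsto_pi_nhds]
    intro p
    refine (hd p.1 p.2).hasFDerivAt.lim e (c := fun n : ℕ => (n : ℝ)) ?_
    simp only [Real.norm_natCast]
    exact tendsto_natCast_atTop_atTop

lemma stronglyMeasurable_gradient (hm : StronglyMeasurable fun p : ℝP => ψ p.1 p.2)
    (hd : ∀ t, Differentiable ℝ (ψ t)) :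
    StronglyMeasurable fun p : ℝP => ∇ (ψ p.1) p.2 := by
  have h : (fun p : ℝP => ∇ (ψ p.1) p.2) = fun p : ℝP =>
      pd 0 (ψ p.1) p.2 • single (0 : Fin 2) (1 : ℝ) + pd 1 (ψ p.1) p.2 • single 1 1 := by
    funext p
    rw [plane_eq_sum (∇ (ψ p.1) p.2), gradient_apply, gradient_apply]
  rw [h]
  exact ((stronglyMeasurable_pd hm hd 0).smul_const _).add
    ((stronglyMeasurable_pd hm hd 1).smul_const _)

/-- The velocity with stream function `ψ`. -/
def streamVel (ψ : ℝ → Plane → ℝ) (t : ℝ) (x : Plane) : Plane :=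
  (- pd 1 (ψ t) x) • single (0 : Fin 2) (1 : ℝ) + pd 0 (ψ t) x • single 1 1

/-- The gradients of the components of `streamVel ψ`. -/
def streamGrad (ψ : ℝ → Plane → ℝ) (t : ℝ) (x : Plane) (i : Fin 2) : Plane :=
  if i = 0 then - ∇ (pd 1 (ψ t)) x else ∇ (pd 0 (ψ t)) x

/-- A stream function that is a test function at each time, with at most exponentially growing
velocity. -/
structure IsStream (ψ : ℝ → Plane → ℝ) (U : ℝ) : Prop where
  meas : StronglyMeasurable fun p : ℝP => ψ p.1 p.2
  test : ∀ t, IsTest (ψ t)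
  bound : ∀ t x i, 0 < t → |pd i (ψ t) x| ≤ U * exp t

lemma streamVel_zero (ψ : ℝ → Plane → ℝ) (t : ℝ) (x : Plane) :
    streamVel ψ t x 0 = - pd 1 (ψ t) x := by simp [streamVel]

lemma streamVel_one (ψ : ℝ → Plane → ℝ) (t : ℝ) (x : Plane) :
    streamVel ψ t x 1 = pd 0 (ψ t) x := by simp [streamVel]

lemma fderiv_streamVel (ψ : ℝ → Plane → ℝ) (t : ℝ) (x : Plane) (φ : Plane → ℝ) :
    fderiv ℝ φ x (streamVel ψ t x) = pd 1 φ x * pd 0 (ψ t) x - pd 0 φ x * pd 1 (ψ t) x := by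
  rw [fderiv_apply_eq, streamVel_zero, streamVel_one]; ring

lemma integral_fderiv_streamVel (hψ : IsTest (ψ t))
    (hφ : Smooth φ) : ∫ x, fderiv ℝ φ x (streamVel ψ t x) ∂μD = 0 := by
  have hi : ∀ i j, Integrable (fun x => pd i φ x * pd j (ψ t) x) μD := fun i j =>
    integrable_continuous_mul (continuous_pd i (hφ.of_le (by simp))) ((hψ.pd j).memLp 2)
  simp only [fderiv_streamVel]
  rw [integral_sub (hi 1 0) (hi 0 1),
    integral_mul_pd_test 0 ((contDiff_pd 1 hφ).of_le (by simp)) hψ,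
    integral_mul_pd_test 1 ((contDiff_pd 0 hφ).of_le (by simp)) hψ]
  simp only [pd_comm (hφ.of_le (coe_le_coe.2 le_top)), sub_self]

lemma IsTest.memH1 (h : IsTest φ) : MemH1 φ (∇ φ) where
  memLp := h.memLp 2
  memLp_grad := h.memLp_gradient 2
  weak_grad := fun w hw i => by
    simp only [gradient_apply]
    exact integral_mul_pd_test i (h.1.of_le (by simp)) hw

namespace IsStream

variable {ψ : ℝ → Plane → ℝ} {U : ℝ}

lemma isFlow (h : IsStream ψ U) : IsFlow (streamVel ψ) (2 * U) where
  meas := by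
    have hd := fun t => (h.test t).differentiable
    exact ((stronglyMeasurable_pd h.meas hd 1).neg.smul_const _).add
      ((stronglyMeasurable_pd h.meas hd 0).smul_const _)
  bound := fun t x ht => by
    refine (norm_add_le _ _).trans ?_
    rw [norm_smul, norm_smul]
    simp only [norm_neg, PiLp.norm_single, norm_one, mul_one, norm_eq_abs]
    linarith [h.bound t x 0 ht, h.bound t x 1 ht]
  div_free := fun t φ _ hφ => by
    simp only [inner_gradient]
    exact integral_fderiv_streamVel (h.test t) hφ.1

lemma isVelocity (h : IsStream ψ U) : IsVelocity (streamVel ψ) (streamGrad ψ) where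
  meas := h.isFlow.meas.aestronglyMeasurable
  meas_grad := by
    have hd := fun t => (h.test t).differentiable
    have hg : ∀ i, StronglyMeasurable fun p : ℝP => ∇ (pd i (ψ p.1)) p.2 := fun i =>
      stronglyMeasurable_gradient (ψ := fun t => pd i (ψ t)) (stronglyMeasurable_pd h.meas hd i)
        fun t => ((h.test t).pd i).differentiable
    refine StronglyMeasurable.aestronglyMeasurable ?_
    refine Measurable.stronglyMeasurable (measurable_pi_iff.2 fun i => ?_)
    by_cases hi : i = 0
    · simp only [streamGrad, hi, if_true]
      exact (hg 1).neg.measurable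
    · simpa only [streamGrad, hi, if_false] using (hg 0).measurable
  memH1 := .of_forall fun t i => by
    have hi : i = 0 ∨ i = 1 := by fin_cases i <;> simp
    rcases hi with rfl | rfl
    · simp only [streamVel_zero, streamGrad, if_true]
      have h1 := (((h.test t).pd 1).const_mul (-1)).memH1
      have h2 : ∇ (fun x => -1 * pd 1 (ψ t) x) = fun x => - ∇ (pd 1 (ψ t)) x := by
        funext x; ext j
        rw [gradient_apply, pd_const_mul _ _ (((h.test t).pd 1).differentiable x)]
        simp [gradient_apply]
      rw [h2] at h1
      simpa only [neg_mul, one_mul] using h1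
    · simp only [streamVel_one, streamGrad, one_ne_zero, if_false]
      exact ((h.test t).pd 0).memH1
  div_free := .of_forall fun t => .of_forall fun x => by
    have h0 := pd_comm ((h.test t).1.of_le (coe_le_coe.2 le_top)) x
    simp [streamGrad, gradient_apply, Fin.sum_univ_two, h0]
  no_penetration := .of_forall fun t φ hφ => by
    have h0 := fun x => pd_comm ((h.test t).1.of_le (coe_le_coe.2 le_top)) x
    have h1 : ∀ x, ∑ i : Fin 2, streamGrad ψ t x i i = 0 := fun x => by
      simp [streamGrad, gradient_apply, Fin.sum_univ_two, h0]
    simp only [h1, zero_mul, add_zero]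
    exact integral_fderiv_streamVel (h.test t) hφ

end IsStream

/-- The sum of the squares of the second derivatives. -/
def hessSq (φ : Plane → ℝ) (x : Plane) : ℝ :=
  pd 0 (pd 0 φ) x ^ 2 + 2 * pd 0 (pd 1 φ) x ^ 2 + pd 1 (pd 1 φ) x ^ 2

lemma hessSq_nonneg (φ : Plane → ℝ) (x : Plane) : 0 ≤ hessSq φ x := by unfold hessSq; positivity

lemma sum_enorm_streamGrad_sq (h : Smooth (ψ t)) (x : Plane) :
    ∑ i : Fin 2, ‖streamGrad ψ t x i‖ₑ ^ 2 = ofReal (hessSq (ψ t) x) := by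
  have h0 := pd_comm (h.of_le (coe_le_coe.2 le_top)) x
  have h1 : ∀ v : Plane, ‖v‖ₑ ^ 2 = ofReal (v 0 ^ 2 + v 1 ^ 2) := fun v => by
    rw [← norm_sq_plane, ofReal_pow (norm_nonneg _), ofReal_norm]
  rw [Fin.sum_univ_two, h1, h1, ← ofReal_add (by positivity) (by positivity)]
  congr 1
  simp only [streamGrad, if_true, one_ne_zero, if_false, PiLp.neg_apply, gradient_apply, hessSq,
    ← h0]
  ring

lemma integral_hessSq_pos (h : IsTest φ) (hx : φ x ≠ 0) : 0 < ∫ x, hessSq φ x ∂μD := by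
  have hp : ∀ {φ : Plane → ℝ}, IsTest φ →
      ∫ x, φ x ^ 2 ∂μD ≤ ∫ x, ‖∇ φ x‖ ^ 2 ∂μD := fun h => h.memH10.poincare
  have hg : ∀ (φ : Plane → ℝ) x, ‖∇ φ x‖ ^ 2 = pd 0 φ x ^ 2 + pd 1 φ x ^ 2 := fun φ x => by
    rw [norm_sq_plane, gradient_apply, gradient_apply]
  simp only [hg] at hp
  have hi : ∀ {φ : Plane → ℝ}, IsTest φ → Integrable (fun x => φ x ^ 2) μD := fun h => by
    exact (h.memLp 2).integrable_sq
  have h1 := hp h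
  rw [integral_add (hi (h.pd 0)) (hi (h.pd 1))] at h1
  have h2 := hp (h.pd 0)
  have h3 := hp (h.pd 1)
  have h4 : 0 < ∫ x, φ x ^ 2 ∂μD := by
    rw [integral_disc_eq fun x hx => by rw [h.eq_zero hx]; simp]
    refine Continuous.integral_pos_of_hasCompactSupport_nonneg_nonzero (x := x)
      (h.continuous.pow 2) ?_ (fun x => sq_nonneg _) (by positivity)
    exact h.2.1.mono fun y hy h0 => hy (by simp only [h0, ne_eq, OfNat.ofNat_ne_zero,
      not_false_eq_true, zero_pow])
  refine h4.trans_le (h1.trans ((add_le_add h2 h3).trans (le_of_eq ?_)))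
  have hij : ∀ i j, Integrable (fun x => pd i (pd j φ) x ^ 2) μD := fun i j => hi ((h.pd j).pd i)
  have i1 : Integrable (fun x => pd 0 (pd 0 φ) x ^ 2 + pd 1 (pd 0 φ) x ^ 2) μD :=
    (hij 0 0).add (hij 1 0)
  have i2 : Integrable (fun x => pd 0 (pd 1 φ) x ^ 2 + pd 1 (pd 1 φ) x ^ 2) μD :=
    (hij 0 1).add (hij 1 1)
  rw [← integral_add i1 i2]
  refine integral_ext fun x => ?_
  simp only [hessSq, ← pd_comm (h.1.of_le (coe_le_coe.2 le_top)) x]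
  ring

/-! ### Mollification -/

/-- The convolution of `k` with the extension of `g` by zero outside the disc. -/
def mol (k g : Plane → ℝ) (x : Plane) : ℝ := ∫ y, k (x - y) * g y ∂μD

lemma mol_eq_convolution (k g : Plane → ℝ) :
    mol k g = convolution k (disc.indicator g) (ContinuousLinearMap.mul ℝ ℝ) volume := by
  funext x
  rw [convolution_eq_swap, mol, discMeasure, ← integral_indicator measurableSet_disc]
  refine integral_ext fun y => ?_
  by_cases hy : y ∈ disc <;> simp [hy]

lemma locallyIntegrable_indicator_disc (hg : MemLp g 2 μD) :
    LocallyIntegrable (disc.indicator g) volume := by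
  refine Integrable.locallyIntegrable ((integrable_indicator_iff measurableSet_disc).2 ?_)
  exact hg.integrable (by norm_num)

lemma contDiff_mol (hk : Smooth k) (hc : HasCompactSupport k)
    (hg : MemLp g 2 μD) : Smooth (mol k g) := by
  rw [mol_eq_convolution]
  exact hc.contDiff_convolution_left _ hk (locallyIntegrable_indicator_disc hg)

lemma pd_mol (hk : Smooth k) (hc : HasCompactSupport k)
    (hg : MemLp g 2 μD) (i : Fin 2) : pd i (mol k g) = mol (pd i k) g := by
  funext x
  have hl := locallyIntegrable_indicator_disc hg
  have h1 := hc.hasFDerivAt_convolution_left (ContinuousLinearMap.mul ℝ ℝ)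
    (hk.of_le (m := 1) (by simp)) hl x
  rw [mol_eq_convolution, mol_eq_convolution, pd, h1.fderiv, convolution_eq_swap,
    convolution_eq_swap]
  have h2 : Integrable (fun t => ((ContinuousLinearMap.mul ℝ ℝ).precompL Plane)
      (fderiv ℝ k (x - t)) (disc.indicator g t)) volume := by
    have h3 := (hc.fderiv (𝕜 := ℝ)).convolutionExists_left
      ((ContinuousLinearMap.mul ℝ ℝ).precompL Plane) (hk.continuous_fderiv (by simp)) hl x
    exact h3.integrable_swap
  rw [ContinuousLinearMap.integral_apply h2]
  rfl

lemma exists_bound_mol (hk : Continuous k) (hc : HasCompactSupport k) :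
    ∃ K, 0 ≤ K ∧ ∀ g, MemLp g 2 μD → ∀ x, |mol k g x| ≤ K * √(∫ y, g y ^ 2 ∂μD) := by
  obtain ⟨K, hK⟩ := hc.exists_bound_of_continuous hk
  have hK0 : 0 ≤ K := (norm_nonneg _).trans (hK 0)
  refine ⟨√(∫ _, K ^ 2 ∂μD), sqrt_nonneg _, fun g hg x => ?_⟩
  have hkx : Continuous fun y => k (x - y) := by fun_prop
  have hm : MemLp (fun y => k (x - y)) 2 μD :=
    MemLp.of_bound hkx.aestronglyMeasurable K (.of_forall fun y => hK _)
  refine (abs_integral_mul_le hm hg).trans (mul_le_mul_of_nonneg_right ?_ (sqrt_nonneg _))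
  refine sqrt_le_sqrt (integral_mono ?_ (integrable_const _) fun y => ?_)
  · exact hm.integrable_sq
  · have := hK (x - y)
    rw [norm_eq_abs] at this
    simpa only [sq_abs] using pow_le_pow_left₀ (abs_nonneg _) this 2

lemma pd_comp_sub (k : Plane → ℝ) (hk : Differentiable ℝ k) (x y : Plane) (i : Fin 2) :
    pd i (fun y => k (x - y)) y = - pd i k (x - y) := by
  have h := (hk (x - y)).hasFDerivAt.comp y ((hasFDerivAt_id y).const_sub x)
  have h2 : fderiv ℝ (fun y => k (x - y)) y = _ := h.fderiv
  simp [pd, h2]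

lemma bdist_pos_of_norm_sub_le {y : Plane} (hr : r ≤ 1) (hx : r ≤ bdist x)
    (h : ‖x - y‖ < r / 4) : 0 < bdist y := by
  have h1 : bdist x = 1 - ‖x‖ ^ 2 := by rw [norm_sq_plane]; rfl
  have h2 : bdist y = 1 - ‖y‖ ^ 2 := by rw [norm_sq_plane]; rfl
  have h3 : ‖y‖ ≤ ‖x‖ + ‖x - y‖ := by
    have := norm_sub_le x (x - y)
    rwa [sub_sub_cancel] at this
  have h4 : 0 < r := by linarith [norm_nonneg (x - y)]
  have h5 : ‖x‖ ≤ 1 := by nlinarith [norm_nonneg x]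
  rw [h1] at hx
  rw [h2]
  have h6 : ‖y‖ ^ 2 ≤ (‖x‖ + ‖x - y‖) ^ 2 := pow_le_pow_left₀ (norm_nonneg _) h3 2
  nlinarith [norm_nonneg x, norm_nonneg (x - y)]

lemma MemH1.mol_pd {g : Plane → Plane} (h : MemH1 v g) (hk : Smooth k) (hr0 : 0 < r) (hr : r ≤ 1)
    (hsupp : tsupport k ⊆ closedBall 0 (r / 8)) (hx : r ≤ bdist x)
    (i : Fin 2) : mol (pd i k) v x = mol k (fun y => g y i) x := by
  have hcs : tsupport (fun y => k (x - y)) ⊆ closedBall x (r / 8) := by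
    refine closure_minimal (fun y hy => ?_) Metric.isClosed_closedBall
    have := hsupp (subset_tsupport k hy)
    rw [mem_closedBall_zero_iff] at this
    rwa [mem_closedBall_iff_norm, norm_sub_rev]
  have ht : IsTest fun y => k (x - y) := by
    refine ⟨hk.comp (contDiff_const.sub contDiff_id), ?_, hcs.trans fun y hy => ?_⟩
    · exact (isCompact_closedBall x (r / 8)).of_isClosed_subset (isClosed_tsupport _) hcs
    · rw [mem_closedBall_iff_norm, norm_sub_rev] at hy
      exact (mem_disc_iff y).2 (bdist_pos_of_norm_sub_le hr hx (by linarith))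
  have h1 := h.weak_grad _ ht i
  have h2 : ∀ y, fderiv ℝ (fun y => k (x - y)) y (single i 1)
      = - pd i k (x - y) := fun y => pd_comp_sub k (hk.differentiable (by simp)) x y i
  simp only [h2, mul_neg, integral_neg, neg_inj] at h1
  simp only [mol, mul_comm _ (v _), mul_comm _ (g _ i)]
  exact h1

/-- An even mollifier at scale `h`. -/
structure IsMollifier (k : Plane → ℝ) (h : ℝ) : Prop where
  smooth : Smooth k
  compact : HasCompactSupport k
  supp : tsupport k ⊆ closedBall 0 h
  nonneg : ∀ x, 0 ≤ k x
  even : ∀ x, k (-x) = k x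
  integral : ∫ x, k x = 1

lemma exists_isMollifier (hh : 0 < h) : ∃ k, IsMollifier k h := by
  let φ : ContDiffBump (0 : Plane) := ⟨h / 2, h, by positivity, by linarith⟩
  refine ⟨φ.normed volume, φ.contDiff_normed, φ.hasCompactSupport_normed, ?_,
    φ.nonneg_normed, φ.normed_neg, φ.integral_normed⟩
  rw [φ.tsupport_normed_eq]

namespace IsMollifier

variable {k : Plane → ℝ} {h : ℝ}

lemma eq_zero (hk : IsMollifier k h) (hx : h < ‖x‖) : k x = 0 := by
  by_contra hne
  have := hk.supp (subset_tsupport k hne)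
  rw [mem_closedBall_zero_iff] at this
  linarith

lemma integrable (hk : IsMollifier k h) : Integrable k :=
  hk.smooth.continuous.integrable_of_hasCompactSupport hk.compact

lemma lintegral_sub (hk : IsMollifier k h) (x : Plane) : ∫⁻ y, ofReal (k (x - y)) = 1 := by
  rw [lintegral_sub_left_eq_self (fun y => ofReal (k y)) x,
    ← ofReal_integral_eq_lintegral_ofReal hk.integrable (.of_forall hk.nonneg),
    hk.integral, ofReal_one]

lemma lintegral_le_one (hk : IsMollifier k h) (x : Plane) : ∫⁻ y, ofReal (k (x - y)) ∂μD ≤ 1 :=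
  (lintegral_mono' restrict_le_self le_rfl).trans (hk.lintegral_sub x).le

lemma lintegral_mul_sq_le {α : Type*} [MeasurableSpace α] {μ : Measure α} {w : α → ℝ≥0∞}
    (hw : AEMeasurable w μ) (hw1 : ∫⁻ y, w y ∂μ ≤ 1) {g : α → ℝ≥0∞} (hg : AEMeasurable g μ) :
    (∫⁻ y, w y * g y ∂μ) ^ 2 ≤ ∫⁻ y, w y * g y ^ 2 ∂μ := by
  have h1 := ENNReal.lintegral_mul_le_Lp_mul_Lq μ Real.HolderConjugate.two_two
    (hw.pow_const (1 / 2 : ℝ)) ((hw.pow_const (1 / 2 : ℝ)).mul hg)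
  have h2 : ∀ a : ℝ≥0∞, a ^ (1 / 2 : ℝ) * a ^ (1 / 2 : ℝ) = a := fun a => by
    rw [← ENNReal.rpow_add_of_nonneg _ _ (by norm_num) (by norm_num)]; norm_num
  have h3 : ∀ a b : ℝ≥0∞, (a ^ (1 / 2 : ℝ) * b) ^ (2 : ℝ) = a * b ^ 2 := fun a b => by
    rw [ENNReal.mul_rpow_of_nonneg _ _ (by norm_num), ← ENNReal.rpow_mul]
    norm_num
  have h4 : ∀ a : ℝ≥0∞, (a ^ (1 / 2 : ℝ)) ^ (2 : ℝ) = a := fun a => by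
    rw [← ENNReal.rpow_mul]; norm_num
  simp only [Pi.mul_apply, h3, h4, ← mul_assoc, h2] at h1
  refine (pow_le_pow_left' (h1.trans (mul_le_of_le_one_left' ?_)) 2).trans (le_of_eq ?_)
  · exact ENNReal.rpow_le_one hw1 (by norm_num)
  · rw [← ENNReal.rpow_natCast, ← ENNReal.rpow_mul]; norm_num

lemma enorm_mol_le (hk : IsMollifier k h) (g : Plane → ℝ) (x : Plane) :
    ‖mol k g x‖ₑ ≤ ∫⁻ y, ofReal (k (x - y)) * ‖g y‖ₑ ∂μD := by
  refine (enorm_integral_le_lintegral_enorm _).trans (le_of_eq ?_)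
  refine lintegral_congr fun y => ?_
  rw [enorm_mul, enorm_of_nonneg (hk.nonneg _)]

lemma lintegral_mol_sq_le (hk : IsMollifier k h) (hg : MemLp g 2 μD) :
    ∫⁻ x, ‖mol k g x‖ₑ ^ 2 ∂μD ≤ ∫⁻ x, ‖g x‖ₑ ^ 2 ∂μD := by
  have hkc := hk.smooth.continuous
  have hkm : ∀ x, AEMeasurable (fun y => ofReal (k (x - y))) μD := fun x =>
    (by fun_prop : Continuous fun y => k (x - y)).measurable.ennreal_ofReal.aemeasurable
  have hgm := hg.1.enorm
  calc ∫⁻ x, ‖mol k g x‖ₑ ^ 2 ∂μD ≤ ∫⁻ x, ∫⁻ y, ofReal (k (x - y)) * ‖g y‖ₑ ^ 2 ∂μD ∂μD := by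
        refine lintegral_mono fun x => ?_
        exact (pow_le_pow_left' (hk.enorm_mol_le g x) 2).trans
          (lintegral_mul_sq_le (hkm x) (hk.lintegral_le_one x) hgm)
    _ = ∫⁻ y, ∫⁻ x, ofReal (k (x - y)) * ‖g y‖ₑ ^ 2 ∂μD ∂μD := by
        have m1 : AEMeasurable (fun p : Plane × Plane => ofReal (k (p.1 - p.2)))
            (discMeasure.prod μD) := (by fun_prop : Continuous fun p : Plane × Plane =>
            k (p.1 - p.2)).measurable.ennreal_ofReal.aemeasurable
        have m2 : AEMeasurable (fun p : Plane × Plane => ‖g p.2‖ₑ ^ 2) (discMeasure.prod μD) :=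
          (hgm.pow_const 2).comp_quasiMeasurePreserving Measure.quasiMeasurePreserving_snd
        exact lintegral_lintegral_swap (m1.mul m2)
    _ ≤ ∫⁻ y, ‖g y‖ₑ ^ 2 ∂μD := by
        refine lintegral_mono fun y => ?_
        rw [lintegral_mul_const' _ _ (by simp)]
        refine mul_le_of_le_one_left' ?_
        have h1 : ∀ x, k (x - y) = k (y - x) := fun x => by rw [← hk.even, neg_sub]
        simp only [h1]
        exact hk.lintegral_le_one y

lemma memLp_mol (hk : IsMollifier k h) (hg : MemLp g 2 μD) : MemLp (mol k g) 2 μD :=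
  memLp_two_of_lintegral (contDiff_mol hk.smooth hk.compact hg).continuous.aestronglyMeasurable
    ((hk.lintegral_mol_sq_le hg).trans_lt (lintegral_enorm_sq_lt_top hg))

lemma integral_mol_sq_le (hk : IsMollifier k h) (hg : MemLp g 2 μD) :
    ∫ x, mol k g x ^ 2 ∂μD ≤ ∫ x, g x ^ 2 ∂μD := by
  have h1 := hk.lintegral_mol_sq_le hg
  rw [← ofReal_integral_normSq hg, ← ofReal_integral_normSq (hk.memLp_mol hg)] at h1
  have h2 := (ofReal_le_ofReal_iff (by positivity)).1 h1
  simpa using h2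

lemma integral_mol_mul (hk : IsMollifier k h) (hf : MemLp f 2 μD) (hv : MemLp v 2 μD) :
    ∫ x, mol k f x * v x ∂μD = ∫ x, f x * mol k v x ∂μD := by
  obtain ⟨K, hK⟩ := hk.compact.exists_bound_of_continuous hk.smooth.continuous
  have hkc := hk.smooth.continuous
  have hi : Integrable (fun p : Plane × Plane => k (p.1 - p.2) * (v p.1 * f p.2))
      (discMeasure.prod μD) := by
    refine Integrable.bdd_mul ((hv.integrable (by norm_num)).mul_prod (hf.integrable (by norm_num)))
      (c := K) (by fun_prop : Continuous fun p : Plane × Plane =>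
        k (p.1 - p.2)).aestronglyMeasurable (.of_forall fun p => hK _)
  have h1 : ∀ x, mol k f x * v x = ∫ y, k (x - y) * (v x * f y) ∂μD := fun x => by
    rw [mol, ← integral_mul_const]
    exact integral_ext (fun y => by ring)
  have h2 : ∀ y, f y * mol k v y = ∫ x, k (x - y) * (v x * f y) ∂μD := fun y => by
    rw [mol, ← integral_const_mul]
    refine integral_ext fun x => ?_
    rw [← hk.even (y - x), neg_sub]
    ring
  simp only [h1, h2]
  exact integral_integral_swap hi

end IsMollifier

lemma IsTest.lintegral_translate_le (hv : IsTest v) (z : Plane) :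
    ∫⁻ x, ‖v x - v (x - z)‖ₑ ^ 2 ≤ ‖z‖ₑ ^ 2 * ∫⁻ x, ‖∇ v x‖ₑ ^ 2 := by
  have hgc := hv.continuous_gradient
  have hpt : ∀ x, ‖v x - v (x - z)‖ₑ ^ 2
      ≤ ∫⁻ σ in Ioc (0 : ℝ) 1, ‖z‖ₑ ^ 2 * ‖∇ v (x - σ • z)‖ₑ ^ 2 := by
    intro x
    have hd : ∀ σ : ℝ, HasDerivAt (fun σ : ℝ => v (x - σ • z))
        (- ⟪∇ v (x - σ • z), z⟫) σ := fun σ => by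
      have h1 := (hv.differentiable (x - σ • z)).hasFDerivAt.comp_hasDerivAt σ
        (((hasDerivAt_id σ).smul_const z).const_sub x)
      rw [inner_gradient]
      simpa using! h1
    have hcont : Continuous fun σ : ℝ => - ⟪∇ v (x - σ • z), z⟫ := by fun_prop
    have h1 := intervalIntegral.integral_eq_sub_of_hasDerivAt (a := 0) (b := 1)
      (fun σ _ => hd σ) (hcont.intervalIntegrable _ _)
    simp only [one_smul, zero_smul, sub_zero] at h1
    have h2 : ‖v x - v (x - z)‖ₑ ≤ ∫⁻ σ in Ioc (0 : ℝ) 1, ‖z‖ₑ * ‖∇ v (x - σ • z)‖ₑ := by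
      rw [← enorm_neg, neg_sub, ← h1, integral_of_le zero_le_one]
      refine (enorm_integral_le_lintegral_enorm _).trans (lintegral_mono fun σ => ?_)
      rw [enorm_neg, mul_comm]
      simp only [enorm_eq_nnnorm]
      exact_mod_cast nnnorm_inner_le_nnnorm (𝕜 := ℝ) (∇ v (x - σ • z)) z
    have hm : AEMeasurable (fun σ : ℝ => ‖z‖ₑ * ‖∇ v (x - σ • z)‖ₑ)
        (volume.restrict (Ioc (0 : ℝ) 1)) := ((by fun_prop : Continuous fun σ : ℝ =>
        ∇ v (x - σ • z)).measurable.enorm.const_mul _).aemeasurable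
    have h3 := IsMollifier.lintegral_mul_sq_le (μ := volume.restrict (Ioc (0 : ℝ) 1))
      (w := fun _ => 1) aemeasurable_const (by simp) hm
    simp only [one_mul, mul_pow] at h3
    exact (pow_le_pow_left' h2 2).trans h3
  calc ∫⁻ x, ‖v x - v (x - z)‖ₑ ^ 2
      ≤ ∫⁻ x, ∫⁻ σ in Ioc (0 : ℝ) 1, ‖z‖ₑ ^ 2 * ‖∇ v (x - σ • z)‖ₑ ^ 2 := lintegral_mono hpt
    _ = ∫⁻ σ in Ioc (0 : ℝ) 1, ∫⁻ x, ‖z‖ₑ ^ 2 * ‖∇ v (x - σ • z)‖ₑ ^ 2 := by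
        refine lintegral_lintegral_swap (Measurable.aemeasurable ?_)
        exact ((by fun_prop : Continuous fun p : Plane × ℝ =>
          ∇ v (p.1 - p.2 • z)).measurable.enorm.pow_const 2).const_mul _
    _ = ∫⁻ σ in Ioc (0 : ℝ) 1, ‖z‖ₑ ^ 2 * ∫⁻ x, ‖∇ v x‖ₑ ^ 2 := by
        refine lintegral_congr fun σ => ?_
        rw [lintegral_const_mul' _ _ (by simp)]
        congr 1
        exact lintegral_sub_right_eq_self (fun x => ‖∇ v x‖ₑ ^ 2) (σ • z)
    _ = _ := by simp

namespace IsMollifier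

variable {k : Plane → ℝ} {h : ℝ}

lemma lintegral_sub_mol_sq_le (hk : IsMollifier k h) (hv : IsTest v) :
    ∫⁻ x, ‖v x - mol k v x‖ₑ ^ 2 ≤ ofReal h ^ 2 * ∫⁻ x, ‖∇ v x‖ₑ ^ 2 := by
  have hkc := hk.smooth.continuous
  have hvc := hv.continuous
  have hpt : ∀ x, ‖v x - mol k v x‖ₑ ^ 2 ≤ ∫⁻ z, ofReal (k z) * ‖v x - v (x - z)‖ₑ ^ 2 := by
    intro x
    have e1 : mol k v x = ∫ z, k z * v (x - z) := by
      rw [mol, integral_disc_eq fun y hy => by rw [hv.eq_zero hy, mul_zero],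
        ← integral_sub_left_eq_self _ volume x]
      simp
    have i1 : Integrable fun z => k z * v x := hk.integrable.mul_const _
    have i2 : Integrable fun z => k z * v (x - z) :=
      (by fun_prop : Continuous fun z => k z * v (x - z)).integrable_of_hasCompactSupport
        (hk.compact.mono fun z hz h0 => hz (by simp only [h0, zero_mul]))
    have e2 : v x - mol k v x = ∫ z, k z * (v x - v (x - z)) := by
      have e3 : v x = ∫ z, k z * v x := by rw [integral_mul_const, hk.integral, one_mul]
      rw [e1]
      nth_rewrite 1 [e3]
      rw [← integral_sub i1 i2]
      simp only [mul_sub]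
    have h2 : ‖v x - mol k v x‖ₑ ≤ ∫⁻ z, ofReal (k z) * ‖v x - v (x - z)‖ₑ := by
      rw [e2]
      refine (enorm_integral_le_lintegral_enorm _).trans (le_of_eq (lintegral_congr fun z => ?_))
      rw [enorm_mul, enorm_of_nonneg (hk.nonneg _)]
    have hw1 : ∫⁻ z, ofReal (k z) ≤ 1 := by
      rw [← ofReal_integral_eq_lintegral_ofReal hk.integrable (.of_forall hk.nonneg),
        hk.integral, ofReal_one]
    exact (pow_le_pow_left' h2 2).trans
      (lintegral_mul_sq_le hkc.measurable.ennreal_ofReal.aemeasurable hw1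
        (by fun_prop : Continuous fun z => v x - v (x - z)).measurable.enorm.aemeasurable)
  calc ∫⁻ x, ‖v x - mol k v x‖ₑ ^ 2
      ≤ ∫⁻ x, ∫⁻ z, ofReal (k z) * ‖v x - v (x - z)‖ₑ ^ 2 := lintegral_mono hpt
    _ = ∫⁻ z, ∫⁻ x, ofReal (k z) * ‖v x - v (x - z)‖ₑ ^ 2 := by
        refine lintegral_lintegral_swap (Measurable.aemeasurable ?_)
        exact ((by fun_prop : Continuous fun p : Plane × Plane =>
          k p.2).measurable.ennreal_ofReal).mul ((by fun_prop : Continuous fun p : Plane × Plane =>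
            v p.1 - v (p.1 - p.2)).measurable.enorm.pow_const 2)
    _ ≤ ∫⁻ z, ofReal (k z) * (ofReal h ^ 2 * ∫⁻ x, ‖∇ v x‖ₑ ^ 2) := by
        refine lintegral_mono fun z => ?_
        rw [lintegral_const_mul' _ _ (by simp)]
        by_cases hz : h < ‖z‖
        · simp [hk.eq_zero hz]
        · refine mul_le_mul_right ((hv.lintegral_translate_le z).trans ?_) _
          refine mul_le_mul_left (pow_le_pow_left' ?_ 2) _
          rw [← ofReal_norm]
          exact ofReal_le_ofReal (not_lt.1 hz)
    _ = _ := by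
        rw [lintegral_mul_const _ hkc.measurable.ennreal_ofReal,
          ← ofReal_integral_eq_lintegral_ofReal hk.integrable (.of_forall hk.nonneg),
          hk.integral, ofReal_one, one_mul]

lemma integral_sub_mol_sq_le (hk : IsMollifier k h) (hh : 0 ≤ h) (hv : IsTest v) :
    ∫ x, (v x - mol k v x) ^ 2 ∂μD ≤ h ^ 2 * ∫ x, ‖∇ v x‖ ^ 2 ∂μD := by
  have hm : MemLp (fun x => v x - mol k v x) 2 μD := (hv.memLp 2).sub (hk.memLp_mol (hv.memLp 2))
  have h1 : ∫⁻ x, ‖∇ v x‖ₑ ^ 2 = ∫⁻ x, ‖∇ v x‖ₑ ^ 2 ∂μD := by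
    rw [discMeasure, ← lintegral_indicator measurableSet_disc]
    refine lintegral_congr fun x => ?_
    by_cases hx : x ∈ disc
    · simp [hx]
    · simp [hx, hv.gradient_eq_zero hx]
  have h2 : ∫⁻ x, ‖v x - mol k v x‖ₑ ^ 2 ∂μD ≤ ofReal h ^ 2 * ∫⁻ x, ‖∇ v x‖ₑ ^ 2 ∂μD := by
    rw [← h1]
    exact (lintegral_mono' restrict_le_self le_rfl).trans (hk.lintegral_sub_mol_sq_le hv)
  rw [← ofReal_integral_normSq (hv.memLp_gradient 2), ← ofReal_integral_normSq hm,
    ← ofReal_pow hh, ← ofReal_mul (by positivity)] at h2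
  have h3 := (ofReal_le_ofReal_iff (mul_nonneg (sq_nonneg _)
    (by positivity))).1 h2
  simpa using h3

lemma abs_integral_sub_mol_le (hk : IsMollifier k h) (hh : 0 ≤ h)
    (hf : MemLp f 2 μD) (hv : IsTest v) : |∫ x, f x * v x ∂μD - ∫ x, mol k f x * v x ∂μD|
      ≤ h * √(∫ x, f x ^ 2 ∂μD) * √(∫ x, ‖∇ v x‖ ^ 2 ∂μD) := by
  have hm := hk.memLp_mol (hv.memLp 2)
  have hm' : MemLp (fun x => v x - mol k v x) 2 μD := (hv.memLp 2).sub hm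
  rw [hk.integral_mol_mul hf (hv.memLp 2), ← integral_sub (integrable_mul_L2 hf (hv.memLp 2))
    (integrable_mul_L2 hf hm)]
  simp only [← mul_sub]
  refine (abs_integral_mul_le hf hm').trans ?_
  have h1 := sqrt_le_sqrt (hk.integral_sub_mol_sq_le hh hv)
  rw [sqrt_mul (sq_nonneg _), sqrt_sq hh] at h1
  calc _ ≤ √(∫ x, f x ^ 2 ∂μD) * (h * √(∫ x, ‖∇ v x‖ ^ 2 ∂μD)) :=
        mul_le_mul_of_nonneg_left h1 (sqrt_nonneg _)
    _ = _ := by ring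

end IsMollifier

/-! ### Horizontal primitives -/

/-- `(s x₀, x₁)`. -/
def squeeze (s : ℝ) (x : Plane) : Plane :=
  x + ((s - 1) * x 0) • single (0 : Fin 2) (1 : ℝ)

/-- The integral of `g` over the horizontal segment from the vertical axis. -/
def hprim (g : Plane → ℝ) (x : Plane) : ℝ := x 0 * ∫ s in (0 : ℝ)..1, g (squeeze s x)

lemma squeeze_zero (s : ℝ) (x : Plane) : squeeze s x 0 = s * x 0 := by simp [squeeze]; ring

lemma squeeze_one (s : ℝ) (x : Plane) : squeeze s x 1 = x 1 := by simp [squeeze]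

lemma bdist_le_bdist_squeeze (hs : s ∈ Icc (0 : ℝ) 1) (x : Plane) :
    bdist x ≤ bdist (squeeze s x) := by
  simp only [bdist, squeeze_zero, squeeze_one]
  have h1 : s ^ 2 ≤ 1 := pow_le_one₀ hs.1 hs.2
  nlinarith [sq_nonneg (x 0)]

lemma contDiff_squeeze : Smooth fun p : ℝP => squeeze p.1 p.2 := by
  have h0 : Smooth fun p : ℝP => p.2 0 := (contDiff_coord 0).comp contDiff_snd
  exact contDiff_snd.add (((contDiff_fst.sub contDiff_const).mul h0).smul contDiff_const)

lemma continuous_squeeze : Continuous fun p : ℝP => squeeze p.1 p.2 := contDiff_squeeze.continuous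

lemma contDiff_hprim (hg : Smooth g) : Smooth (hprim g) :=
  (contDiff_coord 0).mul (contDiff_param_integral (F := fun p : ℝP => g (squeeze p.1 p.2))
    (hg.comp contDiff_squeeze))

/-- `(a, b)` as a point of the plane. -/
def pt (a b : ℝ) : Plane := toLp 2 ![a, b]

lemma pt_zero (a b : ℝ) : pt a b 0 = a := rfl

lemma pt_one (a b : ℝ) : pt a b 1 = b := rfl

lemma pt_coord (x : Plane) : pt (x 0) (x 1) = x := by ext i; fin_cases i <;> rfl

lemma continuous_pt : Continuous fun p : ℝ × ℝ => pt p.1 p.2 := by unfold pt; fun_prop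

lemma continuous_pt_left (b : ℝ) : Continuous fun a : ℝ => pt a b :=
  continuous_pt.comp (continuous_id.prodMk continuous_const)

lemma hprim_eq_intervalIntegral (x : Plane) : hprim g x = ∫ y in (0 : ℝ)..x 0, g (pt y (x 1)) := by
  have h1 : ∀ s, squeeze s x = pt (s * x 0) (x 1) := fun s => by
    rw [← pt_coord (squeeze s x), squeeze_zero, squeeze_one]
  have h2 := intervalIntegral.mul_integral_comp_mul_right (a := 0) (b := 1)
    (f := fun y => g (pt y (x 1))) (c := x 0)
  rw [zero_mul, one_mul] at h2
  simp only [hprim, h1]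
  exact h2

lemma pd_zero_hprim (hg : Smooth g) : pd 0 (hprim g) = g := by
  funext x
  have h1 : HasDerivAt (fun y : ℝ => pt y (x 1)) (single (0 : Fin 2) (1 : ℝ)) (x 0) := by
    have h2 : (fun y : ℝ => pt y (x 1))
        = fun y : ℝ => pt 0 (x 1) + y • single (0 : Fin 2) (1 : ℝ) := by
      funext y; ext i; fin_cases i <;> simp [pt]
    rw [h2]
    simpa using! ((hasDerivAt_id (x 0)).smul_const
      (single (0 : Fin 2) (1 : ℝ))).const_add (pt 0 (x 1))
  have h3 : HasFDerivAt (hprim g) (fderiv ℝ (hprim g) x) (pt (x 0) (x 1)) := by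
    rw [pt_coord]
    exact ((contDiff_hprim hg).differentiable (by simp) x).hasFDerivAt
  have h4 := h3.comp_hasDerivAt (x 0) h1
  have hc : Continuous fun y => g (pt y (x 1)) := hg.continuous.comp (continuous_pt_left _)
  have h5 : HasDerivAt (fun a => ∫ y in (0 : ℝ)..a, g (pt y (x 1))) (g (pt (x 0) (x 1))) (x 0) :=
    integral_hasDerivAt_right (hc.intervalIntegrable _ _)
      (hc.stronglyMeasurableAtFilter _ _) hc.continuousAt
  have h6 : (hprim g ∘ fun y => pt y (x 1)) = fun a => ∫ y in (0 : ℝ)..a, g (pt y (x 1)) := by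
    funext a
    simp only [Function.comp_apply, hprim_eq_intervalIntegral, pt_zero, pt_one]
  rw [h6] at h4
  have h7 := h4.unique h5
  rwa [pt_coord] at h7

lemma pd_one_hprim (hg : Smooth g) : pd 1 (hprim g) = hprim (pd 1 g) := by
  funext x
  have hF : Smooth fun p : ℝP => g (squeeze p.1 p.2) := hg.comp contDiff_squeeze
  have h1 := contDiff_param_integral hF
  have h2 : pd 1 (hprim g) x = x 0 * pd 1 (fun x => ∫ s in (0 : ℝ)..1, g (squeeze s x)) x := by
    refine (pd_mul 1 ((contDiff_coord 0 (n := 1)).differentiable (by simp) x)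
      (h1.differentiable (by simp) x)).trans ?_
    rw [pd_coord]; simp
  rw [h2, hprim, pd, fderiv_param_integral (hF.of_le (by simp))]
  congr 1
  refine integral_congr fun s _ => ?_
  have h3 : HasFDerivAt (fun y => g (squeeze s y))
      ((fderiv ℝ (fun p : ℝP => g (squeeze p.1 p.2)) (s, x)).comp (inr ℝ ℝ Plane)) x :=
    ((hF.differentiable (by simp) (s, x)).hasFDerivAt).comp x (hasFDerivAt_prodMk_right s x)
  have h4 : HasDerivAt (fun τ : ℝ => g (squeeze s (x + τ • single (1 : Fin 2) 1)))
      (fderiv ℝ g (squeeze s x) (single 1 1)) 0 := by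
    have h5 : (fun τ : ℝ => g (squeeze s (x + τ • single (1 : Fin 2) 1)))
        = g ∘ fun τ : ℝ => squeeze s x + τ • single (1 : Fin 2) 1 := by
      funext τ; simp [squeeze, add_right_comm]
    rw [h5]
    have h6 : HasDerivAt (fun τ : ℝ => squeeze s x + τ • single (1 : Fin 2) (1 : ℝ))
        (single (1 : Fin 2) (1 : ℝ)) 0 := by
      simpa using! ((hasDerivAt_id (0 : ℝ)).smul_const
        (single (1 : Fin 2) (1 : ℝ))).const_add (squeeze s x)
    have h7 : HasFDerivAt g (fderiv ℝ g (squeeze s x))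
        (squeeze s x + (0 : ℝ) • single (1 : Fin 2) (1 : ℝ)) := by
      rw [zero_smul, add_zero]
      exact (hg.differentiable (by simp) _).hasFDerivAt
    exact h7.comp_hasDerivAt 0 h6
  have h8 : HasDerivAt (fun τ : ℝ => x + τ • single (1 : Fin 2) (1 : ℝ))
        (single (1 : Fin 2) (1 : ℝ)) 0 := by
    simpa using! ((hasDerivAt_id (0 : ℝ)).smul_const (single (1 : Fin 2) (1 : ℝ))).const_add x
  have h9 : HasFDerivAt (fun y => g (squeeze s y))
      ((fderiv ℝ (fun p : ℝP => g (squeeze p.1 p.2)) (s, x)).comp (inr ℝ ℝ Plane))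
        (x + (0 : ℝ) • single (1 : Fin 2) (1 : ℝ)) := by rwa [zero_smul, add_zero]
  have h11 : HasDerivAt (fun τ : ℝ => g (squeeze s (x + τ • single (1 : Fin 2) 1))) _ 0 :=
    HasFDerivAt.comp_hasDerivAt (l := fun y => g (squeeze s y)) 0 h9 h8
  have h10 := h11.unique h4
  simpa [pd] using h10

lemma abs_hprim_le (hK : ∀ x, |g x| ≤ K) (hx : x ∈ disc) : |hprim g x| ≤ K := by
  have hK0 : 0 ≤ K := (abs_nonneg _).trans (hK 0)
  have h1 : |x 0| ≤ 1 := by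
    have := sq_add_sq_lt_one hx
    exact abs_le_one_iff_mul_self_le_one.2 (by nlinarith [sq_nonneg (x 1)])
  have h2 : ‖∫ s in (0 : ℝ)..1, g (squeeze s x)‖ ≤ K * |1 - 0| :=
    intervalIntegral.norm_integral_le_of_norm_le_const fun s _ => hK _
  rw [sub_zero, abs_one, mul_one, norm_eq_abs] at h2
  rw [hprim, abs_mul]
  calc _ ≤ 1 * K := mul_le_mul h1 h2 (abs_nonneg _) zero_le_one
    _ = K := one_mul K

lemma hprim_congr (hx : r ≤ bdist x)
    (h : ∀ y, r ≤ bdist y → g y = g' y) : hprim g x = hprim g' x := by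
  unfold hprim
  congr 1
  refine integral_congr fun s hs => h _ ?_
  rw [uIcc_of_le zero_le_one] at hs
  exact hx.trans (bdist_le_bdist_squeeze hs x)

/-! ### Weighted bounds for horizontal primitives -/

lemma lintegral_disc {F : Plane → ℝ≥0∞} (hF : Measurable F) : ∫⁻ x, F x ∂μD
      = ∫⁻ b, ∫⁻ a in {a : ℝ | a ^ 2 + b ^ 2 < 1}, F (pt a b) := by
  have hp : MeasurePreserving (fun p : ℝ × ℝ => pt p.1 p.2) (volume.prod volume) volume := by
    have h1 := (PiLp.volume_preserving_toLp (Fin 2)).comp (volume_preserving_finTwoArrow ℝ).symm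
    exact h1
  have hmem : ∀ a b : ℝ, pt a b ∈ disc ↔ a ^ 2 + b ^ 2 < 1 := fun a b => by
    rw [mem_disc_iff, bdist, pt_zero, pt_one, sub_pos]
  rw [discMeasure, ← lintegral_indicator measurableSet_disc,
    ← hp.lintegral_comp (hF.indicator measurableSet_disc),
    lintegral_prod_symm (fun p : ℝ × ℝ => disc.indicator F (pt p.1 p.2))
      ((hF.indicator measurableSet_disc).comp hp.measurable).aemeasurable]
  refine lintegral_congr fun b => ?_
  have hs : MeasurableSet {a : ℝ | a ^ 2 + b ^ 2 < 1} :=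
    (isOpen_lt (by fun_prop) continuous_const).measurableSet
  rw [← lintegral_indicator hs]
  refine lintegral_congr fun a => ?_
  by_cases h : a ^ 2 + b ^ 2 < 1
  · rw [indicator_of_mem ((hmem a b).2 h), indicator_of_mem
      (show a ∈ {a : ℝ | a ^ 2 + b ^ 2 < 1} from h)]
  · rw [indicator_of_notMem (mt (hmem a b).1 h), indicator_of_notMem
      (show a ∉ {a : ℝ | a ^ 2 + b ^ 2 < 1} from h)]

lemma sq_lintegral_le {α : Type*} [MeasurableSpace α] {μ : Measure α} {g : α → ℝ≥0∞}
    (hg : AEMeasurable g μ) : (∫⁻ y, g y ∂μ) ^ 2 ≤ μ univ * ∫⁻ y, g y ^ 2 ∂μ := by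
  have h1 := ENNReal.lintegral_mul_le_Lp_mul_Lq μ Real.HolderConjugate.two_two
    (aemeasurable_const (b := (1 : ℝ≥0∞))) hg
  simp only [Pi.mul_apply, one_mul, ENNReal.one_rpow, lintegral_const] at h1
  refine (pow_le_pow_left' h1 2).trans (le_of_eq ?_)
  rw [mul_pow, ← ENNReal.rpow_natCast, ← ENNReal.rpow_mul, ← ENNReal.rpow_natCast,
    ← ENNReal.rpow_mul]
  norm_num

lemma enorm_hprim_sq_le (hg : Continuous g) (h : a ^ 2 + b ^ 2 < 1) : ‖hprim g (pt a b)‖ₑ ^ 2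
      ≤ ofReal |a| * ∫⁻ y in {a : ℝ | a ^ 2 + b ^ 2 < 1}, ‖g (pt y b)‖ₑ ^ 2 := by
  rw [hprim_eq_intervalIntegral, pt_zero, pt_one]
  have hc : Continuous fun y => g (pt y b) := hg.comp (continuous_pt_left b)
  have h1 : ‖∫ y in (0 : ℝ)..a, g (pt y b)‖ₑ ≤ ∫⁻ y in uIoc 0 a, ‖g (pt y b)‖ₑ := by
    have h2 : ‖∫ y in (0 : ℝ)..a, g (pt y b)‖ₑ = ‖∫ y in uIoc 0 a, g (pt y b)‖ₑ := by
      rw [← ofReal_norm, ← ofReal_norm, intervalIntegral.norm_intervalIntegral_eq]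
    rw [h2]
    exact enorm_integral_le_lintegral_enorm _
  refine (pow_le_pow_left' h1 2).trans ((sq_lintegral_le hc.measurable.enorm.aemeasurable).trans ?_)
  refine mul_le_mul' (le_of_eq ?_) (lintegral_mono_set fun y hy => ?_)
  · rw [Measure.restrict_apply_univ, Real.volume_uIoc, sub_zero]
  · have h3 : |y| ≤ |a| := by
      rcases le_total 0 a with ha | ha
      · rw [uIoc_of_le ha] at hy
        rw [abs_of_pos hy.1, abs_of_nonneg ha]; exact hy.2
      · rw [uIoc_of_ge ha] at hy
        rw [abs_of_nonpos hy.2, abs_of_nonpos ha]; linarith [hy.1]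
    have h4 := sq_le_sq.2 h3
    change y ^ 2 + b ^ 2 < 1
    linarith

lemma lintegral_abs_mul_le (w : ℝ → ℝ≥0∞) (b : ℝ) :
    ∫⁻ a in {a : ℝ | a ^ 2 + b ^ 2 < 1}, ofReal |a| * w (1 - (a ^ 2 + b ^ 2))
      ≤ 2 * ∫⁻ s in Ioo (0 : ℝ) 1, w s := by
  let A : Set ℝ := {a : ℝ | a ^ 2 + b ^ 2 < 1}
  have hA : MeasurableSet A := (isOpen_lt (by fun_prop) continuous_const).measurableSet
  have key : ∀ J : Set ℝ, MeasurableSet J → (∀ x ∈ J, x ≠ 0) →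
      InjOn (fun a : ℝ => 1 - (a ^ 2 + b ^ 2)) J →
      ∫⁻ a in A ∩ J, ofReal |a| * w (1 - (a ^ 2 + b ^ 2)) ≤ ∫⁻ s in Ioo (0 : ℝ) 1, w s := by
    intro J hJ hJ0 hinj
    have hd : ∀ a ∈ A ∩ J, HasDerivWithinAt (fun a : ℝ => 1 - (a ^ 2 + b ^ 2)) (-(2 * a))
        (A ∩ J) a := fun a _ => by
      have := (((hasDerivAt_pow 2 a).add_const (b ^ 2)).const_sub 1).hasDerivWithinAt (s := A ∩ J)
      simpa using this
    have h1 := lintegral_image_eq_lintegral_abs_deriv_mul (hA.inter hJ) hd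
      (hinj.mono inter_subset_right) w
    calc _ ≤ ∫⁻ a in A ∩ J, ofReal |-(2 * a)| * w (1 - (a ^ 2 + b ^ 2)) := by
          refine lintegral_mono fun a => mul_le_mul_left (ofReal_le_ofReal ?_) _
          rw [abs_neg, abs_mul, abs_two]
          linarith [abs_nonneg a]
      _ = _ := h1.symm
      _ ≤ _ := by
          refine lintegral_mono_set ?_
          rintro _ ⟨a, ⟨ha, haJ⟩, rfl⟩
          have h2 : a ^ 2 + b ^ 2 < 1 := ha
          have h3 : 0 < a ^ 2 := by have := hJ0 a haJ; positivity
          constructor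
          · simp only; linarith
          · simp only; linarith [sq_nonneg b]
  have h1 := key (Ioi 0) measurableSet_Ioi (fun x hx => ne_of_gt hx) (by
    intro x hx y hy hxy
    simp only at hxy
    exact (pow_left_inj₀ (le_of_lt hx) (le_of_lt hy) two_ne_zero).1 (by linarith))
  have h2 := key (Iio 0) measurableSet_Iio (fun x hx => ne_of_lt hx) (by
    intro x hx y hy hxy
    simp only at hxy
    have h3 : (-x) ^ 2 = (-y) ^ 2 := by rw [neg_sq, neg_sq]; linarith
    have h4 := (pow_left_inj₀ (neg_nonneg.2 (le_of_lt hx)) (neg_nonneg.2 (le_of_lt hy))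
      two_ne_zero).1 h3
    linarith)
  have hsub : A ≤ᵐ[volume] ((A ∩ Ioi 0) ∪ (A ∩ Iio 0) : Set ℝ) := by
    have : ∀ᵐ a : ℝ, a ≠ 0 := by simp [ae_iff]
    filter_upwards [this] with a ha haA
    rcases lt_or_gt_of_ne ha with h | h
    · exact Or.inr ⟨haA, h⟩
    · exact Or.inl ⟨haA, h⟩
  calc _ ≤ ∫⁻ a in (A ∩ Ioi 0) ∪ (A ∩ Iio 0), ofReal |a| * w (1 - (a ^ 2 + b ^ 2)) :=
        lintegral_mono_set' hsub
    _ ≤ _ := lintegral_union_le _ _ _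
    _ ≤ _ := by rw [two_mul]; exact add_le_add h1 h2

lemma lintegral_hprim_sq_le (hg : Smooth g) {w : ℝ → ℝ≥0∞}
    (hw : Measurable w) : ∫⁻ x, ‖hprim g x‖ₑ ^ 2 * w (bdist x) ∂μD
      ≤ (2 * ∫⁻ s in Ioo (0 : ℝ) 1, w s) * ∫⁻ x, ‖g x‖ₑ ^ 2 ∂μD := by
  have hgc := hg.continuous
  have hb : Measurable bdist := (contDiff_bdist (n := 0)).continuous.measurable
  have m1 : Measurable fun x => ‖hprim g x‖ₑ ^ 2 * w (bdist x) :=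
    ((contDiff_hprim hg).continuous.measurable.enorm.pow_const 2).mul (hw.comp hb)
  have m2 : Measurable fun x => ‖g x‖ₑ ^ 2 := hgc.measurable.enorm.pow_const 2
  rw [lintegral_disc m1, lintegral_disc m2]
  have m3 : Measurable fun b : ℝ => ∫⁻ a in {a : ℝ | a ^ 2 + b ^ 2 < 1}, ‖g (pt a b)‖ₑ ^ 2 := by
    have h1 : ∀ b : ℝ, ∫⁻ a in {a : ℝ | a ^ 2 + b ^ 2 < 1}, ‖g (pt a b)‖ₑ ^ 2
        = ∫⁻ a, {p : ℝ × ℝ | p.1 ^ 2 + p.2 ^ 2 < 1}.indicator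
          (fun p => ‖g (pt p.1 p.2)‖ₑ ^ 2) (a, b) := fun b => by
      rw [← lintegral_indicator (isOpen_lt (by fun_prop) continuous_const).measurableSet]
      rfl
    simp only [h1]
    refine Measurable.lintegral_prod_left' (Measurable.indicator ?_ ?_)
    · exact (hgc.comp continuous_pt).measurable.enorm.pow_const 2
    · exact (isOpen_lt (by fun_prop) continuous_const).measurableSet
  rw [← lintegral_const_mul _ m3]
  refine lintegral_mono fun b => ?_
  set N := ∫⁻ a in {a : ℝ | a ^ 2 + b ^ 2 < 1}, ‖g (pt a b)‖ₑ ^ 2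
  have hA : MeasurableSet {a : ℝ | a ^ 2 + b ^ 2 < 1} :=
    (isOpen_lt (by fun_prop) continuous_const).measurableSet
  have m4 : Measurable fun a : ℝ => ofReal |a| * w (1 - (a ^ 2 + b ^ 2)) :=
    (measurable_id.abs.ennreal_ofReal).mul (hw.comp (by fun_prop))
  calc ∫⁻ a in {a : ℝ | a ^ 2 + b ^ 2 < 1}, ‖hprim g (pt a b)‖ₑ ^ 2 * w (bdist (pt a b))
      ≤ ∫⁻ a in {a : ℝ | a ^ 2 + b ^ 2 < 1}, ofReal |a| * w (1 - (a ^ 2 + b ^ 2)) * N := by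
        refine setLIntegral_mono' hA fun a ha => ?_
        rw [mul_right_comm]
        exact mul_le_mul_left (enorm_hprim_sq_le hgc ha) _
    _ = (∫⁻ a in {a : ℝ | a ^ 2 + b ^ 2 < 1},
          ofReal |a| * w (1 - (a ^ 2 + b ^ 2))) * N := lintegral_mul_const _ m4
    _ ≤ _ := mul_le_mul_left (lintegral_abs_mul_le w b) _

lemma memLp_of_sq_le_hprim (hg : Smooth g) (hg2 : MemLp g 2 μD)
    {w : ℝ → ℝ} (hw : Measurable w) (hw0 : ∀ s, 0 ≤ w s) (hL : 0 ≤ L)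
    (hwL : ∫⁻ s in Ioo (0 : ℝ) 1, ofReal (w s) ≤ ofReal L) (hZ : AEStronglyMeasurable Z μD)
    (h : ∀ x ∈ disc, Z x ^ 2 ≤ hprim g x ^ 2 * w (bdist x)) :
    MemLp Z 2 μD ∧ ∫ x, Z x ^ 2 ∂μD ≤ 2 * L * ∫ x, g x ^ 2 ∂μD := by
  have e1 : ∀ a : ℝ, ‖a‖ₑ ^ 2 = ofReal (a ^ 2) := fun a => by
    rw [← ofReal_norm, ← ofReal_pow (norm_nonneg _), norm_eq_abs, sq_abs]
  have h1 : ∫⁻ x, ‖Z x‖ₑ ^ 2 ∂μD ≤ (2 * ofReal L) * ∫⁻ x, ‖g x‖ₑ ^ 2 ∂μD := by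
    calc _ ≤ ∫⁻ x, ‖hprim g x‖ₑ ^ 2 * ofReal (w (bdist x)) ∂μD := by
          refine setLIntegral_mono' measurableSet_disc fun x hx => ?_
          rw [e1, e1, ← ofReal_mul (sq_nonneg _)]
          exact ofReal_le_ofReal (h x hx)
      _ ≤ _ := lintegral_hprim_sq_le hg hw.ennreal_ofReal
      _ ≤ _ := mul_le_mul_left (mul_le_mul_right hwL _) _
  have h2 : MemLp Z 2 μD := memLp_two_of_lintegral hZ (h1.trans_lt
    (mul_lt_top (mul_lt_top (by simp) (by simp)) (lintegral_enorm_sq_lt_top hg2)))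
  refine ⟨h2, ?_⟩
  rw [← ofReal_integral_normSq hg2, ← ofReal_integral_normSq h2,
    show (2 : ℝ≥0∞) * ofReal L = ofReal (2 * L) by
      rw [ofReal_mul (by norm_num), ENNReal.ofReal_ofNat], ← ofReal_mul (by positivity)] at h1
  have h3 := (ofReal_le_ofReal_iff (mul_nonneg (by positivity)
    (by positivity))).1 h1
  simpa using h3

lemma lintegral_indicator_Iio_le (δ : ℝ) :
    ∫⁻ s in Ioo (0 : ℝ) 1, ofReal ((Iio δ).indicator (fun _ => 1) s) ≤ ofReal δ := by
  calc _ ≤ ∫⁻ s in Ioi (0 : ℝ), (Iio δ).indicator (fun _ => 1) s := by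
        refine (lintegral_mono_set Ioo_subset_Ioi_self).trans (lintegral_mono fun s => ?_)
        by_cases h : s ∈ Iio δ <;> simp [h]
    _ = _ := by
        rw [lintegral_indicator_const measurableSet_Iio, Measure.restrict_apply measurableSet_Iio,
          one_mul, inter_comm, Ioi_inter_Iio, Real.volume_Ioo, sub_zero]

lemma lintegral_inv_le (hr : 0 < r) (hr1 : r ≤ 1) :
    ∫⁻ s in Ioo (0 : ℝ) 1, ofReal ((Ici r).indicator (fun s => s⁻¹) s) ≤ ofReal (log (1 / r)) := by
  have hi : IntervalIntegrable (fun s : ℝ => s⁻¹) volume r 1 := by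
    refine intervalIntegral.intervalIntegrable_inv (fun x hx => ?_) continuousOn_id
    rw [uIcc_of_le hr1] at hx
    exact ne_of_gt (hr.trans_le hx.1)
  rw [intervalIntegrable_iff_integrableOn_Icc_of_le hr1] at hi
  have h1 : ∫ s in Icc r 1, s⁻¹ = log (1 / r) := by
    rw [integral_Icc_eq_integral_Ioc, ← integral_of_le hr1, integral_inv_of_pos hr one_pos]
  rw [← h1, ofReal_integral_eq_lintegral_ofReal hi ((ae_restrict_mem measurableSet_Icc).mono
    fun s hs => inv_nonneg.2 (hr.le.trans hs.1)), ← lintegral_indicator measurableSet_Icc,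
    ← lintegral_indicator measurableSet_Ioo]
  refine lintegral_mono fun s => ?_
  by_cases h : s ∈ Ioo (0 : ℝ) 1
  · by_cases h2 : r ≤ s
    · have h3 : s ∈ Icc r 1 := ⟨h2, h.2.le⟩
      simp [h.1, h.2, h2, h.2.le]
    · simp [h2]
  · simp [h]

/-! ### Sums of oscillating boundary layers -/

/-- `β` is bounded by `K` and supported in `[1/4, 4]`. -/
structure SuppBdd (β : ℝ → ℝ) (K : ℝ) : Prop where
  bound : ∀ y, |β y| ≤ K
  supp : ∀ y, y ∉ Icc (1 / 4 : ℝ) 4 → β y = 0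

lemma eventually_suppBdd {β : ℝ → ℝ} (h : Smooth β) (h0 : ∀ y, y ∉ Icc (1 / 4 : ℝ) 4 → β y = 0) :
    ∀ᶠ K in atTop, SuppBdd β K ∧ SuppBdd (deriv β) K ∧ SuppBdd (deriv (deriv β)) K := by
  have hb : ∀ β : ℝ → ℝ, Smooth β → (∀ y, y ∉ Icc (1 / 4 : ℝ) 4 → β y = 0) →
      (Smooth (deriv β) ∧ ∀ y, y ∉ Icc (1 / 4 : ℝ) 4 → deriv β y = 0) ∧
        ∀ᶠ K in atTop, SuppBdd β K := fun β hs h0 => by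
    obtain ⟨K, hK⟩ := isCompact_Icc.exists_bound_of_continuousOn hs.continuous.continuousOn
    refine ⟨⟨(contDiff_infty_iff_deriv.1 hs).2, fun y hy => ?_⟩, ?_⟩
    · have h1 : β =ᶠ[𝓝 y] fun _ => 0 := by
        filter_upwards [isClosed_Icc.isOpen_compl.mem_nhds hy] with z hz using h0 z hz
      rw [h1.deriv_eq, deriv_const]
    · filter_upwards [eventually_ge_atTop K, eventually_ge_atTop 0] with L hL hL0
      refine ⟨fun y => ?_, h0⟩
      by_cases hy : y ∈ Icc (1 / 4 : ℝ) 4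
      · exact (hK y hy).trans hL
      · rwa [h0 y hy, abs_zero]
  obtain ⟨⟨s1, z1⟩, e0⟩ := hb β h h0
  obtain ⟨⟨s2, z2⟩, e1⟩ := hb _ s1 z1
  exact e0.and (e1.and (hb _ s2 z2).2)

/-- A sum of oscillations of frequency `κ n` in the layers where `1 - |x|²` is about `4⁻ⁿ`. -/
def layers (N : ℕ) (c : ℕ → ℝ) (β : ℝ → ℝ) (κ : ℕ → ℝ) (θ : ℝ) (x : Plane) : ℝ :=
  ∑ n ∈ range N, c n * (β (4 ^ n * bdist x) * sin (κ n * x 1 + θ))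

section layers

variable {N : ℕ} {c : ℕ → ℝ} {β : ℝ → ℝ} {κ : ℕ → ℝ} {θ : ℝ}

lemma contDiff_layers (hβ : Smooth β) : Smooth (layers N c β κ θ) := by
  refine ContDiff.sum fun n _ => contDiff_const.mul ((hβ.comp (contDiff_const.mul contDiff_bdist)).mul
    (Real.contDiff_sin.comp ((contDiff_const.mul (contDiff_coord 1)).add contDiff_const)))

lemma pd_layers (hβ : Smooth β) (i : Fin 2) (x : Plane) : pd i (layers N c β κ θ) x
      = -2 * x i * layers N (fun n => c n * 4 ^ n) (deriv β) κ θ x + (if i = 1 then 1 else 0)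
          * layers N (fun n => c n * κ n) β κ (θ + π / 2) x := by
  have hd : ∀ n, DifferentiableAt ℝ (fun x => β (4 ^ n * bdist x)) x := fun n =>
    ((hβ.comp (contDiff_const.mul contDiff_bdist)).differentiable (by simp) x)
  have hs : ∀ n, DifferentiableAt ℝ (fun x => sin (κ n * x 1 + θ)) x := fun n =>
    ((Real.contDiff_sin.comp ((contDiff_const.mul (contDiff_coord 1)).add
      contDiff_const)).differentiable (n := ∞) (by simp) x)
  have hb : DifferentiableAt ℝ bdist x := (contDiff_bdist (n := 1)).differentiable (by simp) x
  have hx : DifferentiableAt ℝ (fun x => x 1) x :=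
    (contDiff_coord 1 (n := 1)).differentiable (by simp) x
  have h1 : pd i (layers N c β κ θ) x = ∑ n ∈ range N, pd i
      (fun x => c n * (β (4 ^ n * bdist x) * sin (κ n * x 1 + θ))) x :=
    pd_sum _ i fun n _ => ((hd n).mul (hs n)).const_mul _
  rw [h1, layers, layers, mul_sum, mul_sum, ← sum_add_distrib]
  refine sum_congr rfl fun n _ => ?_
  have e1 : pd i (fun x => β (4 ^ n * bdist x)) x
      = deriv β (4 ^ n * bdist x) * (4 ^ n * (-2 * x i)) := by
    rw [pd_comp (φ := β) i (hβ.differentiable (by simp) _) (hb.const_mul _), pd_const_mul _ _ hb,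
      pd_bdist]
  have e2 : pd i (fun x => sin (κ n * x 1 + θ)) x
      = cos (κ n * x 1 + θ) * (κ n * if (1 : Fin 2) = i then 1 else 0) := by
    rw [pd_comp (φ := sin) i Real.differentiable_sin.differentiableAt
      ((hx.const_mul _).add_const _), pd_add i (hx.const_mul _) (differentiableAt_const _),
      pd_const_mul _ _ hx, pd_coord, pd_const, Real.deriv_sin, add_zero]
  rw [pd_const_mul _ _ ((hd n).fun_mul (hs n)), pd_mul i (hd n) (hs n), e1, e2,
    ← add_assoc, Real.sin_add_pi_div_two]
  simp only [eq_comm (a := (1 : Fin 2))]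
  ring

open Classical in
lemma layers_eq_filter (hβ : SuppBdd β K) (x : Plane) :
    layers N c β κ θ x = ∑ n ∈ (range N).filter (fun n => 4 ^ n * bdist x ∈ Icc (1 / 4 : ℝ) 4),
      c n * (β (4 ^ n * bdist x) * sin (κ n * x 1 + θ)) := by
  rw [Finset.sum_filter]
  refine sum_congr rfl fun n _ => ?_
  split_ifs with h
  · rfl
  · rw [hβ.supp _ h, zero_mul, mul_zero]

open Classical in
lemma card_active_le (N : ℕ) (hs : 0 < s) :
    ((range N).filter (fun n => 4 ^ n * s ∈ Icc (1 / 4 : ℝ) 4)).card ≤ 3 := by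
  set A := (range N).filter (fun n => 4 ^ n * s ∈ Icc (1 / 4 : ℝ) 4)
  rcases A.eq_empty_or_nonempty with h | h
  · simp [h]
  · have h0 := (mem_filter.1 (A.min'_mem h)).2
    refine (Finset.card_le_card (t := Finset.Icc (A.min' h) (A.min' h + 2)) fun n hn => ?_).trans
      (by rw [Nat.card_Icc]; omega)
    have h1 := (mem_filter.1 hn).2
    have h2 := A.min'_le n hn
    refine Finset.mem_Icc.2 ⟨h2, ?_⟩
    obtain ⟨d, hd⟩ := Nat.exists_eq_add_of_le h2
    by_contra hd'
    have h3 : (4 : ℝ) ^ 3 ≤ 4 ^ d := pow_le_pow_right₀ (by norm_num) (by omega)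
    have h4 := h1.2
    rw [hd, pow_add] at h4
    have h5 := h0.1
    nlinarith [mul_le_mul_of_nonneg_left h5 (by positivity : (0 : ℝ) ≤ 4 ^ d)]

open Classical in
lemma layers_sq_le_sum (hβ : SuppBdd β K) (hx : x ∈ disc) : layers N c β κ θ x ^ 2
      ≤ ∑ n ∈ (range N).filter (fun n => 4 ^ n * bdist x ∈ Icc (1 / 4 : ℝ) 4),
        3 * K ^ 2 * c n ^ 2 := by
  rw [layers_eq_filter hβ]
  refine sq_sum_le_card_mul_sum_sq.trans ?_
  rw [mul_sum]
  refine sum_le_sum fun n _ => ?_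
  have h1 : ((Finset.card ((range N).filter
      (fun n => 4 ^ n * bdist x ∈ Icc (1 / 4 : ℝ) 4)) : ℕ) : ℝ) ≤ 3 := by
    exact_mod_cast card_active_le N ((mem_disc_iff x).1 hx)
  have h2 : β (4 ^ n * bdist x) ^ 2 ≤ K ^ 2 := sq_le_sq' (neg_le_of_abs_le (hβ.bound _))
    (le_of_abs_le (hβ.bound _))
  have h3 := Real.sin_sq_le_one (κ n * x 1 + θ)
  have h4 : (β (4 ^ n * bdist x) * sin (κ n * x 1 + θ)) ^ 2 ≤ K ^ 2 := by
    rw [mul_pow]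
    exact (mul_le_of_le_one_right (sq_nonneg _) h3).trans h2
  rw [mul_pow]
  calc _ ≤ 3 * (c n ^ 2 * K ^ 2) := mul_le_mul h1 (mul_le_mul_of_nonneg_left h4 (sq_nonneg _))
        (by positivity) (by norm_num)
    _ = _ := by ring

lemma layers_sq_le {Q : ℝ} (hβ : SuppBdd β K) (hQ : 0 ≤ Q) (hx : x ∈ disc)
    (h : ∀ n < N, 1 / 4 ≤ 4 ^ n * bdist x → 4 ^ n * bdist x ≤ 4 → c n ^ 2 ≤ Q) :
    layers N c β κ θ x ^ 2 ≤ 9 * K ^ 2 * Q := by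
  classical
  refine (layers_sq_le_sum hβ hx).trans ?_
  have h1 : ((Finset.card ((range N).filter
      (fun n => 4 ^ n * bdist x ∈ Icc (1 / 4 : ℝ) 4)) : ℕ) : ℝ) ≤ 3 := by
    exact_mod_cast card_active_le N ((mem_disc_iff x).1 hx)
  refine (Finset.sum_le_card_nsmul _ _ (3 * K ^ 2 * Q) fun n hn => ?_).trans ?_
  · obtain ⟨h2, h3⟩ := mem_filter.1 hn
    exact mul_le_mul_of_nonneg_left (h n (Finset.mem_range.1 h2) h3.1 h3.2) (by positivity)
  · rw [nsmul_eq_mul]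
    nlinarith [mul_le_mul_of_nonneg_right h1 (by positivity : 0 ≤ 3 * K ^ 2 * Q)]

lemma layers_eq_zero (hβ : SuppBdd β K) (hN : N ≤ M + 1)
    (hx : bdist x < 1 / 4 ^ (M + 1)) : layers N c β κ θ x = 0 := by
  refine sum_eq_zero fun n hn => ?_
  rw [hβ.supp, zero_mul, mul_zero]
  rintro ⟨h1, -⟩
  have h2 : n ≤ M := by have := Finset.mem_range.1 hn; omega
  have h3 : (4 : ℝ) ^ n ≤ 4 ^ M := pow_le_pow_right₀ (by norm_num) h2
  rw [lt_div_iff₀ (by positivity), pow_succ] at hx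
  have h4 : 0 < bdist x := by
    by_contra h5
    have : (4 : ℝ) ^ n * bdist x ≤ 0 := mul_nonpos_of_nonneg_of_nonpos (by positivity) (not_lt.1 h5)
    linarith
  nlinarith

lemma measureReal_dyadic_layer_le (n : ℕ) :
    discMeasure.real {x | bdist x < 8 / 4 ^ n} ≤ 8 * π / 4 ^ n := by
  by_cases h : (8 : ℝ) / 4 ^ n ≤ 1
  · refine (measureReal_layer_le (by positivity) h).trans (le_of_eq (by ring))
  · have h1 : discMeasure.real {x | bdist x < 8 / 4 ^ n} ≤ π := by
      refine (measureReal_mono (subset_univ _)).trans (le_of_eq ?_)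
      rw [discMeasure, measureReal_restrict_apply_univ, volume_real_disc]
    refine h1.trans ?_
    rw [mul_div_right_comm]
    have := pi_pos
    nlinarith

lemma integral_layers_sq_le (hβ : SuppBdd β K) : ∫ x, layers N c β κ θ x ^ 2 ∂μD
      ≤ 24 * π * K ^ 2 * ∑ n ∈ range N, c n ^ 2 / 4 ^ n := by
  classical
  have hms : ∀ n : ℕ, MeasurableSet {x : Plane | bdist x < 8 / 4 ^ n} := fun n =>
    (isOpen_lt (contDiff_bdist (n := 0)).continuous continuous_const).measurableSet
  have hi : ∀ n ∈ range N, Integrable ({x : Plane | bdist x < 8 / 4 ^ n}.indicator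
      (fun _ => 3 * K ^ 2 * c n ^ 2)) μD := fun n _ => (integrable_const _).indicator (hms n)
  calc _ ≤ ∫ x, ∑ n ∈ range N, {x : Plane | bdist x < 8 / 4 ^ n}.indicator
        (fun _ => 3 * K ^ 2 * c n ^ 2) x ∂μD := by
        refine integral_mono_of_nonneg (.of_forall fun x => sq_nonneg _)
          (integrable_finsetSum _ hi) ?_
        filter_upwards [ae_mem_disc] with x hx
        refine (layers_sq_le_sum hβ hx).trans ?_
        rw [Finset.sum_filter]
        refine sum_le_sum fun n _ => ?_
        split_ifs with h
        · have h1 : x ∈ {x : Plane | bdist x < 8 / 4 ^ n} := by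
            change bdist x < 8 / 4 ^ n
            rw [lt_div_iff₀ (by positivity)]
            linarith [h.2]
          rw [indicator_of_mem h1]
        · exact indicator_nonneg (fun _ _ => by positivity) _
    _ = ∑ n ∈ range N, discMeasure.real {x | bdist x < 8 / 4 ^ n} * (3 * K ^ 2 * c n ^ 2) := by
        rw [integral_finsetSum _ hi]
        refine sum_congr rfl fun n _ => ?_
        rw [integral_indicator_const _ (hms n), smul_eq_mul]
    _ ≤ ∑ n ∈ range N, 8 * π / 4 ^ n * (3 * K ^ 2 * c n ^ 2) := sum_le_sum fun n _ =>
          mul_le_mul_of_nonneg_right (measureReal_dyadic_layer_le n) (by positivity)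
    _ = _ := by
        rw [mul_sum]
        exact sum_congr rfl fun n _ => by ring

end layers

/-! ### A smooth partition of unity in the layers -/

/-- A smooth function that is `1` on `(-∞, 1]` and `0` on `[4, ∞)`. -/
def layerDown (y : ℝ) : ℝ := cos (π / 2 * smoothTransition ((y - 1) / 3))

/-- A smooth function with `∑ β(4ⁿ s)² = 1`. -/
def layerProfile (y : ℝ) : ℝ :=
  layerDown y * sin (π / 2 * smoothTransition ((4 * y - 1) / 3))

lemma layerDown_of_le (h : y ≤ 1) : layerDown y = 1 := by
  rw [layerDown, smoothTransition.zero_of_nonpos (by linarith), mul_zero, Real.cos_zero]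

lemma layerDown_of_ge (h : 4 ≤ y) : layerDown y = 0 := by
  rw [layerDown, smoothTransition.one_of_one_le (by linarith), mul_one, Real.cos_pi_div_two]

lemma contDiff_layerDown : Smooth layerDown :=
  Real.contDiff_cos.comp (contDiff_const.mul (contDiff_smoothTransition.comp
    ((contDiff_id.sub contDiff_const).div_const _)))

lemma contDiff_layerProfile : Smooth layerProfile :=
  contDiff_layerDown.mul (Real.contDiff_sin.comp (contDiff_const.mul
    (contDiff_smoothTransition.comp (((contDiff_const.mul contDiff_id).sub
      contDiff_const).div_const _))))

lemma layerProfile_eq_zero (h : y ∉ Icc (1 / 4 : ℝ) 4) : layerProfile y = 0 := by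
  rw [layerProfile]
  by_cases h1 : 1 / 4 ≤ y
  · rw [layerDown_of_ge (le_of_not_ge fun h2 => h ⟨h1, h2⟩), zero_mul]
  · rw [smoothTransition.zero_of_nonpos (by linarith), mul_zero, Real.sin_zero, mul_zero]

lemma layerProfile_sq (y : ℝ) : layerProfile y ^ 2 = layerDown y ^ 2 - layerDown (4 * y) ^ 2 := by
  have h1 : sin (π / 2 * smoothTransition ((4 * y - 1) / 3)) ^ 2
      = 1 - layerDown (4 * y) ^ 2 := by rw [Real.sin_sq, layerDown]
  rw [layerProfile, mul_pow, h1]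
  rcases le_total y 1 with h | h
  · rw [layerDown_of_le h]; ring
  · rw [layerDown_of_ge (by linarith : 4 ≤ 4 * y)]; ring

lemma sum_layerProfile_sq (s : ℝ) (hs : s ≤ 1) (N : ℕ) :
    ∑ n ∈ range N, layerProfile (4 ^ n * s) ^ 2 = 1 - layerDown (4 ^ N * s) ^ 2 := by
  induction N with
  | zero => simp [layerDown_of_le hs]
  | succ N ih =>
    rw [sum_range_succ, ih, layerProfile_sq, pow_succ (4 : ℝ) N, mul_comm ((4 : ℝ) ^ N) 4,
      mul_assoc]
    ring

lemma layerProfile_mul_eq_zero {d : ℕ} (hd : 2 ≤ d) :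
    layerProfile y * layerProfile (4 ^ d * y) = 0 := by
  by_cases h : 1 / 4 < y
  · have h1 : (4 : ℝ) ^ 2 ≤ 4 ^ d := pow_le_pow_right₀ (by norm_num) hd
    rw [layerProfile_eq_zero (y := 4 ^ d * y), mul_zero]
    rintro ⟨-, h2⟩
    nlinarith
  · have : layerProfile y = 0 := by
      rw [layerProfile, smoothTransition.zero_of_nonpos (by linarith), mul_zero,
        Real.sin_zero, mul_zero]
    rw [this, zero_mul]

lemma sum_sum_tridiagonal (a : ℕ → ℕ → ℝ) (h : ∀ n m, n + 2 ≤ m → a n m = 0 ∧ a m n = 0) (M : ℕ) :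
    ∑ n ∈ range (M + 1), ∑ m ∈ range (M + 1), a n m
      = ∑ n ∈ range (M + 1), a n n + ∑ n ∈ range M, (a n (n + 1) + a (n + 1) n) := by
  induction M with
  | zero => simp
  | succ M ih =>
    have h1 : ∑ n ∈ range (M + 1), a n (M + 1) = a M (M + 1) := by
      rw [sum_range_succ, sum_eq_zero, zero_add]
      intro n hn
      exact (h n (M + 1) (by have := Finset.mem_range.1 hn; omega)).1
    have h2 : ∑ n ∈ range (M + 1), a (M + 1) n = a (M + 1) M := by
      rw [sum_range_succ, sum_eq_zero, zero_add]
      intro n hn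
      exact (h n (M + 1) (by have := Finset.mem_range.1 hn; omega)).2
    have h3 : ∑ n ∈ range (M + 1), ∑ m ∈ range (M + 1 + 1), a n m
        = ∑ n ∈ range (M + 1), ∑ m ∈ range (M + 1), a n m + ∑ n ∈ range (M + 1), a n (M + 1) := by
      simp only [sum_range_succ _ (M + 1)]
      exact sum_add_distrib
    rw [sum_range_succ (fun n => ∑ m ∈ range (M + 1 + 1), a n m) (M + 1), h3,
      sum_range_succ (a (M + 1)) (M + 1), ih, h1, h2, sum_range_succ (fun n => a n n) (M + 1),
      sum_range_succ (fun n => a n (n + 1) + a (n + 1) n) M]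
    ring

/-! ### The branching pattern -/

/-- A stream factor `Ψ` and a dual potential `H` with `Ψ ∂₁H = S + ∂₁W` up to a small error,
where `S = 1` outside a boundary layer of width `4⁻ᴹ`. -/
structure IsPattern (C : ℝ) (M : ℕ) (Ψ H W S : Plane → ℝ) : Prop where
  smooth_Ψ : Smooth Ψ
  smooth_H : Smooth H
  smooth_W : Smooth W
  cont_S : Continuous S
  supp : ∀ x, bdist x < 1 / 4 ^ (M + 1) → Ψ x = 0 ∧ H x = 0 ∧ W x = 0
  S_zero : ∀ x, bdist x < 1 / 4 ^ (M + 1) → S x = 0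
  S_mem : ∀ x, S x ∈ Icc (0 : ℝ) 1
  S_one : ∀ x, 1 / 4 ^ M ≤ bdist x → S x = 1
  Ψ_sq : ∀ x ∈ disc, Ψ x ^ 2 ≤ C / 4 ^ M
  pd_Ψ_sq : ∀ x ∈ disc, ∀ i, pd i Ψ x ^ 2 ≤ C
  pd_pd_Ψ_sq : ∀ x ∈ disc, ∀ i j, pd i (pd j Ψ) x ^ 2 ≤ C * 4 ^ M / bdist x
  W_sq : ∀ x ∈ disc, W x ^ 2 ≤ C / 4 ^ M
  pd_W_sq : ∀ x ∈ disc, pd 0 W x ^ 2 ≤ C / 4 ^ M / bdist x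
  flux_sq : ∀ x ∈ disc, (Ψ x * pd 0 H x) ^ 2 ≤ C / 4 ^ M / bdist x
  error_sq : ∀ x ∈ disc, (Ψ x * pd 1 H x - S x - pd 1 W x) ^ 2 ≤ C / 4 ^ M / bdist x
  integral_H : ∫ x, (pd 0 H x ^ 2 + pd 1 H x ^ 2) ∂μD ≤ C * (4 ^ M * (M + 1))

lemma sq_coord_le_one (hx : x ∈ disc) (i : Fin 2) : x i ^ 2 ≤ 1 := by
  have h := sq_add_sq_lt_one hx
  have hi : i = 0 ∨ i = 1 := by fin_cases i <;> simp
  rcases hi with rfl | rfl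
  · linarith [sq_nonneg (x 1)]
  · linarith [sq_nonneg (x 0)]

lemma two_coord_mul_sq_le (hx : x ∈ disc) (i : Fin 2) (h : a ^ 2 ≤ q) :
    (-2 * x i * a) ^ 2 ≤ 4 * q := by
  have h1 := sq_coord_le_one hx i
  have h2 : (-2 * x i * a) ^ 2 = 4 * (x i ^ 2 * a ^ 2) := by ring
  rw [h2]
  nlinarith [sq_nonneg a]

lemma ite_mul_sq_le (p : Prop) [Decidable p] (h : a ^ 2 ≤ q) :
    ((if p then 1 else 0) * a) ^ 2 ≤ q := by
  split_ifs
  · simpa using h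
  · have := sq_nonneg a; simpa using this.trans h

lemma add_sq_le_two {p : ℝ} (ha : a ^ 2 ≤ p) (hb : b ^ 2 ≤ q) :
    (a + b) ^ 2 ≤ 2 * (p + q) := by nlinarith [sq_nonneg (a - b)]

section pattern

/-- Frequencies of the pattern. -/
def freq (M n : ℕ) : ℝ := 2 ^ (M + n)

lemma freq_pos (M n : ℕ) : 0 < freq M n := by unfold freq; positivity

lemma freq_sq (M n : ℕ) : freq M n ^ 2 = 4 ^ M * 4 ^ n := by
  rw [freq, ← pow_mul, mul_comm (M + n) 2, pow_mul, pow_add]; norm_num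

lemma freq_succ (M n : ℕ) : freq M (n + 1) = 2 * freq M n := by
  rw [freq, freq, ← add_assoc, pow_succ]; ring

lemma layerProfile_double_sum (M : ℕ) (s y : ℝ) : (∑ n ∈ range (M + 1), 2 / freq M n *
        (layerProfile (4 ^ n * s) * cos (freq M n * y))) * ∑ n ∈ range (M + 1), freq M n *
        (layerProfile (4 ^ n * s) * cos (freq M n * y))
      = ∑ n ∈ range (M + 1), layerProfile (4 ^ n * s) ^ 2
        + ∑ n ∈ range (M + 1), layerProfile (4 ^ n * s) ^ 2 * cos (2 * freq M n * y)
        + ∑ n ∈ range M, 5 / 2 * (layerProfile (4 ^ n * s) * layerProfile (4 * (4 ^ n * s))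
          * cos (freq M n * y))
        + ∑ n ∈ range M, 5 / 2 * (layerProfile (4 ^ n * s) * layerProfile (4 * (4 ^ n * s))
          * cos (3 * freq M n * y)) := by
  rw [Finset.sum_mul_sum, sum_sum_tridiagonal _ fun n m hnm => ?_]
  · rw [← sum_add_distrib, add_assoc, ← sum_add_distrib]
    refine congrArg₂ _ (sum_congr rfl fun n _ => ?_) (sum_congr rfl fun n _ => ?_)
    · have h := freq_pos M n
      rw [mul_assoc 2 (freq M n) y, Real.cos_two_mul]
      field_simp
      ring
    · have h := freq_pos M n
      rw [freq_succ, mul_assoc 2 (freq M n) y, mul_assoc 3 (freq M n) y, Real.cos_two_mul,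
        Real.cos_three_mul, pow_succ, mul_comm ((4 : ℝ) ^ n) 4, mul_assoc 4]
      field_simp
      ring
  · obtain ⟨d, rfl⟩ := Nat.exists_eq_add_of_le hnm
    have h := layerProfile_mul_eq_zero (y := 4 ^ n * s) (d := 2 + d) (by omega)
    have h2 : (4 : ℝ) ^ (2 + d) * (4 ^ n * s) = 4 ^ (n + 2 + d) * s := by
      rw [← mul_assoc, ← pow_add]; congr 2; omega
    rw [h2] at h
    constructor
    · linear_combination (2 / freq M n * cos (freq M n * y)
        * (freq M (n + 2 + d) * cos (freq M (n + 2 + d) * y))) * h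
    · linear_combination (2 / freq M (n + 2 + d) * cos (freq M n * y)
        * (freq M n * cos (freq M (n + 2 + d) * y))) * h

lemma exists_isPattern : ∃ C, 0 < C ∧ ∀ M : ℕ, ∃ Ψ H W S, IsPattern C M Ψ H W S := by
  let γ : ℝ → ℝ := fun y => layerProfile y * layerProfile (4 * y)
  let β₂ : ℝ → ℝ := fun y => layerProfile y ^ 2
  have sβ := contDiff_layerProfile
  have sβ' : Smooth (deriv layerProfile) := (contDiff_infty_iff_deriv.1 sβ).2
  have sγ : Smooth γ := sβ.mul (sβ.comp (contDiff_const.mul contDiff_id))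
  have sβ₂ : Smooth β₂ := sβ.pow 2
  obtain ⟨K, hK1, ⟨a0, a1, a2⟩, ⟨b0, b1, -⟩, d0, d1, -⟩ := ((eventually_ge_atTop (1 : ℝ)).and
    ((eventually_suppBdd sβ fun y => layerProfile_eq_zero).and
    ((eventually_suppBdd sγ fun y hy => by simp [γ, layerProfile_eq_zero hy]).and
    (eventually_suppBdd sβ₂ fun y hy => by simp [β₂, layerProfile_eq_zero hy])))).exists
  have hK0 := sq_nonneg K
  have hK : K ^ 2 ≤ K ^ 4 := pow_le_pow_right₀ hK1 (by norm_num)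
  refine ⟨10 ^ 6 * K ^ 4, by positivity, fun M => ?_⟩
  set m : ℝ := 4 ^ M
  have hm : 0 < m := by positivity
  let k : ℕ → ℝ := freq M
  have hk0 : ∀ n, 0 < k n := freq_pos M
  have hk2 : ∀ n, k n ^ 2 = m * 4 ^ n := freq_sq M
  have k4 : ∀ n < M + 1, (4 : ℝ) ^ n ≤ m := fun n hn =>
    pow_le_pow_right₀ (by norm_num) (by omega)
  have h4k : ∀ n < M + 1, 1 ≤ k n ∧ (4 : ℝ) ^ n ≤ k n := fun n hn => by
    have h1 : (4 : ℝ) ^ n ≤ k n := by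
      refine le_of_sq_le_sq ?_ (hk0 n).le
      rw [hk2, sq]; gcongr; exact k4 n hn
    exact ⟨(one_le_pow₀ (by norm_num)).trans h1, h1⟩
  let D := layers (M + 1) (fun n => 1 * 4 ^ n) (deriv layerProfile) k 0
  let E := layers (M + 1) (fun n => 1 * k n) layerProfile k (0 + π / 2)
  let Ψ := layers (M + 1) (fun n => 2 / k n) layerProfile k (π / 2)
  let H := layers (M + 1) (fun _ => 1) layerProfile k 0
  let w := fun N β c d => layers N (fun n => c / (d * k n)) β (fun n => d * k n) 0
  let w' := fun N β c d => layers N (fun n => c / (d * k n) * 4 ^ n) (deriv β) (fun n => d * k n) 0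
  let W : Plane → ℝ := fun x => w (M + 1) β₂ 1 2 x + w M γ (5 / 2) 1 x + w M γ (5 / 2) 3 x
  let S : Plane → ℝ := fun x => 1 - layerDown (4 ^ (M + 1) * bdist x) ^ 2
  have sw : ∀ {N β c d}, Smooth β → Smooth (w N β c d) := contDiff_layers
  have pH : ∀ i x, pd i H x = -2 * x i * D x + (if i = 1 then 1 else 0) * E x := pd_layers sβ
  have pw : ∀ {N β c d} i x, Smooth β → 0 < d → pd i (w N β c d) x = -2 * x i * w' N β c d x
      + (if i = 1 then 1 else 0) * ∑ n ∈ range N,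
        c * (β (4 ^ n * bdist x) * cos (d * k n * x 1)) := fun i x h hd => by
    rw [pd_layers h]
    simp only [layers, zero_add, Real.sin_add_pi_div_two]
    congr! 4 with n
    exact div_mul_cancel₀ _ (mul_pos hd (hk0 n)).ne'
  have pW : ∀ i x, pd i W x = pd i (w (M + 1) β₂ 1 2) x + pd i (w M γ (5 / 2) 1) x
      + pd i (w M γ (5 / 2) 3) x := fun i x => by
    have h1 := (sw (N := M + 1) (c := 1) (d := 2) sβ₂).differentiable (by simp) x
    have h2 := fun d => (sw (N := M) (c := 5 / 2) (d := d) sγ).differentiable (by simp) x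
    rw [← pd_add i h1 (h2 1)]
    exact pd_add i (h1.add (h2 1)) (h2 3)
  have inv_k : ∀ {n : ℕ} {s : ℝ}, 1 / 4 ≤ 4 ^ n * s → 1 / k n ^ 2 ≤ 4 / m * s := fun h => by
    rw [hk2, div_le_iff₀ (by positivity)]
    field_simp
    linarith
  have four : ∀ {n : ℕ} {x}, x ∈ disc → 4 ^ n * bdist x ≤ 4 → (4 : ℝ) ^ n ≤ 4 / bdist x :=
    fun hx h => (le_div_iff₀ ((mem_disc_iff _).1 hx)).2 h
  have bΨ : ∀ x ∈ disc, Ψ x ^ 2 ≤ 9 * K ^ 2 * (16 / m * bdist x) := fun x hx => by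
    have hs := (mem_disc_iff x).1 hx
    refine layers_sq_le a0 (by positivity) hx fun n _ h1 _ => ?_
    calc (2 / k n) ^ 2 = 4 * (1 / k n ^ 2) := by ring
      _ ≤ 4 * (4 / m * bdist x) := by linarith [inv_k h1]
      _ = _ := by ring
  have bw : ∀ {N β c d x}, SuppBdd β K → (c / d) ^ 2 ≤ 25 / 4 → x ∈ disc →
      w N β c d x ^ 2 ≤ 9 * K ^ 2 * (25 / m) := fun {N β c d x} hβ hc hx => by
    refine layers_sq_le hβ (by positivity) hx fun n _ h1 _ => ?_
    have h3 : 4 / m * bdist x ≤ 4 / m := mul_le_of_le_one_right (by positivity) (bdist_le_one x)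
    calc (c / (d * k n)) ^ 2 = (c / d) ^ 2 * (1 / k n ^ 2) := by ring
      _ ≤ 25 / 4 * (4 / m) := mul_le_mul hc ((inv_k h1).trans h3) (by positivity) (by norm_num)
      _ = _ := by ring
  have bw' : ∀ {N β c d x} i, SuppBdd (deriv β) K → (c / d) ^ 2 ≤ 25 / 4 → x ∈ disc →
      (-2 * x i * w' N β c d x) ^ 2 ≤ 4 * (9 * K ^ 2 * (25 / m / bdist x)) :=
    fun {N β c d x} i hβ hc hx => by
    have hs := (mem_disc_iff x).1 hx
    refine two_coord_mul_sq_le hx i (layers_sq_le hβ (by positivity) hx fun n _ _ h1 => ?_)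
    calc (c / (d * k n) * 4 ^ n) ^ 2 = (c / d) ^ 2 * (4 ^ n) ^ 2 / k n ^ 2 := by ring
      _ = (c / d) ^ 2 / m * 4 ^ n := by rw [hk2]; field_simp
      _ ≤ 25 / 4 / m * (4 / bdist x) :=
        mul_le_mul (by gcongr) (four hx h1) (by positivity) (by positivity)
      _ = _ := by ring
  have bΨD : ∀ i, ∀ x ∈ disc, (Ψ x * (-2 * x i * D x)) ^ 2 ≤ 82944 * K ^ 4 / (m * bdist x) :=
    fun i x hx => by
    have hs := (mem_disc_iff x).1 hx
    have h1 : D x ^ 2 ≤ 9 * K ^ 2 * (16 / bdist x ^ 2) :=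
      layers_sq_le a1 (by positivity) hx fun n _ _ h1 => by
        rw [one_mul]
        exact (pow_le_pow_left₀ (by positivity) (four hx h1) 2).trans_eq (by ring)
    rw [mul_pow]
    refine (mul_le_mul (bΨ x hx) (two_coord_mul_sq_le hx i h1) (sq_nonneg _)
      (by positivity)).trans (le_of_eq ?_)
    field_simp; ring
  refine ⟨Ψ, H, W, S, contDiff_layers sβ, contDiff_layers sβ, ((sw sβ₂).add (sw sγ)).add (sw sγ),
    continuous_const.sub ((contDiff_layerDown.continuous.comp
      (continuous_const.mul (contDiff_bdist (n := 0)).continuous)).pow 2),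
    fun x hx => ⟨layers_eq_zero a0 le_rfl hx, layers_eq_zero a0 le_rfl hx, ?_⟩, fun x hx => ?_,
    fun x => ⟨sub_nonneg.2 (Real.cos_sq_le_one _), sub_le_self _ (sq_nonneg _)⟩, fun x hx => ?_,
    fun x hx => ?_, fun x hx i => ?_, fun x hx i j => ?_, fun x hx => ?_, fun x hx => ?_,
    fun x hx => ?_, fun x hx => ?_, ?_⟩
  · simp only [W, w, layers_eq_zero d0 le_rfl hx, layers_eq_zero b0 M.le_succ hx, add_zero]
  · rw [lt_div_iff₀ (by positivity)] at hx
    simp [S, layerDown_of_le (y := 4 ^ (M + 1) * bdist x) (by linarith)]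
  · rw [div_le_iff₀ (by positivity)] at hx
    simp [S, layerDown_of_ge (y := 4 ^ (M + 1) * bdist x) (by rw [pow_succ]; linarith)]
  · calc _ ≤ 9 * K ^ 2 * (16 / m) := (bΨ x hx).trans
          (by gcongr; exact mul_le_of_le_one_right (by positivity) (bdist_le_one x))
      _ = 144 * K ^ 2 / m := by ring
      _ ≤ _ := by gcongr; linarith
  · have e1 : layers (M + 1) (fun n => 2 / k n * 4 ^ n) (deriv layerProfile) k (π / 2) x ^ 2
        ≤ 9 * K ^ 2 * 4 := layers_sq_le a1 (by positivity) hx fun n hn _ _ => by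
      have h0 := hk0 n
      have := (div_le_one h0).2 (h4k n hn).2
      calc _ = 4 * (4 ^ n / k n) ^ 2 := by ring
        _ ≤ 4 * 1 ^ 2 := by gcongr
        _ = 4 := by norm_num
    have e2 : layers (M + 1) (fun n => 2 / k n * k n) layerProfile k (π / 2 + π / 2) x ^ 2
        ≤ 9 * K ^ 2 * 4 := layers_sq_le a0 (by positivity) hx fun n hn _ _ => by
      rw [div_mul_cancel₀ _ (hk0 n).ne']; norm_num
    rw [pd_layers sβ]
    refine (add_sq_le_two (two_coord_mul_sq_le hx i e1) (ite_mul_sq_le _ e2)).trans ?_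
    linarith
  · have hs := (mem_disc_iff x).1 hx
    set q : ℝ := 9 * K ^ 2 * (16 * m / bdist x) with hq
    have key : ∀ {β : ℝ → ℝ} {c : ℕ → ℝ} {θ : ℝ}, SuppBdd β K →
        (∀ n < M + 1, ∃ a ∈ Icc 0 (k n), c n = 2 * a) → layers (M + 1) c β k θ x ^ 2 ≤ q :=
      fun hβ h => layers_sq_le hβ (by positivity) hx fun n hn _ h1 => by
        obtain ⟨a, ha, e⟩ := h n hn
        calc _ = 4 * a ^ 2 := by rw [e]; ring
          _ ≤ 4 * k n ^ 2 := by have := ha.1; have := ha.2; gcongr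
          _ = 4 * m * 4 ^ n := by rw [hk2]; ring
          _ ≤ 4 * m * (4 / bdist x) := by gcongr; exact four hx h1
          _ = _ := by ring
    have c3 : ∀ n, 2 / k n * 4 ^ n * k n = 2 * 4 ^ n := fun n => by
      have := (hk0 n).ne'; field_simp
    have c5 : ∀ n, 2 / k n * k n = 2 := fun n => div_mul_cancel₀ _ (hk0 n).ne'
    have r1 : ∀ n < M + 1, (4 : ℝ) ^ n / k n ≤ 1 := fun n hn => (div_le_one (hk0 n)).2 (h4k n hn).2
    let B₁ := layers (M + 1) (fun n => 2 / k n * 4 ^ n) (deriv layerProfile) k (π / 2)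
    let B₂ := layers (M + 1) (fun n => 2 / k n * k n) layerProfile k (π / 2 + π / 2)
    have dB₁ : DifferentiableAt ℝ B₁ x := (contDiff_layers sβ').differentiable (by simp) x
    have dB₂ : DifferentiableAt ℝ B₂ x := (contDiff_layers sβ).differentiable (by simp) x
    have dx : DifferentiableAt ℝ (fun y : Plane => y j) x :=
      (contDiff_coord j (n := 1)).differentiable (by simp) x
    have e1 : pd j Ψ = fun x => -2 * x j * B₁ x + (if j = 1 then 1 else 0) * B₂ x :=
      funext fun x => pd_layers sβ j x
    have e2 : pd i (pd j Ψ) x = (if j = i then 1 else 0) * (-2 * B₁ x) + -2 * x j * pd i B₁ x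
        + (if j = 1 then 1 else 0) * pd i B₂ x := by
      rw [e1, pd_add i ((dx.const_mul _).fun_mul dB₁) (dB₂.const_mul _),
        pd_mul i (dx.const_mul _) dB₁, pd_const_mul _ _ dx, pd_const_mul _ _ dB₂, pd_coord]
      ring
    have h1 : B₁ x ^ 2 ≤ q := key a1 fun n hn => ⟨4 ^ n / k n,
      ⟨by have := hk0 n; positivity, (r1 n hn).trans (h4k n hn).1⟩, by ring⟩
    have h2 : pd i B₁ x ^ 2 ≤ 2 * (4 * q + q) := by
      rw [pd_layers sβ']
      refine add_sq_le_two (two_coord_mul_sq_le hx i (key a2 fun n hn => ⟨4 ^ n / k n * 4 ^ n,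
        ⟨by have := hk0 n; positivity, ?_⟩, by ring⟩)) (ite_mul_sq_le _ (key a1 fun n hn =>
          ⟨4 ^ n, ⟨by positivity, (h4k n hn).2⟩, c3 n⟩))
      exact (mul_le_of_le_one_left (by positivity) (r1 n hn)).trans (h4k n hn).2
    have h3 : pd i B₂ x ^ 2 ≤ 2 * (4 * q + q) := by
      rw [pd_layers sβ]
      exact add_sq_le_two (two_coord_mul_sq_le hx i (key a1 fun n hn =>
        ⟨4 ^ n, ⟨by positivity, (h4k n hn).2⟩, by rw [c5]⟩)) (ite_mul_sq_le _ (key a0 fun n hn =>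
          ⟨k n, ⟨(hk0 n).le, le_rfl⟩, by rw [c5]⟩))
    have h4 : (-2 * B₁ x) ^ 2 ≤ 4 * q := by linarith
    rw [e2]
    refine (add_sq_le_two (add_sq_le_two (ite_mul_sq_le _ h4) (two_coord_mul_sq_le hx j h2))
      (ite_mul_sq_le _ h3)).trans ?_
    calc _ = 28224 * K ^ 2 * m / bdist x := by rw [hq]; ring
      _ ≤ _ := by gcongr; linarith
  · refine (add_sq_le_two (add_sq_le_two (bw d0 (by norm_num) hx) (bw b0 (by norm_num) hx))
      (bw b0 (by norm_num) hx)).trans ?_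
    calc _ = 2250 * K ^ 2 / m := by ring
      _ ≤ _ := by gcongr; linarith
  · have hs := (mem_disc_iff x).1 hx
    rw [pW, pw 0 x sβ₂ (by norm_num), pw 0 x sγ (by norm_num), pw 0 x sγ (by norm_num)]
    simp only [zero_ne_one, if_false, zero_mul, add_zero]
    refine (add_sq_le_two (add_sq_le_two (bw' 0 d1 (by norm_num) hx) (bw' 0 b1 (by norm_num) hx))
      (bw' 0 b1 (by norm_num) hx)).trans ?_
    calc _ = 9000 * K ^ 2 / m / bdist x := by ring
      _ ≤ _ := by gcongr; linarith
  · have hs := (mem_disc_iff x).1 hx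
    rw [pH, if_neg zero_ne_one, zero_mul, add_zero, div_div]
    refine (bΨD 0 x hx).trans ?_
    gcongr; norm_num
  · have hs := (mem_disc_iff x).1 hx
    have hd := layerProfile_double_sum M (bdist x) (x 1)
    rw [sum_layerProfile_sq _ (bdist_le_one x)] at hd
    have e2 : Ψ x = ∑ n ∈ range (M + 1), 2 / freq M n *
        (layerProfile (4 ^ n * bdist x) * cos (freq M n * x 1)) := by
      simp only [Ψ, layers, Real.sin_add_pi_div_two]; rfl
    have e3 : E x = ∑ n ∈ range (M + 1), freq M n *
        (layerProfile (4 ^ n * bdist x) * cos (freq M n * x 1)) := by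
      simp only [E, layers, zero_add, Real.sin_add_pi_div_two, one_mul]; rfl
    rw [← e2, ← e3] at hd
    have e1 : Ψ x * pd 1 H x - S x - pd 1 W x = Ψ x * (-2 * x 1 * D x)
        + ((2 * x 1 * w' (M + 1) β₂ 1 2 x + 2 * x 1 * w' M γ (5 / 2) 1 x)
          + 2 * x 1 * w' M γ (5 / 2) 3 x) := by
      rw [pW, pH, pw 1 x sβ₂ (by norm_num), pw 1 x sγ (by norm_num), pw 1 x sγ (by norm_num)]
      simp only [if_true, one_mul, S, β₂, γ, k]
      linear_combination hd
    have neg : ∀ {a q : ℝ}, (-2 * x 1 * a) ^ 2 ≤ q → (2 * x 1 * a) ^ 2 ≤ q := fun h => by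
      linarith
    rw [e1]
    refine (add_sq_le_two (bΨD 1 x hx) (add_sq_le_two (add_sq_le_two (neg (bw' 1 d1 (by norm_num) hx))
      (neg (bw' 1 b1 (by norm_num) hx))) (neg (bw' 1 b1 (by norm_num) hx)))).trans ?_
    calc _ = (165888 * K ^ 4 + 18000 * K ^ 2) / m / bdist x := by ring
      _ ≤ _ := by gcongr; nlinarith
  · have hi : ∀ {c : ℕ → ℝ} {β : ℝ → ℝ} {θ : ℝ}, Smooth β → SuppBdd β K →
        Integrable (fun x => layers (M + 1) c β k θ x ^ 2) μD := fun {c β θ} h1 h2 => by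
      have h3 : IsTest (layers (M + 1) c β k θ) := isTest_of_eq_zero (contDiff_layers h1)
        (r := 1 / 4 ^ (M + 1)) (by positivity) fun x hx => layers_eq_zero h2 le_rfl hx
      exact (h3.memLp 2).integrable_sq
    have i1 : Integrable (fun x => 8 * D x ^ 2) μD := (hi sβ' a1).const_mul 8
    have i2 : Integrable (fun x => 2 * E x ^ 2) μD := (hi sβ a0).const_mul 2
    have hs : ∀ c : ℕ → ℝ, (∀ n < M + 1, c n ^ 2 ≤ m * 4 ^ n) →
        ∑ n ∈ range (M + 1), c n ^ 2 / 4 ^ n ≤ m * (M + 1) := fun c hc => by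
      refine (sum_le_sum fun n hn => (div_le_iff₀ (by positivity)).2
        (hc n (Finset.mem_range.1 hn))).trans_eq ?_
      simp; ring
    have j1 : ∫ x, D x ^ 2 ∂μD ≤ _ := integral_layers_sq_le a1
    have j2 : ∫ x, E x ^ 2 ∂μD ≤ _ := integral_layers_sq_le a0
    have q1 := mul_le_mul_of_nonneg_left (hs (fun n => 1 * 4 ^ n) fun n hn => by
      rw [one_mul, sq]; gcongr; exact k4 n hn) (by positivity : 0 ≤ 24 * π * K ^ 2)
    have q2 := mul_le_mul_of_nonneg_left (hs (fun n => 1 * k n) fun n hn => by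
      rw [one_mul, hk2]) (by positivity : 0 ≤ 24 * π * K ^ 2)
    calc _ ≤ ∫ x, (8 * D x ^ 2 + 2 * E x ^ 2) ∂μD := by
          refine integral_mono_of_nonneg (.of_forall fun x => by positivity) (i1.add i2) ?_
          filter_upwards [ae_mem_disc] with x hx
          have h1 := mul_nonneg (sq_nonneg (D x)) (sub_nonneg.2 (sq_add_sq_lt_one hx).le)
          simp only [pH, zero_ne_one, if_false, if_true]
          nlinarith [sq_nonneg (2 * x 1 * D x + E x), mul_nonneg (sq_nonneg (D x)) (sq_nonneg (x 0))]
      _ = 8 * ∫ x, D x ^ 2 ∂μD + 2 * ∫ x, E x ^ 2 ∂μD := by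
          rw [integral_add i1 i2, integral_const_mul, integral_const_mul]
      _ ≤ 240 * π * K ^ 2 * (m * (M + 1)) := by linarith
      _ ≤ _ := by gcongr; nlinarith [Real.pi_le_four, sq_nonneg K]

end pattern

/-! ### The source at one time -/

/-- The function `Z` is square integrable on the disc, with the given bound. -/
def L2Bdd (Z : Plane → ℝ) (B : ℝ) : Prop := MemLp Z 2 μD ∧ ∫ x, Z x ^ 2 ∂μD ≤ B

lemma L2Bdd.mono (h : L2Bdd Z B) (hB : B ≤ B') : L2Bdd Z B' := ⟨h.1, h.2.trans hB⟩

lemma L2Bdd.add {Z' : Plane → ℝ} (h : L2Bdd Z B) (h' : L2Bdd Z' B') :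
    L2Bdd (fun x => Z x + Z' x) (2 * (B + B')) := by
  have i1 := h.1.integrable_sq.const_mul 2
  have i2 := h'.1.integrable_sq.const_mul 2
  refine ⟨h.1.add h'.1, ?_⟩
  calc _ ≤ ∫ x, (2 * Z x ^ 2 + 2 * Z' x ^ 2) ∂μD := by
        refine integral_mono_of_nonneg (.of_forall fun x => sq_nonneg _) (i1.add i2)
          (.of_forall fun x => ?_)
        have := add_sq_le_two (le_refl (Z x ^ 2)) (le_refl (Z' x ^ 2))
        simp only; linarith
    _ = 2 * ∫ x, Z x ^ 2 ∂μD + 2 * ∫ x, Z' x ^ 2 ∂μD := by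
        rw [integral_add i1 i2, integral_const_mul, integral_const_mul]
    _ ≤ _ := by linarith [h.2, h'.2]

lemma L2Bdd.mul (hg : L2Bdd g B) (hw : Continuous w) (hq : 0 ≤ q) (h : ∀ x ∈ disc, w x ^ 2 ≤ q) :
    L2Bdd (fun x => g x * w x) (q * B) := by
  have hae : ∀ᵐ x ∂μD, (g x * w x) ^ 2 ≤ g x ^ 2 * q := by
    filter_upwards [ae_mem_disc] with x hx
    rw [mul_pow]; exact mul_le_mul_of_nonneg_left (h x hx) (sq_nonneg _)
  have h1 : MemLp (fun x => √q * g x) 2 μD := hg.1.const_mul _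
  refine ⟨h1.mono (hg.1.1.mul hw.aestronglyMeasurable) ?_, ?_⟩
  · filter_upwards [hae] with x hx
    rw [norm_eq_abs, norm_eq_abs, ← sq_le_sq, mul_pow (√q), sq_sqrt hq]
    linarith
  · calc _ ≤ ∫ x, g x ^ 2 * q ∂μD := integral_mono_of_nonneg (.of_forall fun x => sq_nonneg _)
          (hg.1.integrable_sq.mul_const q) hae
      _ = q * ∫ x, g x ^ 2 ∂μD := by rw [integral_mul_const, mul_comm]
      _ ≤ _ := mul_le_mul_of_nonneg_left hg.2 hq

lemma L2Bdd.hprim_mul (hg : L2Bdd g B) (hgs : Smooth g) (hθ : Measurable θ)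
    (hθ0 : ∀ s, 0 ≤ θ s) (hL : 0 ≤ L) (hθL : ∫⁻ s in Ioo (0 : ℝ) 1, ofReal (θ s) ≤ ofReal L)
    (hw : Continuous w) (h : ∀ x ∈ disc, w x ^ 2 ≤ θ (bdist x)) :
    L2Bdd (fun x => hprim g x * w x) (2 * L * B) := by
  obtain ⟨h1, h2⟩ := memLp_of_sq_le_hprim hgs hg.1 hθ hθ0 hL hθL
    ((contDiff_hprim hgs).continuous.mul hw).aestronglyMeasurable fun x hx =>
      (mul_pow (hprim g x) (w x) 2).trans_le
        (mul_le_mul_of_nonneg_left (h x hx) (sq_nonneg _))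
  exact ⟨h1, h2.trans (mul_le_mul_of_nonneg_left hg.2 (by positivity))⟩

lemma L2Bdd.hprim_mul_of_layer (hg : L2Bdd g B) (hgs : Smooth g) (hδ : 0 ≤ δ) (hw : Continuous w)
    (h : ∀ x, w x ^ 2 ≤ 1) (h0 : ∀ x, δ ≤ bdist x → w x = 0) :
    L2Bdd (fun x => hprim g x * w x) (2 * δ * B) :=
  hg.hprim_mul hgs (θ := (Iio δ).indicator fun _ => 1) (measurable_const.indicator measurableSet_Iio)
    (fun s => indicator_nonneg (fun _ _ => zero_le_one) s) hδ (lintegral_indicator_Iio_le δ)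
    hw fun x _ => by
      by_cases hs : bdist x ∈ Iio δ
      · rw [indicator_of_mem hs]; exact h x
      · rw [indicator_of_notMem hs, h0 x (not_lt.1 hs)]; simp

lemma log_four_pow_le (M : ℕ) : log (1 / (1 / 4 ^ (M + 1))) ≤ 2 * (M + 1) := by
  rw [one_div_one_div, log_pow, show (4 : ℝ) = 2 ^ 2 by norm_num, log_pow]
  push_cast
  have := Real.log_two_lt_d9
  have hM : (0 : ℝ) ≤ M := cast_nonneg M
  nlinarith

lemma L2Bdd.hprim_mul_inv (hg : L2Bdd g B) (hgs : Smooth g) (hB : 0 ≤ B) (hq : 0 ≤ q)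
    (hw : Continuous w) (h : ∀ x ∈ disc, w x ^ 2 ≤ q / bdist x)
    (h0 : ∀ x, bdist x < 1 / 4 ^ (M + 1) → w x = 0) :
    L2Bdd (fun x => hprim g x * w x) (4 * q * (M + 1) * B) := by
  set r : ℝ := 1 / 4 ^ (M + 1) with hr
  have hr0 : 0 < r := by positivity
  have hr1 : r ≤ 1 := (div_le_one (by positivity)).2 (one_le_pow₀ (by norm_num))
  have hlog : 0 ≤ log (1 / r) := Real.log_nonneg ((one_le_div hr0).2 hr1)
  refine (hg.hprim_mul hgs (θ := fun s => q * (Ici r).indicator (fun s => s⁻¹) s)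
    (L := q * log (1 / r)) ((measurable_inv.indicator measurableSet_Ici).const_mul q)
    (fun s => mul_nonneg hq (indicator_nonneg (fun s hs => inv_nonneg.2 (hr0.le.trans hs)) s))
    (mul_nonneg hq hlog) (by
      simp only [ofReal_mul hq]
      rw [lintegral_const_mul' _ _ (by simp)]
      exact mul_le_mul_right (lintegral_inv_le hr0 hr1) _) hw fun x hx => by
      by_cases hs : bdist x ∈ Ici r
      · rw [indicator_of_mem hs, ← div_eq_mul_inv]; exact h x hx
      · rw [indicator_of_notMem hs, h0 x (not_le.1 hs)]; simp).mono ?_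
  have := mul_le_mul_of_nonneg_left (log_four_pow_le M) hq
  rw [← hr] at this
  gcongr ?_ * B
  linarith

lemma mul_congr_of_layer {G : Plane → ℝ} (h0 : ∀ x, bdist x < r → w x = 0)
    (e : ∀ x, r ≤ bdist x → G x = g x) : (fun x => G x * w x) = fun x => g x * w x := by
  funext x
  by_cases h : bdist x < r
  · simp only [h0 x h, mul_zero]
  · rw [e x (not_lt.1 h)]

lemma diffAt (h : Smooth g) (x : Plane) : DifferentiableAt ℝ g x := h.differentiable (by simp) x

lemma continuous_pd' (i : Fin 2) (h : Smooth g) : Continuous (pd i g) := (contDiff_pd i h).continuous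

lemma pd_pd_comm (h : Smooth g) : pd 0 (pd 1 g) x = pd 1 (pd 0 g) x :=
  pd_comm (h.of_le (coe_le_coe.2 le_top)) x

/-- The square of the `H²`-norm of the source. -/
def sourceSq (f : Plane → ℝ) (Df : Plane → Plane) (D2f : Plane → Fin 2 → Plane) : ℝ :=
  ∫ x, f x ^ 2 ∂μD + ∫ x, ‖Df x‖ ^ 2 ∂μD + ∫ x, ‖D2f x 0‖ ^ 2 ∂μD + ∫ x, ‖D2f x 1‖ ^ 2 ∂μD

lemma L2Bdd.apply {g : Plane → Plane} (hg : MemLp g 2 μD) (i : Fin 2) :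
    L2Bdd (fun x => g x i) (∫ x, ‖g x‖ ^ 2 ∂μD) := by
  refine ⟨memLp_apply hg i, integral_mono_of_nonneg (.of_forall fun x => sq_nonneg _)
    (integrable_normSq hg) (.of_forall fun x => ?_)⟩
  simp only [norm_sq_plane]
  have hi : i = 0 ∨ i = 1 := by fin_cases i <;> simp
  rcases hi with rfl | rfl
  · linarith [sq_nonneg (g x 1)]
  · linarith [sq_nonneg (g x 0)]

lemma sourceSq_parts (f : Plane → ℝ) (Df : Plane → Plane) (D2f : Plane → Fin 2 → Plane) :
    0 ≤ ∫ x, f x ^ 2 ∂μD ∧ 0 ≤ ∫ x, ‖Df x‖ ^ 2 ∂μD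
      ∧ 0 ≤ ∫ x, ‖D2f x 0‖ ^ 2 ∂μD ∧ 0 ≤ ∫ x, ‖D2f x 1‖ ^ 2 ∂μD :=
  ⟨by positivity, by positivity,
    by positivity, by positivity⟩

/-- The mollified source and its derivatives. -/
structure IsSmoothing (M : ℕ) (g g₀ g₁ g₁₁ : Plane → ℝ) (B : ℝ) : Prop where
  smooth : Smooth g
  smooth₁ : Smooth g₁
  smooth₁₁ : Smooth g₁₁
  bdd : L2Bdd g B
  bdd₀ : L2Bdd g₀ B
  bdd₁ : L2Bdd g₁ B
  bdd₁₁ : L2Bdd g₁₁ B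
  pd₀ : ∀ x, 1 / 4 ^ (M + 1) ≤ bdist x → pd 0 g x = g₀ x
  pd₁ : ∀ x, 1 / 4 ^ (M + 1) ≤ bdist x → pd 1 g x = g₁ x
  pd₁₁ : ∀ x, 1 / 4 ^ (M + 1) ≤ bdist x → pd 1 (pd 1 g) x = g₁₁ x
  nonneg : 0 ≤ B

lemma isSmoothing_mol
    (hf : MemH1 f Df) (hD : MemH1Vec Df D2f)
    (hk : IsMollifier k (1 / 4 ^ (M + 1) / 8)) :
    IsSmoothing M (mol k f) (mol k fun x => Df x 0) (mol k fun x => Df x 1)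
      (mol k fun x => D2f x 1 1) (sourceSq f Df D2f) := by
  obtain ⟨p0, p1, p2, p3⟩ := sourceSq_parts f Df D2f
  have hr0 : (0 : ℝ) < 1 / 4 ^ (M + 1) := by positivity
  have hr1 : (1 : ℝ) / 4 ^ (M + 1) ≤ 1 := (div_le_one (by positivity)).2 (one_le_pow₀ (by norm_num))
  have m0 := memLp_apply hf.memLp_grad 0
  have m1 := memLp_apply hf.memLp_grad 1
  have m11 := memLp_apply (hD 1).memLp_grad 1
  have b : ∀ {v : Plane → ℝ} {B : ℝ}, L2Bdd v B → L2Bdd (mol k v) B := fun h =>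
    ⟨hk.memLp_mol h.1, (hk.integral_mol_sq_le h.1).trans h.2⟩
  have key : ∀ x, 1 / 4 ^ (M + 1) ≤ bdist x → ∀ i, pd i (mol k f) x = mol k (fun y => Df y i) x :=
    fun x hx i => by
      rw [pd_mol hk.smooth hk.compact hf.memLp]
      exact hf.mol_pd hk.smooth hr0 hr1 hk.supp hx i
  constructor
  case smooth => exact contDiff_mol hk.smooth hk.compact hf.memLp
  case smooth₁ => exact contDiff_mol hk.smooth hk.compact m1
  case smooth₁₁ => exact contDiff_mol hk.smooth hk.compact m11
  case bdd => exact b ⟨hf.memLp, by unfold sourceSq; linarith⟩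
  case bdd₀ => exact b ((L2Bdd.apply hf.memLp_grad 0).mono (by unfold sourceSq; linarith))
  case bdd₁ => exact b ((L2Bdd.apply hf.memLp_grad 1).mono (by unfold sourceSq; linarith))
  case bdd₁₁ => exact b ((L2Bdd.apply (hD 1).memLp_grad 1).mono (by unfold sourceSq; linarith))
  case pd₀ => exact fun x hx => key x hx 0
  case pd₁ => exact fun x hx => key x hx 1
  case pd₁₁ =>
    intro x hx
    have hk1 := contDiff_pd 1 hk.smooth
    have hc1 := hasCompactSupport_pd 1 hk.compact
    rw [pd_mol hk.smooth hk.compact hf.memLp, pd_mol hk1 hc1 hf.memLp,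
      hf.mol_pd hk1 hr0 hr1 ((tsupport_pd_subset 1 k).trans hk.supp) hx 1]
    exact (hD 1).mol_pd hk.smooth hr0 hr1 hk.supp hx 1
  case nonneg => unfold sourceSq; linarith

/-- The Poisson bracket. -/
def bracket (a b : Plane → ℝ) (x : Plane) : ℝ :=
  pd 0 a x * pd 1 b x - pd 1 a x * pd 0 b x

lemma pd_eq_zero_of_layer (h : ∀ x, bdist x < r → φ x = 0) (i : Fin 2) (hx : bdist x < r) : pd i φ x = 0 := by
  have h1 : φ =ᶠ[𝓝 x] fun _ => 0 := by
    have ho : IsOpen {x : Plane | bdist x < r} :=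
      isOpen_lt (contDiff_bdist (n := 0)).continuous continuous_const
    filter_upwards [ho.mem_nhds hx] with y hy using h y hy
  rw [pd, h1.fderiv_eq]; simp

namespace IsPattern

variable {C : ℝ} {M : ℕ} {Ψ H W S : Plane → ℝ}

lemma test_Ψ (hp : IsPattern C M Ψ H W S) : IsTest Ψ :=
  isTest_of_eq_zero hp.smooth_Ψ (r := 1 / 4 ^ (M + 1)) (by positivity) fun x hx => (hp.supp x hx).1

lemma test_H (hp : IsPattern C M Ψ H W S) : IsTest H :=
  isTest_of_eq_zero hp.smooth_H (r := 1 / 4 ^ (M + 1)) (by positivity)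
    fun x hx => (hp.supp x hx).2.1

lemma abs_integral_bracket_sub_le (hp : IsPattern C M Ψ H W S) (hC : 0 ≤ C)
    (hg : IsSmoothing M g g₀ g₁ g₁₁ B) (hv : IsTest v) :
    |∫ x, bracket (fun x => hprim g x * Ψ x) H x * v x ∂μD - ∫ x, g x * v x ∂μD|
      ≤ √((100 * C + 10) * (M + 1) / 4 ^ M * B) * √(∫ x, ‖∇ v x‖ ^ 2 ∂μD) := by
  set m : ℝ := 4 ^ M with hm
  have hm0 : 0 < m := by positivity
  have hB := hg.nonneg
  let G := hprim g
  have sG : Smooth G := contDiff_hprim hg.smooth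
  have sΨ := hp.smooth_Ψ
  have sH := hp.smooth_H
  have sW := hp.smooth_W
  have sGW : Smooth fun x => G x * W x := sG.mul sW
  have sGΨ : Smooth fun x => G x * Ψ x := sG.mul sΨ
  let a₀ : Plane → ℝ := fun x => G x * Ψ x * pd 1 H x - G x - pd 1 (fun x => G x * W x) x
  let a₁ : Plane → ℝ := fun x => pd 0 (fun x => G x * W x) x - G x * Ψ x * pd 0 H x
  have sΨ1 := sGΨ.mul (contDiff_pd 1 sH)
  have sΨ0 := sGΨ.mul (contDiff_pd 0 sH)
  have s₀ : Smooth a₀ := (sΨ1.sub sG).sub (contDiff_pd 1 sGW)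
  have s₁ : Smooth a₁ := (contDiff_pd 0 sGW).sub sΨ0
  have hpdG : pd 0 G = g := pd_zero_hprim hg.smooth
  have hdiv : ∀ x, pd 0 a₀ x + pd 1 a₁ x = bracket (fun x => G x * Ψ x) H x - g x := fun x => by
    rw [pd_sub 0 (diffAt (sΨ1.sub sG) x) (diffAt (contDiff_pd 1 sGW) x),
      pd_sub 0 (diffAt sΨ1 x) (diffAt sG x), pd_mul 0 (diffAt sGΨ x) (diffAt (contDiff_pd 1 sH) x),
      pd_sub 1 (diffAt (contDiff_pd 0 sGW) x) (diffAt sΨ0 x),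
      pd_mul 1 (diffAt sGΨ x) (diffAt (contDiff_pd 0 sH) x), pd_pd_comm sH, pd_pd_comm sGW, hpdG,
      bracket]
    ring
  have i0 := integrable_continuous_mul (continuous_pd' 0 s₀) (hv.memLp 2)
  have i1 := integrable_continuous_mul (continuous_pd' 1 s₁) (hv.memLp 2)
  have hbr : Continuous (bracket (fun x => G x * Ψ x) H) :=
    ((continuous_pd' 0 sGΨ).mul (continuous_pd' 1 sH)).sub
      ((continuous_pd' 1 sGΨ).mul (continuous_pd' 0 sH))
  have hid : ∫ x, bracket (fun x => G x * Ψ x) H x * v x ∂μD - ∫ x, g x * v x ∂μD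
      = - (∫ x, a₀ x * pd 0 v x ∂μD + ∫ x, a₁ x * pd 1 v x ∂μD) := by
    rw [integral_mul_pd_test 0 (s₀.of_le (by simp)) hv,
      integral_mul_pd_test 1 (s₁.of_le (by simp)) hv, ← neg_add, neg_neg, ← integral_add i0 i1,
      ← integral_sub (integrable_continuous_mul hbr (hv.memLp 2))
        (integrable_continuous_mul hg.smooth.continuous (hv.memLp 2))]
    exact integral_ext (fun x => by simp only [← add_mul, hdiv, sub_mul])
  -- The six contributions to the residual.
  have hq0 : 0 ≤ C / m := by positivity
  set E : ℝ := (M + 1) / m * B with hE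
  have hE0 : 0 ≤ E := by positivity
  have hBm : B / m ≤ E := by
    rw [hE, div_mul_eq_mul_div]
    gcongr
    exact le_mul_of_one_le_left hB (by simp)
  have hqB : C / m * B ≤ C * E := by
    calc C / m * B = C * (B / m) := by ring
      _ ≤ _ := mul_le_mul_of_nonneg_left hBm hC
  have hqM : 4 * (C / m) * (M + 1) * B = 4 * C * E := by ring
  have zΨ : ∀ x, bdist x < 1 / 4 ^ (M + 1) → Ψ x = 0 := fun x hx => (hp.supp x hx).1
  have zW : ∀ x, bdist x < 1 / 4 ^ (M + 1) → W x = 0 := fun x hx => (hp.supp x hx).2.2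
  have t1 : L2Bdd (fun x => G x * (S x - 1)) (2 * (1 / m) * B) := by
    refine hg.bdd.hprim_mul_of_layer hg.smooth (by positivity) (hp.cont_S.sub continuous_const)
      (fun x => ?_) fun x hx => by rw [hp.S_one x hx, sub_self]
    have h1 := hp.S_mem x
    nlinarith [h1.1, h1.2]
  have t2 : L2Bdd (fun x => G x * (Ψ x * pd 1 H x - S x - pd 1 W x)) (4 * C * E) := hqM ▸
    hg.bdd.hprim_mul_inv hg.smooth hB hq0 (((sΨ.continuous.mul (continuous_pd' 1 sH)).sub
      hp.cont_S).sub (continuous_pd' 1 sW)) hp.error_sq fun x hx => by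
        rw [zΨ x hx, hp.S_zero x hx, pd_eq_zero_of_layer zW 1 hx]; ring
  have t3 : L2Bdd (fun x => pd 1 G x * -W x) (2 * (C / m) * B) := by
    rw [mul_congr_of_layer (w := fun x => -W x) (fun x hx => by rw [zW x hx, neg_zero])
      fun x hx => by rw [pd_one_hprim hg.smooth, hprim_congr hx hg.pd₁]]
    exact hg.bdd₁.hprim_mul hg.smooth₁ measurable_const (fun _ => hq0) hq0 (by simp)
      sW.continuous.neg fun x hx => by rw [neg_sq]; exact hp.W_sq x hx
  have t4 : L2Bdd (fun x => g x * W x) (C / m * B) := hg.bdd.mul sW.continuous hq0 hp.W_sq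
  have t5 : L2Bdd (fun x => G x * pd 0 W x) (4 * C * E) := hqM ▸ hg.bdd.hprim_mul_inv hg.smooth hB
    hq0 (continuous_pd' 0 sW) hp.pd_W_sq fun x hx => pd_eq_zero_of_layer zW 0 hx
  have t6 : L2Bdd (fun x => G x * -(Ψ x * pd 0 H x)) (4 * C * E) := hqM ▸
    hg.bdd.hprim_mul_inv hg.smooth hB hq0 (sΨ.continuous.mul (continuous_pd' 0 sH)).neg
      (fun x hx => by rw [neg_sq]; exact hp.flux_sq x hx)
      fun x hx => by rw [zΨ x hx, zero_mul, neg_zero]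
  have b₀ : L2Bdd a₀ ((28 * C + 8) * E) := by
    convert ((t1.add t2).add t3).mono (B' := (28 * C + 8) * E) ?_ using 1
    · funext x
      simp only [a₀, pd_mul 1 (diffAt sG x) (diffAt sW x)]
      ring
    · have : 2 * (1 / m) * B = 2 * (B / m) := by ring
      nlinarith [mul_nonneg hC hE0]
  have b₁ : L2Bdd a₁ (28 * C * E) := by
    convert ((t4.add t5).add t6).mono (B' := 28 * C * E) (by nlinarith [mul_nonneg hC hE0]) using 1
    funext x
    simp only [a₁, pd_mul 0 (diffAt sG x) (diffAt sW x), hpdG]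
    ring
  have hgr : ∫ x, ‖∇ v x‖ ^ 2 ∂μD = ∫ x, pd 0 v x ^ 2 ∂μD + ∫ x, pd 1 v x ^ 2 ∂μD := by
    rw [← integral_add ((hv.pd 0).memLp 2).integrable_sq ((hv.pd 1).memLp 2).integrable_sq]
    exact integral_ext (fun x => by simp only [norm_sq_plane, gradient_apply])
  rw [hid, abs_neg, hgr]
  have hn : ∀ φ : Plane → ℝ, 0 ≤ ∫ x, φ x ^ 2 ∂μD := fun φ => by positivity
  have hcs : ∀ {a b c d : ℝ}, 0 ≤ a → 0 ≤ b → 0 ≤ c → 0 ≤ d →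
      √a * √c + √b * √d ≤ √(a + b) * √(c + d) := fun {a b c d} ha hb hc hd => by
    rw [← sqrt_mul (add_nonneg ha hb)]
    refine Real.le_sqrt_of_sq_le ?_
    nlinarith [sq_nonneg (√a * √d - √b * √c), sq_sqrt ha, sq_sqrt hb, sq_sqrt hc, sq_sqrt hd]
  calc _ ≤ _ := (abs_add_le _ _).trans (add_le_add (abs_integral_mul_le b₀.1 ((hv.pd 0).memLp 2))
        (abs_integral_mul_le b₁.1 ((hv.pd 1).memLp 2)))
    _ ≤ _ := hcs (hn a₀) (hn a₁) (hn _) (hn _)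
    _ ≤ _ := by
      gcongr
      calc _ ≤ (28 * C + 8) * E + 28 * C * E := add_le_add b₀.2 b₁.2
        _ ≤ (100 * C + 10) * E := by nlinarith [mul_nonneg hC hE0]
        _ = _ := by rw [hE]; ring

lemma integral_hessSq_le (hp : IsPattern C M Ψ H W S) (hC : 0 ≤ C)
    (hg : IsSmoothing M g g₀ g₁ g₁₁ B) :
    ∫ x, hessSq (fun x => hprim g x * Ψ x) x ∂μD ≤ 1000 * C * (4 ^ M * (M + 1)) * B := by
  set m : ℝ := 4 ^ M with hm
  have hm1 : 1 ≤ m := one_le_pow₀ (by norm_num)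
  have hB := hg.nonneg
  let G := hprim g
  have sG : Smooth G := contDiff_hprim hg.smooth
  have sΨ := hp.smooth_Ψ
  have hpdG : pd 0 G = g := pd_zero_hprim hg.smooth
  have hpdG1 : pd 1 G = hprim (pd 1 g) := pd_one_hprim hg.smooth
  set E : ℝ := m * (M + 1) * B with hE
  have hBE : B ≤ E := le_mul_of_one_le_left hB (one_le_mul_of_one_le_of_one_le hm1 (by simp))
  have hCB : C * B ≤ C * E := mul_le_mul_of_nonneg_left hBE hC
  have hCE : 0 ≤ C * E := by positivity
  have zΨ : ∀ x, bdist x < 1 / 4 ^ (M + 1) → Ψ x = 0 := fun x hx => (hp.supp x hx).1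
  have zdΨ : ∀ j x, bdist x < 1 / 4 ^ (M + 1) → pd j Ψ x = 0 := fun j x hx =>
    pd_eq_zero_of_layer zΨ j hx
  have Ψ_sq : ∀ x ∈ disc, Ψ x ^ 2 ≤ C := fun x hx => (hp.Ψ_sq x hx).trans (div_le_self hC hm1)
  have cΨ := sΨ.continuous
  have h3 : ∀ i j, L2Bdd (fun x => pd i G x * pd j Ψ x) (2 * C * E) := fun i j => by
    have hi : i = 0 ∨ i = 1 := by fin_cases i <;> simp
    rcases hi with rfl | rfl
    · rw [hpdG]
      exact (hg.bdd.mul (continuous_pd' j sΨ) hC fun x hx => hp.pd_Ψ_sq x hx j).mono (by nlinarith)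
    · rw [mul_congr_of_layer (zdΨ j) fun x hx => by rw [hpdG1, hprim_congr hx hg.pd₁]]
      exact (hg.bdd₁.hprim_mul hg.smooth₁ measurable_const (fun _ => hC) hC (by simp)
        (continuous_pd' j sΨ) fun x hx => hp.pd_Ψ_sq x hx j).mono (by linarith)
  have main : ∀ i j, L2Bdd (fun x => pd i (pd j G) x * Ψ x) (2 * C * E) →
      L2Bdd (pd i (pd j fun x => G x * Ψ x)) (48 * C * E) := fun i j h1 => by
    have h4 : L2Bdd (fun x => G x * pd i (pd j Ψ) x) (4 * C * E) :=
      (hg.bdd.hprim_mul_inv hg.smooth hB (q := C * m) (by positivity)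
        (continuous_pd' i (contDiff_pd j sΨ)) (fun x hx => hp.pd_pd_Ψ_sq x hx i j)
        fun x hx => pd_eq_zero_of_layer (zdΨ j) i hx).mono (by rw [hE]; linarith)
    convert ((h1.add (h3 j i)).add ((h3 i j).add h4)).mono (B' := 48 * C * E) (by linarith) using 1
    funext x
    have d1 := diffAt ((contDiff_pd j sG).mul sΨ) x
    have d2 := diffAt (sG.mul (contDiff_pd j sΨ)) x
    rw [show (pd j fun x => G x * Ψ x) = fun x => pd j G x * Ψ x + G x * pd j Ψ x from
      funext fun x => pd_mul j (diffAt sG x) (diffAt sΨ x), pd_add i d1 d2,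
      pd_mul i (diffAt (contDiff_pd j sG) x) (diffAt sΨ x),
      pd_mul i (diffAt sG x) (diffAt (contDiff_pd j sΨ) x)]
  have k00 := main 0 0 (by
    rw [mul_congr_of_layer zΨ fun x hx => by rw [hpdG, hg.pd₀ x hx]]
    exact (hg.bdd₀.mul cΨ hC Ψ_sq).mono (by linarith))
  have k01 := main 0 1 (by
    rw [mul_congr_of_layer zΨ fun x hx => by rw [pd_pd_comm sG, hpdG, hg.pd₁ x hx]]
    exact (hg.bdd₁.mul cΨ hC Ψ_sq).mono (by linarith))
  have k11 := main 1 1 (by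
    rw [mul_congr_of_layer zΨ fun x hx => by
      rw [hpdG1, pd_one_hprim (contDiff_pd 1 hg.smooth), hprim_congr hx hg.pd₁₁]]
    exact (hg.bdd₁₁.hprim_mul hg.smooth₁₁ measurable_const (fun _ => hC) hC (by simp) cΨ
      Ψ_sq).mono (by linarith))
  have i00 := k00.1.integrable_sq
  have i01 := k01.1.integrable_sq.const_mul 2
  have e : ∫ x, hessSq (fun x => G x * Ψ x) x ∂μD = _ :=
    integral_add (i00.add i01) k11.1.integrable_sq
  rw [integral_add i00 i01, integral_const_mul] at e
  calc _ ≤ 1000 * (C * E) := by linarith [k00.2, k01.2, k11.2]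
    _ = _ := by rw [hE]; ring

end IsPattern

/-! ### The velocity -/

lemma stronglyMeasurable_mol (hk : Continuous k) {g : ℝP → ℝ} (hg : StronglyMeasurable g) :
    StronglyMeasurable fun p : ℝP => mol k (fun y => g (p.1, y)) p.2 := by
  have h : StronglyMeasurable fun q : (ℝP) × Plane => k (q.1.2 - q.2) * g (q.1.1, q.2) :=
    (hk.comp (by fun_prop : Continuous fun q : (ℝP) × Plane =>
      q.1.2 - q.2)).stronglyMeasurable.mul (hg.comp_measurable (by fun_prop))
  exact h.integral_prod_right'

lemma stronglyMeasurable_hprim {g : ℝ → Plane → ℝ}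
    (hg : StronglyMeasurable fun p : ℝP => g p.1 p.2) :
    StronglyMeasurable fun p : ℝP => hprim (g p.1) p.2 := by
  have h : StronglyMeasurable fun q : (ℝP) × ℝ => g q.1.1 (squeeze q.2 q.1.2) :=
    hg.comp_measurable (measurable_fst.fst.prodMk (continuous_squeeze.comp
      (by fun_prop : Continuous fun q : (ℝP) × ℝ => (q.2, q.1.2))).measurable)
  simp only [hprim, integral_of_le zero_le_one]
  exact (by fun_prop : Continuous fun p : ℝP => p.2 0).stronglyMeasurable.mul
    h.integral_prod_right'

lemma IsTest.exists_bound (h : IsTest φ) : ∃ K, 0 ≤ K ∧ ∀ x, |φ x| ≤ K := by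
  obtain ⟨K, hK⟩ := h.continuous.bounded_above_of_compact_support h.2.1
  exact ⟨K, (norm_nonneg _).trans (hK 0), hK⟩

lemma exists_isStream {χ : Plane → ℝ} (hk : IsMollifier k h) (hΨ : IsTest Ψ)
    (hχ : IsTest χ) {g : ℝP → ℝ} (hg : StronglyMeasurable g)
    (hg2 : ∀ t, MemLp (fun y => g (t, y)) 2 μD)
    (hgt : ∀ t, √(∫ y, g (t, y) ^ 2 ∂μD) ≤ exp t) (α : ℝ) :
    ∃ U, IsStream (fun t x => α * (hprim (mol k fun y => g (t, y)) x * Ψ x) + χ x) U := by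
  have sm : ∀ t, Smooth (mol k fun y => g (t, y)) := fun t =>
    contDiff_mol hk.smooth hk.compact (hg2 t)
  have tψ : ∀ t, IsTest fun x => hprim (mol k fun y => g (t, y)) x * Ψ x := fun t =>
    hΨ.mul_left (contDiff_hprim (sm t))
  obtain ⟨K, hK0, hK⟩ := exists_bound_mol hk.smooth.continuous hk.compact
  obtain ⟨K', hK0', hK'⟩ := exists_bound_mol (contDiff_pd 1 hk.smooth).continuous
    (hasCompactSupport_pd 1 hk.compact)
  obtain ⟨P, hP0, hP⟩ := hΨ.exists_bound
  choose P' hP0' hP' using fun i => (hΨ.pd i).exists_bound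
  choose X hX0 hX using fun i => (hχ.pd i).exists_bound
  have hb : ∀ t y, |mol k (fun y => g (t, y)) y| ≤ K * exp t := fun t y =>
    (hK _ (hg2 t) y).trans (mul_le_mul_of_nonneg_left (hgt t) hK0)
  have hb' : ∀ t y, |pd 1 (mol k fun y => g (t, y)) y| ≤ K' * exp t := fun t y => by
    rw [pd_mol hk.smooth hk.compact (hg2 t)]
    exact (hK' _ (hg2 t) y).trans (mul_le_mul_of_nonneg_left (hgt t) hK0')
  refine ⟨|α| * ((K + K') * P + K * (P' 0 + P' 1)) + (X 0 + X 1),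
    (((stronglyMeasurable_hprim (g := fun t => mol k fun y => g (t, y))
      (stronglyMeasurable_mol hk.smooth.continuous hg)).mul
      (hΨ.continuous.comp continuous_snd).stronglyMeasurable).const_mul α).add
      (hχ.continuous.comp continuous_snd).stronglyMeasurable,
    fun t => ((tψ t).const_mul α).add hχ, fun t x i ht => ?_⟩
  have he := (Real.one_le_exp ht.le)
  have hi : i = 0 ∨ i = 1 := by fin_cases i <;> simp
  by_cases hx : x ∈ disc
  · rw [pd_add i (((tψ t).const_mul α).differentiable x) (hχ.differentiable x),
      pd_const_mul α i ((tψ t).differentiable x),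
      pd_mul i ((contDiff_hprim (sm t)).differentiable (by simp) x) (hΨ.differentiable x)]
    have h1 : |pd i (hprim (mol k fun y => g (t, y))) x| ≤ (K + K') * exp t := by
      have := exp_pos t
      rcases hi with rfl | rfl
      · rw [pd_zero_hprim (sm t)]
        exact (hb t x).trans (mul_le_mul_of_nonneg_right (by linarith) this.le)
      · rw [pd_one_hprim (sm t)]
        exact (abs_hprim_le (hb' t) hx).trans (mul_le_mul_of_nonneg_right (by linarith) this.le)
    have h2 := abs_hprim_le (hb t) hx
    have h3 : P' i ≤ P' 0 + P' 1 := by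
      rcases hi with rfl | rfl <;> linarith [hP0' 0, hP0' 1]
    have h4 : X i ≤ (X 0 + X 1) * exp t := by
      refine le_trans ?_ (le_mul_of_one_le_right (add_nonneg (hX0 0) (hX0 1)) he)
      rcases hi with rfl | rfl <;> linarith [hX0 0, hX0 1]
    calc _ ≤ |α| * (|pd i (hprim (mol k fun y => g (t, y))) x| * |Ψ x|
          + |hprim (mol k fun y => g (t, y)) x| * |pd i Ψ x|) + |pd i χ x| := by
          refine (abs_add_le _ _).trans (add_le_add_left ?_ _)
          rw [abs_mul, ← abs_mul _ (Ψ x), ← abs_mul _ (pd i Ψ x)]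
          exact mul_le_mul_of_nonneg_left (abs_add_le _ _) (abs_nonneg _)
      _ ≤ |α| * ((K + K') * exp t * P + K * exp t * (P' 0 + P' 1)) + (X 0 + X 1) * exp t := by
          gcongr
          · exact hP x
          · exact (hP' i x).trans h3
          · exact (hX i x).trans h4
      _ = _ := by ring
  · rw [((((tψ t).const_mul α).add hχ).pd i).eq_zero hx, abs_zero]
    have := hP0' 0; have := hP0' 1; have := hX0 0; have := hX0 1
    positivity

lemma exists_tame_source {f : ℝ → Plane → ℝ} (hf : JointlyMeasurable f)
    (hf2 : ∀ᵐ t ∂μT, MemLp (f t) 2 μD) : ∃ g : ℝP → ℝ, StronglyMeasurable g ∧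
      (∀ t, MemLp (fun y => g (t, y)) 2 μD) ∧ (∀ t, √(∫ y, g (t, y) ^ 2 ∂μD) ≤ exp t) ∧
      ∀ᵐ t ∂μT, (fun y => g (t, y)) =ᵐ[discMeasure] f t ∨
        (∀ y, g (t, y) = 0) ∧ exp t < √(∫ y, f t y ^ 2 ∂μD) := by
  obtain ⟨f', hm, hff⟩ := hf
  let Q : Set ℝ := {t | ∫⁻ y, ‖f' (t, y)‖ₑ ^ 2 ∂μD ≤ ofReal (exp t ^ 2)}
  have hQm : MeasurableSet Q := measurableSet_le
    ((hm.enorm.pow_const 2).lintegral_prod_right') (by fun_prop)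
  have hae : ∀ᵐ t ∂μT, f t =ᵐ[discMeasure] fun y => f' (t, y) := by
    rw [cylMeasure_eq] at hff
    exact Measure.ae_ae_of_ae_prod hff
  have hmem : ∀ t ∈ Q, MemLp (fun y => f' (t, y)) 2 μD := fun t ht =>
    memLp_two_of_lintegral (hm.comp_measurable measurable_prodMk_left).aestronglyMeasurable
      (lt_of_le_of_lt ht ENNReal.ofReal_lt_top)
  have hg : ∀ t ∈ Q, (fun y => (Prod.fst ⁻¹' Q).indicator f' (t, y)) = fun y => f' (t, y) :=
    fun t ht => funext fun y => indicator_of_mem (show (t, y) ∈ Prod.fst ⁻¹' Q from ht) f'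
  have hg0 : ∀ t ∉ Q, ∀ y, (Prod.fst ⁻¹' Q).indicator f' (t, y) = 0 :=
    fun t ht y => indicator_of_notMem (show (t, y) ∉ Prod.fst ⁻¹' Q from ht) f'
  refine ⟨(Prod.fst ⁻¹' Q).indicator f', hm.indicator (measurable_fst hQm), fun t => ?_,
    fun t => ?_, ?_⟩
  · by_cases ht : t ∈ Q
    · rw [hg t ht]; exact hmem t ht
    · simp only [hg0 t ht]; exact MemLp.zero'
  · by_cases ht : t ∈ Q
    · have h1 : ofReal _ ≤ _ := (ofReal_integral_normSq (hmem t ht)).trans_le ht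
      rw [ofReal_le_ofReal_iff (by positivity)] at h1
      simp only [norm_eq_abs, sq_abs] at h1
      simp only [fun y => congrFun (hg t ht) y]
      exact (Real.sqrt_le_left (exp_pos t).le).2 h1
    · simp only [hg0 t ht]; simp [Real.exp_nonneg]
  · filter_upwards [hae, hf2] with t ht h2
    by_cases hq : t ∈ Q
    · left; rw [hg t hq]; exact ht.symm
    · right
      refine ⟨hg0 t hq, Real.lt_sqrt_of_sq_lt ?_⟩
      have h1 : ofReal (exp t ^ 2) < ∫⁻ y, ‖f' (t, y)‖ₑ ^ 2 ∂μD := not_le.1 hq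
      rw [← lintegral_congr_ae (ht.mono fun y (hy : f t y = f' (t, y)) => by
          simp only [hy] : (fun y => ‖f t y‖ₑ ^ 2) =ᵐ[discMeasure] _),
        ← ofReal_integral_normSq h2, ENNReal.ofReal_lt_ofReal_iff'] at h1
      simpa only [norm_eq_abs, sq_abs] using h1.1

lemma pd_congr {ψ : Plane → ℝ} (h : φ =ᶠ[𝓝 x] ψ) (i : Fin 2) : pd i φ =ᶠ[𝓝 x] pd i ψ :=
  (h.fderiv (𝕜 := ℝ)).mono fun y hy => by simp only [pd, hy]

lemma hessSq_congr {ψ : Plane → ℝ} (h : φ =ᶠ[𝓝 x] ψ) : hessSq φ x = hessSq ψ x := by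
  simp only [hessSq, (pd_congr (pd_congr h _) _).eq_of_nhds]

lemma hessSq_const_mul (h : IsTest φ) (c : ℝ) (x : Plane) :
    hessSq (fun x => c * φ x) x = c ^ 2 * hessSq φ x := by
  have e : ∀ {φ : Plane → ℝ} (i), IsTest φ → pd i (fun x => c * φ x) = fun x => c * pd i φ x :=
    fun i h => funext fun x => pd_const_mul c i (h.differentiable x)
  simp only [hessSq, e _ h, e _ (h.pd _)]
  ring

lemma exists_isTest_layer (hr : 0 < r) (hr1 : r ≤ 1) : ∃ χ : Plane → ℝ, IsTest χ ∧
    (∀ x, r ≤ bdist x → χ =ᶠ[𝓝 x] 0) ∧ 0 < ∫ x, hessSq χ x ∂μD := by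
  let χ : Plane → ℝ := fun x => smoothTransition (4 * bdist x / r - 1)
    * smoothTransition (3 - 4 * bdist x / r)
  have hb : Smooth fun x => 4 * bdist x / r := (contDiff_const.mul contDiff_bdist).div_const _
  have hχ : Smooth χ := (contDiff_smoothTransition.comp (hb.sub contDiff_const)).mul
    (contDiff_smoothTransition.comp (contDiff_const.sub hb))
  have ht : IsTest χ := isTest_of_eq_zero hχ (r := r / 4) (by positivity) fun x hx => by
    have : 4 * bdist x / r ≤ 1 := (div_le_one hr).2 (by linarith)
    simp only [χ, smoothTransition.zero_of_nonpos (by linarith : 4 * bdist x / r - 1 ≤ 0), zero_mul]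
  refine ⟨χ, ht, fun x hx => ?_, ?_⟩
  · have ho : IsOpen {x : Plane | 3 / 4 * r < bdist x} :=
      isOpen_lt continuous_const (contDiff_bdist (n := 0)).continuous
    filter_upwards [ho.mem_nhds (show 3 / 4 * r < bdist x by linarith)] with y hy
    have : 3 ≤ 4 * bdist y / r := by
      rw [le_div_iff₀ hr]; linarith [show 3 / 4 * r < bdist y from hy]
    simp only [χ, smoothTransition.zero_of_nonpos (by linarith : 3 - 4 * bdist y / r ≤ 0),
      mul_zero, Pi.zero_apply]
  · refine integral_hessSq_pos ht (x := pt √(1 - r / 2) 0) ?_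
    have h1 : bdist (pt √(1 - r / 2) 0) = r / 2 := by
      simp only [bdist, norm_sq_plane, pt_zero, pt_one, sq_sqrt (by linarith : 0 ≤ 1 - r / 2)]
      ring
    have h2 : 4 * (r / 2) / r = 2 := by field_simp; norm_num
    simp only [χ, h1, h2]
    rw [smoothTransition.one_of_one_le (by norm_num), smoothTransition.one_of_one_le (by norm_num)]
    norm_num

lemma avg_add_stationary (F : ℝ → Plane → ℝ≥0∞) {G : Plane → ℝ≥0∞} (hG : Measurable G) :
    avg (fun t x => F t x + G x) = avg F + (∫⁻ x, G x ∂μD) / volume disc := by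
  unfold avg
  rw [← limsup_add_const _ _ _ (by isBoundedDefault) (by isBoundedDefault)]
  refine limsup_congr ?_
  filter_upwards [eventually_gt_atTop 0] with τ hτ
  have h0 : ofReal τ ≠ 0 := by simpa using hτ
  simp only [lintegral_add_right _ hG]
  rw [lintegral_add_right _ measurable_const, setLIntegral_const, ENNReal.add_div,
    Real.volume_Ioc, sub_zero, mul_comm _ (ofReal τ), ENNReal.mul_div_mul_left _ _ h0 ofReal_ne_top]

lemma hessSq_zero (x : Plane) : hessSq (fun _ => 0) x = 0 := by
  have : ∀ i, pd i (fun _ => (0 : ℝ)) = fun _ => 0 := fun i => funext (pd_const 0 i)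
  simp only [hessSq, this]; norm_num

lemma mol_congr (h : g =ᵐ[discMeasure] g') : mol k g = mol k g' :=
  funext fun x => integral_congr_ae (h.mono fun y hy => by simp only [hy])

lemma ofReal_sourceSq (hf : MemH1 f Df) (hD : MemH1Vec Df D2f) : ofReal (sourceSq f Df D2f)
      = ∫⁻ x, (‖f x‖ₑ ^ 2 + ‖Df x‖ₑ ^ 2 + ∑ i : Fin 2, ‖D2f x i‖ₑ ^ 2) ∂μD := by
  obtain ⟨p0, p1, p2, p3⟩ := sourceSq_parts f Df D2f
  have e0 := ofReal_integral_normSq hf.memLp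
  simp only [norm_eq_abs, sq_abs] at e0
  have m : ∀ {F : Type} [NormedAddCommGroup F] {v : Plane → F}, MemLp v 2 μD →
      AEMeasurable (fun x => ‖v x‖ₑ ^ 2) μD := fun h => h.1.enorm.pow_const 2
  simp only [Fin.sum_univ_two, ← add_assoc]
  rw [lintegral_add_right' _ (m (hD 1).memLp_grad), lintegral_add_right' _ (m (hD 0).memLp_grad),
    lintegral_add_right' _ (m hf.memLp_grad), ← e0, ← ofReal_integral_normSq hf.memLp_grad,
    ← ofReal_integral_normSq (hD 0).memLp_grad, ← ofReal_integral_normSq (hD 1).memLp_grad,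
    sourceSq, ofReal_add (by positivity) p3, ofReal_add (by positivity) p2, ofReal_add p0 p1]

/-- The residual of the approximate solution `η` of `u · ∇η = f` at one time. -/
def ResidualLe (f : Plane → ℝ) (w : Plane → Plane) (η : Plane → ℝ) (R β : ℝ) : Prop :=
  ∀ v g, MemH10 v g → |∫ x, f x * v x ∂μD - ∫ x, fderiv ℝ η x (w x) * v x ∂μD|
    ≤ √R * √(∫ x, ‖g x‖ ^ 2 ∂μD) + β * √(∫ x, v x ^ 2 ∂μD)

/-- The part of the `L²`-norm of the source at time `t` that is not balanced by the flow. -/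
def excess (f : ℝ → Plane → ℝ) (t : ℝ) : ℝ :=
  min √(∫ x, f t x ^ 2 ∂μD) (exp (-t) * ∫ x, f t x ^ 2 ∂μD)

lemma IsPattern.residual_le {H S : Plane → ℝ} (hp : IsPattern C M Ψ H W S) (hC : 0 ≤ C)
    (hf : MemH1 f Df) (hD : MemH1Vec Df D2f)
    (hk : IsMollifier k (1 / 4 ^ (M + 1) / 8)) {w : Plane → Plane}
    (hw : ∀ x, fderiv ℝ η x (w x) = bracket (fun x => hprim (mol k f) x * Ψ x) H x) {β : ℝ}
    (hβ : 0 ≤ β) : ResidualLe f w η ((200 * C + 22) * ((M + 1) / 4 ^ M) * sourceSq f Df D2f) β := by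
  have hg := isSmoothing_mol hf hD hk
  have sG := contDiff_hprim hg.smooth
  have sGΨ : Smooth fun x => hprim (mol k f) x * Ψ x := sG.mul hp.smooth_Ψ
  have hbr : Continuous (bracket (fun x => hprim (mol k f) x * Ψ x) H) :=
    ((contDiff_pd 0 sGΨ).continuous.mul (contDiff_pd 1 hp.smooth_H).continuous).sub
      ((contDiff_pd 1 sGΨ).continuous.mul (contDiff_pd 0 hp.smooth_H).continuous)
  have hbm : MemLp (bracket (fun x => hprim (mol k f) x * Ψ x) H) 2 μD := by
    simpa using memLp_continuous_mul hbr (memLp_const (1 : ℝ))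
  intro v g hv
  set B := sourceSq f Df D2f with hB
  set m : ℝ := 4 ^ M with hm
  have hm0 : 0 < m := by positivity
  have hm1 : 1 ≤ m := one_le_pow₀ (by norm_num)
  have hM : (0 : ℝ) ≤ M := cast_nonneg M
  have hB0 : 0 ≤ B := hg.nonneg
  have key := hv.abs_integral_le (k := fun x => f x - bracket (fun x => hprim (mol k f) x * Ψ x) H x)
    (Z := fun _ => 0) (hf.memLp.sub hbm) MemLp.zero'
    (C := √((200 * C + 22) * ((M + 1) / m) * B)) fun φ hφ => by
      have h1 := hk.abs_integral_sub_mol_le (by positivity) hf.memLp hφ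
      have h2 := hp.abs_integral_bracket_sub_le hC hg hφ
      simp only [inner_zero_right, integral_zero, add_zero, sub_mul]
      rw [integral_sub (integrable_mul_L2 hf.memLp (hφ.memLp 2))
        (integrable_mul_L2 hbm (hφ.memLp 2))]
      rw [← sqrt_sq (by positivity : (0 : ℝ) ≤ 1 / 4 ^ (M + 1) / 8),
        ← sqrt_mul (by positivity)] at h1
      refine (abs_sub_le _ (∫ x, mol k f x * φ x ∂μD) _).trans ?_
      rw [abs_sub_comm (∫ x, mol k f x * φ x ∂μD)]
      refine (add_le_add h1 h2).trans ?_
      rw [← add_mul]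
      refine mul_le_mul_of_nonneg_right ?_ (sqrt_nonneg _)
      have hΦ : ∫ x, f x ^ 2 ∂μD ≤ B := by
        obtain ⟨-, p1, p2, p3⟩ := sourceSq_parts f Df D2f
        rw [hB, sourceSq]; linarith
      have a1 : (1 / 4 ^ (M + 1) / 8) ^ 2 * ∫ x, f x ^ 2 ∂μD ≤ (M + 1) / m * B := by
        refine mul_le_mul ?_ hΦ (by positivity) (by positivity)
        rw [pow_succ (4 : ℝ) M, ← hm, div_div, div_pow, one_pow]
        refine div_le_div₀ (by positivity) (by linarith) hm0 ?_
        nlinarith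
      set a := (1 / 4 ^ (M + 1) / 8) ^ 2 * ∫ x, f x ^ 2 ∂μD
      have ha : 0 ≤ a := mul_nonneg (sq_nonneg _) (by positivity)
      set b := (100 * C + 10) * (M + 1) / m * B with hb
      have hb0 : 0 ≤ b := by positivity
      refine Real.le_sqrt_of_sq_le ?_
      have e : (200 * C + 22) * ((M + 1) / m) * B = 2 * b + 2 * ((M + 1) / m * B) := by
        rw [hb]; ring
      rw [e]
      nlinarith [sq_nonneg (√a - √b), sq_sqrt ha, sq_sqrt hb0]
  simp only [inner_zero_right, integral_zero, add_zero, sub_mul] at key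
  rw [integral_sub (integrable_mul_L2 hf.memLp hv.memLp)
    (integrable_mul_L2 hbm hv.memLp)] at key
  simp only [hw]
  exact key.trans (le_add_of_nonneg_right (by positivity))

theorem exists_velocity {f : ℝ → Plane → ℝ} {Df : ℝ → Plane → Plane}
    {D2f : ℝ → Plane → Fin 2 → Plane} (hf : IsSource f Df D2f) {L : ℝ} (hL : 0 < L)
    (havg : avg (fun t x => ‖f t x‖ₑ ^ 2 + ‖Df t x‖ₑ ^ 2 + ∑ i : Fin 2, ‖D2f t x i‖ₑ ^ 2)
      ≤ ofReal L)
    {C : ℝ} (hC : 0 < C) {M : ℕ} {Ψ H W S : Plane → ℝ} (hp : IsPattern C M Ψ H W S)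
    {Pe : ℝ} (hPe : 0 < Pe) :
    ∃ u U η, IsAdmissible Pe u ∧ IsFlow u U ∧ IsTest η ∧ ∫ x, ‖∇ η x‖ ^ 2 ∂discMeasure
        ≤ 1000 * C ^ 2 * L * ((4 ^ M) ^ 2 * (M + 1) ^ 2 / Pe ^ 2) ∧
      ∀ᵐ t ∂volume.restrict (Ioi (0 : ℝ)), ResidualLe (f t) (u t) η
        ((200 * C + 22) * ((M + 1) / 4 ^ M) * sourceSq (f t) (Df t) (D2f t)) (excess f t) := by
  have hr0 : (0 : ℝ) < 1 / 4 ^ (M + 1) := by positivity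
  obtain ⟨k, hk⟩ := exists_isMollifier (h := 1 / 4 ^ (M + 1) / 8) (by positivity)
  obtain ⟨χ, hχ, hχ0, hχpos⟩ := exists_isTest_layer hr0
    ((div_le_one (by positivity)).2 (one_le_pow₀ (by norm_num)))
  obtain ⟨g, hgm, hg2, hgt, hgae⟩ := exists_tame_source hf.meas (hf.memH1.mono fun t h => h.memLp)
  set K : ℝ := 1000 * C * (4 ^ M * (M + 1)) with hK
  have hK0 : 0 < K := by positivity
  set ε : ℝ := √(K * L) / Pe with hε
  have hε0 : 0 < ε := by positivity
  have hε2 : ε ^ 2 = K * L / Pe ^ 2 := by rw [hε, div_pow, Real.sq_sqrt (by positivity)]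
  let P : ℝ → Plane → ℝ := fun t x => hprim (mol k fun y => g (t, y)) x * Ψ x
  have sm : ∀ t, ContDiff ℝ ∞ (hprim (mol k fun y => g (t, y))) := fun t =>
    contDiff_hprim (contDiff_mol hk.smooth hk.compact (hg2 t))
  have tP : ∀ t, IsTest (P t) := fun t => hp.test_Ψ.mul_left (sm t)
  have ho : IsOpen {x : Plane | bdist x < 1 / 4 ^ (M + 1)} :=
    isOpen_lt (contDiff_bdist (n := 0)).continuous continuous_const
  -- Mean enstrophy of the first part.
  have hens : avg (fun t x => ofReal (hessSq (fun x => ε⁻¹ * P t x) x))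
      ≤ ofReal (Pe ^ 2) := by
    have hle : ∀ᵐ t ∂volume.restrict (Ioi (0 : ℝ)),
        ∫⁻ x, ofReal (hessSq (fun x => ε⁻¹ * P t x) x) ∂discMeasure
          ≤ ofReal (ε⁻¹ ^ 2 * K) * ∫⁻ x, (‖f t x‖ₑ ^ 2 + ‖Df t x‖ₑ ^ 2
            + ∑ i : Fin 2, ‖D2f t x i‖ₑ ^ 2) ∂discMeasure := by
      filter_upwards [hf.memH1, hf.memH1_grad, hgae] with t h1 h2 h3
      rcases h3 with h3 | ⟨h3, -⟩
      · have e1 : P t = fun x => hprim (mol k (f t)) x * Ψ x := by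
          simp only [P, mol_congr h3]
        have hg := isSmoothing_mol h1 h2 hk
        rw [← ofReal_sourceSq h1 h2, ← ENNReal.ofReal_mul (by positivity),
          ← ofReal_integral_eq_lintegral_ofReal]
        · refine ENNReal.ofReal_le_ofReal ?_
          simp only [hessSq_const_mul (tP t)]
          rw [integral_const_mul, mul_assoc, e1]
          exact mul_le_mul_of_nonneg_left (hp.integral_hessSq_le hC.le hg) (sq_nonneg _)
        · have ht := (tP t).const_mul ε⁻¹
          exact ((((ht.pd 0).pd 0).memLp 2).integrable_sq.add
            ((((ht.pd 1).pd 0).memLp 2).integrable_sq.const_mul 2)).add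
            (((ht.pd 1).pd 1).memLp 2).integrable_sq
        · exact Eventually.of_forall fun x => hessSq_nonneg _ x
      · have e1 : (fun x => ε⁻¹ * P t x) = fun _ => 0 := by
          simp [P, h3, mol, hprim]
        simp [e1, hessSq_zero]
    have hfin : ε⁻¹ ^ 2 * K * L = Pe ^ 2 := by
      rw [inv_pow, hε2]; field_simp
    calc _ ≤ ofReal (ε⁻¹ ^ 2 * K) * avg (fun t x => ‖f t x‖ₑ ^ 2 + ‖Df t x‖ₑ ^ 2
          + ∑ i : Fin 2, ‖D2f t x i‖ₑ ^ 2) := by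
          unfold avg
          rw [← ENNReal.limsup_const_mul_of_ne_top ENNReal.ofReal_ne_top]
          refine limsup_le_limsup (Eventually.of_forall fun τ => ?_) (by isBoundedDefault)
            (by isBoundedDefault)
          simp only
          rw [← mul_div_assoc, ← lintegral_const_mul' _ _ ENNReal.ofReal_ne_top]
          refine ENNReal.div_le_div_right (lintegral_mono_ae ?_) _
          exact ae_mono (Measure.restrict_mono Ioc_subset_Ioi_self le_rfl) hle
      _ ≤ ofReal (ε⁻¹ ^ 2 * K) * ofReal L := by gcongr
      _ = _ := by rw [← ENNReal.ofReal_mul (by positivity), hfin]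
  set A := avg (fun t x => ofReal (hessSq (fun x => ε⁻¹ * P t x) x)) with hA
  set hχi := ∫ x, hessSq χ x ∂discMeasure
  set b : ℝ := √((Pe ^ 2 - A.toReal) * Real.pi / hχi) with hb
  have hAtop : A ≠ ⊤ := ne_top_of_le_ne_top ENNReal.ofReal_ne_top hens
  have hAle : A.toReal ≤ Pe ^ 2 := ENNReal.toReal_le_of_le_ofReal (by positivity) hens
  have hb2 : b ^ 2 * hχi = (Pe ^ 2 - A.toReal) * Real.pi := by
    rw [hb, Real.sq_sqrt (by have := Real.pi_pos; have : 0 ≤ Pe ^ 2 - A.toReal := by linarith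
                             positivity)]
    field_simp
  obtain ⟨U, hU⟩ := exists_isStream hk hp.test_Ψ (hχ.const_mul b) hgm hg2 hgt ε⁻¹
  set ψ : ℝ → Plane → ℝ := fun t x => ε⁻¹ * (hprim (mol k fun y => g (t, y)) x * Ψ x) + b * χ x
    with hψ
  have tχ := hχ.const_mul b
  have near : ∀ t x, (ψ t =ᶠ[𝓝 x] (fun x => ε⁻¹ * P t x) ∧ (fun x => b * χ x) =ᶠ[𝓝 x] fun _ => 0) ∨
      (bdist x < 1 / 4 ^ (M + 1) ∧ ψ t =ᶠ[𝓝 x] (fun x => b * χ x) ∧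
        (fun x => ε⁻¹ * P t x) =ᶠ[𝓝 x] fun _ => 0) := by
    intro t x
    by_cases hx : bdist x < 1 / 4 ^ (M + 1)
    · refine Or.inr ⟨hx, ?_⟩
      constructor <;> filter_upwards [ho.mem_nhds hx] with y hy
      · simp only [hψ, (hp.supp y hy).1]; ring
      · simp only [P, (hp.supp y hy).1, mul_zero]
    · left
      constructor <;> filter_upwards [hχ0 x (not_lt.1 hx)] with y hy
      · simp only [hψ, hy, Pi.zero_apply, P]; ring
      · simp only [hy, Pi.zero_apply, mul_zero]
  have hsum : ∀ t x, hessSq (ψ t) x = hessSq (fun x => ε⁻¹ * P t x) x + b ^ 2 * hessSq χ x := by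
    intro t x
    rw [← hessSq_const_mul hχ]
    rcases near t x with ⟨h1, h2⟩ | ⟨-, h1, h2⟩ <;> rw [hessSq_congr h1, hessSq_congr h2, hessSq_zero] <;> ring
  refine ⟨streamVel ψ, 2 * U, fun x => ε * H x, ⟨streamGrad ψ, hU.isVelocity, ?_⟩, hU.isFlow,
    hp.test_H.const_mul ε, ?_, ?_⟩
  · simp only [meanEnstrophy, sum_enorm_streamGrad_sq (hU.test _).1, hsum]
    simp only [ENNReal.ofReal_add (hessSq_nonneg _ _) (mul_nonneg (sq_nonneg b) (hessSq_nonneg _ _))]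
    rw [avg_add_stationary, ← hA, ← ofReal_integral_eq_lintegral_ofReal, integral_const_mul,
      volume_disc, hb2, ← ENNReal.ofReal_div_of_pos Real.pi_pos,
      mul_div_cancel_right₀ _ Real.pi_ne_zero]
    · nth_rewrite 1 [← ENNReal.ofReal_toReal hAtop]
      rw [← ENNReal.ofReal_add ENNReal.toReal_nonneg (by linarith)]
      congr 1; ring
    · exact (((((hχ.pd 0).pd 0).memLp 2).integrable_sq.add
        ((((hχ.pd 1).pd 0).memLp 2).integrable_sq.const_mul 2)).add
        (((hχ.pd 1).pd 1).memLp 2).integrable_sq).const_mul _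
    · exact Eventually.of_forall fun x => mul_nonneg (sq_nonneg b) (hessSq_nonneg _ x)
    · have c : ∀ i j, Continuous (pd i (pd j χ)) := fun i j => ((hχ.pd j).pd i).continuous
      have : Continuous (hessSq χ) := (((c 0 0).pow 2).add
        (((c 0 1).pow 2).const_smul (2 : ℝ))).add ((c 1 1).pow 2)
      fun_prop
  · have e : ∀ x, ‖∇ (fun x => ε * H x) x‖ ^ 2 = ε ^ 2 * (pd 0 H x ^ 2 + pd 1 H x ^ 2) := by
      intro x
      simp only [norm_sq_plane, gradient_apply, pd_const_mul ε _ (hp.test_H.differentiable x)]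
      ring
    simp only [e]
    rw [integral_const_mul, hε2]
    refine (mul_le_mul_of_nonneg_left hp.integral_H (by positivity)).trans (le_of_eq ?_)
    rw [hK]; field_simp
  · have hbr : ∀ t x, fderiv ℝ (fun x => ε * H x) x (streamVel ψ t x) = bracket (P t) H x := by
      intro t x
      rw [fderiv_streamVel]
      simp only [pd_const_mul ε _ (hp.test_H.differentiable x), bracket]
      rcases near t x with ⟨h1, -⟩ | ⟨hx, -⟩
      · simp only [(pd_congr h1 _).eq_of_nhds, pd_const_mul ε⁻¹ _ ((tP t).differentiable x)]
        field_simp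
      · simp only [pd_eq_zero_of_layer (fun y hy => (hp.supp y hy).2.1) _ hx]; ring
    filter_upwards [hf.memH1, hf.memH1_grad, hgae] with t h1 h2 h3
    have hΦ : 0 ≤ ∫ x, f t x ^ 2 ∂discMeasure := by positivity
    rcases h3 with h3 | ⟨h3, h4⟩
    · refine hp.residual_le hC.le h1 h2 hk (fun x => ?_)
        (le_min (Real.sqrt_nonneg _) (mul_nonneg (Real.exp_pos _).le hΦ))
      rw [hbr]
      simp only [P, mol_congr h3]
    · intro v w hv
      have e1 : P t = fun _ => 0 := by
        simp [P, h3, mol, hprim]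
      have e2 : ∀ x, bracket (P t) H x = 0 := fun x => by simp [bracket, e1, pd_const]
      simp only [hbr, e2, zero_mul, integral_zero, sub_zero]
      refine (abs_integral_mul_le h1.memLp hv.memLp).trans (le_add_of_nonneg_of_le (by positivity)
        (mul_le_mul_of_nonneg_right (le_min le_rfl ?_) (Real.sqrt_nonneg _)))
      nth_rewrite 2 [← Real.sq_sqrt hΦ]
      rw [Real.exp_neg, inv_mul_eq_div, le_div_iff₀ (Real.exp_pos t), sq]
      exact mul_le_mul_of_nonneg_left h4.le (Real.sqrt_nonneg _)

/-! ### The upper bound -/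

lemma IsFlow.memLp_of_norm_le (hu : IsFlow u U)
    (ht : 0 < t) {F G : Type*} [NormedAddCommGroup F] [NormedAddCommGroup G] {v : Plane → F}
    {z : Plane → G} (hv : MemLp v 2 μD) (hz : AEStronglyMeasurable z μD)
    (h : ∀ x, ‖z x‖ ≤ ‖u t x‖ * ‖v x‖) : MemLp z 2 μD := by
  refine (hv.norm.const_mul (U * exp t)).mono hz (.of_forall fun x => (h x).trans ?_)
  rw [norm_mul, norm_norm]
  exact mul_le_mul_of_nonneg_right ((hu.bound t x ht).trans (le_abs_self _)) (norm_nonneg _)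

lemma IsFlow.dissipation_le (hu : IsFlow u U) (ht : 0 < t) (hη : IsTest η) {g μ : Plane → Plane} (hv : MemH10 v g) (hk : MemLp k 2 μD) (hμ : MemLp μ 2 μD)
    (heq : ∀ φ, IsTest φ → ∫ x, ⟪∇ φ x, μ x⟫ ∂μD = ∫ x, ⟪∇ φ x, g x⟫ ∂μD
        + ∫ x, ⟪u t x, g x⟫ * φ x ∂μD - ∫ x, k x * φ x ∂μD)
    {R β N : ℝ} (hR : 0 ≤ R) (hN : ∫ x, ‖∇ η x‖ ^ 2 ∂μD ≤ N)
    (hres : ResidualLe k (u t) η R β) : ∫ x, ‖g x - ∇ η x‖ ^ 2 ∂μD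
      ≤ 2 * ∫ x, ⟪g x - ∇ η x, μ x⟫ ∂μD + 2 * N + 2 * R
        + 2 * (β * √(∫ x, (v x - η x) ^ 2 ∂μD)) := by
  have hum := hu.memLp_slice ht
  have hV := hv.sub hη.memH10
  have hηg := hη.memLp_gradient 2
  set V : Plane → ℝ := fun x => v x - η x
  set q : Plane → Plane := fun x => g x - ∇ η x with hq
  have ug : ∀ {w : Plane → Plane}, MemLp w 2 μD → MemLp (fun x => ⟪u t x, w x⟫) 2 μD := fun hw =>
    hu.memLp_of_norm_le ht hw (hum.1.inner hw.1) fun x => norm_inner_le_norm _ _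
  have uV : MemLp (fun x => V x • u t x) 2 μD :=
    hu.memLp_of_norm_le ht hV.memLp (hV.memLp.1.smul hum.1) fun x => by rw [norm_smul, mul_comm]
  have hskew : ∫ x, ⟪u t x, q x⟫ * V x ∂μD = 0 := by
    have h1 := hV.integral_eq_zero (ug hV.memLp_grad) uV fun φ hφ => by
      have h2 := hu.skew ht hφ hV
      rw [add_comm] at h2
      convert h2 using 2 <;> refine integral_ext (fun x => ?_) <;>
        simp only [inner_smul_right, real_inner_comm (u t x)] <;> ring
    have h3 : ∫ x, ⟪q x, V x • u t x⟫ ∂μD = ∫ x, ⟪u t x, q x⟫ * V x ∂μD := by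
      refine integral_ext fun x => ?_
      simp only [inner_smul_right, real_inner_comm (u t x)]; ring
    linarith
  have hbal := hV.integral_eq_zero (k := fun x => k x - ⟪u t x, g x⟫)
    (Z := fun x => μ x - g x) (hk.sub (ug hv.memLp_grad)) (hμ.sub hv.memLp_grad) fun φ hφ => by
      have h1 := heq φ hφ
      simp only [sub_mul, inner_sub_right]
      rw [integral_sub (integrable_mul_L2 hk (hφ.memLp 2))
        (integrable_mul_L2 (ug hv.memLp_grad) (hφ.memLp 2)),
        integral_sub (integrable_inner (hφ.memLp_gradient 2) hμ)
        (integrable_inner (hφ.memLp_gradient 2) hv.memLp_grad)]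
      linarith
  have hgq : ∀ x, g x = q x + ∇ η x := fun x => by simp [hq]
  have hfd : ∀ x, ⟪u t x, ∇ η x⟫ = fderiv ℝ η x (u t x) := fun x => by
    rw [← inner_gradient, real_inner_comm]
  have hηm : MemLp (fun x => fderiv ℝ η x (u t x)) 2 μD := by simpa only [hfd] using ug hηg
  have e1 : ∫ x, (k x - ⟪u t x, g x⟫) * V x ∂μD
      = ∫ x, k x * V x ∂μD - ∫ x, fderiv ℝ η x (u t x) * V x ∂μD := by
    have i1 := integrable_mul_L2 (ug hV.memLp_grad) hV.memLp
    have i2 := integrable_mul_L2 hηm hV.memLp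
    have i3 := integrable_mul_L2 hk hV.memLp
    have i32 : Integrable (fun x => k x * V x - fderiv ℝ η x (u t x) * V x) μD := i3.sub i2
    rw [← sub_zero (_ - _), ← hskew, ← integral_sub i3 i2, ← integral_sub i32 i1]
    refine integral_ext fun x => ?_
    simp only [hgq x, inner_add_right, hfd]; ring
  have e2 : ∫ x, ⟪q x, μ x - g x⟫ ∂μD = ∫ x, ⟪q x, μ x⟫ ∂μD
      - ∫ x, ‖q x‖ ^ 2 ∂μD - ∫ x, ⟪q x, ∇ η x⟫ ∂μD := by
    have i1 := integrable_inner hV.memLp_grad hμ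
    have i2 := integrable_normSq hV.memLp_grad
    have i12 : Integrable (fun x => ⟪q x, μ x⟫ - ‖q x‖ ^ 2) μD := i1.sub i2
    rw [← integral_sub i1 i2, ← integral_sub i12 (integrable_inner hV.memLp_grad hηg)]
    refine integral_ext fun x => ?_
    simp only [hgq x, inner_sub_right, inner_add_right, real_inner_self_eq_norm_sq]; ring
  rw [e1, e2] at hbal
  have h1 := (le_abs_self _).trans (hres V q hV)
  have h2 := (neg_le_abs _).trans (abs_integral_inner_le hV.memLp_grad hηg)
  set Q := ∫ x, ‖q x‖ ^ 2 ∂μD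
  set E := ∫ x, V x ^ 2 ∂μD
  set Y := ∫ x, ‖∇ η x‖ ^ 2 ∂μD
  have hQ : 0 ≤ Q := by positivity
  have hY : 0 ≤ Y := by positivity
  nlinarith [sq_nonneg (√Q - 2 * √R), sq_nonneg (√Q - 2 * √Y), sq_sqrt hQ, sq_sqrt hR, sq_sqrt hY]

lemma lintegral_Ioc_zero_le {F : ℝ → ℝ≥0∞} {K : ℝ≥0∞}
    (h : ∀ δ, 0 < δ → ∃ a ∈ Ioo 0 δ, ∫⁻ t in Ioc a b, F t ≤ K) : ∫⁻ t in Ioc 0 b, F t ≤ K := by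
  have hU : Ioc 0 b = ⋃ n : ℕ, Ioc (1 / ((n : ℝ) + 1)) b := by
    ext t
    simp only [mem_iUnion, mem_Ioc]
    refine ⟨fun ht => ?_, fun ⟨n, h1, h2⟩ => ⟨lt_trans (by positivity) h1, h2⟩⟩
    obtain ⟨n, hn⟩ := exists_nat_one_div_lt ht.1
    exact ⟨n, hn, ht.2⟩
  have hmono : Monotone fun n : ℕ => Ioc (1 / ((n : ℝ) + 1)) b := fun n n' h =>
    Ioc_subset_Ioc_left (Nat.one_div_le_one_div h)
  rw [hU, ← withDensity_apply F (MeasurableSet.iUnion fun n => measurableSet_Ioc),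
    hmono.measure_iUnion]
  refine iSup_le fun n => ?_
  obtain ⟨a, ha, hle⟩ := h (1 / ((n : ℝ) + 1)) (by positivity)
  rw [withDensity_apply F measurableSet_Ioc]
  exact (lintegral_mono_set (Ioc_subset_Ioc_left ha.2.le)).trans hle

section

variable {f : ℝ → Plane → ℝ} {u : ℝ → Plane → Plane} {U : ℝ} {T₀ : Plane → ℝ} {T : ℝ → Plane → ℝ}
  {DT : ℝ → Plane → Plane} {η : Plane → ℝ} {N e : ℝ} {F : ℝ → ℝ}

lemma IsTemperature.lintegral_grad_le (hT : IsTemperature f u T₀ T DT) (hu : IsFlow u U)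
    (hη : IsTest η) (hN : ∫ x, ‖∇ η x‖ ^ 2 ∂μD ≤ N) (he : 0 ≤ e) (hf : ∀ᵐ t ∂μT,
      MemLp (f t) 2 μD ∧ ∫ x, f t x ^ 2 ∂μD ≤ F t) (iF : ∀ τ, IntegrableOn F (Ioc 0 τ))
    (iE : IntegrableOn (fun t => exp (-t) * F t) (Ioi 0))
    (hres : ∀ᵐ t ∂μT, ResidualLe (f t) (u t) η (e * F t) (excess f t)) :
    ∃ S : Set ℝ, (∀ᵐ t, t ∈ S) ∧ ∀ a ∈ S, ∀ b ∈ S, 0 < a → a < b →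
      ∀ E, ∫ x, (T a x - η x) ^ 2 ∂μD ≤ E →
      ∫⁻ t in Ioc a b, ∫⁻ x, ‖DT t x‖ₑ ^ 2 ∂μD ≤ ofReal (2 * E + 6 * N * b
        + 4 * e * (∫ t in Ioc 0 b, F t) + 4 * √(E + 2 * N * b + (2 * e + 1) * ∫ t in Ioc 0 b, F t)
          * ∫ t in Ioi 0, exp (-t) * F t) := by
  obtain ⟨m, hev, heq⟩ := hT.exists_evolution
  obtain ⟨S, hS, hSE⟩ := hev.energy_sub hη
  refine ⟨S, hS, fun a ha b hb ha0 hab E hE => ?_⟩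
  have hηg := hη.memLp_gradient 2
  have hN0 : 0 ≤ N := (integral_nonneg fun x => by positivity).trans hN
  have hb0 := ha0.trans hab
  have hsub : Ioc a b ⊆ Ioi 0 := fun t ht => ha0.trans ht.1
  have hsub' : Ioc a b ⊆ Ioc 0 b := Ioc_subset_Ioc_left ha0.le
  have bD : MemLp ♯DT 2 ((volume.restrict (Ioc a b)).prod μD) :=
    (hev.memL2Loc_grad.memLp_Icc ha0 hab).mono_measure
      (Measure.prod_mono (restrict_mono Ioc_subset_Icc_self le_rfl) le_rfl)
  have bm : MemLp ♯m 2 ((volume.restrict (Ioc a b)).prod μD) :=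
    (hev.memL2Loc_flux.memLp_Icc ha0 hab).mono_measure
      (Measure.prod_mono (restrict_mono Ioc_subset_Icc_self le_rfl) le_rfl)
  obtain ⟨hMa, hMb, iJ, hEb⟩ := hSE a ha b hb ha0 hab
  set J : ℝ → ℝ := fun t => ∫ x, ⟪DT t x - ∇ η x, m t x⟫ ∂μD
  let V : ℝ → ℝ := fun t => ∫ x, (T t x - η x) ^ 2 ∂μD
  have hpos : ∀ᵐ t ∂μT, 0 ≤ F t := hf.mono fun t ht =>
    (integral_nonneg fun x => sq_nonneg _).trans ht.2
  have point : ∀ᵐ t ∂volume.restrict (Ioc a b), 0 ≤ F t ∧ ∫ x, ‖DT t x - ∇ η x‖ ^ 2 ∂μD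
        ≤ 2 * J t + 2 * N + 2 * (e * F t) + 2 * (excess f t * √(V t)) ∧ ∫ x, ‖DT t x‖ ^ 2 ∂μD
        ≤ 2 * (∫ x, ‖DT t x - ∇ η x‖ ^ 2 ∂μD) + 2 * N ∧
      excess f t ≤ √(F t) ∧ excess f t ≤ exp (-t) * F t ∧
      V t ≤ ∫ x, ‖DT t x - ∇ η x‖ ^ 2 ∂μD := by
    filter_upwards [ae_mono (restrict_mono hsub le_rfl) hf,
      ae_mono (restrict_mono hsub le_rfl) hpos, ae_mono (restrict_mono hsub le_rfl) hres,
      ae_mono (restrict_mono hsub le_rfl) heq,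
      ae_mono (restrict_mono hsub le_rfl) hev.memH10, ae_memLp_slice bm,
      ae_restrict_mem measurableSet_Ioc] with t h1 h2 h3 h4 h5 h6 h7
    have hq := h5.sub hη.memH10
    refine ⟨h2, hu.dissipation_le (hsub h7) hη h5 h1.1 h6 h4 (mul_nonneg he h2) hN h3, ?_,
      (min_le_left _ _).trans (sqrt_le_sqrt h1.2), (min_le_right _ _).trans
      (mul_le_mul_of_nonneg_left h1.2 (exp_pos _).le), hq.poincare⟩
    have i1 := (integrable_normSq hq.memLp_grad).const_mul 2
    have i2 := (integrable_normSq hηg).const_mul 2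
    calc _ ≤ ∫ x, (2 * ‖DT t x - ∇ η x‖ ^ 2 + 2 * ‖∇ η x‖ ^ 2) ∂μD := by
          refine integral_mono (integrable_normSq h5.memLp_grad) (i1.add i2) fun x => ?_
          have h := norm_add_le (DT t x - ∇ η x) (∇ η x)
          rw [sub_add_cancel] at h
          simp only
          nlinarith [norm_nonneg (DT t x), sq_nonneg (‖DT t x - ∇ η x‖ - ‖∇ η x‖)]
      _ ≤ _ := by rw [integral_add i1 i2, integral_const_mul, integral_const_mul]; linarith
  set IF := ∫ t in Ioc 0 b, F t
  set X := E + 2 * N * b + (2 * e + 1) * IF with hX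
  have hIab : ∫ t in Ioc a b, F t ≤ IF := setIntegral_mono_set (iF b)
    (ae_mono (restrict_mono Ioc_subset_Ioi_self le_rfl) hpos) hsub'.eventuallyLE
  have hV : ∀ᵐ t ∂volume.restrict (Ioc a b), V t ≤ X := by
    filter_upwards [ae_restrict_mem measurableSet_Ioc, ae_restrict_of_ae hS] with t ht htS
    obtain ⟨-, -, jJ, hEt⟩ := hSE a ha t htS ha0 ht.1
    have hs : Ioc a t ⊆ Ioc a b := Ioc_subset_Ioc_right ht.2
    have jF : IntegrableOn F (Ioc a t) := (iF b).mono_set (hs.trans hsub')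
    have h1 : -2 * ∫ t in Ioc a t, J t ≤ ∫ t in Ioc a t, (2 * N + (2 * e + 1) * F t) := by
      rw [← integral_const_mul]
      refine integral_mono_ae (jJ.const_mul _) ((integrableOn_const (by simp)).add
        (jF.const_mul _)) ?_
      filter_upwards [ae_mono (restrict_mono hs le_rfl) point] with s ⟨p0, p1, _, p3, _, p5⟩
      have hV0 : 0 ≤ V s := by positivity
      have := mul_le_mul_of_nonneg_right p3 (sqrt_nonneg (V s))
      have := sq_nonneg (√(F s) - √(V s))
      have := sq_sqrt p0
      have := sq_sqrt hV0
      nlinarith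
    have kN : IntegrableOn (fun _ : ℝ => 2 * N) (Ioc a t) := integrableOn_const (by simp)
    rw [integral_add kN (jF.const_mul _), integral_const_mul (2 * e + 1),
      setIntegral_const, Real.volume_real_Ioc_of_le ht.1.le, smul_eq_mul] at h1
    have h2 : ∫ t in Ioc a t, F t ≤ IF := setIntegral_mono_set (iF b)
      (ae_mono (restrict_mono Ioc_subset_Ioi_self le_rfl) hpos) (hs.trans hsub').eventuallyLE
    have h3 : (t - a) * (2 * N) ≤ b * (2 * N) :=
      mul_le_mul_of_nonneg_right (by linarith [ht.2]) (by linarith)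
    have h4 := mul_le_mul_of_nonneg_left h2 (by linarith : 0 ≤ 2 * e + 1)
    have h5 : V t - V a = _ := hEt
    have h6 : V a ≤ E := hE
    rw [hX]
    linarith
  have iΛ : IntegrableOn (fun t => exp (-t) * F t) (Ioc a b) := iE.mono_set hsub
  have jF : IntegrableOn F (Ioc a b) := (iF b).mono_set hsub'
  have hΛ : ∫ t in Ioc a b, exp (-t) * F t ≤ ∫ t in Ioi 0, exp (-t) * F t :=
    setIntegral_mono_set iE (hpos.mono fun t ht => mul_nonneg (exp_pos _).le ht) hsub.eventuallyLE
  have k1 : IntegrableOn (fun t => 4 * J t) (Ioc a b) := iJ.const_mul 4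
  have k2 : IntegrableOn (fun _ : ℝ => 6 * N) (Ioc a b) := integrableOn_const (by simp)
  have k3 : IntegrableOn (fun t => 4 * e * F t) (Ioc a b) := jF.const_mul _
  have k4 : IntegrableOn (fun t => 4 * √X * (exp (-t) * F t)) (Ioc a b) := iΛ.const_mul _
  have k12 : IntegrableOn (fun t => 4 * J t + 6 * N) (Ioc a b) := k1.add k2
  have k123 : IntegrableOn (fun t => 4 * J t + 6 * N + 4 * e * F t) (Ioc a b) := k12.add k3
  have main : ∫ t in Ioc a b, ∫ x, ‖DT t x‖ ^ 2 ∂μD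
      ≤ ∫ t in Ioc a b, (4 * J t + 6 * N + 4 * e * F t + 4 * √X * (exp (-t) * F t)) := by
    refine integral_mono_ae (integrable_slice_normSq bD) (k123.add k4) ?_
    filter_upwards [point, hV] with t ⟨p0, p1, p2, _, p4, _⟩ hVt
    have h1 := mul_le_mul p4 (sqrt_le_sqrt hVt) (sqrt_nonneg _) (mul_nonneg (exp_pos _).le p0)
    linarith
  rw [integral_add k123 k4, integral_add k12 k3,
    integral_add k1 k2, integral_const_mul 4 J, integral_const_mul (4 * e), integral_const_mul (4 * √X),
    setIntegral_const, Real.volume_real_Ioc_of_le hab.le, smul_eq_mul] at main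
  rw [← lintegral_prod _ (bD.1.enorm.pow_const 2), ← ofReal_integral_normSq bD,
    integral_prod _ (integrable_normSq bD)]
  refine ofReal_le_ofReal (main.trans ?_)
  have h1 := mul_le_mul_of_nonneg_left hΛ (by positivity : 0 ≤ 4 * √X)
  have h2 := mul_le_mul_of_nonneg_left hIab (by linarith : 0 ≤ 4 * e)
  have h3 : (b - a) * (6 * N) ≤ b * (6 * N) :=
    mul_le_mul_of_nonneg_right (by linarith) (by linarith)
  have h4 : 0 ≤ ∫ x, (T b x - η x) ^ 2 ∂μD := by positivity
  linarith

end

lemma exists_growth_bound {E N e Λ : ℝ} (hE : 0 ≤ E) (hN : 0 ≤ N) (he : 0 < e) (hB : 0 < B) :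
    ∃ τ₁, 1 ≤ τ₁ ∧ ∀ τ, τ₁ ≤ τ → ∀ b I, 0 ≤ b → b ≤ τ + 1 → 0 ≤ I → I ≤ B * π * (τ + 1) →
      2 * E + 6 * N * b + 4 * e * I + 4 * √(E + 2 * N * b + (2 * e + 1) * I) * Λ
        ≤ 10 * (N + e * B) * (τ * π) := by
  have hπ := pi_pos
  set Y : ℝ := 2 * N + (2 * e + 1) * (B * π) with hY
  have hY0 : 0 ≤ Y := by positivity
  set θ : ℝ := e * B / (Y + 1) with hθ
  have hθ0 : 0 < θ := by positivity
  have hθY : θ * Y ≤ e * B := by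
    have : θ * (Y + 1) = e * B := div_mul_cancel₀ _ (by positivity)
    linarith
  set c := 2 * E + 6 * N + 4 * e * (B * π) + θ * E + e * B + (4 * Λ) ^ 2 / (4 * θ) with hc
  refine ⟨max 1 (c / (e * B)), le_max_left _ _, fun τ hτ b I hb0 hb hI0 hI => ?_⟩
  have hτ1 := (le_max_left _ _).trans hτ
  have hτc := (div_le_iff₀ (by positivity)).1 ((le_max_right _ _).trans hτ)
  have hX : E + 2 * N * b + (2 * e + 1) * I ≤ E + Y * (τ + 1) := by
    have h1 := mul_le_mul_of_nonneg_left hb (by positivity : 0 ≤ 2 * N)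
    have h2 := mul_le_mul_of_nonneg_left hI (by positivity : 0 ≤ 2 * e + 1)
    rw [hY]; linarith
  have hX0 : 0 ≤ E + 2 * N * b + (2 * e + 1) * I := by positivity
  have h1 := mul_le_young (x := √(E + 2 * N * b + (2 * e + 1) * I)) (y := 4 * Λ) hθ0
  rw [sq_sqrt hX0] at h1
  have h2 := mul_le_mul_of_nonneg_left hX hθ0.le
  have h3 := mul_le_mul_of_nonneg_right hθY (by linarith : 0 ≤ τ + 1)
  have h4 := mul_le_mul_of_nonneg_left hb (by positivity : 0 ≤ 6 * N)
  have h5 := mul_le_mul_of_nonneg_left hI (by positivity : 0 ≤ 4 * e)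
  have hτ3 : τ * 3 ≤ τ * π := mul_le_mul_of_nonneg_left Real.pi_gt_three.le (by linarith)
  have h6 : 6 * N * τ ≤ 10 * N * (τ * π) := by nlinarith
  have h7 : e * B * (τ * 3) ≤ e * B * (τ * π) := mul_le_mul_of_nonneg_left hτ3 (by positivity)
  have h8 : 0 ≤ e * B * τ := by positivity
  linarith

section

variable {F : ℝ → ℝ} {B τ₀ : ℝ}

lemma integrableOn_exp_neg_mul (hF : ∀ᵐ t ∂μT, 0 ≤ F t)
    (iF : ∀ τ, IntegrableOn F (Ioc 0 τ)) (hτ₀ : 0 < τ₀)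
    (hFB : ∀ τ, τ₀ ≤ τ → ∫ t in Ioc 0 τ, F t ≤ B * τ) :
    IntegrableOn (fun t => exp (-t) * F t) (Ioi 0) := by
  have hae : ∀ {s : Set ℝ}, s ⊆ Ioi 0 → ∀ᵐ t ∂volume.restrict s, 0 ≤ F t := fun hs =>
    ae_mono (restrict_mono hs le_rfl) hF
  have hU : Ioi (0 : ℝ) = ⋃ n : ℕ, Ioc (0 : ℝ) n := by
    ext t
    simp only [mem_Ioi, mem_iUnion, mem_Ioc]
    exact ⟨fun h => (exists_nat_ge t).imp fun n hn => ⟨h, hn⟩, fun ⟨n, h, _⟩ => h⟩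
  have hm : AEStronglyMeasurable (fun t => exp (-t) * F t) (volume.restrict (Ioi 0)) := by
    refine (by fun_prop : Continuous fun t => exp (-t)).aestronglyMeasurable.mul ?_
    rw [hU, aestronglyMeasurable_iUnion_iff]
    exact fun n => (iF n).1
  refine ⟨hm, ?_⟩
  have hB0 : 0 ≤ B := by
    have h1 := hFB τ₀ le_rfl
    have h2 := integral_nonneg_of_ae (hae (Ioc_subset_Ioi_self : Ioc 0 τ₀ ⊆ Ioi 0))
    by_contra! h
    nlinarith
  have hIb : ∀ n : ℕ, ∫ t in Ioc (0 : ℝ) (n + 1), F t ≤ B * (τ₀ + n + 1) := fun n =>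
    (setIntegral_mono_set (iF _) (hae Ioc_subset_Ioi_self)
      (Ioc_subset_Ioc_right (by linarith)).eventuallyLE).trans
      (hFB (τ₀ + n + 1) (by linarith [(cast_nonneg n : (0 : ℝ) ≤ n)]))
  have hsub : Ioi (0 : ℝ) ⊆ ⋃ n : ℕ, Ioc (n : ℝ) (n + 1) := fun t ht => by
    refine mem_iUnion.2 ⟨⌈t⌉₊ - 1, ?_⟩
    have h1 : 1 ≤ ⌈t⌉₊ := Nat.one_le_ceil_iff.2 ht
    push_cast [Nat.cast_sub h1]
    exact ⟨by linarith [Nat.ceil_lt_add_one (mem_Ioi.1 ht).le], by linarith [Nat.le_ceil t]⟩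
  have hterm : ∀ n : ℕ, ∫⁻ t in Ioc (n : ℝ) (n + 1), ‖exp (-t) * F t‖ₑ
      ≤ ofReal (B * (τ₀ + 1) * ((n : ℝ) ^ 0 * exp (-1 * n))
        + B * ((n : ℝ) ^ 1 * exp (-1 * n))) := fun n => by
    have hs : Ioc (n : ℝ) (n + 1) ⊆ Ioc 0 (n + 1) := Ioc_subset_Ioc_left (cast_nonneg n)
    calc _ ≤ ∫⁻ t in Ioc (n : ℝ) (n + 1), ofReal (exp (-1 * n)) * ofReal (F t) := by
          refine lintegral_mono_ae ?_
          filter_upwards [hae (hs.trans Ioc_subset_Ioi_self), ae_restrict_mem measurableSet_Ioc]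
            with t h1 h2
          rw [enorm_of_nonneg (mul_nonneg (exp_pos _).le h1), ofReal_mul (exp_pos _).le]
          gcongr
          linarith [h2.1]
      _ ≤ ofReal (exp (-1 * n)) * ∫⁻ t in Ioc (0 : ℝ) (n + 1), ofReal (F t) := by
          rw [lintegral_const_mul' _ _ ofReal_ne_top]
          gcongr
      _ ≤ _ := by
          rw [← ofReal_integral_eq_lintegral_ofReal (iF _) (hae Ioc_subset_Ioi_self),
            ← ofReal_mul (exp_pos _).le]
          refine ofReal_le_ofReal
            ((mul_le_mul_of_nonneg_left (hIb n) (exp_pos _).le).trans (le_of_eq ?_))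
          ring
  have hsum := ((Real.summable_pow_mul_exp_neg_nat_mul 0 one_pos).mul_left (B * (τ₀ + 1))).add
    ((Real.summable_pow_mul_exp_neg_nat_mul 1 one_pos).mul_left B)
  calc _ ≤ ∫⁻ t in ⋃ n : ℕ, Ioc (n : ℝ) (n + 1), ‖exp (-t) * F t‖ₑ := lintegral_mono_set hsub
    _ ≤ _ := lintegral_iUnion_le _ _
    _ ≤ _ := ENNReal.tsum_le_tsum hterm
    _ < ⊤ := hsum.tsum_ofReal_lt_top

variable {f : ℝ → Plane → ℝ} {u : ℝ → Plane → Plane} {U : ℝ} {T₀ : Plane → ℝ} {T : ℝ → Plane → ℝ}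
  {DT : ℝ → Plane → Plane} {η : Plane → ℝ} {N e : ℝ}

theorem IsTemperature.meanSqGrad_le (hT : IsTemperature f u T₀ T DT) (hT₀ : MemLp T₀ 2 μD)
    (hu : IsFlow u U) (hη : IsTest η) (hN : ∫ x, ‖∇ η x‖ ^ 2 ∂μD ≤ N) (he : 0 < e)
    (hf : ∀ᵐ t ∂μT, MemLp (f t) 2 μD ∧ ∫ x, f t x ^ 2 ∂μD ≤ F t)
    (iF : ∀ τ, IntegrableOn F (Ioc 0 τ)) (hB : 0 < B) (hτ₀ : 0 < τ₀)
    (hFB : ∀ τ, τ₀ ≤ τ → ∫ t in Ioc 0 τ, F t ≤ B * π * τ)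
    (hres : ∀ᵐ t ∂μT, ResidualLe (f t) (u t) η (e * F t) (excess f t)) :
    meanSqGrad DT ≤ ofReal (10 * (N + e * B)) := by
  have hpos : ∀ᵐ t ∂μT, 0 ≤ F t := hf.mono fun t ht =>
    (integral_nonneg fun x => sq_nonneg _).trans ht.2
  have hN0 : 0 ≤ N := (integral_nonneg fun x => by positivity).trans hN
  obtain ⟨S, hS, hle⟩ := hT.lintegral_grad_le hu hη hN he.le hf iF
    (integrableOn_exp_neg_mul hpos iF hτ₀ hFB) hres
  set Λ := ∫ t in Ioi 0, exp (-t) * F t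
  have h0 : L2Bdd (fun x => T₀ x - η x) (∫ x, (T₀ x - η x) ^ 2 ∂μD) :=
    ⟨hT₀.sub (hη.memLp 2), le_rfl⟩
  set E := 2 * (1 + ∫ x, (T₀ x - η x) ^ 2 ∂μD)
  have hE0 : 0 ≤ E := by
    have : 0 ≤ ∫ x, (T₀ x - η x) ^ 2 ∂μD := by positivity
    positivity
  obtain ⟨s, hs, w, hw, hsw⟩ := mem_inf_iff.1 (hT.initial.eventually (gt_mem_nhds one_pos))
  obtain ⟨ρ, hρ, hρw⟩ := Metric.mem_nhds_iff.1 hw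
  have small : ∀ δ, 0 < δ → ∃ a ∈ S, a ∈ Ioo 0 δ ∧ ∫ x, (T a x - η x) ^ 2 ∂μD ≤ E := by
    intro δ hδ
    have h1 : ∃ᵐ t : ℝ, t ∈ Ioo 0 (min δ ρ) := by rw [frequently_ae_mem_iff]; simp [hδ, hρ]
    obtain ⟨a, ha, haS, has, haT⟩ := (h1.and_eventually (hS.and
      (((ae_restrict_iff' measurableSet_Ioi).1 hs).and
      ((ae_restrict_iff' measurableSet_Ioi).1 hT.memH10)))).exists
    have hTa := (haT ha.1).memLp
    have hlt : a ∈ {t | eLpNorm (fun x => T t x - T₀ x) 2 μD < 1} := by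
      rw [hsw]
      refine ⟨has ha.1, hρw ?_⟩
      rw [Metric.mem_ball, dist_zero_right, norm_of_nonneg ha.1.le]
      exact ha.2.trans_le (min_le_right _ _)
    have hd : MemLp (fun x => T a x - T₀ x) 2 μD := hTa.sub hT₀
    have h3 : ∫ x, (T a x - T₀ x) ^ 2 ∂μD ≤ 1 := by
      have h2 : eLpNorm (fun x => T a x - T₀ x) 2 μD < 1 := hlt
      rw [eLpNorm_eq_ofReal_sqrt hd, ENNReal.ofReal_lt_one] at h2
      simp only [norm_eq_abs, sq_abs] at h2
      exact (Real.sqrt_le_one).1 h2.le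
    refine ⟨a, haS, ⟨ha.1, ha.2.trans_le (min_le_left _ _)⟩, ?_⟩
    have h4 := (L2Bdd.add ⟨hd, h3⟩ h0).2
    simpa only [sub_add_sub_cancel] using h4
  obtain ⟨τ₁, hτ₁, hgrowth⟩ := exists_growth_bound (Λ := Λ) hE0 hN0 he hB
  refine limsup_le_of_le (by isBoundedDefault) ?_
  filter_upwards [eventually_ge_atTop (max τ₁ τ₀)] with τ hτ
  have hτ0 : 0 < τ := hτ₀.trans_le ((le_max_right _ _).trans hτ)
  have h1 : ∃ᵐ t : ℝ, t ∈ Ioo τ (τ + 1) := by rw [frequently_ae_mem_iff]; simp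
  obtain ⟨b, hb, hbS⟩ := (h1.and_eventually hS).exists
  have hb0 : 0 < b := hτ0.trans hb.1
  have hae : ∀ {s : Set ℝ}, s ⊆ Ioi 0 → ∀ᵐ t ∂volume.restrict s, 0 ≤ F t := fun hs =>
    ae_mono (restrict_mono hs le_rfl) hpos
  have hI : ∫ t in Ioc 0 b, F t ≤ B * π * (τ + 1) :=
    (setIntegral_mono_set (iF _) (hae Ioc_subset_Ioi_self)
      (Ioc_subset_Ioc_right hb.2.le).eventuallyLE).trans
      (hFB _ (by linarith [(le_max_right _ _).trans hτ]))
  have hI0 : 0 ≤ ∫ t in Ioc 0 b, F t := integral_nonneg_of_ae (hae Ioc_subset_Ioi_self)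
  refine ENNReal.div_le_of_le_mul ?_
  rw [volume_disc, ← ofReal_mul hτ0.le, ← ofReal_mul (by positivity)]
  refine (lintegral_mono_set (Ioc_subset_Ioc_right hb.1.le)).trans ((lintegral_Ioc_zero_le
    fun δ hδ => ?_).trans (ofReal_le_ofReal (hgrowth τ ((le_max_left _ _).trans hτ) b _
      hb0.le hb.2.le hI0 hI)))
  obtain ⟨a, haS, ha, haE⟩ := small (min δ b) (lt_min hδ hb0)
  exact ⟨a, ⟨ha.1, ha.2.trans_le (min_le_left _ _)⟩,
    hle a haS b hbS ha.1 (ha.2.trans_le (min_le_right _ _)) E haE⟩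

lemma memLp_exp_neg_mul (hm : JointlyMeasurable f) (hf : ∀ᵐ t ∂μT,
      MemLp (f t) 2 μD ∧ ∫ x, f t x ^ 2 ∂μD ≤ F t)
    (iE : IntegrableOn (fun t => exp (-t) * F t) (Ioi 0)) :
    MemLp (fun p => exp (-p.1) * f p.1 p.2) 2 μC := by
  have h0 : AEStronglyMeasurable (fun p => exp (-p.1) * f p.1 p.2) μC :=
    (by fun_prop : Continuous fun p => exp (-p.1)).aestronglyMeasurable.mul hm
  refine memLp_two_of_lintegral h0 ?_
  rw [cylMeasure_eq] at h0 ⊢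
  rw [lintegral_prod _ (h0.enorm.pow_const 2)]
  refine lt_of_le_of_lt (lintegral_mono_ae ?_) iE.lintegral_lt_top
  filter_upwards [hf, ae_restrict_mem measurableSet_Ioi] with t h1 h2
  have e := ofReal_integral_normSq h1.1
  simp only [norm_eq_abs, sq_abs] at e
  simp only [enorm_mul, mul_pow]
  rw [lintegral_const_mul' _ _ (by finiteness), ← e, enorm_of_nonneg (exp_pos _).le,
    ← ofReal_pow (exp_pos _).le, ← ofReal_mul (by positivity)]
  refine ofReal_le_ofReal (mul_le_mul ?_ h1.2 (by positivity) (exp_pos _).le)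
  exact pow_le_of_le_one (exp_pos _).le (Real.exp_le_one_iff.2 (by linarith [mem_Ioi.1 h2]))
    two_ne_zero

end

lemma exists_scale (hPe : exp 1 ≤ Pe) : ∃ M : ℕ, (4 ^ M) ^ 2 * ((M : ℝ) + 1) ^ 2 / Pe ^ 2
      ≤ 4 * (log Pe ^ (4 / 3 : ℝ) / Pe ^ (2 / 3 : ℝ)) ∧
    ((M : ℝ) + 1) / 4 ^ M ≤ 8 * (log Pe ^ (4 / 3 : ℝ) / Pe ^ (2 / 3 : ℝ)) := by
  have hPe0 : 0 < Pe := (exp_pos 1).trans_le hPe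
  set l := log Pe with hl
  have hl1 : 1 ≤ l := (Real.le_log_iff_exp_le hPe0).2 hPe
  have hl0 : 0 < l := by linarith
  set p := Pe ^ (2 / 3 : ℝ) with hp
  set w := l ^ (1 / 3 : ℝ) with hw
  have hp0 : 0 < p := Real.rpow_pos_of_pos hPe0 _
  have hw0 : 0 < w := Real.rpow_pos_of_pos hl0 _
  have hp3 : Pe ^ 2 = p ^ 3 := by
    rw [hp, ← rpow_natCast, ← rpow_natCast, ← rpow_mul hPe0.le]; norm_num
  have hw3 : l = w ^ 3 := by rw [hw, ← rpow_natCast, ← rpow_mul hl0.le]; norm_num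
  have hw4 : l ^ (4 / 3 : ℝ) = w ^ 4 := by rw [hw, ← rpow_natCast, ← rpow_mul hl0.le]; norm_num
  have hlPe : l ≤ Pe := (Real.log_le_sub_one_of_pos hPe0).trans (by linarith)
  have hPe1 : 1 ≤ Pe := hl1.trans hlPe
  obtain ⟨M, hM1, hM2⟩ := exists_nat_pow_near (x := Pe ^ 2 / l) (y := 64)
    ((one_le_div hl0).2 (hlPe.trans (by nlinarith))) (by norm_num)
  have hML : (M : ℝ) + 1 ≤ 2 * l := by
    have h1 := Real.log_le_log (by positivity) (hM1.trans (div_le_self (by positivity) hl1))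
    rw [log_pow, log_pow, show (64 : ℝ) = 2 ^ 6 by norm_num, log_pow] at h1
    push_cast at h1
    have h2 := Real.log_two_gt_d9
    have h3 : (0 : ℝ) ≤ M := cast_nonneg M
    nlinarith
  have e64 : ∀ n : ℕ, (64 : ℝ) ^ n = (4 ^ n) ^ 3 := fun n => by
    rw [← pow_mul, mul_comm, pow_mul]; norm_num
  have ey : Pe ^ 2 / l = (p / w) ^ 3 := by rw [hp3, div_pow, ← hw3]
  rw [e64, ey] at hM1 hM2
  replace hM1 := le_of_pow_le_pow_left₀ three_ne_zero (by positivity) hM1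
  replace hM2 := lt_of_pow_lt_pow_left₀ 3 (by positivity) hM2
  refine ⟨M, ?_, ?_⟩
  · rw [hw4, hp3]
    calc _ ≤ (p / w) ^ 2 * (2 * w ^ 3) ^ 2 / p ^ 3 := by rw [← hw3]; gcongr
      _ = _ := by field_simp; ring
  · rw [hw4]
    have h4 : p / w / 4 ≤ 4 ^ M := by rw [pow_succ] at hM2; linarith
    calc _ ≤ 2 * w ^ 3 / (p / w / 4) := by rw [← hw3]; gcongr
      _ = _ := by field_simp; ring

lemma IsSource.integral_sourceSq_le {f : ℝ → Plane → ℝ} {Df : ℝ → Plane → Plane}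
    {D2f : ℝ → Plane → Fin 2 → Plane} (hf : IsSource f Df D2f) (hL : 0 < L)
    (havg : avg (fun t x => ‖f t x‖ₑ ^ 2 + ‖Df t x‖ₑ ^ 2 + ∑ i : Fin 2, ‖D2f t x i‖ₑ ^ 2)
      < ofReal L) : (∀ τ, IntegrableOn (fun t => sourceSq (f t) (Df t) (D2f t)) (Ioc 0 τ)) ∧
      ∃ τ₀, 0 < τ₀ ∧ ∀ τ, τ₀ ≤ τ →
        ∫ t in Ioc 0 τ, sourceSq (f t) (Df t) (D2f t) ≤ 4 * L * π * τ := by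
  obtain ⟨m, τa, ha, ba⟩ := memLp_of_avg_lt hf.meas hL.le ((avg_mono fun t x => by
    rw [add_assoc]; exact le_self_add).trans_lt havg)
  obtain ⟨m', τb, hb, bb⟩ := memLp_of_avg_lt hf.meas_grad hL.le ((avg_mono fun t x =>
    le_self_add.trans' le_add_self).trans_lt havg)
  choose m'' τc hc bc using fun i => memLp_of_avg_lt (hf.meas_hess.apply i) hL.le
    ((avg_mono fun t x => (Finset.single_le_sum (f := fun i => ‖D2f t x i‖ₑ ^ 2)
      (fun _ _ => zero_le) (Finset.mem_univ i)).trans le_add_self).trans_lt havg)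
  have i1 : ∀ τ, IntegrableOn (fun t => ∫ x, f t x ^ 2 ∂μD) (Ioc 0 τ) := fun τ => by
    have := integrable_slice_normSq (m τ)
    simp only [norm_eq_abs, sq_abs] at this
    exact this
  have i2 : ∀ τ, IntegrableOn (fun t => ∫ x, ‖Df t x‖ ^ 2 ∂μD) (Ioc 0 τ) := fun τ =>
    integrable_slice_normSq (m' τ)
  have i3 : ∀ i τ, IntegrableOn (fun t => ∫ x, ‖D2f t x i‖ ^ 2 ∂μD) (Ioc 0 τ) :=
    fun i τ => integrable_slice_normSq (v := fun t x => D2f t x i) (m'' i τ)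
  have i12 : ∀ τ, IntegrableOn (fun t => ∫ x, f t x ^ 2 ∂μD
    + ∫ x, ‖Df t x‖ ^ 2 ∂μD) (Ioc 0 τ) := fun τ => (i1 τ).add (i2 τ)
  have i123 : ∀ τ, IntegrableOn (fun t => ∫ x, f t x ^ 2 ∂μD
    + ∫ x, ‖Df t x‖ ^ 2 ∂μD + ∫ x, ‖D2f t x 0‖ ^ 2 ∂μD) (Ioc 0 τ) := fun τ => (i12 τ).add (i3 0 τ)
  refine ⟨fun τ => (i123 τ).add (i3 1 τ), τa + τb + τc 0 + τc 1,
    by linarith [hc 0, hc 1], fun τ hτ => ?_⟩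
  have h0 := hc 0; have h1 := hc 1
  have b1 := ba τ (by linarith)
  have b2 := bb τ (by linarith)
  have b3 := bc 0 τ (by linarith)
  have b4 := bc 1 τ (by linarith)
  simp only [norm_eq_abs, sq_abs] at b1
  simp only [sourceSq]
  rw [integral_add (i123 τ) (i3 1 τ), integral_add (i12 τ) (i3 0 τ), integral_add (i1 τ) (i2 τ)]
  linarith

end DiscCooling

end

theorem theorem1 (f : ℝ → Plane → ℝ) (Df : ℝ → Plane → Plane)
    (D2f : ℝ → Plane → Fin 2 → Plane) (hf : IsSource f Df D2f) (hgrowth : ControlledGrowth f)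
    (hfinite : avg (fun t x => ‖f t x‖ₑ ^ 2 + ‖Df t x‖ₑ ^ 2 + ∑ i : Fin 2, ‖D2f t x i‖ₑ ^ 2) < ⊤)
    (hpos : 0 < signedAvg f) : ∃ C C' c : ℝ, 0 < C ∧ 0 < C' ∧ 0 < c ∧ ∀ Pe : ℝ, c ≤ Pe →
      ENNReal.ofReal (C * (1 / Pe ^ (2 / 3 : ℝ))) ≤ minCooling f Pe ∧ minCooling f Pe ≤
        ENNReal.ofReal (C' * (Real.log Pe ^ (4 / 3 : ℝ) / Pe ^ (2 / 3 : ℝ))) ∧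
      ∃ u : ℝ → Plane → Plane, IsAdmissible Pe u ∧ (∀ T₀ : Plane → ℝ, MemLp T₀ 2 discMeasure →
          ∃ (T : ℝ → Plane → ℝ) (DT : ℝ → Plane → Plane), IsTemperature f u T₀ T DT) ∧
        ∀ (T₀ : Plane → ℝ) (T : ℝ → Plane → ℝ) (DT : ℝ → Plane → Plane),
          MemLp T₀ 2 discMeasure → IsTemperature f u T₀ T DT → meanSqGrad DT ≤
              ENNReal.ofReal (C' * (Real.log Pe ^ (4 / 3 : ℝ) / Pe ^ (2 / 3 : ℝ))) := by
  obtain ⟨K, c, hK, hc, hlower⟩ := exists_le_meanSqGrad hf.meas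
    ((avg_mono fun t x => by rw [add_assoc]; exact le_self_add).trans_lt hfinite) hpos
  obtain ⟨A, hA, hpat⟩ := exists_isPattern
  set L := (avg fun t x => ‖f t x‖ₑ ^ 2 + ‖Df t x‖ₑ ^ 2 + ∑ i : Fin 2, ‖D2f t x i‖ₑ ^ 2).toReal + 1
  have hL : 0 < L := by positivity
  have havg : avg (fun t x => ‖f t x‖ₑ ^ 2 + ‖Df t x‖ₑ ^ 2 + ∑ i : Fin 2, ‖D2f t x i‖ₑ ^ 2)
      < ENNReal.ofReal L := (ENNReal.lt_ofReal_iff_toReal_lt hfinite.ne).2 (lt_add_one _)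
  obtain ⟨iF, τ₀, hτ₀, hFB⟩ := hf.integral_sourceSq_le hL havg
  have hfF : ∀ᵐ t ∂μT, MemLp (f t) 2 μD ∧ ∫ x, f t x ^ 2 ∂μD ≤ sourceSq (f t) (Df t) (D2f t) := by
    filter_upwards [hf.memH1] with t ht
    obtain ⟨-, p1, p2, p3⟩ := sourceSq_parts (f t) (Df t) (D2f t)
    exact ⟨ht.memLp, by unfold sourceSq; linarith⟩
  have hfe := memLp_exp_neg_mul hf.meas hfF (integrableOn_exp_neg_mul
    (hfF.mono fun t ht => (integral_nonneg fun x => sq_nonneg _).trans ht.2) iF hτ₀ hFB)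
  refine ⟨K, 10 * (4000 * A ^ 2 * L + (200 * A + 22) * 8 * (4 * L)), max c (Real.exp 1), hK,
    by positivity, lt_max_of_lt_left hc, fun Pe hPe => ?_⟩
  have hPe0 : 0 < Pe := hc.trans_le ((le_max_left _ _).trans hPe)
  obtain ⟨M, hM1, hM2⟩ := exists_scale ((le_max_right _ _).trans hPe)
  obtain ⟨Ψ, H, W, S, hp⟩ := hpat M
  obtain ⟨u, U, η, hadm, hu, hη, hN, hres⟩ := exists_velocity hf hL havg.le hA hp hPe0
  have upper : ∀ (T₀ : Plane → ℝ) (T : ℝ → Plane → ℝ) (DT : ℝ → Plane → Plane),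
      MemLp T₀ 2 μD → IsTemperature f u T₀ T DT → meanSqGrad DT ≤ ENNReal.ofReal
        (10 * (4000 * A ^ 2 * L + (200 * A + 22) * 8 * (4 * L))
          * (Real.log Pe ^ (4 / 3 : ℝ) / Pe ^ (2 / 3 : ℝ))) := fun T₀ T DT hT₀ hT => by
    refine (hT.meanSqGrad_le hT₀ hu hη hN (by positivity) hfF iF (by positivity) hτ₀ hFB
      hres).trans (ENNReal.ofReal_le_ofReal ?_)
    have h1 := mul_le_mul_of_nonneg_left hM1 (by positivity : 0 ≤ 1000 * A ^ 2 * L)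
    have h2 := mul_le_mul_of_nonneg_left hM2 (by positivity : 0 ≤ (200 * A + 22) * (4 * L))
    linarith
  refine ⟨le_sInf ?_, ?_, u, hadm, fun T₀ hT₀ => hu.exists_temperature hfe hT₀, upper⟩
  · rintro q ⟨u, T₀, T, DT, h1, -, h2, rfl⟩
    exact hlower Pe ((le_max_left _ _).trans hPe) u T₀ T DT h1 h2
  · obtain ⟨T, DT, hT⟩ := hu.exists_temperature hfe (T₀ := fun _ => 0) MemLp.zero'
    have : minCooling f Pe ≤ meanSqGrad DT := sInf_le ⟨u, _, T, DT, hadm, MemLp.zero', hT, rfl⟩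
    exact this.trans (upper _ T DT MemLp.zero' hT)
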